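/- **Setting.** Let $\mathfrak V$ be a sequentially complete Hausdorff locally convex complex vector space and let $A\subseteq\mathfrak V\times\mathfrak V$ be a sequentially closed linear subspace (a multivalued linear operator; $(y,x)\in A$ means that $y$ is a value of $A$ at $x$). For multivalued operators, $\frac{aA+b}{cA+d}=\{(ay+bx,cy+dx):(y,x)\in A\}$; an expression $Bx$ *makes sense* and equals $y$ if $y$ is the one and only value of $B$ at $x$. Let $\gamma:[a_1,b_1]\to\mathbb C$, $a_1<b_1$, be a Lipschitz curve: it is bi-Lipschitz onto $\Gamma=\gamma([a_1,b_1])$, and $\Gamma$ is locally the graph of a real Lipschitz function in suitable rotated coordinates. For $n\in\mathbb N$, $\mathrm D^n_\Gamma(A)$ is the set of $u\in\mathfrak V$ such that for all $0\le m\le n$ the functions $(z_1,\dots,z_m)\mapsto(z_1-A)^{-1}\cdots(z_m-A)^{-1}u$ on $\Gamma^m$ and $(z_1,\dots,z_m)\mapsto(z_1^{-1}-A^{-1})^{-1}\cdots(z_m^{-1}-A^{-1})^{-1}u$ on $(\Gamma\setminus\{0\})^m$ are well defined and continuous. An $(n)$-normal form of $f:\mathbb C\setminus\Gamma\to\mathbb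 C$ is a representation $f(z)=\sum_{j=0}^n\int_\Gamma\frac{d\mu_j(w)}{(w-z)^j}$ with complex Borel measures $\mu_j$ of bounded variation carried by $\Gamma$. If $f$ has an $(n)$-normal form and $u\in\mathrm D^n_\Gamma(A)$, one puts $f(A)u=\sum_{j=0}^n\int_\Gamma (w-A)^{-j}u\,d\mu_j(w)$ (weak vector integrals); "$f(A)u=v$" includes that the result does not depend on $n$ and on the normal form. Put $\log(\gamma,z)=\int_{a_1}^{b_1}\frac{d\gamma(t)}{\gamma(t)-z}$, $g_k(z)=\log(\gamma,z)^k$, and $f_\alpha(z)=\left(\frac{\gamma(b_1)-z}{\gamma(a_1)-z}\right)^\alpha_{(\gamma)}=\exp(\alpha\log(\gamma,z))$ for $z\in\mathbb C\setminus\Gamma$. For $n\in\mathbb N$ let $S_n=\{\alpha\in\mathbb C:|\alpha|<n\}\cup[-n,n]$. The statement $\exp(\alpha\log(\gamma,A))u=v$ means that all iterates $(\log(\gamma,A))^ku$ make sense and that the partial sums of $\sum_{k\ge0}\frac{\alpha^k}{k!}(\log(\gamma,A))^ku$ converge to $v$. **Lemma.** (a) If $u\in\mathrm D^2_\Gamma(A)$,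 then $\log(\gamma,A)$ can be iterated on $u$ arbitrarily many times, and $(\log(\gamma,A))^nu=g_n(A)u$ for all $n\in\mathbb N$. (b) Let $n\in\mathbb N$ and $u\in\mathrm D^n_\Gamma(A)$. Then $f_\alpha(A)u$ is well defined for all $\alpha\in S_n$, and $\alpha\mapsto f_\alpha(A)u$ is continuous on $\{|\alpha|<n\}$ and on $[-n,n]$. If $n\ge2$, then for all $\alpha\in S_n$ $$f_\alpha(A)u=\sum_{k=0}^\infty\frac{\alpha^k}{k!}g_k(A)u=\exp(\alpha\log(\gamma,A))u .$$ (c) Let $n\ge2$, $u\in\mathrm D^n_\Gamma(A)$, $n_1,n_2\in\mathbb N$, $n_1+n_2\le n$, $\alpha_1\in S_{n_1}$, $\alpha_2\in S_{n_2}$. Put $v=f_{\alpha_2}(A)u=\exp(\alpha_2\log(\gamma,A))u$. Then $v\in\mathrm D^{n-n_2}_\Gamma(A)$ and $$f_{\alpha_1}(A)v=f_{\alpha_1+\alpha_2}(A)u=\exp((\alpha_1+\alpha_2)\log(\gamma,A))u .$$ Moreover $f_{\alpha_1}(A)v=\sum_{k\ge0}\frac{\alpha_1^k}{k!}g_k(A)v$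 if $n_1\ge1$, and $f_{\alpha_1}(A)v=\exp(\alpha_1\log(\gamma,A))v$ if $n-n_2\ge2$, or if $n-n_2\ge1$ and $|\alpha_2|<n_2$. In particular, if $n\ge2$, the $\exp(\alpha\log(\gamma,A))$ form a local group on $\mathrm D^n_\Gamma(A)$ with infinitesimal generator $\log(\gamma,A)$: for $u\in\mathrm D^n_\Gamma(A)$, $F(\alpha)=\exp(\alpha\log(\gamma,A))u$ is defined for all $\alpha\in S_n$, continuous on $\{|\alpha|<n\}$ and on $[-n,n]$, $F(0)=u$, and $\lim_{\alpha\to0}\alpha^{-1}(F(\alpha)-u)=\log(\gamma,A)u$. -/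

import Mathlib

open MeasureTheory Set Filter Topology

namespace ResolventCalculus

/-! ### Lipschitz curves and the associated logarithm -/

/-- `γ : [a, b] → ℂ` is a (simple, nondegenerate) Lipschitz curve with a bi-Lipschitz
parametrization: its image is locally the graph of a real Lipschitz function in suitable
rotated coordinates. Only the values of `γ` on `[a, b]` matter. -/
structure IsLipschitzCurve (γ : ℝ → ℂ) (a b : ℝ) : Prop where
  lt : a < b
  biLipschitz : ∃ C₁ C₂ : ℝ, 0 < C₁ ∧ 0 < C₂ ∧ ∀ s ∈ Icc a b, ∀ t ∈ Icc a b,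
    C₁ * |t - s| ≤ ‖γ t - γ s‖ ∧ ‖γ t - γ s‖ ≤ C₂ * |t - s|
  locallyGraph : ∀ t₀ ∈ Icc a b, ∃ (ξ : ℂ) (K : NNReal) (φ : ℝ → ℝ) (U : Set ℂ),
    ‖ξ‖ = 1 ∧ LipschitzWith K φ ∧ U ∈ 𝓝 (γ t₀) ∧
      ∀ w ∈ γ '' Icc a b ∩ U, (w * ξ).im = φ (w * ξ).re

/-- `log(γ, z) = ∫ dγ(t) / (γ(t) - z)`, for `z` off the curve. -/
noncomputable def curveLog (γ : ℝ → ℂ) (a b : ℝ) (z : ℂ) : ℂ :=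
  ∫ t in a..b, deriv γ t / (γ t - z)

/-- `((γ(b) - z) / (γ(a) - z)) ^ α`, with the branch given by the curve: `exp (α log(γ, z))`. -/
noncomputable def curvePow (γ : ℝ → ℂ) (a b : ℝ) (α z : ℂ) : ℂ :=
  Complex.exp (α * curveLog γ a b z)

section Operators

variable {V : Type*} [AddCommGroup V] [Module ℂ V]

/-! ### Multivalued operators

A multivalued linear operator is a linear subspace `A` of `V × V`;
a pair `(y, x) ∈ A` means that `y` is a value of `A` at `x`. -/

/-- `(aA + b) / (cA + d) = {(ay + bx, cy + dx) : (y, x) ∈ A}`. -/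
def moebius (a b c d : ℂ) (A : Submodule ℂ (V × V)) : Submodule ℂ (V × V) :=
  A.map ((a • LinearMap.fst ℂ V V + b • LinearMap.snd ℂ V V).prod
    (c • LinearMap.fst ℂ V V + d • LinearMap.snd ℂ V V))

/-- `(w - A)⁻¹ = 1 / (-A + w)`. -/
def resolventOp (w : ℂ) (A : Submodule ℂ (V × V)) : Submodule ℂ (V × V) :=
  moebius 0 1 (-1) w A

/-- `A⁻¹ = (0 A + 1) / (A + 0)`. -/
def inverseOp (A : Submodule ℂ (V × V)) : Submodule ℂ (V × V) :=
  moebius 0 1 1 0 A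

/-- `B x` makes sense and equals `y`: `y` is the one and only value of the relation `B` at `x`. -/
def HasValue (B : Set (V × V)) (x y : V) : Prop :=
  (y, x) ∈ B ∧ ∀ y', (y', x) ∈ B → y' = y

/-- `B ^ k x` makes sense, as a `k`-fold iteration, and equals `y`. -/
def IterValue (B : Set (V × V)) : ℕ → V → V → Prop
  | 0, x, y => y = x
  | k + 1, x, y => ∃ x', IterValue B k x x' ∧ HasValue B x' y

/-- `(z₁ - A)⁻¹ ⋯ (zₘ - A)⁻¹ u` makes sense and equals `y`, for the list `[z₁, …, zₘ]`. -/
def ResolventChain (A : Submodule ℂ (V × V)) (u : V) : List ℂ → V → Prop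
  | [], y => y = u
  | z :: zs, y => ∃ x, ResolventChain A u zs x ∧ HasValue (resolventOp z A : Set (V × V)) x y

/-- The domain `Dⁿ_Γ(A)` for `Γ ⊆ ℂ`: for all `m ≤ n` the maps
`z ↦ (z₁ - A)⁻¹ ⋯ (zₘ - A)⁻¹ u` on `Γᵐ` and
`z ↦ (z₁⁻¹ - A⁻¹)⁻¹ ⋯ (zₘ⁻¹ - A⁻¹)⁻¹ u` on `(Γ \ {0})ᵐ` are well defined and continuous. -/
def resolventDomain [TopologicalSpace V] (n : ℕ) (Γ : Set ℂ) (A : Submodule ℂ (V × V)) : Set V :=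
  {u | ∀ m ≤ n,
    (∃ R : (Fin m → ℂ) → V,
      (∀ z : Fin m → ℂ, (∀ i, z i ∈ Γ) → ResolventChain A u (List.ofFn z) (R z)) ∧
      ContinuousOn R {z | ∀ i, z i ∈ Γ}) ∧
    (∃ R : (Fin m → ℂ) → V,
      (∀ z : Fin m → ℂ, (∀ i, z i ∈ Γ \ {0}) →
        ResolventChain (inverseOp A) u (List.ofFn fun i => (z i)⁻¹) (R z)) ∧
      ContinuousOn R {z | ∀ i, z i ∈ Γ \ {0}})}

/-! ### The holomorphic functional calculus -/

/-- An `(n)`-normal form of `f` along `Γ ⊆ ℂ`: complex measures `μ₀, …, μₙ` of bounded variation,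
carried by `Γ`, with `f(z) = ∑_{j ≤ n} ∫ dμⱼ(w) / (w - z)ʲ` for all `z` off `Γ`. -/
def IsNormalForm (Γ : Set ℂ) (f : ℂ → ℂ) (n : ℕ) (μ : ℕ → ComplexMeasure ℂ) : Prop :=
  (∀ j ≤ n, IsFiniteMeasure (μ j).variation ∧ (μ j).variation Γᶜ = 0) ∧
  ∀ z ∉ Γ, f z = ∑ j ∈ Finset.range (n + 1),
    (μ j).integral (fun w => ((w - z) ^ j)⁻¹) (ContinuousLinearMap.mul ℝ ℂ)

/-- `v = ∫ F dμ`, the integral of a vector valued function against a complex measure, in the weak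
sense: it is tested against all continuous linear functionals. -/
def IsVectorIntegral [TopologicalSpace V] (μ : ComplexMeasure ℂ) (F : ℂ → V) (v : V) : Prop :=
  ∀ ℓ : V →L[ℂ] ℂ, μ.Integrable (fun w => ℓ (F w)) ∧
    ℓ v = μ.integral (fun w => ℓ (F w)) (ContinuousLinearMap.mul ℝ ℂ)

/-- The operator `f(A)`, as the set of all pairs `(v, u)` such that, for some `n`,
`f` has an `(n)`-normal form `(μⱼ)`, `u ∈ Dⁿ_Γ(A)`, and
`v = ∑_{j ≤ n} ∫ (w - A)⁻ʲ u dμⱼ(w)`. That `f(A) u` is well defined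
(independent of the normal form) is part of the assertion `HasValue (funCalc Γ A f) u v`. -/
def funCalc [TopologicalSpace V] (Γ : Set ℂ) (A : Submodule ℂ (V × V)) (f : ℂ → ℂ) :
    Set (V × V) :=
  {p | ∃ (n : ℕ) (μ : ℕ → ComplexMeasure ℂ) (R : ℕ → ℂ → V) (x : ℕ → V),
    IsNormalForm Γ f n μ ∧ p.2 ∈ resolventDomain n Γ A ∧
    (∀ j ≤ n, ∀ w ∈ Γ, ResolventChain A p.2 (List.replicate j w) (R j w)) ∧
    (∀ j ≤ n, IsVectorIntegral (μ j) (R j) (x j)) ∧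
    p.1 = ∑ j ∈ Finset.range (n + 1), x j}

/-! ### Exponential series -/

/-- `y = ∑ₖ αᵏ / k! sₖ`, as a limit of partial sums. -/
def IsExpSum [TopologicalSpace V] (α : ℂ) (s : ℕ → V) (y : V) : Prop :=
  Tendsto (fun N => ∑ k ∈ Finset.range N, (α ^ k / (k.factorial : ℂ)) • s k) atTop (𝓝 y)

/-- `exp(α B) x` makes sense and equals `y`: all iterates `Bᵏ x` make sense and
`y = ∑ₖ αᵏ / k! Bᵏ x`. -/
def ExpValue [TopologicalSpace V] (B : Set (V × V)) (α : ℂ) (x y : V) : Prop :=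
  ∃ s : ℕ → V, (∀ k, IterValue B k x (s k)) ∧ IsExpSum α s y

/-! ### The operators of the statement -/

/-- `log(γ, A)`. -/
def logOp [TopologicalSpace V] (γ : ℝ → ℂ) (a b : ℝ) (A : Submodule ℂ (V × V)) : Set (V × V) :=
  funCalc (γ '' Icc a b) A (curveLog γ a b)

/-- `g_k(A)`, where `g_k(z) = log(γ, z) ^ k`. -/
def logPowOp [TopologicalSpace V] (γ : ℝ → ℂ) (a b : ℝ) (k : ℕ) (A : Submodule ℂ (V × V)) :
    Set (V × V) :=
  funCalc (γ '' Icc a b) A (fun z => curveLog γ a b z ^ k)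

/-- `f_α(A)`, where `f_α(z) = ((γ(b) - z) / (γ(a) - z)) ^ α`. -/
def powOp [TopologicalSpace V] (γ : ℝ → ℂ) (a b : ℝ) (α : ℂ) (A : Submodule ℂ (V × V)) :
    Set (V × V) :=
  funCalc (γ '' Icc a b) A (curvePow γ a b α)

end Operators

/-- The open disc `{α : |α| < n}`. -/
def openDisc (n : ℕ) : Set ℂ := {α | ‖α‖ < n}

/-- The real interval `[-n, n]`, in `ℂ`. -/
def realInterval (n : ℕ) : Set ℂ := {α | α.im = 0 ∧ |α.re| ≤ n}

end ResolventCalculus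

open ResolventCalculus

namespace ResolventCalculus

/-! A vector `u` of order `n` is encoded by the symmetric continuous family φ(z₁,…,z_m) =
(z₁-A)⁻¹⋯(z_m-A)⁻¹u, m ≤ n, which satisfies the resolvent equation φ(z,s) - φ(w,s) = (w-z)φ(z,w,s)
(`exists_opFam`, `ResFam`). A normal form of f acts linearly and boundedly on every scalar family of
this kind, and on the pole family s ↦ ∏(w-ζ)⁻¹ it returns f(ζ). The pole families are dense among
the scalar families of order `n` (`ResFam.exists_approx`), so a bounded functional is determined by
the function it represents (`IsBddFunctional.eq_of_poleFam`). Independence of the normal form,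
multiplicativity of the calculus (`CurveForm.Represents.eval_eval`) and the identification of the
sum of the exponential series are all instances of this one principle, tested against continuous
functionals of `V`.

Density rests on the geometry of the arc. By integrating the resolvent equation along a bi-Lipschitz
arc, a family is bounded by its diagonal of order `n` and by its values at one endpoint
(`ResFam.exists_norm_le`), so it may be regarded as an element of C(Γ) × ℂⁿ, where Hahn–Banach
applies. An annihilating functional Λ has Λ((ζ-·)⁻ⁿ) equal to a combination of the (ζ-c)⁻ʲ, j < n;
the behaviour at infinity and the connectedness of ℂ ∖ Γ bring the exponent down to one, and the
Hartogs–Rosenthal theorem (`resolventSpan_eq_top`, Γ having area zero) gives Λ = 0.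

Since `V` is only sequentially complete and `A` only sequentially closed, integrals over the curve
are constructed as limits of sequences of Riemann sums. They commute with the resolvents, so a form
of order k maps order n to order n - k (`CurveForm.opFam_eval`).

The forms themselves come from a logarithm Λ of (γ(b)-w)/(w-γ(a)) on the open arc. The graph
condition prevents spiralling at the endpoints, so Im Λ is bounded and e^{αΛ} is integrable for |Re
α| < 1. Its Cauchy integral solves the same first-order equation in z as f_α, whence f_α = 1 +
N(α)∫e^{αΛ}dw/(w-z) with N entire and zero at all integers (`ArcLog.exists_jump`). Derivatives at α
= 0 give forms of order one for every power of the logarithm; this is why two orders suffice to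
iterate log(γ, A) indefinitely. Larger exponents are reached through exp(±log(γ, z)) = 1 +
const/(endpoint - z), and division by (endpoint - z) raises the order of a form by one, through an
averaging of Hardy type (`HasForm.div_left`).

The critical point is convergence of the exponential series at α = ±n. The density of a partial sum
is a truncated Cauchy product of e^{αλ} with the Taylor series of N at 0. As that series sums to
N(±n) = 0, its partial sums decay geometrically. Hence the densities tend to zero geometrically on
compact subarcs, and they are bounded in L¹ with weight ((t-a)(b-t))^{n-1} by an incomplete Gamma
integral. Families vanishing to order n at both endpoints carry this weight
(`BiLipArc.exists_flat_bound`), so for them the series converges to φ(∅)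
(`tendsto_expPartial_of_flat`). An arbitrary family differs from such a flat one by finitely many
pole families, on which the series is the scalar exponential series. Abel summation and a geometric
estimate carry convergence from ±n to the real segment and the open disc, together with continuity,
and uniform bounds make the limit a bounded functional, which is therefore the value of f_α. The law
of exponents is then multiplicativity. -/

theorem isSimplyConnected_univ_of_contractible (E : Type*) [NormedAddCommGroup E]
    [NormedSpace ℝ E] : IsSimplyConnected (univ : Set E) := by
  have : ContractibleSpace (univ : Set E) := convex_univ.contractibleSpace univ_nonempty
  exact SimplyConnectedSpace.ofContractible (univ : Set E)

/-! ### Bi-Lipschitz arcs in the plane -/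

/-- `γ` is globally Lipschitz with constant `C₂` and expands distances on `[a, b]` by at least
`C₁`. -/
structure BiLipArc (γ : ℝ → ℂ) (a b C₁ C₂ : ℝ) : Prop where
  lt : a < b
  pos₁ : 0 < C₁
  pos₂ : 0 < C₂
  lower : ∀ s ∈ Icc a b, ∀ t ∈ Icc a b, C₁ * |t - s| ≤ ‖γ t - γ s‖
  upper : ∀ s t, ‖γ t - γ s‖ ≤ C₂ * |t - s|

namespace BiLipArc

variable {γ : ℝ → ℂ} {a b C₁ C₂ : ℝ}

theorem lipschitz (h : BiLipArc γ a b C₁ C₂) : LipschitzWith C₂.toNNReal γ :=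
  LipschitzWith.of_dist_le_mul fun x y => by
    rw [dist_eq_norm, Real.dist_eq, Real.coe_toNNReal _ h.pos₂.le]
    exact h.upper y x

theorem continuous (h : BiLipArc γ a b C₁ C₂) : Continuous γ := h.lipschitz.continuous

theorem isCompact (h : BiLipArc γ a b C₁ C₂) : IsCompact (γ '' Icc a b) :=
  isCompact_Icc.image h.continuous

theorem injOn (h : BiLipArc γ a b C₁ C₂) : InjOn γ (Icc a b) := by
  intro s hs t ht hst
  have h1 := h.lower s hs t ht
  rw [hst, sub_self, norm_zero] at h1
  have h2 : |t - s| ≤ 0 := by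
    by_contra hc
    push Not at hc
    nlinarith [h.pos₁]
  have := abs_nonpos_iff.1 h2
  linarith

/-- The path t ↦ γ(t) - z₀ lifts through exp because the line is simply connected. The inverse
parametrization, Lipschitz by the lower bound, carries the lift to the arc, and Tietze's theorem
extends it to the plane. -/
theorem exists_continuous_log (h : BiLipArc γ a b C₁ C₂) {z₀ : ℂ} (hz : z₀ ∉ γ '' Icc a b) :
    ∃ g : ℂ → ℂ, Continuous g ∧ ∀ w ∈ γ '' Icc a b, Complex.exp (g w) = w - z₀ := by
  have hsc : IsSimplyConnected (univ : Set ℝ) := isSimplyConnected_univ_of_contractible _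
  obtain ⟨l, hlc, hl⟩ := Complex.exists_continuousOn_eqOn_exp_comp (X := ℝ) (U := univ)
    hsc isOpen_univ (g := fun t => γ (projIcc a b h.lt.le t) - z₀)
    ((h.continuous.comp (continuous_subtype_val.comp continuous_projIcc)).sub
      continuous_const).continuousOn (by
      rintro ⟨t, -, ht⟩
      exact hz ⟨_, (projIcc a b h.lt.le t).2, sub_eq_zero.1 ht⟩)
  have hlc : Continuous l := continuousOn_univ.1 hlc
  set τ := Function.invFunOn γ (Icc a b)
  have hτ : ∀ w ∈ γ '' Icc a b, τ w ∈ Icc a b ∧ γ (τ w) = w := fun w hw =>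
    ⟨Function.invFunOn_mem hw, Function.invFunOn_eq hw⟩
  have hτl : LipschitzOnWith (1 / C₁).toNNReal τ (γ '' Icc a b) := by
    apply LipschitzOnWith.of_dist_le_mul
    intro x hx y hy
    have h1 := h.lower _ (hτ y hy).1 _ (hτ x hx).1
    rw [(hτ x hx).2, (hτ y hy).2] at h1
    rw [Real.dist_eq, dist_eq_norm, Real.coe_toNNReal _ (by have := h.pos₁; positivity),
      one_div, ← div_eq_inv_mul, le_div_iff₀ h.pos₁]
    linarith
  have hc : Continuous ((γ '' Icc a b).domRestrict fun w => l (τ w)) :=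
    continuousOn_iff_continuous_domRestrict.1 (hlc.comp_continuousOn hτl.continuousOn)
  obtain ⟨g, hg⟩ := ContinuousMap.exists_restrict_eq h.isCompact.isClosed ⟨_, hc⟩
  refine ⟨g, g.continuous, fun w hw => ?_⟩
  have h1 : g w = l (τ w) := congrArg (fun f => f ⟨w, hw⟩) hg
  rw [h1]
  have := hl (mem_univ (τ w))
  simp only [Function.comp_apply] at this
  rw [this, projIcc_of_mem _ (hτ w hw).1, (hτ w hw).2]

end BiLipArc

theorem isPreconnected_norm_gt (R : ℝ) : IsPreconnected {z : ℂ | R < ‖z‖} := by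
  have : {z : ℂ | R < ‖z‖} =
      (fun p : ℝ × ℝ => (p.1 : ℂ) * Complex.exp (p.2 * Complex.I)) '' (Ioi (max R 0) ×ˢ univ) ∪
      (fun p : ℝ × ℝ => (p.1 : ℂ) * Complex.exp (p.2 * Complex.I)) ''
        ({r | R < r ∧ 0 ≤ r} ×ˢ univ) := by
    ext z
    constructor
    · intro hz
      exact Or.inr ⟨(‖z‖, z.arg), ⟨⟨hz, norm_nonneg z⟩, trivial⟩, Complex.norm_mul_exp_arg_mul_I z⟩
    · rintro (⟨⟨r, θ⟩, ⟨hr, -⟩, rfl⟩ | ⟨⟨r, θ⟩, ⟨hr, -⟩, rfl⟩)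
      · have h1 : R < r ∧ 0 < r := max_lt_iff.1 hr
        simpa [abs_of_pos h1.2] using h1.1
      · simpa [abs_of_nonneg hr.2] using hr.1
  have h2 : IsPreconnected {r : ℝ | R < r ∧ 0 ≤ r} :=
    ((convex_Ioi R).inter (convex_Ici 0)).isPreconnected
  have hcont : Continuous (fun p : ℝ × ℝ => (p.1 : ℂ) * Complex.exp (p.2 * Complex.I)) := by
    fun_prop
  rw [this]
  refine IsPreconnected.union (((max R 0 + 1 : ℝ) : ℂ) * Complex.exp ((0 : ℝ) * Complex.I))
    ⟨(max R 0 + 1, 0), by simp, rfl⟩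
    ⟨(max R 0 + 1, 0), ⟨⟨by simp only; linarith [le_max_left R 0],
      by simp only; linarith [le_max_right R 0]⟩, trivial⟩, rfl⟩
    ((isPreconnected_Ioi.prod isPreconnected_univ).image _ hcont.continuousOn)
    ((h2.prod isPreconnected_univ).image _ hcont.continuousOn)

/-- There is no continuous logarithm of `z - z₀` along a circle around `z₀`. -/
theorem no_continuous_log_circle (z₀ : ℂ) {r : ℝ} (hr : 0 < r) (f : ℂ → ℂ) (hf : Continuous f)
    (h : ∀ θ : ℝ, Complex.exp (f (z₀ + r * Complex.exp (θ * Complex.I))) =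
      r * Complex.exp (θ * Complex.I)) : False := by
  have hr' : (r : ℂ) ≠ 0 := by exact_mod_cast hr.ne'
  set c := f (z₀ + r)
  have hc : Complex.exp c = r := by simpa [c] using h 0
  -- Both sides lift the same curve through the covering exp and agree at θ = 0; at θ = 2π they
  -- would differ by 2πi.
  have key : (fun θ : ℝ => f (z₀ + r * Complex.exp (θ * Complex.I))) =
      fun θ : ℝ => c + θ * Complex.I := by
    refine Complex.isCoveringMap_exp.eq_of_comp_eq (by fun_prop) (by fun_prop) ?_ 0 (by simp [c])
    funext θ
    apply Subtype.ext
    simp only [Function.comp_apply]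
    rw [h θ, Complex.exp_add, hc]
  have h1 := congrFun key (2 * Real.pi)
  have h2 : f (z₀ + r * Complex.exp (((2 * Real.pi : ℝ) : ℂ) * Complex.I)) = c := by
    push_cast
    rw [Complex.exp_two_pi_mul_I, mul_one]
  simp only [h2] at h1
  have : ((2 * Real.pi : ℝ) : ℂ) * Complex.I = 0 := by linear_combination -h1
  simp [Real.pi_ne_zero] at this

/-- An arc does not separate the plane. -/
theorem BiLipArc.isPreconnected_compl {γ : ℝ → ℂ} {a b C₁ C₂ : ℝ} (h : BiLipArc γ a b C₁ C₂) :
    IsPreconnected (γ '' Icc a b)ᶜ := by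
  set Γ := γ '' Icc a b with hΓ
  obtain ⟨R, hR⟩ := h.isCompact.isBounded.subset_closedBall 0
  have hfar : {z : ℂ | R < ‖z‖} ⊆ Γᶜ := fun z hz hzΓ => by
    have := hR hzΓ
    rw [mem_closedBall_zero_iff] at this
    exact absurd hz (not_lt.2 this)
  have hfar_conn := isPreconnected_norm_gt R
  obtain ⟨p, hp⟩ : ∃ p : ℂ, R < ‖p‖ := ⟨((|R| + 1 : ℝ) : ℂ), by
    rw [Complex.norm_real, Real.norm_eq_abs, abs_of_nonneg (by positivity)]
    linarith [le_abs_self R]⟩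
  -- Every component of the complement contains the far point p. Otherwise the component U of z₀ is
  -- bounded with frontier in Γ.
  have main : ∀ z₀ ∈ Γᶜ, p ∈ connectedComponentIn Γᶜ z₀ := by
    intro z₀ hz₀
    by_contra hpU
    set U := connectedComponentIn Γᶜ z₀ with hU
    have hUo : IsOpen U := h.isCompact.isClosed.isOpen_compl.connectedComponentIn
    have hUfar : ∀ z ∈ U, ‖z‖ ≤ R := by
      intro z hz
      by_contra hc
      push Not at hc
      have h1 : {z : ℂ | R < ‖z‖} ⊆ connectedComponentIn Γᶜ z :=
        hfar_conn.subset_connectedComponentIn hc hfar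
      rw [← connectedComponentIn_eq hz] at h1
      exact hpU (h1 hp)
    have hfront : frontier U ⊆ Γ := by
      intro z hz
      by_contra hzΓ
      have hzU : z ∉ U := fun hh => by
        rw [hUo.frontier_eq] at hz
        exact hz.2 hh
      have ho : IsOpen (connectedComponentIn Γᶜ z) :=
        h.isCompact.isClosed.isOpen_compl.connectedComponentIn
      have hzz : z ∈ connectedComponentIn Γᶜ z := mem_connectedComponentIn hzΓ
      obtain ⟨y, hy1, hy2⟩ := mem_closure_iff.1 (frontier_subset_closure hz) _ ho hzz
      have e1 := connectedComponentIn_eq hy1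
      have e2 := connectedComponentIn_eq hy2
      apply hzU
      rw [hU, e2, ← e1]
      exact hzz
    obtain ⟨g, hgc, hg⟩ := h.exists_continuous_log hz₀
    classical
    -- The logarithm on Γ replaces w - z₀ inside U by a function without zeros; the two pieces agree
    -- on the frontier. Since the plane is simply connected, G has a continuous logarithm, and on a
    -- large circle G is w - z₀, which has none.
    set G : ℂ → ℂ := fun w => if w ∈ U then Complex.exp (g w) else w - z₀ with hG
    have hGc : Continuous G := by
      refine Continuous.if (fun w hw => hg w (hfront hw)) (by fun_prop) (by fun_prop)
    have hG0 : ∀ w, G w ≠ 0 := by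
      intro w
      simp only [hG]
      split_ifs with hw
      · exact Complex.exp_ne_zero _
      · intro h0
        apply hw
        rw [sub_eq_zero.1 h0]
        exact mem_connectedComponentIn hz₀
    obtain ⟨f, hfc, hf⟩ := Complex.exists_continuousOn_eqOn_exp_comp (X := ℂ) (U := univ)
      (isSimplyConnected_univ_of_contractible _) isOpen_univ (g := G) hGc.continuousOn
      (by rintro ⟨w, -, hw⟩; exact hG0 w hw)
    set r := |R| + ‖z₀‖ + 1 with hr
    have hrp : 0 < r := by positivity
    refine no_continuous_log_circle z₀ hrp f (continuousOn_univ.1 hfc) fun θ => ?_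
    have h1 := hf (mem_univ (z₀ + r * Complex.exp (θ * Complex.I)))
    simp only [Function.comp_apply] at h1
    rw [h1]
    simp only [hG]
    rw [if_neg, add_sub_cancel_left]
    intro hmem
    have h2 := hUfar _ hmem
    have h3 : ‖(r : ℂ) * Complex.exp (θ * Complex.I)‖ = r := by
      rw [norm_mul, Complex.norm_exp_ofReal_mul_I, mul_one, Complex.norm_real, Real.norm_eq_abs,
        abs_of_pos hrp]
    have h4 := norm_sub_le (z₀ + r * Complex.exp (θ * Complex.I)) z₀
    rw [add_sub_cancel_left, h3] at h4
    linarith [le_abs_self R]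
  have : Γᶜ = connectedComponentIn Γᶜ p := by
    apply Subset.antisymm
    · intro z hz
      rw [← connectedComponentIn_eq (main z hz)]
      exact mem_connectedComponentIn hz
    · exact connectedComponentIn_subset _ _
  rw [this]
  exact isPreconnected_connectedComponentIn

/-- A Lipschitz arc is a null set of the plane. -/
theorem BiLipArc.volume_eq_zero {γ : ℝ → ℂ} {a b C₁ C₂ : ℝ} (h : BiLipArc γ a b C₁ C₂) :
    volume (γ '' Icc a b) = 0 := by
  -- A Lipschitz image of the line has Hausdorff dimension at most 1.
  have hd : dimH (γ '' Icc a b) < ((2 : NNReal) : ENNReal) := by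
    refine lt_of_le_of_lt (h.lipschitz.dimH_image_le _) ?_
    refine lt_of_le_of_lt (dimH_mono (subset_univ _)) ?_
    rw [Real.dimH_univ]
    norm_num
  refine measure_zero_of_dimH_lt ?_ hd
  have : ((2 : NNReal) : ℝ) = (Module.finrank ℝ ℂ : ℝ) := by simp
  rw [this]
  exact Measure.absolutelyContinuous_isAddHaarMeasure _ _

end ResolventCalculus

namespace ResolventCalculus

/-! ### The Cauchy transform of the area measure of a disc -/

/-- In polar coordinates about w the Jacobian r cancels the singularity 1/r. -/
theorem lintegral_inv_sub_ball_le (w : ℂ) {δ : ℝ} (hδ : 0 < δ) :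
    ∫⁻ ζ in Metric.ball w δ, ‖(w - ζ)⁻¹‖ₑ ≤ ENNReal.ofReal (2 * Real.pi * δ) := by
  have h1 : ∫⁻ ζ in Metric.ball w δ, ‖(w - ζ)⁻¹‖ₑ =
      ∫⁻ ζ, (Metric.ball (0 : ℂ) δ).indicator (fun ζ => ‖ζ⁻¹‖ₑ) ζ := by
    rw [← lintegral_indicator Metric.isOpen_ball.measurableSet,
      ← lintegral_sub_left_eq_self _ w]
    congr 1 with ζ
    by_cases hζ : ζ ∈ Metric.ball (0 : ℂ) δ
    · rw [indicator_of_mem hζ, indicator_of_mem]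
      · simp
      · simpa using hζ
    · rw [indicator_of_notMem hζ, indicator_of_notMem]
      simpa using hζ
  rw [h1, ← Complex.lintegral_comp_polarCoord_symm]
  calc _ ≤ ∫⁻ p in polarCoord.target, (Ioo 0 δ ×ˢ Ioo (-Real.pi) Real.pi).indicator 1 p := by
        refine setLIntegral_mono' polarCoord.open_target.measurableSet fun p hp => ?_
        simp only [polarCoord_target, mem_prod, mem_Ioi] at hp
        by_cases hpδ : p.1 < δ
        · rw [indicator_of_mem (show p ∈ Ioo 0 δ ×ˢ Ioo (-Real.pi) Real.pi from
            ⟨⟨hp.1, hpδ⟩, hp.2⟩), indicator_of_mem]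
          · simp only [Pi.one_apply, smul_eq_mul]
            rw [enorm_inv (by
              rw [← norm_ne_zero_iff, Complex.norm_polarCoord_symm]; simpa using hp.1.ne'),
              ← ofReal_norm, Complex.norm_polarCoord_symm, abs_of_pos hp.1]
            exact ENNReal.mul_inv_le_one _
          · rw [mem_ball_zero_iff, Complex.norm_polarCoord_symm, abs_of_pos hp.1]
            exact hpδ
        · rw [indicator_of_notMem]
          · simp
          · rw [mem_ball_zero_iff, Complex.norm_polarCoord_symm, abs_of_pos hp.1]
            exact hpδ
    _ ≤ ∫⁻ p, (Ioo 0 δ ×ˢ Ioo (-Real.pi) Real.pi).indicator 1 p := setLIntegral_le_lintegral _ _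
    _ = volume (Ioo 0 δ ×ˢ Ioo (-Real.pi) Real.pi) :=
        lintegral_indicator_one (measurableSet_Ioo.prod measurableSet_Ioo)
    _ = ENNReal.ofReal (2 * Real.pi * δ) := by
        rw [Measure.volume_eq_prod, Measure.prod_prod, Real.volume_Ioo, Real.volume_Ioo,
          ← ENNReal.ofReal_mul (by linarith)]
        congr 1
        ring

/-- Splitting at distance δ from w gives a bound uniform in w which is small when the area of E is
small: δ is fixed for the first term, and the area handles the second. -/
theorem setLIntegral_inv_sub_le (w : ℂ) {δ : ℝ} (hδ : 0 < δ) (E : Set ℂ) :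
    ∫⁻ ζ in E, ‖(w - ζ)⁻¹‖ₑ ≤
      ENNReal.ofReal (2 * Real.pi * δ) + ENNReal.ofReal δ⁻¹ * volume E := by
  have hb : MeasurableSet (Metric.ball w δ) := Metric.isOpen_ball.measurableSet
  rw [← lintegral_inter_add_sdiff _ E hb]
  refine add_le_add ?_ ?_
  · exact (lintegral_mono_set inter_subset_right).trans (lintegral_inv_sub_ball_le w hδ)
  · calc ∫⁻ ζ in E \ Metric.ball w δ, ‖(w - ζ)⁻¹‖ₑ
        ≤ ∫⁻ ζ in E \ Metric.ball w δ, ENNReal.ofReal δ⁻¹ := by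
          refine lintegral_mono_ae ?_
          have : ∀ᵐ ζ ∂(volume.restrict (E \ Metric.ball w δ)), ζ ∉ Metric.ball w δ := by
            have := ae_restrict_of_ae_restrict_of_subset
              (show E \ Metric.ball w δ ⊆ (Metric.ball w δ)ᶜ from fun x hx => hx.2)
              (ae_restrict_mem (μ := volume) hb.compl)
            exact this
          filter_upwards [this] with ζ hζ
          rw [← ofReal_norm]
          refine ENNReal.ofReal_le_ofReal ?_
          rw [norm_inv]
          refine inv_anti₀ hδ ?_
          rw [Metric.mem_ball, dist_eq_norm, norm_sub_rev] at hζ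
          exact not_lt.1 hζ
      _ = ENNReal.ofReal δ⁻¹ * volume (E \ Metric.ball w δ) := by
          rw [setLIntegral_const]
      _ ≤ _ := by gcongr; exact sdiff_subset

theorem integrableOn_inv_sub (w : ℂ) {E : Set ℂ} (hE : volume E ≠ ⊤) :
    IntegrableOn (fun ζ => (w - ζ)⁻¹) E := by
  refine ⟨(by fun_prop : Measurable fun ζ : ℂ => (w - ζ)⁻¹).aestronglyMeasurable, ?_⟩
  refine lt_of_le_of_lt (setLIntegral_inv_sub_le w one_pos E) ?_
  rw [inv_one, ENNReal.ofReal_one, one_mul]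
  exact ENNReal.add_lt_top.2 ⟨ENNReal.ofReal_lt_top, hE.lt_top⟩

theorem integral_polarCoord_symm_eq_circleAverage (f : ℂ → ℂ) (r : ℝ) :
    ∫ θ in Ioo (-Real.pi) Real.pi, f (Complex.polarCoord.symm (r, θ)) =
      2 * Real.pi * Real.circleAverage f 0 r := by
  rw [Real.circleAverage_eq_integral_add (-Real.pi),
    intervalIntegral.integral_comp_add_right (fun θ => f (circleMap 0 r θ)),
    ← integral_Ioc_eq_integral_Ioo, ← intervalIntegral.integral_of_le (by linarith [Real.pi_pos]),
    Complex.real_smul]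
  push_cast
  rw [← mul_assoc, mul_inv_cancel₀ (by simp [Real.pi_ne_zero]), one_mul]
  have h2 : -Real.pi + 2 * Real.pi = Real.pi := by ring
  rw [zero_add, show 2 * Real.pi + -Real.pi = Real.pi by ring]
  congr 1 with θ
  congr 1
  rw [Complex.polarCoord_symm_apply, circleMap, zero_add, Complex.exp_mul_I]
  simp

/-- Here (w-ζ)⁻¹ = w⁻¹ - w⁻¹ζ/(ζ-w), and Cauchy's formula for the constant 1 says that ζ/(ζ-w) has
average 1. -/
theorem circleAverage_inv_sub_of_lt {w : ℂ} {r : ℝ} (hw : w ≠ 0) (hr : ‖w‖ < r) :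
    Real.circleAverage (fun ζ => (w - ζ)⁻¹) 0 r = 0 := by
  have hr0 : 0 < r := (norm_nonneg w).trans_lt hr
  have h1 := DiffContOnCl.circleAverage_smul_div (c := 0) (R := r) (w := w)
    (f := fun _ => (1 : ℂ)) diffContOnCl_const (by rw [abs_of_pos hr0]; simpa using hr)
  have h2 : Real.circleAverage (fun ζ => (w - ζ)⁻¹) 0 r =
      Real.circleAverage (fun ζ => w⁻¹ - w⁻¹ * ((ζ - 0) / (ζ - w)) • (1 : ℂ)) 0 r := by
    refine Real.circleAverage_congr_sphere fun ζ hζ => ?_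
    have hne : ζ - w ≠ 0 := by
      intro h0
      rw [mem_sphere_zero_iff_norm, abs_of_pos hr0, sub_eq_zero.1 h0] at hζ
      exact hr.ne hζ
    have hne' : w - ζ ≠ 0 := by rwa [← neg_sub, neg_ne_zero]
    simp only [sub_zero, smul_eq_mul, mul_one]
    field_simp
    ring
  have hci : CircleIntegrable (fun ζ => ((ζ - 0) / (ζ - w)) • (1 : ℂ)) 0 r := by
    refine ContinuousOn.circleIntegrable hr0.le ?_
    have : ContinuousOn (fun ζ : ℂ => (ζ - 0) / (ζ - w)) (Metric.sphere 0 r) := by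
      refine ContinuousOn.div (by fun_prop) (by fun_prop) fun ζ hζ h0 => ?_
      rw [mem_sphere_zero_iff_norm, sub_eq_zero.1 h0] at hζ
      exact hr.ne hζ
    exact this.smul continuousOn_const
  have h3 : Real.circleAverage (fun ζ => w⁻¹ - w⁻¹ * ((ζ - 0) / (ζ - w)) • (1 : ℂ)) 0 r =
      w⁻¹ - w⁻¹ * Real.circleAverage (fun ζ => ((ζ - 0) / (ζ - w)) • (1 : ℂ)) 0 r := by
    have := Real.circleAverage_fun_sub (f₁ := fun _ => w⁻¹)
      (f₂ := fun ζ => w⁻¹ • (((ζ - 0) / (ζ - w)) • (1 : ℂ)))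
      (circleIntegrable_const w⁻¹ 0 r) (hci.const_fun_smul (a := w⁻¹))
    rw [Real.circleAverage_const, Real.circleAverage_fun_smul] at this
    simpa only [smul_eq_mul] using this
  rw [h2, h3, h1, mul_one, sub_self]

theorem circleAverage_inv_sub_of_gt {w : ℂ} {r : ℝ} (h0 : 0 < r) (hr : r < ‖w‖) :
    Real.circleAverage (fun ζ => (w - ζ)⁻¹) 0 r = w⁻¹ := by
  have hne : ∀ z ∈ Metric.closedBall (0 : ℂ) |r|, w - z ≠ 0 := fun z hz h1 => by
    rw [abs_of_pos h0, mem_closedBall_zero_iff, ← sub_eq_zero.1 h1] at hz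
    exact absurd hr (not_lt.2 hz)
  have := circleAverage_of_differentiable_on_off_countable (c := 0) (R := r)
    (f := fun ζ => (w - ζ)⁻¹) countable_empty
    (ContinuousOn.inv₀ (by fun_prop) hne)
    (fun z hz => DifferentiableAt.inv (by fun_prop) (hne z (Metric.ball_subset_closedBall hz.1)))
  simpa using this

/-- The circle of radius r contributes w⁻¹ for r < |w| and nothing beyond, so the integral is
w⁻¹·π|w|²; for w = 0 the integrand is odd. This exhibits the complex conjugate as an integral of
resolvents. -/
theorem integral_ball_inv_sub {w : ℂ} {R : ℝ} (hw : ‖w‖ < R) :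
    ∫ ζ in Metric.ball (0 : ℂ) R, (w - ζ)⁻¹ = Real.pi * (starRingEnd ℂ) w := by
  have hb : MeasurableSet (Metric.ball (0 : ℂ) R) := Metric.isOpen_ball.measurableSet
  have hR : 0 < R := (norm_nonneg w).trans_lt hw
  rcases eq_or_ne w 0 with rfl | hw0
  · have h1 : ∫ ζ in Metric.ball (0 : ℂ) R, ((0 : ℂ) - ζ)⁻¹ =
        -∫ ζ in Metric.ball (0 : ℂ) R, ((0 : ℂ) - ζ)⁻¹ := by
      rw [← integral_indicator hb]
      refine (integral_neg_eq_self ((Metric.ball (0 : ℂ) R).indicator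
        fun ζ => ((0 : ℂ) - ζ)⁻¹) volume).symm.trans ?_
      rw [← integral_neg]
      congr 1 with ζ
      by_cases hζ : ζ ∈ Metric.ball (0 : ℂ) R
      · rw [indicator_of_mem hζ, indicator_of_mem (by simpa using hζ), ← inv_neg]
        congr 1
        ring
      · rw [indicator_of_notMem hζ, indicator_of_notMem (by simpa using hζ), neg_zero]
    simpa using self_eq_neg.1 h1
  · have hwp : 0 < ‖w‖ := norm_pos_iff.2 hw0
    set f : ℂ → ℂ := (Metric.ball (0 : ℂ) R).indicator fun ζ => (w - ζ)⁻¹ with hf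
    have hpt : ∀ p ∈ polarCoord.target, p.1 • f (Complex.polarCoord.symm p) =
        (Ioo 0 R ×ˢ Ioo (-Real.pi) Real.pi).indicator
          (fun p => (p.1 : ℂ) * (w - Complex.polarCoord.symm p)⁻¹) p := by
      intro p hp
      simp only [polarCoord_target, mem_prod, mem_Ioi] at hp
      by_cases hpR : p.1 < R
      · rw [indicator_of_mem (show p ∈ Ioo 0 R ×ˢ Ioo (-Real.pi) Real.pi from
          ⟨⟨hp.1, hpR⟩, hp.2⟩), hf, indicator_of_mem]
        · rfl
        · rw [mem_ball_zero_iff, Complex.norm_polarCoord_symm, abs_of_pos hp.1]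
          exact hpR
      · rw [indicator_of_notMem (fun hh => hpR hh.1.2), hf, indicator_of_notMem, smul_zero]
        rw [mem_ball_zero_iff, Complex.norm_polarCoord_symm, abs_of_pos hp.1]
        exact hpR
    have hsub : Ioo 0 R ×ˢ Ioo (-Real.pi) Real.pi ⊆ polarCoord.target := fun p hp =>
      ⟨hp.1.1, hp.2⟩
    have hmeas : MeasurableSet (Ioo (0 : ℝ) R ×ˢ Ioo (-Real.pi) Real.pi) :=
      measurableSet_Ioo.prod measurableSet_Ioo
    have hint : IntegrableOn (fun p : ℝ × ℝ => (p.1 : ℂ) * (w - Complex.polarCoord.symm p)⁻¹)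
        (Ioo 0 R ×ˢ Ioo (-Real.pi) Real.pi) := by
      have hm : Measurable fun p : ℝ × ℝ => (p.1 : ℂ) * (w - Complex.polarCoord.symm p)⁻¹ := by
        simp only [Complex.polarCoord_symm_apply]
        fun_prop
      refine ⟨hm.aestronglyMeasurable, ?_⟩
      have h1 := lintegral_inv_sub_ball_le (0 : ℂ) hR
      have hfin : ∫⁻ ζ, ‖f ζ‖ₑ < ⊤ := by
        have := (integrableOn_inv_sub w (E := Metric.ball (0 : ℂ) R)
          measure_ball_lt_top.ne).integrable_indicator hb
        exact this.2
      rw [← Complex.lintegral_comp_polarCoord_symm] at hfin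
      refine lt_of_le_of_lt ?_ hfin
      refine le_trans ?_ (lintegral_mono_set hsub)
      refine setLIntegral_mono' hmeas fun p hp => ?_
      have h2 := hpt p (hsub hp)
      rw [indicator_of_mem hp] at h2
      change ‖(p.1 : ℂ) * (w - Complex.polarCoord.symm p)⁻¹‖ₑ ≤ _
      rw [← h2, enorm_smul, Real.enorm_eq_ofReal hp.1.1.le]
      rfl
    rw [← integral_indicator hb, ← Complex.integral_comp_polarCoord_symm,
      setIntegral_congr_fun polarCoord.open_target.measurableSet hpt,
      setIntegral_indicator hmeas, inter_eq_self_of_subset_right hsub, Measure.volume_eq_prod,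
      setIntegral_prod _ hint]
    have hin : ∀ r ∈ Ioo 0 R, r ≠ ‖w‖ →
        ∫ θ in Ioo (-Real.pi) Real.pi, ((r : ℝ) : ℂ) * (w - Complex.polarCoord.symm (r, θ))⁻¹ =
        (Ioo 0 ‖w‖).indicator (fun r : ℝ => ((2 * Real.pi * r : ℝ) : ℂ) * w⁻¹) r := by
      intro r hr hne
      rw [integral_const_mul, integral_polarCoord_symm_eq_circleAverage (fun ζ => (w - ζ)⁻¹) r]
      rcases lt_or_gt_of_ne hne with hlt | hgt
      · rw [circleAverage_inv_sub_of_gt hr.1 hlt, indicator_of_mem (show r ∈ Ioo 0 ‖w‖ from ⟨hr.1, hlt⟩)]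
        push_cast
        ring
      · rw [circleAverage_inv_sub_of_lt hw0 hgt, indicator_of_notMem (fun hh => hgt.not_gt hh.2)]
        simp
    have hae : ∀ᵐ r ∂(volume.restrict (Ioo 0 R)), r ≠ ‖w‖ :=
      ae_restrict_of_ae (by simp [ae_iff, measure_singleton])
    rw [integral_congr_ae (g := (Ioo 0 ‖w‖).indicator
      (fun r : ℝ => ((2 * Real.pi * r : ℝ) : ℂ) * w⁻¹))]
    · rw [setIntegral_indicator measurableSet_Ioo, inter_eq_self_of_subset_right
        (Ioo_subset_Ioo_right hw.le), integral_mul_const, integral_complex_ofReal,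
        integral_const_mul, ← integral_Ioc_eq_integral_Ioo,
        ← intervalIntegral.integral_of_le hwp.le, integral_id]
      have h3 : w * (starRingEnd ℂ) w = (‖w‖ : ℂ) ^ 2 := Complex.mul_conj' w
      field_simp
      push_cast
      linear_combination (-(Real.pi : ℂ)) * h3
    · filter_upwards [hae, ae_restrict_mem measurableSet_Ioo] with r h1 h2 using hin r h2 h1

/-! ### The Hartogs–Rosenthal theorem -/

section Density

variable {K : Set ℂ} [CompactSpace K]

/-- The identity function on `K`, as an element of `C(K, ℂ)`. -/
noncomputable abbrev coordFun (K : Set ℂ) : C(K, ℂ) := ContinuousMap.restrict K (ContinuousMap.id ℂ)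

theorem mem_resolventSet_coordFun {ζ : ℂ} (h : ζ ∉ K) : ζ ∈ resolventSet ℂ (coordFun K) := by
  rw [spectrum.mem_resolventSet_iff, ContinuousMap.isUnit_iff_forall_ne_zero]
  intro w h0
  apply h
  have : ζ - (w : ℂ) = 0 := by simpa using h0
  rw [sub_eq_zero.1 this]
  exact w.2

theorem resolvent_coordFun_mul {ζ : ℂ} (h : ζ ∉ K) :
    (algebraMap ℂ C(K, ℂ) ζ - coordFun K) * resolvent (coordFun K) ζ = 1 :=
  Ring.mul_inverse_cancel _ (mem_resolventSet_coordFun h)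

theorem resolvent_coordFun_apply {ζ : ℂ} (h : ζ ∉ K) (w : K) :
    resolvent (coordFun K) ζ w = (ζ - w)⁻¹ := by
  have h1 := congrArg (fun f : C(K, ℂ) => f w) (resolvent_coordFun_mul h)
  simp only [ContinuousMap.mul_apply, ContinuousMap.one_apply] at h1
  exact (eq_inv_of_mul_eq_one_right (by simpa using h1))

variable (K) in
/-- The closed span of the functions `w ↦ (ζ - w)⁻¹`, `ζ ∉ K`. -/
noncomputable def resolventSpan : Submodule ℂ C(K, ℂ) :=
  (Submodule.span ℂ ((fun ζ => resolvent (coordFun K) ζ) '' Kᶜ)).topologicalClosure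

theorem isClosed_resolventSpan : IsClosed (resolventSpan K : Set C(K, ℂ)) :=
  Submodule.isClosed_topologicalClosure _

theorem resolvent_mem_resolventSpan {ζ : ℂ} (h : ζ ∉ K) :
    resolvent (coordFun K) ζ ∈ resolventSpan K :=
  Submodule.le_topologicalClosure _ (Submodule.subset_span ⟨ζ, h, rfl⟩)

theorem resolventSpan_le {T : Submodule ℂ C(K, ℂ)} (hT : IsClosed (T : Set C(K, ℂ)))
    (h : ∀ ζ ∉ K, resolvent (coordFun K) ζ ∈ T) : resolventSpan K ≤ T := by
  refine Submodule.topologicalClosure_minimal _ (Submodule.span_le.2 ?_) hT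
  rintro _ ⟨ζ, hζ, rfl⟩
  exact h ζ hζ

/-- For distinct points the product splits into partial fractions; for ζ = η it is minus the
derivative of the resolvent, a limit of difference quotients. -/
theorem resolvent_mul_resolvent_mem {ζ η : ℂ} (hζ : ζ ∉ K) (hη : η ∉ K) :
    resolvent (coordFun K) ζ * resolvent (coordFun K) η ∈ resolventSpan K := by
  rcases eq_or_ne ζ η with rfl | hne
  · have h1 := (spectrum.hasDerivAt_resolvent_const_left
      (mem_resolventSet_coordFun hζ)).tendsto_slope
    rw [← sq, ← neg_neg (_ ^ 2)]
    refine Submodule.neg_mem _ (isClosed_resolventSpan.mem_of_tendsto h1 ?_)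
    have hK : IsClosed K := (isCompact_iff_compactSpace.2 inferInstance).isClosed
    have : ∀ᶠ z in 𝓝[≠] ζ, z ∉ K := nhdsWithin_le_nhds (hK.isOpen_compl.mem_nhds hζ)
    filter_upwards [this] with z hz
    rw [slope_def_module]
    exact Submodule.smul_mem _ _ (Submodule.sub_mem _ (resolvent_mem_resolventSpan hz)
      (resolvent_mem_resolventSpan hζ))
  · have : resolvent (coordFun K) ζ * resolvent (coordFun K) η =
        (η - ζ)⁻¹ • (resolvent (coordFun K) ζ - resolvent (coordFun K) η) := by
      ext w
      have h1 : ζ - w ≠ 0 := fun h => hζ (sub_eq_zero.1 h ▸ w.2)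
      have h2 : η - w ≠ 0 := fun h => hη (sub_eq_zero.1 h ▸ w.2)
      have h3 : η - ζ ≠ 0 := sub_ne_zero.2 hne.symm
      simp only [ContinuousMap.mul_apply, ContinuousMap.smul_apply, ContinuousMap.sub_apply,
        resolvent_coordFun_apply hζ, resolvent_coordFun_apply hη, smul_eq_mul]
      field_simp
      ring
    rw [this]
    exact Submodule.smul_mem _ _ (Submodule.sub_mem _ (resolvent_mem_resolventSpan hζ)
      (resolvent_mem_resolventSpan hη))

theorem mul_mem_resolventSpan {f g : C(K, ℂ)} (hf : f ∈ resolventSpan K)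
    (hg : g ∈ resolventSpan K) : f * g ∈ resolventSpan K := by
  have key : ∀ f : C(K, ℂ), IsClosed
      ((resolventSpan K).comap (LinearMap.mulLeft ℂ f) : Set C(K, ℂ)) := fun f =>
    isClosed_resolventSpan.preimage (continuous_const.mul continuous_id)
  have h1 : ∀ ζ ∉ K, resolventSpan K ≤
      (resolventSpan K).comap (LinearMap.mulLeft ℂ (resolvent (coordFun K) ζ)) := fun ζ hζ =>
    resolventSpan_le (key _) fun η hη => resolvent_mul_resolvent_mem hζ hη
  refine resolventSpan_le (T := (resolventSpan K).comap (LinearMap.mulLeft ℂ f)) (key f)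
    (fun ζ hζ => ?_) hg
  have := h1 ζ hζ hf
  simp only [Submodule.mem_comap, LinearMap.mulLeft_apply] at this ⊢
  rwa [mul_comm]

/-- The expansion ζ/(ζ-w) = 1 + w/(ζ-w) at infinity is the source of the constants in the span, and
of the coordinate function at the next order. -/
theorem tendsto_smul_resolvent :
    Tendsto (fun ζ : ℂ => ζ • resolvent (coordFun K) ζ) (Bornology.cobounded ℂ) (𝓝 1) := by
  have hK : IsCompact K := isCompact_iff_compactSpace.2 inferInstance
  have h1 : Tendsto (fun ζ : ℂ => 1 + coordFun K * resolvent (coordFun K) ζ)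
      (Bornology.cobounded ℂ) (𝓝 (1 + coordFun K * 0)) :=
    ((spectrum.resolvent_tendsto_cobounded (𝕜 := ℂ) (coordFun K)).const_mul _).const_add _
  rw [mul_zero, add_zero] at h1
  refine h1.congr' ?_
  filter_upwards [Bornology.isBounded_def.1 hK.isBounded] with ζ hζ
  have h2 := resolvent_coordFun_mul hζ
  rw [← h2, sub_mul, sub_add_cancel, Algebra.smul_def]

theorem one_mem_resolventSpan : (1 : C(K, ℂ)) ∈ resolventSpan K := by
  have hK : IsCompact K := isCompact_iff_compactSpace.2 inferInstance
  refine isClosed_resolventSpan.mem_of_tendsto tendsto_smul_resolvent ?_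
  filter_upwards [Bornology.isBounded_def.1 hK.isBounded] with ζ hζ
  exact Submodule.smul_mem _ _ (resolvent_mem_resolventSpan hζ)

theorem coordFun_mem_resolventSpan : coordFun K ∈ resolventSpan K := by
  have hK : IsCompact K := isCompact_iff_compactSpace.2 inferInstance
  have h1 := (tendsto_smul_resolvent (K := K)).const_mul (coordFun K)
  rw [mul_one] at h1
  refine isClosed_resolventSpan.mem_of_tendsto h1 ?_
  filter_upwards [Bornology.isBounded_def.1 hK.isBounded] with ζ hζ
  have h2 := resolvent_coordFun_mul hζ
  have h3 : coordFun K * ζ • resolvent (coordFun K) ζ =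
      ζ • (ζ • resolvent (coordFun K) ζ - 1) := by
    rw [← h2, sub_mul, Algebra.smul_def ζ (resolvent _ _)]
    rw [sub_sub_cancel, Algebra.smul_def, mul_left_comm]
  rw [h3]
  exact Submodule.smul_mem _ _ (Submodule.sub_mem _ (Submodule.smul_mem _ _
    (resolvent_mem_resolventSpan hζ)) one_mem_resolventSpan)

/-- Averages of a function with values in a closed convex set stay in it, and a subspace absorbs the
factor vol(E). -/
theorem setIntegral_resolvent_mem {E : Set ℂ} (hE : IsCompact E) (hEK : Disjoint E K) :
    IntegrableOn (fun ζ => resolvent (coordFun K) ζ) E ∧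
      ∫ ζ in E, resolvent (coordFun K) ζ ∈ resolventSpan K := by
  have hc : ContinuousOn (fun ζ => resolvent (coordFun K) ζ) E := fun ζ hζ =>
    (spectrum.hasDerivAt_resolvent_const_left (mem_resolventSet_coordFun
      (hEK.notMem_of_mem_left hζ))).continuousAt.continuousWithinAt
  have hi := hc.integrableOn_compact hE (μ := volume)
  refine ⟨hi, ?_⟩
  rcases eq_or_ne (volume E) 0 with h0 | h0
  · rw [Measure.restrict_eq_zero.2 h0, integral_zero_measure]
    exact Submodule.zero_mem _
  · rw [← measure_smul_setAverage _ hE.measure_lt_top.ne]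
    have h1 : (⨍ ζ in E, resolvent (coordFun K) ζ) ∈
        (((resolventSpan K).restrictScalars ℝ : Submodule ℝ C(K, ℂ)) : Set C(K, ℂ)) := by
      refine Convex.set_average_mem (Submodule.convex _) isClosed_resolventSpan h0
        hE.measure_lt_top.ne ?_ hi
      filter_upwards [ae_restrict_mem hE.measurableSet] with ζ hζ
      exact resolvent_mem_resolventSpan (hEK.notMem_of_mem_left hζ)
    exact ((resolventSpan K).restrictScalars ℝ).smul_mem _ h1

/-- The Cauchy transform of a disc containing K is πw̄. Removing a thin neighbourhood of K from the
disc leaves an integral of resolvents with poles off K, and the removed part contributes little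
because the neighbourhood has small area. -/
theorem star_coordFun_mem_resolventSpan (h0 : volume K = 0) :
    star (coordFun K) ∈ resolventSpan K := by
  have hK : IsCompact K := isCompact_iff_compactSpace.2 inferInstance
  obtain ⟨R, hR⟩ := hK.isBounded.subset_ball (0 : ℂ)
  have hth : Tendsto (fun r => volume (Metric.thickening r K)) (𝓝[>] 0) (𝓝 0) := by
    rw [← h0]
    exact tendsto_measure_thickening_of_isClosed ⟨1, one_pos,
      (hK.isBounded.thickening).measure_lt_top.ne⟩ hK.isClosed
  suffices h : (-(Real.pi : ℂ)) • star (coordFun K) ∈ resolventSpan K by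
    have := Submodule.smul_mem _ ((-(Real.pi : ℂ))⁻¹) h
    rwa [smul_smul, inv_mul_cancel₀ (by simp [Real.pi_ne_zero]), one_smul] at this
  rw [← SetLike.mem_coe, ← isClosed_resolventSpan.closure_eq, Metric.mem_closure_iff]
  intro ε hε
  -- The part within distance δ of w costs less than ε/2; once δ is fixed, the neighbourhood is
  -- thinned until its area is below δε/2, which accounts for the other half.
  obtain ⟨δ, hδ, hδε⟩ : ∃ δ > 0, 2 * Real.pi * δ < ε / 2 :=
    ⟨ε / (8 * Real.pi), by positivity, by field_simp; norm_num⟩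
  have hev : ∀ᶠ r in 𝓝[>] (0 : ℝ), volume (Metric.thickening r K) < ENNReal.ofReal (δ * (ε / 2)) :=
    hth.eventually_lt_const (by simp; positivity)
  obtain ⟨r, hr, hr0⟩ := (hev.and self_mem_nhdsWithin).exists
  have hr0 : 0 < r := hr0
  set E : Set ℂ := Metric.closedBall 0 R \ Metric.thickening r K with hE
  have hEc : IsCompact E := (isCompact_closedBall 0 R).diff Metric.isOpen_thickening
  have hEK : Disjoint E K := disjoint_left.2 fun z hz hzK =>
    hz.2 (Metric.self_subset_thickening hr0 K hzK)
  obtain ⟨hi, hm⟩ := setIntegral_resolvent_mem hEc hEK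
  refine ⟨_, hm, ?_⟩
  rw [dist_eq_norm, ContinuousMap.norm_lt_iff _ hε]
  intro w
  set T : Set ℂ := Metric.closedBall 0 R ∩ Metric.thickening r K with hT
  have hvT : volume T ≤ ENNReal.ofReal (δ * (ε / 2)) := (measure_mono inter_subset_right).trans hr.le
  have hw : ‖(w : ℂ)‖ < R := mem_ball_zero_iff.1 (hR w.2)
  have h1 : (∫ ζ in E, resolvent (coordFun K) ζ) w = -∫ ζ in E, ((w : ℂ) - ζ)⁻¹ := by
    rw [ContinuousMap.integral_apply hi, ← integral_neg]
    refine setIntegral_congr_fun hEc.measurableSet fun ζ hζ => ?_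
    change resolvent (coordFun K) ζ w = -((w : ℂ) - ζ)⁻¹
    rw [resolvent_coordFun_apply (hEK.notMem_of_mem_left hζ), ← inv_neg, neg_sub]
  have hib : IntegrableOn (fun ζ => ((w : ℂ) - ζ)⁻¹) (Metric.closedBall 0 R) :=
    integrableOn_inv_sub w (isCompact_closedBall _ _).measure_lt_top.ne
  have h2 : ∫ ζ in Metric.closedBall (0 : ℂ) R, ((w : ℂ) - ζ)⁻¹ =
      Real.pi * (starRingEnd ℂ) w := by
    rw [← integral_ball_inv_sub hw]
    refine setIntegral_congr_set ?_
    rw [← Metric.ball_union_sphere]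
    refine union_ae_eq_left_of_ae_eq_empty (ae_eq_empty.2 ?_)
    exact Measure.addHaar_sphere _ _ _
  have h3 := integral_inter_add_sdiff (μ := volume) (s := Metric.closedBall (0 : ℂ) R)
    (t := Metric.thickening r K) (f := fun ζ => ((w : ℂ) - ζ)⁻¹)
    Metric.isOpen_thickening.measurableSet hib
  have h4 : (-(Real.pi : ℂ) • star (coordFun K) - ∫ ζ in E, resolvent (coordFun K) ζ) w =
      -∫ ζ in T, ((w : ℂ) - ζ)⁻¹ := by
    rw [ContinuousMap.sub_apply, h1]
    change -(Real.pi : ℂ) * (starRingEnd ℂ) w - -_ = _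
    rw [h2] at h3
    rw [neg_mul, ← h3]
    ring
  rw [h4, norm_neg]
  refine (norm_integral_le_lintegral_norm _).trans_lt ?_
  rw [← ENNReal.toReal_ofReal hε.le]
  refine (ENNReal.toReal_lt_toReal ?_ (by simp)).2 ?_
  · have := (hib.mono_set (inter_subset_left : T ⊆ _)).2
    simp only [HasFiniteIntegral] at this
    simpa only [ofReal_norm] using this.ne
  · simp only [ofReal_norm]
    refine (setLIntegral_inv_sub_le w hδ T).trans_lt ?_
    calc _ ≤ ENNReal.ofReal (2 * Real.pi * δ) +
          ENNReal.ofReal δ⁻¹ * ENNReal.ofReal (δ * (ε / 2)) := by gcongr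
      _ = ENNReal.ofReal (2 * Real.pi * δ + ε / 2) := by
          rw [← ENNReal.ofReal_mul (by positivity), ← ENNReal.ofReal_add (by positivity)
            (by positivity)]
          congr 2
          field_simp
      _ < ENNReal.ofReal ε := (ENNReal.ofReal_lt_ofReal_iff hε).2 (by linarith)

/-- **Hartogs–Rosenthal**: on a compact set of area zero, the functions `w ↦ (ζ - w)⁻¹`,
`ζ ∉ K`, span a dense subspace of the continuous functions. -/
theorem resolventSpan_eq_top (h0 : volume K = 0) : resolventSpan K = ⊤ := by
  have hK : IsCompact K := isCompact_iff_compactSpace.2 inferInstance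
  -- The closed span is an algebra containing the coordinate function and its conjugate;
  -- Stone–Weierstrass does the rest.
  let B : Subalgebra ℂ C(K, ℂ) :=
    { carrier := resolventSpan K
      mul_mem' := mul_mem_resolventSpan
      add_mem' := Submodule.add_mem _
      algebraMap_mem' := fun c => by
        rw [Algebra.algebraMap_eq_smul_one]
        exact Submodule.smul_mem _ _ one_mem_resolventSpan }
  have h1 : (StarAlgebra.adjoin ℂ {coordFun K}).toSubalgebra ≤ B := by
    rw [StarAlgebra.adjoin_toSubalgebra]
    refine Algebra.adjoin_le ?_
    rintro f (rfl | hf)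
    · exact coordFun_mem_resolventSpan
    · have : f = star (coordFun K) := by
        rw [Set.mem_star, mem_singleton_iff] at hf
        rw [← hf, star_star]
      rw [this]
      exact star_coordFun_mem_resolventSpan h0
  have h2 := ContinuousMap.elemental_id_eq_top (𝕜 := ℂ) K
  refine eq_top_iff.2 fun f _ => ?_
  have h3 : f ∈ StarAlgebra.elemental ℂ (coordFun K) := by
    rw [h2]
    trivial
  exact closure_minimal (show ((StarAlgebra.adjoin ℂ {coordFun K} : StarSubalgebra ℂ C(K, ℂ)) :
    Set C(K, ℂ)) ⊆ resolventSpan K from h1) isClosed_resolventSpan h3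

end Density

end ResolventCalculus

/-! ### Integration along Lipschitz arcs -/

namespace ResolventCalculus

/-- The fundamental theorem of calculus for Lipschitz functions. -/
theorem integral_of_lipschitzOnWith {f f' : ℝ → ℂ} {s t : ℝ} {K : NNReal}
    (hf : LipschitzOnWith K f (uIcc s t))
    (hd : ∀ᵐ x, x ∈ Ioo (min s t) (max s t) → HasDerivAt f (f' x) x) :
    IntervalIntegrable f' volume s t ∧ ∫ x in s..t, f' x = f t - f s := by
  have hne : ∀ c : ℝ, ∀ᵐ x : ℝ, x ≠ c := fun c => by simp [ae_iff, measure_singleton]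
  have hnb : ∀ᵐ x, x ∈ uIcc s t → x ∈ Ioo (min s t) (max s t) := by
    filter_upwards [hne (max s t), hne (min s t)] with x hx hx' h
    exact ⟨lt_of_le_of_ne h.1 hx'.symm, lt_of_le_of_ne h.2 hx⟩
  have hd' : ∀ᵐ x, x ∈ uIcc s t → HasDerivAt f (f' x) x := by
    filter_upwards [hd, hnb] with x h1 h2 h3 using h1 (h2 h3)
  have hbd : ∀ᵐ x, x ∈ uIcc s t → ‖f' x‖ ≤ K := by
    filter_upwards [hd', hnb] with x h1 h2 h3
    refine (h1 h3).le_of_lip' K.2 ?_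
    filter_upwards [isOpen_Ioo.mem_nhds (h2 h3)] with y hy
    have := hf.norm_sub_le (x := y) (y := x) (Ioo_subset_Icc_self hy) h3
    simpa using this
  have hbd' : ∀ᵐ x, x ∈ uIoc s t → ‖f' x‖ ≤ K := by
    filter_upwards [hbd] with x h1 h2 using h1 (uIoc_subset_uIcc h2)
  have hsm : AEStronglyMeasurable f' (volume.restrict (uIoc s t)) := by
    refine (aestronglyMeasurable_deriv f _).congr ?_
    filter_upwards [ae_restrict_of_ae hd', ae_restrict_mem measurableSet_uIoc] with x h1 h2
    exact (h1 (uIoc_subset_uIcc h2)).deriv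
  have hint : IntervalIntegrable f' volume s t := by
    rw [intervalIntegrable_iff]
    refine IntegrableOn.of_bound measure_Ioc_lt_top hsm K ?_
    filter_upwards [ae_restrict_of_ae hbd', ae_restrict_mem measurableSet_uIoc] with x h1 h2
      using h1 h2
  refine ⟨hint, ?_⟩
  have hG : LipschitzOnWith K (fun y => ∫ x in s..y, f' x) (uIcc s t) := by
    refine LipschitzOnWith.of_dist_le_mul fun y hy x hx => ?_
    have hi : ∀ {z}, z ∈ uIcc s t → IntervalIntegrable f' volume s z := fun hz =>
      hint.mono_set (uIcc_subset_uIcc_left hz)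
    rw [dist_eq_norm, intervalIntegral.integral_interval_sub_left (hi hy) (hi hx), Real.dist_eq]
    refine intervalIntegral.norm_integral_le_of_norm_le_const_ae ?_
    filter_upwards [hbd] with z h1 h2
    exact h1 (uIcc_subset_uIcc hx hy (uIoc_subset_uIcc h2))
  -- The difference between f and the integral of f' is absolutely continuous with derivative zero
  -- almost everywhere, hence constant.
  have hac := hf.absolutelyContinuousOnInterval.sub hG.absolutelyContinuousOnInterval
  obtain ⟨C, hC⟩ := hac.const_of_ae_hasDerivAt_zero (by
    filter_upwards [hd', hint.ae_hasDerivAt_integral] with x h1 h2 h3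
    have := (h1 h3).sub (h2 h3 s left_mem_uIcc)
    simpa using this)
  have h1 := hC s left_mem_uIcc
  have h2 := hC t right_mem_uIcc
  simp only [Pi.sub_apply, intervalIntegral.integral_same, sub_zero] at h1 h2
  rw [← h1] at h2
  linear_combination -h2

variable {γ : ℝ → ℂ} {a b C₁ C₂ : ℝ}

/-- The derivative of F exists only within Γ, which is not convex, so no mean value inequality is
available in the plane. Instead the right slopes of F∘γ are bounded through |γ(v)-γ(z)| ≤ C₂|v-z|
and integrated by a growth lemma on the line. -/
theorem BiLipArc.lipschitzOnWith_comp (h : BiLipArc γ a b C₁ C₂) {F F' : ℂ → ℂ} {M : ℝ}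
    (hM : 0 ≤ M)
    (hF : ∀ w ∈ γ '' Icc a b, HasDerivWithinAt F (F' w) (γ '' Icc a b) w)
    (hF' : ∀ w ∈ γ '' Icc a b, ‖F' w‖ ≤ M) :
    LipschitzOnWith (M * C₂).toNNReal (F ∘ γ) (Icc a b) := by
  have hMC : 0 ≤ M * C₂ := mul_nonneg hM h.pos₂.le
  have hc : ContinuousOn (F ∘ γ) (Icc a b) := ContinuousOn.comp
    (fun w hw => (hF w hw).continuousWithinAt) h.continuous.continuousOn (mapsTo_image _ _)
  have key : ∀ x ∈ Icc a b, ∀ y ∈ Icc a b, x ≤ y →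
      ‖(F ∘ γ) y - (F ∘ γ) x‖ ≤ M * C₂ * (y - x) := by
    intro x hx y hy hxy
    have hsub : Icc x y ⊆ Icc a b := Icc_subset_Icc hx.1 hy.2
    refine image_le_of_liminf_slope_right_le_deriv_boundary
      (f := fun z => ‖(F ∘ γ) z - (F ∘ γ) x‖) (a := x) (b := y)
      (B := fun z => M * C₂ * (z - x)) (B' := fun _ => M * C₂)
      ((hc.mono hsub).sub continuousOn_const).norm (by simp) (by fun_prop) (fun z _ => ?_)
      (fun z hz r hr => ?_) (right_mem_Icc.2 hxy)
    · simpa using (((hasDerivAt_id z).sub_const x).const_mul (M * C₂)).hasDerivWithinAt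
    · have hz' : z ∈ Icc a b := hsub (Ico_subset_Icc_self hz)
      obtain ⟨ε, hε, hεr⟩ : ∃ ε > 0, (M + ε) * C₂ < r :=
        ⟨(r - M * C₂) / (2 * C₂), div_pos (sub_pos.2 hr) (by linarith [h.pos₂]), by
          have := h.pos₂
          field_simp
          linarith⟩
      have h1 := (hasDerivWithinAt_iff_isLittleO.1 (hF _ (mem_image_of_mem γ hz'))).def hε
      have h2 : Tendsto γ (𝓝[>] z) (𝓝[γ '' Icc a b] (γ z)) := by
        refine tendsto_nhdsWithin_iff.2
          ⟨h.continuous.continuousAt.tendsto.mono_left nhdsWithin_le_nhds, ?_⟩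
        filter_upwards [Ioo_mem_nhdsGT hz.2] with v hv
        exact mem_image_of_mem γ (hsub ⟨hz.1.trans hv.1.le, hv.2.le⟩)
      refine Eventually.frequently ?_
      filter_upwards [h2.eventually h1, self_mem_nhdsWithin] with v hv hvz
      have hvz : z < v := hvz
      rw [slope_def_field, div_lt_iff₀ (sub_pos.2 hvz)]
      have h3 : ‖F (γ v) - F (γ z)‖ ≤ (M + ε) * ‖γ v - γ z‖ := by
        have h4 := norm_le_norm_add_norm_sub' (F (γ v) - F (γ z)) ((γ v - γ z) • F' (γ z))
        rw [norm_smul] at h4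
        have := hF' _ (mem_image_of_mem γ hz')
        nlinarith [norm_nonneg (γ v - γ z)]
      have h5 : ‖γ v - γ z‖ ≤ C₂ * (v - z) := by
        simpa [abs_of_pos (sub_pos.2 hvz)] using h.upper z v
      have h6 := norm_sub_norm_le (F (γ v) - F (γ x)) (F (γ z) - F (γ x))
      rw [sub_sub_sub_cancel_right] at h6
      calc _ ≤ _ := h6
        _ ≤ (M + ε) * (C₂ * (v - z)) := h3.trans (by gcongr)
        _ < r * (v - z) := by rw [← mul_assoc]; gcongr
  refine LipschitzOnWith.of_dist_le_mul fun x hx y hy => ?_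
  rw [Real.coe_toNNReal _ hMC, dist_eq_norm, Real.dist_eq]
  rcases le_total x y with hxy | hxy
  · rw [norm_sub_rev, abs_sub_comm, abs_of_nonneg (sub_nonneg.2 hxy)]
    exact key x hx y hy hxy
  · rw [abs_of_nonneg (sub_nonneg.2 hxy)]
    exact key y hy x hx hxy

/-- F∘γ is Lipschitz, and wherever γ is differentiable, that is almost everywhere by Rademacher, the
chain rule gives its derivative. -/
theorem BiLipArc.integral_comp_mul_deriv (h : BiLipArc γ a b C₁ C₂) {F F' : ℂ → ℂ}
    (hF : ∀ w ∈ γ '' Icc a b, HasDerivWithinAt F (F' w) (γ '' Icc a b) w)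
    (hF' : ContinuousOn F' (γ '' Icc a b)) {s t : ℝ} (hs : s ∈ Icc a b) (ht : t ∈ Icc a b) :
    IntervalIntegrable (fun x => F' (γ x) * deriv γ x) volume s t ∧
      ∫ x in s..t, F' (γ x) * deriv γ x = F (γ t) - F (γ s) := by
  obtain ⟨M, hM⟩ := h.isCompact.exists_bound_of_continuousOn hF'
  have hM0 : 0 ≤ M := (norm_nonneg _).trans (hM _ (mem_image_of_mem γ hs))
  have hsub : uIcc s t ⊆ Icc a b := ordConnected_Icc.uIcc_subset hs ht
  refine integral_of_lipschitzOnWith ((h.lipschitzOnWith_comp hM0 hF hM).mono hsub) ?_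
  filter_upwards [h.lipschitz.ae_differentiableAt] with x hx hxm
  have hx' : Icc a b ∈ 𝓝 x := mem_of_superset (isOpen_Ioo.mem_nhds hxm)
    (Ioo_subset_Icc_self.trans hsub)
  have h1 := (hF _ (mem_image_of_mem γ (mem_of_mem_nhds hx'))).scomp x
    (hx.hasDerivAt.hasDerivWithinAt (s := Icc a b)) (mapsTo_image _ _)
  have h2 := h1.hasDerivAt hx'
  rwa [smul_eq_mul, mul_comm] at h2

end ResolventCalculus

/-! ### Families satisfying the resolvent equation -/

namespace ResolventCalculus

/-- A family `φ` indexed by the multisets of at most `n` points of `Γ`, continuous, which satisfies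
the resolvent equation. -/
structure ResFam {V : Type*} [AddCommGroup V] [Module ℂ V] [TopologicalSpace V]
    (n : ℕ) (Γ : Set ℂ) (φ : Multiset ℂ → V) : Prop where
  cont : ∀ m ≤ n, ContinuousOn (fun z : Fin m → ℂ => φ (List.ofFn z)) {z | ∀ i, z i ∈ Γ}
  sub_eq : ∀ s z w, s.card + 2 ≤ n → (∀ x ∈ s, x ∈ Γ) → z ∈ Γ → w ∈ Γ →
    φ (z ::ₘ s) - φ (w ::ₘ s) = (w - z) • φ (z ::ₘ w ::ₘ s)

/-- The family `s ↦ ∏_{w ∈ s} (w - ζ)⁻¹`. -/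
noncomputable def poleFam (ζ : ℂ) (s : Multiset ℂ) : ℂ := (s.map fun w => (w - ζ)⁻¹).prod

@[simp] theorem poleFam_zero (ζ : ℂ) : poleFam ζ 0 = 1 := rfl

@[simp] theorem poleFam_cons (ζ w : ℂ) (s : Multiset ℂ) :
    poleFam ζ (w ::ₘ s) = (w - ζ)⁻¹ * poleFam ζ s := by simp [poleFam]

theorem poleFam_add (ζ : ℂ) (s t : Multiset ℂ) :
    poleFam ζ (s + t) = poleFam ζ s * poleFam ζ t := by simp [poleFam]

theorem poleFam_replicate (ζ w : ℂ) (k : ℕ) :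
    poleFam ζ (Multiset.replicate k w) = ((w - ζ) ^ k)⁻¹ := by simp [poleFam]

namespace ResFam

section General

variable {V : Type*} [AddCommGroup V] [Module ℂ V] [TopologicalSpace V]
  {n : ℕ} {Γ : Set ℂ} {φ ψ : Multiset ℂ → V}

theorem of_le {m : ℕ} (h : ResFam n Γ φ) (hm : m ≤ n) : ResFam m Γ φ :=
  ⟨fun k hk => h.cont k (hk.trans hm), fun s z w hs => h.sub_eq s z w (hs.trans hm)⟩

/-- General substitution principle: all joint continuity statements below are obtained by choosing
the list of functions, constants included. -/
theorem continuousOn_map {X : Type*} [TopologicalSpace X] {S : Set X} (h : ResFam n Γ φ)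
    (l : List (X → ℂ)) (hl : l.length ≤ n) (hc : ∀ g ∈ l, ContinuousOn g S)
    (hm : ∀ g ∈ l, MapsTo g S Γ) :
    ContinuousOn (fun x => φ (l.map fun g => g x : List ℂ)) S := by
  have h1 : ContinuousOn (fun x => (fun i : Fin l.length => l.get i x)) S :=
    continuousOn_pi.2 fun i => hc _ (List.get_mem _ _)
  have h2 := (h.cont _ hl).comp h1 fun x hx i => hm _ (List.get_mem _ _) hx
  refine h2.congr fun x _ => ?_
  have h3 : l.map (fun g => g x) = List.ofFn fun i : Fin l.length => l.get i x := by
    conv_lhs => rw [← List.ofFn_get l, List.map_ofFn]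
    rfl
  simp only [Function.comp_apply, h3]

/-- Continuity of `x ↦ φ(s, f(x), …, f(x))`. -/
theorem continuousOn_add_replicate {X : Type*} [TopologicalSpace X] {S : Set X}
    (h : ResFam n Γ φ) {s : Multiset ℂ} {k : ℕ} (hs : ∀ x ∈ s, x ∈ Γ) (hk : s.card + k ≤ n)
    {f : X → ℂ} (hf : ContinuousOn f S) (hfm : MapsTo f S Γ) :
    ContinuousOn (fun x => φ (s + Multiset.replicate k (f x))) S := by
  have h1 := h.continuousOn_map (S := S)
    (s.toList.map (fun (c : ℂ) (_ : X) => c) ++ List.replicate k f) (by simpa using hk) (by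
      intro g hg
      rcases List.mem_append.1 hg with hg | hg
      · obtain ⟨c, -, rfl⟩ := List.mem_map.1 hg
        exact continuousOn_const
      · rwa [List.eq_of_mem_replicate hg]) (by
      intro g hg
      rcases List.mem_append.1 hg with hg | hg
      · obtain ⟨c, hc, rfl⟩ := List.mem_map.1 hg
        exact fun x _ => hs c (Multiset.mem_toList.1 hc)
      · rwa [List.eq_of_mem_replicate hg])
  refine h1.congr fun x _ => ?_
  simp only [List.map_append, List.map_map, List.map_replicate, ← Multiset.coe_add,
    Multiset.coe_replicate]
  congr 2
  conv_lhs => rw [← Multiset.coe_toList s]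
  simp [Function.comp_def]

theorem continuousOn_two {X : Type*} [TopologicalSpace X] {S : Set X}
    (h : ResFam n Γ φ) {s : Multiset ℂ} {i j : ℕ} (hs : ∀ x ∈ s, x ∈ Γ) (hk : s.card + i + j ≤ n)
    {f g : X → ℂ} (hf : ContinuousOn f S) (hfm : MapsTo f S Γ) (hg : ContinuousOn g S)
    (hgm : MapsTo g S Γ) :
    ContinuousOn (fun x => φ (s + Multiset.replicate i (f x) + Multiset.replicate j (g x))) S := by
  have h1 := h.continuousOn_map (S := S)
    (s.toList.map (fun (c : ℂ) (_ : X) => c) ++ List.replicate i f ++ List.replicate j g)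
    (by simp; omega) (by
      intro u hu
      rcases List.mem_append.1 hu with hu | hu
      · rcases List.mem_append.1 hu with hu | hu
        · obtain ⟨c, -, rfl⟩ := List.mem_map.1 hu
          exact continuousOn_const
        · rwa [List.eq_of_mem_replicate hu]
      · rwa [List.eq_of_mem_replicate hu]) (by
      intro u hu
      rcases List.mem_append.1 hu with hu | hu
      · rcases List.mem_append.1 hu with hu | hu
        · obtain ⟨c, hc, rfl⟩ := List.mem_map.1 hu
          exact fun x _ => hs c (Multiset.mem_toList.1 hc)
        · rwa [List.eq_of_mem_replicate hu]
      · rwa [List.eq_of_mem_replicate hu])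
  refine h1.congr fun x _ => ?_
  simp only [List.map_append, List.map_map, List.map_replicate, ← Multiset.coe_add,
    Multiset.coe_replicate]
  congr 3
  conv_lhs => rw [← Multiset.coe_toList s]
  simp [Function.comp_def]

/-- Freezing some arguments leaves a family whose order drops by their number; nested evaluation of
two forms rests on this. -/
theorem shift (h : ResFam n Γ φ) {s : Multiset ℂ} {m : ℕ} (hs : ∀ x ∈ s, x ∈ Γ)
    (hm : s.card + m ≤ n) : ResFam m Γ fun t => φ (s + t) := by
  refine ⟨fun k hk => ?_, fun t z w ht htΓ hz hw => ?_⟩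
  · have h1 := h.continuousOn_map (S := {z : Fin k → ℂ | ∀ i, z i ∈ Γ})
      (s.toList.map (fun (c : ℂ) (_ : Fin k → ℂ) => c) ++ List.ofFn fun i z => z i)
      (by simp; omega) (by
        intro g hg
        rcases List.mem_append.1 hg with hg | hg
        · obtain ⟨c, -, rfl⟩ := List.mem_map.1 hg
          exact continuousOn_const
        · obtain ⟨i, rfl⟩ := List.mem_ofFn.1 hg
          exact (continuous_apply i).continuousOn) (by
        intro g hg
        rcases List.mem_append.1 hg with hg | hg
        · obtain ⟨c, hc, rfl⟩ := List.mem_map.1 hg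
          exact fun x _ => hs c (Multiset.mem_toList.1 hc)
        · obtain ⟨i, rfl⟩ := List.mem_ofFn.1 hg
          exact fun z hz => hz i)
    refine h1.congr fun x _ => ?_
    simp only [List.map_append, List.map_map, ← Multiset.coe_add, List.map_ofFn]
    congr 2
    conv_lhs => rw [← Multiset.coe_toList s]
    simp [Function.comp_def]
  · have := h.sub_eq (s + t) z w (by rw [Multiset.card_add]; omega) (by
      intro x hx
      rcases Multiset.mem_add.1 hx with hx | hx
      exacts [hs x hx, htΓ x hx]) hz hw
    simpa only [Multiset.add_cons] using this

theorem sub [IsTopologicalAddGroup V] (h : ResFam n Γ φ) (h' : ResFam n Γ ψ) :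
    ResFam n Γ fun s => φ s - ψ s := by
  refine ⟨fun m hm => (h.cont m hm).sub (h'.cont m hm), fun s z w hs hΓ hz hw => ?_⟩
  rw [smul_sub, ← h.sub_eq s z w hs hΓ hz hw, ← h'.sub_eq s z w hs hΓ hz hw]
  abel

theorem sum [IsTopologicalAddGroup V] {ι : Type*} (t : Finset ι) {f : ι → Multiset ℂ → V}
    (h : ∀ i ∈ t, ResFam n Γ (f i)) : ResFam n Γ fun s => ∑ i ∈ t, f i s := by
  refine ⟨fun m hm => continuousOn_finsetSum _ fun i hi => (h i hi).cont m hm,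
    fun s z w hs hΓ hz hw => ?_⟩
  rw [← Finset.sum_sub_distrib, Finset.smul_sum]
  exact Finset.sum_congr rfl fun i hi => (h i hi).sub_eq s z w hs hΓ hz hw

theorem clm {W : Type*} [AddCommGroup W] [Module ℂ W] [TopologicalSpace W] (h : ResFam n Γ φ)
    (ℓ : V →L[ℂ] W) : ResFam n Γ fun s => ℓ (φ s) := by
  refine ⟨fun m hm => ℓ.continuous.comp_continuousOn (h.cont m hm), fun s z w hs hΓ hz hw => ?_⟩
  rw [← map_sub, h.sub_eq s z w hs hΓ hz hw, map_smul]

end General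

theorem poleFam (n : ℕ) {Γ : Set ℂ} {ζ : ℂ} (hζ : ζ ∉ Γ) : ResFam n Γ (poleFam ζ) := by
  refine ⟨fun m _ => ?_, fun s z w _ _ hz hw => ?_⟩
  · simp only [ResolventCalculus.poleFam, Multiset.map_coe, Multiset.prod_coe, List.map_ofFn,
      List.prod_ofFn, Function.comp_apply]
    refine continuousOn_finsetProd _ fun i _ => ContinuousOn.inv₀ (by fun_prop) ?_
    exact fun z hz h0 => hζ (sub_eq_zero.1 h0 ▸ hz i)
  · have h1 : z - ζ ≠ 0 := fun h0 => hζ (sub_eq_zero.1 h0 ▸ hz)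
    have h2 : w - ζ ≠ 0 := fun h0 => hζ (sub_eq_zero.1 h0 ▸ hw)
    simp only [poleFam_cons, smul_eq_mul]
    field_simp
    ring

theorem smul_const {V : Type*} [AddCommGroup V] [Module ℂ V] [TopologicalSpace V]
    [ContinuousSMul ℂ V] {n : ℕ} {Γ : Set ℂ} {φ : Multiset ℂ → ℂ} (h : ResFam n Γ φ) (x : V) :
    ResFam n Γ fun s => φ s • x := by
  refine ⟨fun m hm => (h.cont m hm).smul continuousOn_const, fun s z w hs hΓ hz hw => ?_⟩
  rw [← sub_smul, h.sub_eq s z w hs hΓ hz hw, smul_smul, smul_eq_mul]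

section Scalar

variable {n : ℕ} {Γ : Set ℂ} {ψ : Multiset ℂ → ℂ}

/-- The k copies of w are exchanged for z one at a time; each exchange is one resolvent equation and
needs one slot beyond the s.card + k already occupied. -/
theorem sub_replicate_eq (h : ResFam n Γ ψ) (k : ℕ) : ∀ {s : Multiset ℂ},
    (∀ x ∈ s, x ∈ Γ) → s.card + k + 1 ≤ n → ∀ {z w : ℂ}, z ∈ Γ → w ∈ Γ →
    ψ (s + Multiset.replicate k z) - ψ (s + Multiset.replicate k w) =
      (w - z) * ∑ i ∈ Finset.range k,
        ψ (s + Multiset.replicate (i + 1) z + Multiset.replicate (k - i) w) := by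
  induction k with
  | zero => intro s _ _ z w _ _; simp
  | succ k ih =>
    intro s hs hk z w hz hw
    have h1 := ih (s := z ::ₘ s) (by
      intro x hx
      rcases Multiset.mem_cons.1 hx with rfl | hx
      exacts [hz, hs x hx]) (by rw [Multiset.card_cons]; omega) hz hw
    have h2 := h.sub_eq (s + Multiset.replicate k w) z w (by simp; omega) (by
      intro x hx
      rcases Multiset.mem_add.1 hx with hx | hx
      · exact hs x hx
      · rwa [Multiset.eq_of_mem_replicate hx]) hz hw
    rw [Finset.sum_range_succ', mul_add]
    have e1 : ∀ (i j : ℕ), s + Multiset.replicate (i + 1) z + Multiset.replicate j w =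
        z ::ₘ s + Multiset.replicate i z + Multiset.replicate j w := by
      intro i j
      simp [Multiset.replicate_succ, Multiset.cons_add, Multiset.add_cons]
    have e2 : ∀ x : ℂ, s + Multiset.replicate (k + 1) x = x ::ₘ s + Multiset.replicate k x := by
      intro x
      simp [Multiset.replicate_succ, Multiset.add_cons]
    simp only [Nat.add_sub_add_right, e1 (_ + 1), Nat.sub_zero]
    rw [← h1, e2 z, e2 w, Multiset.cons_add w, ← sub_add_sub_cancel, ← Multiset.cons_add,
      Multiset.cons_add z s (Multiset.replicate k w), Multiset.cons_add w, h2, smul_eq_mul]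
    congr 3
    simp only [← Multiset.singleton_add, Multiset.replicate_succ, Multiset.replicate_zero]
    abel

/-- The telescoped resolvent equation writes the difference quotient as a sum of k terms continuous
in the moving point, all with the same limit. Thus continuity of the family upgrades itself to
differentiability of the diagonals along Γ. -/
theorem hasDerivWithinAt (h : ResFam n Γ ψ) {s : Multiset ℂ} {k : ℕ}
    (hs : ∀ x ∈ s, x ∈ Γ) (hk : s.card + k + 1 ≤ n) {w : ℂ} (hw : w ∈ Γ) :
    HasDerivWithinAt (fun w => ψ (s + Multiset.replicate k w))
      (-(k * ψ (s + Multiset.replicate (k + 1) w))) Γ w := by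
  rw [hasDerivWithinAt_iff_tendsto_slope]
  have h1 : ContinuousOn (fun z => -∑ i ∈ Finset.range k,
      ψ (s + Multiset.replicate (i + 1) z + Multiset.replicate (k - i) w)) Γ := by
    refine (continuousOn_finsetSum _ fun i hi => ?_).neg
    refine h.continuousOn_two hs ?_ continuousOn_id (mapsTo_id _) continuousOn_const
      (fun _ _ => hw)
    have := Finset.mem_range.1 hi
    omega
  have h2 := (h1 w hw).tendsto.mono_left (nhdsWithin_mono w (sdiff_subset (t := {w})))
  have h3 : -∑ i ∈ Finset.range k,
      ψ (s + Multiset.replicate (i + 1) w + Multiset.replicate (k - i) w) =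
      -(k * ψ (s + Multiset.replicate (k + 1) w)) := by
    rw [Finset.sum_congr rfl (g := fun _ => ψ (s + Multiset.replicate (k + 1) w))]
    · simp
    · intro i hi
      have := Finset.mem_range.1 hi
      rw [add_assoc, ← Multiset.replicate_add]
      congr 3
      omega
  rw [h3] at h2
  refine h2.congr' ?_
  filter_upwards [self_mem_nhdsWithin] with z hz
  have hne : z - w ≠ 0 := sub_ne_zero.2 hz.2
  rw [slope_def_field, h.sub_replicate_eq k hs hk hz.1 hw]
  field_simp
  ring

variable {γ : ℝ → ℂ} {a b C₁ C₂ : ℝ}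

/-- Descending induction on the order j = n - i: the diagonal of order j has derivative -j times the
diagonal of order j + 1, so it is bounded by its value at γ(a) plus an integral of the next one. -/
theorem norm_replicate_le (hγ : BiLipArc γ a b C₁ C₂) (h : ResFam n (γ '' Icc a b) ψ) {δ : ℝ}
    (hδ : ∀ w ∈ γ '' Icc a b, ‖ψ (Multiset.replicate n w)‖ ≤ δ)
    (hδ' : ∀ j < n, ‖ψ (Multiset.replicate j (γ a))‖ ≤ δ) (i : ℕ) :
    ∀ j, i + j = n → ∀ w ∈ γ '' Icc a b, ‖ψ (Multiset.replicate j w)‖ ≤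
      (1 + n * C₂ * (b - a)) ^ i * δ := by
  have haΓ : γ a ∈ γ '' Icc a b := mem_image_of_mem γ (left_mem_Icc.2 hγ.lt.le)
  have hδ0 : 0 ≤ δ := (norm_nonneg _).trans (hδ _ haΓ)
  have hL : 0 ≤ n * C₂ * (b - a) := mul_nonneg (mul_nonneg n.cast_nonneg hγ.pos₂.le)
    (sub_nonneg.2 hγ.lt.le)
  induction i with
  | zero =>
    intro j hj w hw
    obtain rfl : j = n := by omega
    simpa using hδ w hw
  | succ i ih =>
    intro j hj w hw
    obtain ⟨t, ht, rfl⟩ := hw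
    set B := (1 + n * C₂ * (b - a)) ^ i with hB
    have hB1 : 1 ≤ B := one_le_pow₀ (by linarith)
    have hd : ∀ w ∈ γ '' Icc a b, HasDerivWithinAt (fun w => ψ (0 + Multiset.replicate j w))
        (-(j * ψ (0 + Multiset.replicate (j + 1) w))) (γ '' Icc a b) w := fun w hw =>
      h.hasDerivWithinAt (by simp) (by simp; omega) hw
    have hl := hγ.lipschitzOnWith_comp (M := n * (B * δ)) (by positivity) hd (by
      intro w hw
      rw [norm_neg, norm_mul, Complex.norm_natCast, zero_add]
      have h1 := ih (j + 1) (by omega) w hw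
      have h2 : (j : ℝ) ≤ n := by exact_mod_cast (by omega : j ≤ n)
      gcongr)
    have h1 := hl.norm_sub_le ht (left_mem_Icc.2 hγ.lt.le)
    simp only [Function.comp_apply, zero_add] at h1
    rw [Real.coe_toNNReal _ (by have := hγ.pos₂; positivity), Real.norm_eq_abs,
      abs_of_nonneg (sub_nonneg.2 ht.1)] at h1
    have h2 := hδ' j (by omega)
    have h3 := norm_le_norm_add_norm_sub' (ψ (Multiset.replicate j (γ t)))
      (ψ (Multiset.replicate j (γ a)))
    calc _ ≤ δ + n * (B * δ) * C₂ * (t - a) := by linarith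
      _ ≤ B * δ + n * (B * δ) * C₂ * (b - a) := by
        have := hγ.pos₂
        have := ht.2
        gcongr
        exact le_mul_of_one_le_left hδ0 hB1
      _ = _ := by rw [pow_succ, ← hB]; ring

/-- One off-diagonal point z = γ(t₀) is removed at a time. The function (x-z)^{k+1}ψ(z,s,x^{k+1})
vanishes at x = z and has derivative (k+1)(x-z)^kψ(s,x^{k+2}) along the arc, which is under control
by induction. Integrating and dividing by |x-z|^{k+1} costs only a power of C₂/C₁, since numerator
and denominator are both of order |t-t₀|^{k+1}. -/
theorem norm_add_replicate_le (hγ : BiLipArc γ a b C₁ C₂) (h : ResFam n (γ '' Icc a b) ψ) {D : ℝ}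
    (hD : ∀ j ≤ n, ∀ w ∈ γ '' Icc a b, ‖ψ (Multiset.replicate j w)‖ ≤ D) (s : Multiset ℂ) :
    ∀ k, s.card + (k + 1) ≤ n → (∀ x ∈ s, x ∈ γ '' Icc a b) → ∀ v ∈ γ '' Icc a b,
      ‖ψ (s + Multiset.replicate (k + 1) v)‖ ≤ (1 + n * (C₂ / C₁) ^ n) ^ s.card * D := by
  have hp1 := hγ.pos₁
  have hp2 := hγ.pos₂
  have haΓ : γ a ∈ γ '' Icc a b := mem_image_of_mem γ (left_mem_Icc.2 hγ.lt.le)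
  have hD0 : 0 ≤ D := (norm_nonneg _).trans (hD 0 (Nat.zero_le n) _ haΓ)
  have hC : 1 ≤ C₂ / C₁ := by
    rw [one_le_div hp1]
    have h1 := hγ.lower a (left_mem_Icc.2 hγ.lt.le) b (right_mem_Icc.2 hγ.lt.le)
    have h2 := h1.trans (hγ.upper a b)
    exact le_of_mul_le_mul_right h2 (abs_pos.2 (sub_ne_zero.2 hγ.lt.ne'))
  induction s using Multiset.induction_on with
  | empty =>
    intro k hk _ v hv
    simpa using hD (k + 1) (by simpa using hk) v hv
  | cons z s ih =>
    intro k hk hs v hv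
    have hz : z ∈ γ '' Icc a b := hs z (Multiset.mem_cons_self z s)
    have hs' : ∀ x ∈ s, x ∈ γ '' Icc a b := fun x hx => hs x (Multiset.mem_cons_of_mem hx)
    rw [Multiset.card_cons] at hk ⊢
    set E := 1 + n * (C₂ / C₁) ^ n with hE
    have hE1 : 1 ≤ E := le_add_of_nonneg_right (by positivity)
    have hB := ih (k + 1) (by omega) hs'
    set B := E ^ s.card * D with hBdef
    have hB0 : 0 ≤ B := by positivity
    obtain ⟨t₀, ht₀, rfl⟩ := hz
    obtain ⟨t, ht, rfl⟩ := hv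
    have key : ∀ x ∈ γ '' Icc a b, ψ (γ t₀ ::ₘ s + Multiset.replicate k x) -
        ψ (s + Multiset.replicate (k + 1) x) =
        (x - γ t₀) * ψ (γ t₀ ::ₘ s + Multiset.replicate (k + 1) x) := by
      intro x hx
      have h1 := h.sub_eq (s + Multiset.replicate k x) (γ t₀) x (by simp; omega) (by
        intro y hy
        rcases Multiset.mem_add.1 hy with hy | hy
        · exact hs' y hy
        · rwa [Multiset.eq_of_mem_replicate hy]) (mem_image_of_mem γ ht₀) hx
      simpa [Multiset.replicate_succ, Multiset.cons_add, Multiset.add_cons,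
        Multiset.cons_swap (γ t₀) x] using h1
    have hd : ∀ x ∈ γ '' Icc a b, HasDerivWithinAt
        (fun x => (x - γ t₀) ^ k * (ψ (γ t₀ ::ₘ s + Multiset.replicate k x) -
          ψ (s + Multiset.replicate (k + 1) x)))
        ((k + 1) * (x - γ t₀) ^ k * ψ (s + Multiset.replicate (k + 1 + 1) x))
        (γ '' Icc a b) x := by
      intro x hx
      have h1 := h.hasDerivWithinAt (k := k) hs (by simp; omega) hx
      have h2 := h.hasDerivWithinAt (k := k + 1) hs' (by omega) hx
      have h3 := ((((hasDerivWithinAt_id x (γ '' Icc a b)).sub_const (γ t₀)).pow k)).mul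
        (h1.sub h2)
      refine h3.congr_deriv ?_
      simp only [id, Pi.sub_apply, Pi.pow_apply]
      rw [key x hx]
      rcases k with _ | k
      · simp
      · push_cast
        simp only [pow_succ]
        ring
    obtain ⟨-, hint⟩ := hγ.integral_comp_mul_deriv hd (by
      refine ContinuousOn.mul (by fun_prop) ?_
      exact h.continuousOn_add_replicate hs' (by omega) continuousOn_id (mapsTo_id _)) ht₀ ht
    rw [sub_self, key _ (mem_image_of_mem γ ht)] at hint
    have hbd : ‖(γ t - γ t₀) ^ (k + 1) * ψ (γ t₀ ::ₘ s + Multiset.replicate (k + 1) (γ t))‖ ≤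
        ((k + 1) * (C₂ * |t - t₀|) ^ k * B * C₂) * |t - t₀| := by
      have e : (γ t - γ t₀) ^ (k + 1) * ψ (γ t₀ ::ₘ s + Multiset.replicate (k + 1) (γ t)) =
          ∫ x in t₀..t, ((k + 1) * (γ x - γ t₀) ^ k *
            ψ (s + Multiset.replicate (k + 1 + 1) (γ x))) * deriv γ x := by
        rw [hint, key _ (mem_image_of_mem γ ht₀), sub_self, zero_mul, mul_zero, sub_zero]
        ring
      rw [e]
      refine intervalIntegral.norm_integral_le_of_norm_le_const fun x hx => ?_
      have hx' := uIoc_subset_uIcc hx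
      have hxm : x ∈ Icc a b := ordConnected_Icc.uIcc_subset ht₀ ht hx'
      have h1 : ‖deriv γ x‖ ≤ C₂ := by
        refine (norm_deriv_le_of_lipschitz hγ.lipschitz).trans ?_
        rw [Real.coe_toNNReal _ hp2.le]
      have h2 : ‖γ x - γ t₀‖ ≤ C₂ * |t - t₀| :=
        (hγ.upper t₀ x).trans 
          (mul_le_mul_of_nonneg_left (abs_sub_left_of_mem_uIcc hx') hp2.le)
      have h3 := hB _ (mem_image_of_mem γ hxm)
      have h4 : ‖((k : ℂ) + 1)‖ = k + 1 := by exact_mod_cast Complex.norm_natCast (k + 1)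
      rw [norm_mul, norm_mul, norm_mul, norm_pow, h4]
      gcongr
    -- Division by |t-t₀| is impossible at t = t₀, but there the point coincides with the diagonal
    -- variable and the inductive bound applies as it stands.
    rcases eq_or_ne t t₀ with rfl | hne
    · have h1 := hB _ (mem_image_of_mem γ ht)
      have h2 : γ t ::ₘ s + Multiset.replicate (k + 1) (γ t) =
          s + Multiset.replicate (k + 1 + 1) (γ t) := by
        simp [Multiset.replicate_succ, Multiset.add_cons]
      rw [h2]
      refine h1.trans ?_
      rw [hBdef]
      gcongr
      omega
    · have hT : 0 < |t - t₀| := abs_pos.2 (sub_ne_zero.2 hne)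
      have hlow := hγ.lower t₀ ht₀ t ht
      rw [norm_mul, norm_pow] at hbd
      have h1 : (C₁ * |t - t₀|) ^ (k + 1) *
          ‖ψ (γ t₀ ::ₘ s + Multiset.replicate (k + 1) (γ t))‖ ≤
          (C₁ * |t - t₀|) ^ (k + 1) * ((k + 1) * (C₂ / C₁) ^ (k + 1) * B) := by
        calc _ ≤ _ := mul_le_mul_of_nonneg_right
              (pow_le_pow_left₀ (by positivity) hlow (k + 1)) (norm_nonneg _)
          _ ≤ _ := hbd
          _ = _ := by
            rw [mul_pow, mul_pow, div_pow]
            field_simp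
            ring
      have h2 := le_of_mul_le_mul_left h1 (by positivity)
      refine h2.trans ?_
      have h3 : ((k : ℝ) + 1) * (C₂ / C₁) ^ (k + 1) ≤ E := by
        have : ((k : ℝ) + 1) ≤ n := by exact_mod_cast (by omega : k + 1 ≤ n)
        have h4 : (C₂ / C₁) ^ (k + 1) ≤ (C₂ / C₁) ^ n := pow_le_pow_right₀ hC (by omega)
        have h5 : ((k : ℝ) + 1) * (C₂ / C₁) ^ (k + 1) ≤ n * (C₂ / C₁) ^ n := by gcongr
        linarith
      rw [pow_succ' E, mul_assoc E]
      exact mul_le_mul_of_nonneg_right h3 hB0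

/-- A scalar family of order `n` is controlled by its diagonal of order `n` and by its values
at one end of the arc. -/
theorem exists_norm_le (hγ : BiLipArc γ a b C₁ C₂) (n : ℕ) : ∃ C : ℝ, ∀ ψ : Multiset ℂ → ℂ,
    ResFam n (γ '' Icc a b) ψ → ∀ δ : ℝ,
    (∀ w ∈ γ '' Icc a b, ‖ψ (Multiset.replicate n w)‖ ≤ δ) →
    (∀ j < n, ‖ψ (Multiset.replicate j (γ a))‖ ≤ δ) →
    ∀ s : Multiset ℂ, s.card ≤ n → (∀ x ∈ s, x ∈ γ '' Icc a b) → ‖ψ s‖ ≤ C * δ := by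
  refine ⟨(1 + n * (C₂ / C₁) ^ n) ^ n * (1 + n * C₂ * (b - a)) ^ n,
    fun ψ h δ hδ hδ' s hs hsΓ => ?_⟩
  have hp1 := hγ.pos₁
  have hp2 := hγ.pos₂
  have hab := sub_nonneg.2 hγ.lt.le
  have haΓ : γ a ∈ γ '' Icc a b := mem_image_of_mem γ (left_mem_Icc.2 hγ.lt.le)
  have hδ0 : 0 ≤ δ := (norm_nonneg _).trans (hδ _ haΓ)
  have hL : 0 ≤ n * C₂ * (b - a) := by positivity
  have hE : 0 ≤ n * (C₂ / C₁) ^ n := by positivity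
  have hD : ∀ j ≤ n, ∀ w ∈ γ '' Icc a b, ‖ψ (Multiset.replicate j w)‖ ≤
      (1 + n * C₂ * (b - a)) ^ n * δ := by
    intro j hj w hw
    refine (h.norm_replicate_le hγ hδ hδ' (n - j) j (by omega) w hw).trans ?_
    gcongr
    · linarith
    · omega
  rw [mul_assoc]
  rcases s.empty_or_exists_mem with rfl | ⟨v, hv⟩
  · refine (hD 0 (Nat.zero_le n) _ haΓ).trans ?_
    exact le_mul_of_one_le_left (by positivity) (one_le_pow₀ (by linarith))
  · obtain ⟨s, rfl⟩ := Multiset.exists_cons_of_mem hv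
    rw [Multiset.card_cons] at hs
    have h1 := h.norm_add_replicate_le hγ hD s 0 (by omega)
      (fun x hx => hsΓ x (Multiset.mem_cons_of_mem hx)) v (hsΓ v hv)
    have h2 : v ::ₘ s = s + Multiset.replicate (0 + 1) v := by
      simp [← Multiset.singleton_add, add_comm]
    rw [h2]
    refine h1.trans ?_
    gcongr
    · linarith
    · omega

end Scalar

end ResFam

end ResolventCalculus

/-! ### Density of the pole families -/

namespace ResolventCalculus

theorem exists_clm_ne_zero_of_notMem {E : Type*} [NormedAddCommGroup E] [NormedSpace ℂ E]
    (p : Submodule ℂ E) (hp : IsClosed (p : Set E)) {x : E} (hx : x ∉ p) :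
    ∃ f : E →L[ℂ] ℂ, (∀ y ∈ p, f y = 0) ∧ f x ≠ 0 := by
  have : IsClosed (p : Set E) := hp
  have hne : (Submodule.Quotient.mk x : E ⧸ p) ≠ 0 := by
    rwa [Ne, Submodule.Quotient.mk_eq_zero]
  obtain ⟨g, -, hg⟩ := exists_dual_vector ℂ (Submodule.Quotient.mk x : E ⧸ p) (norm_ne_zero_iff.2 hne)
  refine ⟨g.comp p.mkQL, fun y hy => ?_, ?_⟩
  · have : (Submodule.Quotient.mk y : E ⧸ p) = 0 := (Submodule.Quotient.mk_eq_zero p).2 hy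
    change g (Submodule.Quotient.mk y) = 0
    rw [this, map_zero]
  · change g (Submodule.Quotient.mk x) ≠ 0
    rw [hg]
    simpa using hne

section Vanishing

variable {K : Set ℂ} [CompactSpace K]

theorem tendsto_sub_smul_resolvent (c : ℂ) :
    Tendsto (fun ζ : ℂ => (ζ - c) • resolvent (coordFun K) ζ) (Bornology.cobounded ℂ) (𝓝 1) := by
  have h1 := (tendsto_smul_resolvent (K := K)).sub
    ((spectrum.resolvent_tendsto_cobounded (𝕜 := ℂ) (coordFun K)).const_smul c)
  rw [smul_zero, sub_zero] at h1
  simpa only [sub_smul] using h1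

theorem tendsto_pow_smul_resolvent_pow (c : ℂ) {j n : ℕ} (hj : j < n) :
    Tendsto (fun ζ : ℂ => (ζ - c) ^ j • resolvent (coordFun K) ζ ^ n) (Bornology.cobounded ℂ)
      (𝓝 0) := by
  have h1 := ((tendsto_sub_smul_resolvent (K := K) c).pow j).mul
    ((spectrum.resolvent_tendsto_cobounded (𝕜 := ℂ) (coordFun K)).pow (n - j))
  rw [zero_pow (by omega), mul_zero] at h1
  refine h1.congr fun ζ => ?_
  rw [smul_pow, smul_mul_assoc, ← pow_add, Nat.add_sub_cancel' hj.le]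

theorem tendsto_sub_cobounded (c : ℂ) :
    Tendsto (fun ζ : ℂ => (ζ - c)⁻¹) (Bornology.cobounded ℂ) (𝓝 0) :=
  tendsto_inv₀_cobounded.comp (tendsto_sub_const_cobounded c)

/-- A functional on `C(K, ℂ)` with values on `(ζ - w)⁻ⁿ` equal to a combination of the
`(ζ - c)⁻ʲ`, `j < n`, vanishes, and so do the coefficients of the combination. -/
theorem eq_zero_of_apply_resolvent_pow (h0 : volume K = 0) (hc : IsPreconnected Kᶜ)
    (Λ : C(K, ℂ) →L[ℂ] ℂ) (c : ℂ) {n : ℕ} (hn : n ≠ 0) (l : ℕ → ℂ)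
    (h : ∀ ζ ∉ K, Λ (resolvent (coordFun K) ζ ^ n) = ∑ j ∈ Finset.range n, l j * ((ζ - c) ^ j)⁻¹) :
    Λ = 0 ∧ ∀ j < n, l j = 0 := by
  have hK : IsCompact K := isCompact_iff_compactSpace.2 inferInstance
  have hev : ∀ᶠ ζ in Bornology.cobounded ℂ, ζ ∉ K := Bornology.isBounded_def.1 hK.isBounded
  -- By strong induction on j: multiplied by (ζ-c)^j and taken to infinity, the identity isolates l
  -- j on the right, while the left side tends to zero because j < n.
  have hl : ∀ j < n, l j = 0 := by
    intro j
    induction j using Nat.strong_induction_on with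
    | _ j ih =>
      intro hj
      have h1 : Tendsto (fun ζ => Λ ((ζ - c) ^ j • resolvent (coordFun K) ζ ^ n))
          (Bornology.cobounded ℂ) (𝓝 0) := by
        have := (Λ.continuous.tendsto 0).comp (tendsto_pow_smul_resolvent_pow (K := K) c hj)
        rwa [map_zero] at this
      have h2 : Tendsto (fun ζ => ∑ i ∈ Finset.range n, if i ≤ j then (if i = j then l j else 0) else
          l i * ((ζ - c)⁻¹) ^ (i - j)) (Bornology.cobounded ℂ)
          (𝓝 (∑ i ∈ Finset.range n, if i = j then l j else 0)) := by
        refine tendsto_finsetSum _ fun i _ => ?_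
        by_cases hij : i ≤ j
        · simp only [hij, if_true]
          exact tendsto_const_nhds
        · simp only [hij, if_false, show i ≠ j by omega]
          have := ((tendsto_sub_cobounded c).pow (i - j)).const_mul (l i)
          rwa [zero_pow (by omega), mul_zero] at this
      rw [Finset.sum_ite_eq' (Finset.range n) j, if_pos (Finset.mem_range.2 hj)] at h2
      refine (tendsto_nhds_unique (h2.congr' ?_) h1)
      have hev' : ∀ᶠ ζ in Bornology.cobounded ℂ, ζ ≠ c :=
        Bornology.isBounded_def.1 Bornology.isBounded_singleton
      filter_upwards [hev, hev'] with ζ hζ hζc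
      have hne : ζ - c ≠ 0 := sub_ne_zero.2 hζc
      rw [map_smul, h ζ hζ, smul_eq_mul, Finset.mul_sum]
      refine Finset.sum_congr rfl fun i hi => ?_
      split_ifs with h3 h4
      · subst h4
        field_simp
      · rw [ih i (lt_of_le_of_ne h3 h4) (Finset.mem_range.1 hi)]
        simp
      · obtain ⟨m, rfl⟩ := Nat.exists_eq_add_of_le (not_le.1 h3).le
        rw [Nat.add_sub_cancel_left, pow_add, inv_pow]
        field_simp
  refine ⟨?_, hl⟩
  -- The exponent descends: Λ of the power m + 1 of the resolvent has derivative -(m+1) times Λ of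
  -- the power m + 2, which is zero. So it is constant on the connected complement, and it vanishes
  -- at infinity.
  have hz : ∀ k, k + 1 ≤ n → ∀ ζ ∉ K, Λ (resolvent (coordFun K) ζ ^ (n - k)) = 0 := by
    intro k
    induction k with
    | zero =>
      intro _ ζ hζ
      rw [Nat.sub_zero, h ζ hζ]
      exact Finset.sum_eq_zero fun j hj => by rw [hl j (Finset.mem_range.1 hj), zero_mul]
    | succ k ih =>
      intro hk ζ hζ
      obtain ⟨m, hm⟩ : ∃ m, n - k = m + 2 := ⟨n - k - 2, by omega⟩
      have hm' : n - (k + 1) = m + 1 := by omega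
      rw [hm']
      have ih' := ih (by omega)
      rw [hm] at ih'
      have hd : ∀ ζ ∈ Kᶜ, HasDerivAt (fun ζ => Λ (resolvent (coordFun K) ζ ^ (m + 1))) 0 ζ := by
        intro ζ hζ
        have h1 := ((spectrum.hasDerivAt_resolvent_const_left
          (mem_resolventSet_coordFun hζ)).pow (m + 1))
        have h2 := Λ.hasFDerivAt.comp_hasDerivAt ζ h1
        refine h2.congr_deriv ?_
        have e : (((m + 1 : ℕ) : C(K, ℂ)) * resolvent (coordFun K) ζ ^ (m + 1 - 1) *
            -resolvent (coordFun K) ζ ^ 2) =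
            (-((m + 1 : ℕ) : ℂ)) • resolvent (coordFun K) ζ ^ (m + 2) := by
          rw [Algebra.smul_def, map_neg, map_natCast, Nat.add_sub_cancel, pow_add]
          ring
        rw [e, map_smul, ih' ζ hζ, smul_zero]
      have hconst : ∀ η ∉ K, Λ (resolvent (coordFun K) η ^ (m + 1)) =
          Λ (resolvent (coordFun K) ζ ^ (m + 1)) := fun η hη =>
        IsOpen.is_const_of_deriv_eq_zero hK.isClosed.isOpen_compl hc
          (fun x hx => (hd x hx).differentiableAt.differentiableWithinAt)
          (fun x hx => (hd x hx).deriv) hη hζ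
      have h1 : Tendsto (fun ζ => Λ (resolvent (coordFun K) ζ ^ (m + 1)))
          (Bornology.cobounded ℂ) (𝓝 0) := by
        have := (Λ.continuous.tendsto 0).comp
          (tendsto_pow_smul_resolvent_pow (K := K) c (Nat.succ_pos m))
        rw [map_zero] at this
        simpa [Function.comp_def] using this
      refine tendsto_nhds_unique (tendsto_const_nhds.congr' ?_) h1
      filter_upwards [hev] with η hη
      exact (hconst η hη).symm
  have h1 : ∀ ζ ∉ K, Λ (resolvent (coordFun K) ζ) = 0 := by
    intro ζ hζ
    have := hz (n - 1) (by omega) ζ hζ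
    rwa [show n - (n - 1) = 1 by omega, pow_one] at this
  ext f
  have h2 := resolventSpan_le (T := LinearMap.ker (Λ : C(K, ℂ) →ₗ[ℂ] ℂ))
    (Λ.isClosed_ker) h1
  rw [resolventSpan_eq_top h0] at h2
  exact h2 (Submodule.mem_top (x := f))

end Vanishing

variable {γ : ℝ → ℂ} {a b C₁ C₂ : ℝ}

theorem BiLipArc.exists_notMem (hγ : BiLipArc γ a b C₁ C₂) : ∃ ζ, ζ ∉ γ '' Icc a b := by
  by_contra hc
  push Not at hc
  have := hγ.volume_eq_zero
  rw [eq_univ_of_forall hc] at this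
  simp at this

/-- The families `poleFam ζ` span a dense subspace of the families of order `n`. -/
theorem ResFam.exists_approx {n : ℕ} {ψ : Multiset ℂ → ℂ} (hγ : BiLipArc γ a b C₁ C₂)
    (h : ResFam n (γ '' Icc a b) ψ) {ε : ℝ} (hε : 0 < ε) :
    ∃ (t : Finset ℂ) (c : ℂ → ℂ), (∀ ζ ∈ t, ζ ∉ γ '' Icc a b) ∧
      ∀ s : Multiset ℂ, s.card ≤ n → (∀ x ∈ s, x ∈ γ '' Icc a b) →
        ‖ψ s - ∑ ζ ∈ t, c ζ * ResolventCalculus.poleFam ζ s‖ ≤ ε := by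
  rcases eq_or_ne n 0 with rfl | hn
  · obtain ⟨ζ, hζ⟩ := hγ.exists_notMem
    refine ⟨{ζ}, fun _ => ψ 0, by simpa using hζ, fun s hs _ => ?_⟩
    obtain rfl : s = 0 := Multiset.card_eq_zero.1 (Nat.le_zero.1 hs)
    simpa using hε.le
  set Γ := γ '' Icc a b with hΓ
  have : CompactSpace Γ := isCompact_iff_compactSpace.1 hγ.isCompact
  have haΓ : γ a ∈ Γ := mem_image_of_mem γ (left_mem_Icc.2 hγ.lt.le)
  -- A family enters the Banach space C(Γ) × ℂⁿ through its diagonal of order n and its lower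
  -- diagonals at γ(a); `exists_norm_le` says that these data control it. G and ev are the images of
  -- the pole families and of ψ.
  let G : ℂ → C(Γ, ℂ) × (Fin n → ℂ) := fun ζ =>
    ((-resolvent (coordFun Γ) ζ) ^ n, fun j => ((γ a - ζ) ^ (j : ℕ))⁻¹)
  let ev : C(Γ, ℂ) × (Fin n → ℂ) := (⟨fun w => ψ (Multiset.replicate n (w : ℂ)), by
    have := h.continuousOn_add_replicate (X := Γ) (S := univ) (s := 0) (k := n) (by simp)
      (by simp) continuous_subtype_val.continuousOn (fun w _ => w.2)
    simpa [continuousOn_univ] using this⟩, fun j => ψ (Multiset.replicate j (γ a)))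
  obtain ⟨C, hC⟩ := exists_norm_le hγ n
  have hdense : ev ∈ (Submodule.span ℂ (G '' Γᶜ)).topologicalClosure := by
    by_contra hev
    obtain ⟨f, hf, hfev⟩ := exists_clm_ne_zero_of_notMem _
      (Submodule.isClosed_topologicalClosure _) hev
    have hfG : ∀ ζ ∉ Γ, f (G ζ) = 0 := fun ζ hζ =>
      hf _ (Submodule.le_topologicalClosure _ (Submodule.subset_span (mem_image_of_mem G hζ)))
    -- The signs here and in l translate the factors (w-ζ)⁻¹ of a pole family into the resolvents
    -- (ζ-w)⁻¹.
    let Λ : C(Γ, ℂ) →L[ℂ] ℂ := (-1 : ℂ) ^ n • f.comp (ContinuousLinearMap.inl ℂ _ _)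
    let l : ℕ → ℂ := fun j => if hj : j < n then
      -((-1 : ℂ) ^ j * f (0, Pi.single ⟨j, hj⟩ 1)) else 0
    have hsplit : ∀ x : C(Γ, ℂ) × (Fin n → ℂ), f x = f (x.1, 0) +
        ∑ j : Fin n, x.2 j * f (0, Pi.single j 1) := by
      intro x
      have e1 : x = (x.1, 0) + ∑ j : Fin n, x.2 j • ((0 : C(Γ, ℂ)), (Pi.single j 1 : Fin n → ℂ)) := by
        refine Prod.ext ?_ ?_
        · simp [Prod.fst_sum]
        · simp only [Prod.snd_add, Prod.snd_sum, Prod.smul_snd, zero_add]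
          exact (pi_eq_sum_univ' x.2)
      conv_lhs => rw [e1]
      simp only [map_add, map_sum, map_smul, smul_eq_mul]
    obtain ⟨hΛ, hl⟩ := eq_zero_of_apply_resolvent_pow hγ.volume_eq_zero hγ.isPreconnected_compl
      Λ (γ a) hn l (by
        intro ζ hζ
        have h1 := hfG ζ hζ
        rw [hsplit] at h1
        have h2 : Λ (resolvent (coordFun Γ) ζ ^ n) = f ((G ζ).1, 0) := by
          change (-1 : ℂ) ^ n • f (_, 0) = f ((-resolvent (coordFun Γ) ζ) ^ n, 0)
          rw [← map_smul, neg_pow]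
          congr 1
          ext w
          · simp [neg_pow (resolvent (coordFun Γ) ζ w)]
          · simp
        rw [h2, eq_neg_of_add_eq_zero_left h1, ← Finset.sum_neg_distrib, ← Fin.sum_univ_eq_sum_range
          (fun j => l j * ((ζ - γ a) ^ j)⁻¹)]
        refine Finset.sum_congr rfl fun j _ => ?_
        simp only [l, G, j.2, dif_pos, Fin.eta]
        rw [← neg_sub ζ, neg_pow, mul_inv, ← inv_pow, inv_neg, inv_one]
        ring)
    apply hfev
    rw [hsplit]
    have h1 : f (ev.1, 0) = 0 := by
      have := congrArg (fun L : C(Γ, ℂ) →L[ℂ] ℂ => L ev.1) hΛ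
      simpa [Λ] using this
    rw [h1, zero_add]
    refine Finset.sum_eq_zero fun j _ => ?_
    have := hl j j.2
    simp only [l, j.2, dif_pos, Fin.eta, neg_eq_zero, mul_eq_zero] at this
    rw [this.resolve_left (by simp), mul_zero]
  obtain ⟨δ, hδ, hδε⟩ : ∃ δ > 0, C * δ ≤ ε :=
    ⟨ε / (|C| + 1), by positivity, by
      rw [mul_div_assoc', div_le_iff₀ (by positivity)]
      nlinarith [le_abs_self C]⟩
  obtain ⟨y, hy, hyd⟩ := Metric.mem_closure_iff.1 hdense δ hδ
  obtain ⟨c, hcs, rfl⟩ := (Finsupp.mem_span_image_iff_linearCombination ℂ).1 hy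
  rw [Finsupp.linearCombination_apply, Finsupp.sum] at hyd
  refine ⟨c.support, c, fun ζ hζ => ?_, fun s hs hsΓ => ?_⟩
  · exact (Finsupp.mem_supported ℂ c).1 hcs hζ
  · have hfam : ResFam n Γ fun s => ψ s - ∑ ζ ∈ c.support, c ζ * ResolventCalculus.poleFam ζ s := by
      refine h.sub (ResFam.sum _ fun ζ hζ => ?_)
      have := (ResFam.poleFam n ((Finsupp.mem_supported ℂ c).1 hcs hζ)).smul_const (c ζ)
      simpa only [smul_eq_mul, mul_comm] using this
    refine (hC _ hfam δ ?_ ?_ s hs hsΓ).trans hδε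
    · intro w hw
      have h1 := (norm_fst_le _).trans (dist_eq_norm ev _ ▸ hyd).le
      have h2 := (ContinuousMap.norm_coe_le_norm _ (⟨w, hw⟩ : Γ)).trans h1
      refine le_trans (le_of_eq ?_) h2
      simp only [Prod.fst_sub, Prod.fst_sum, Prod.smul_fst, ContinuousMap.sub_apply,
        ContinuousMap.sum_apply, ContinuousMap.smul_apply, smul_eq_mul]
      congr 2
      refine Finset.sum_congr rfl fun ζ hζ => ?_
      have hζ' : ζ ∉ Γ := (Finsupp.mem_supported ℂ c).1 hcs hζ
      simp only [G, ContinuousMap.pow_apply, ContinuousMap.neg_apply]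
      rw [poleFam_replicate, resolvent_coordFun_apply hζ', ← inv_neg, neg_sub, inv_pow]
    · intro j hj
      have h1 := (norm_snd_le _).trans (dist_eq_norm ev _ ▸ hyd).le
      have h2 := (norm_le_pi_norm _ (⟨j, hj⟩ : Fin n)).trans h1
      refine le_trans (le_of_eq ?_) h2
      simp only [Prod.snd_sub, Prod.snd_sum, Prod.smul_snd, Pi.sub_apply, Finset.sum_apply,
        Pi.smul_apply, smul_eq_mul, poleFam_replicate, ev, G]

/-- A bounded linear functional on the scalar families of order `n` on `Γ`. -/
structure IsBddFunctional (n : ℕ) (Γ : Set ℂ) (Λ : (Multiset ℂ → ℂ) → ℂ) : Prop where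
  add : ∀ φ ψ, ResFam n Γ φ → ResFam n Γ ψ → Λ (fun s => φ s + ψ s) = Λ φ + Λ ψ
  smul : ∀ (c : ℂ) φ, ResFam n Γ φ → Λ (fun s => c * φ s) = c * Λ φ
  bound : ∃ C, ∀ φ, ResFam n Γ φ → ∀ δ, (∀ s : Multiset ℂ, s.card ≤ n → (∀ x ∈ s, x ∈ Γ) →
    ‖φ s‖ ≤ δ) → ‖Λ φ‖ ≤ C * δ

namespace ResFam

theorem add {n : ℕ} {Γ : Set ℂ} {φ ψ : Multiset ℂ → ℂ} (h : ResFam n Γ φ) (h' : ResFam n Γ ψ) :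
    ResFam n Γ fun s => φ s + ψ s := by
  refine ⟨fun m hm => (h.cont m hm).add (h'.cont m hm), fun s z w hs hΓ hz hw => ?_⟩
  rw [smul_add, ← h.sub_eq s z w hs hΓ hz hw, ← h'.sub_eq s z w hs hΓ hz hw]
  ring

theorem const_mul {n : ℕ} {Γ : Set ℂ} {φ : Multiset ℂ → ℂ} (h : ResFam n Γ φ) (c : ℂ) :
    ResFam n Γ fun s => c * φ s := by
  simpa only [smul_eq_mul, mul_comm] using h.smul_const c

theorem zero (n : ℕ) (Γ : Set ℂ) : ResFam n Γ fun _ => (0 : ℂ) :=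
  ⟨fun _ _ => continuousOn_const, fun _ _ _ _ _ _ _ => by simp⟩

end ResFam

namespace IsBddFunctional

variable {n : ℕ} {Γ : Set ℂ} {Λ Λ' : (Multiset ℂ → ℂ) → ℂ}

theorem map_zero (h : IsBddFunctional n Γ Λ) : Λ (fun _ => 0) = 0 := by
  have := h.smul 0 _ (ResFam.zero n Γ)
  simpa using this

theorem map_sum (h : IsBddFunctional n Γ Λ) {ι : Type*} (t : Finset ι)
    {f : ι → Multiset ℂ → ℂ} (hf : ∀ i ∈ t, ResFam n Γ (f i)) :
    Λ (fun s => ∑ i ∈ t, f i s) = ∑ i ∈ t, Λ (f i) := by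
  classical
  induction t using Finset.induction_on with
  | empty => simpa using h.map_zero
  | insert i t hi ih =>
    have hf' : ∀ j ∈ t, ResFam n Γ (f j) := fun j hj => hf j (Finset.mem_insert_of_mem hj)
    simp only [Finset.sum_insert hi]
    rw [h.add _ _ (hf i (Finset.mem_insert_self i t)) (ResFam.sum t hf'), ih hf']

theorem sub (h : IsBddFunctional n Γ Λ) (h' : IsBddFunctional n Γ Λ') :
    IsBddFunctional n Γ fun φ => Λ φ - Λ' φ := by
  obtain ⟨C, hC⟩ := h.bound
  obtain ⟨C', hC'⟩ := h'.bound
  refine ⟨fun φ ψ hφ hψ => ?_, fun c φ hφ => ?_, C + C', fun φ hφ δ hδ => ?_⟩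
  · rw [h.add φ ψ hφ hψ, h'.add φ ψ hφ hψ]
    ring
  · rw [h.smul c φ hφ, h'.smul c φ hφ]
    ring
  · refine (norm_sub_le _ _).trans ?_
    rw [add_mul]
    exact add_le_add (hC φ hφ δ hδ) (hC' φ hφ δ hδ)

/-- Bounded functionals of order `n` are determined by their values on the families `poleFam ζ`. -/
theorem eq_of_poleFam (hγ : BiLipArc γ a b C₁ C₂) (h : IsBddFunctional n (γ '' Icc a b) Λ)
    (h' : IsBddFunctional n (γ '' Icc a b) Λ')
    (heq : ∀ ζ ∉ γ '' Icc a b, Λ (poleFam ζ) = Λ' (poleFam ζ)) {ψ : Multiset ℂ → ℂ}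
    (hψ : ResFam n (γ '' Icc a b) ψ) : Λ ψ = Λ' ψ := by
  have hs := h.sub h'
  obtain ⟨C, hC⟩ := hs.bound
  rw [← sub_eq_zero, ← norm_le_zero_iff]
  refine le_of_forall_pos_le_add fun ε hε => ?_
  obtain ⟨δ, hδ, hδε⟩ : ∃ δ > 0, C * δ ≤ ε :=
    ⟨ε / (|C| + 1), by positivity, by
      rw [mul_div_assoc', div_le_iff₀ (by positivity)]
      nlinarith [le_abs_self C]⟩
  obtain ⟨t, c, ht, hc⟩ := hψ.exists_approx hγ hδ
  have hf : ∀ ζ ∈ t, ResFam n (γ '' Icc a b) fun s => c ζ * poleFam ζ s := fun ζ hζ =>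
    (ResFam.poleFam n (ht ζ hζ)).const_mul (c ζ)
  have hfs := ResFam.sum t hf
  have h1 := hC _ (hψ.sub hfs) δ hc
  have h2 := hs.add _ _ (hψ.sub hfs) hfs
  have h3 := hs.map_sum t hf
  have h4 : ∀ ζ ∈ t, (Λ fun s => c ζ * poleFam ζ s) - (Λ' fun s => c ζ * poleFam ζ s) = 0 := by
    intro ζ hζ
    rw [hs.smul (c ζ) _ (ResFam.poleFam n (ht ζ hζ)) |>.trans (by rw [heq ζ (ht ζ hζ), sub_self,
      mul_zero])]
  rw [Finset.sum_eq_zero h4] at h3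
  simp only [sub_add_cancel] at h2
  rw [h3, add_zero] at h2
  rw [zero_add]
  refine le_trans (le_of_eq ?_) (h1.trans hδε)
  rw [← h2]

end IsBddFunctional

end ResolventCalculus

/-! ### Duality and integrals in sequentially complete spaces -/

namespace ResolventCalculus

theorem polynormableSpace_of_locallyConvexSpace_real (V : Type*) [AddCommGroup V] [Module ℂ V]
    [TopologicalSpace V] [IsTopologicalAddGroup V] [ContinuousSMul ℂ V] [LocallyConvexSpace ℝ V] :
    PolynormableSpace ℂ V := by
  have : ContinuousSMul ℝ V :=
    ⟨(Complex.continuous_ofReal.comp continuous_fst).smul continuous_snd⟩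
  open scoped ComplexOrder in
  have : LocallyConvexSpace ℂ V := by
    rw [locallyConvexSpace_iff_exists_convex_subset_zero]
    intro U hU
    obtain ⟨S, hS, hc, hSU⟩ := (locallyConvexSpace_iff_exists_convex_subset_zero ℝ V).1
      inferInstance U hU
    exact ⟨S, hS, convex_RCLike_iff_convex_real.2 hc, hSU⟩
  open scoped ComplexOrder in
  exact LocallyConvexSpace.toPolynormableSpace

section Seminorms

variable {V : Type*} [AddCommGroup V] [Module ℂ V] [UniformSpace V] [IsUniformAddGroup V]
  [ContinuousSMul ℂ V] [PolynormableSpace ℂ V]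

/-- Hahn–Banach from the line through x. Every vector estimate below becomes a scalar estimate,
provided that the latter is uniform over the functionals dominated by p. -/
theorem exists_dual_apply_eq_seminorm {p : Seminorm ℂ V} (hp : Continuous p) (x : V) :
    ∃ ℓ : V →L[ℂ] ℂ, (∀ y, ‖ℓ y‖ ≤ p y) ∧ ‖ℓ x‖ = p x := by
  rcases eq_or_ne x 0 with rfl | hx
  · exact ⟨0, fun y => by simp, by simp⟩
  let e := LinearEquiv.toSpanNonzeroSingleton ℂ V x hx
  let f : Module.Dual ℂ (Submodule.span ℂ {x}) :=
    (p x : ℂ) • ((e.symm : Submodule.span ℂ {x} →ₗ[ℂ] ℂ))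
  have hf : ∀ c : ℂ, f (e c) = p x * c := fun c => by simp [f]
  obtain ⟨g, hg, hgp⟩ := Module.Dual.exists_continuous_extension_of_le_seminorm
    (Submodule.span ℂ {x}) f hp (by
      intro y
      obtain ⟨c, rfl⟩ := e.surjective y
      rw [hf]
      have : ((e c : Submodule.span ℂ {x}) : V) = c • x := rfl
      rw [this, map_smul_eq_mul, norm_mul, Complex.norm_real, Real.norm_of_nonneg (apply_nonneg p x),
        mul_comm])
  refine ⟨g, hgp, ?_⟩
  have h1 := hg (e 1)
  rw [hf] at h1
  have h2 : ((e 1 : Submodule.span ℂ {x}) : V) = x := by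
    change (1 : ℂ) • x = x
    rw [one_smul]
  rw [h2] at h1
  rw [h1, mul_one, Complex.norm_real, Real.norm_of_nonneg (apply_nonneg p x)]

theorem seminorm_le_of_dual {p : Seminorm ℂ V} (hp : Continuous p) {x : V} {c : ℝ}
    (h : ∀ ℓ : V →L[ℂ] ℂ, (∀ y, ‖ℓ y‖ ≤ p y) → ‖ℓ x‖ ≤ c) : p x ≤ c := by
  obtain ⟨ℓ, h1, h2⟩ := exists_dual_apply_eq_seminorm hp x
  rw [← h2]
  exact h ℓ h1

theorem tendsto_nhds_iff_seminorm {ι : Type*} {l : Filter ι} {u : ι → V} {y : V} :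
    Tendsto u l (𝓝 y) ↔ ∀ p : Seminorm ℂ V, Continuous p → Tendsto (fun i => p (u i - y)) l (𝓝 0) := by
  rw [(PolynormableSpace.withSeminorms ℂ V).tendsto_nhds]
  refine ⟨fun h p hp => ?_, fun h p ε hε => ?_⟩
  · rw [Metric.tendsto_nhds]
    intro ε hε
    filter_upwards [h ⟨p, hp⟩ ε hε] with i hi
    rwa [Real.dist_0_eq_abs, abs_of_nonneg (apply_nonneg p _)]
  · exact (h p.1 p.2).eventually_lt_const hε

theorem eq_of_forall_dual [T2Space V] {x y : V} (h : ∀ ℓ : V →L[ℂ] ℂ, ℓ x = ℓ y) : x = y := by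
  have : Tendsto (fun _ : ℕ => x) atTop (𝓝 y) := by
    refine tendsto_nhds_iff_seminorm.2 fun p hp => ?_
    have h0 : p (x - y) ≤ 0 := seminorm_le_of_dual hp fun ℓ _ => by simp [h ℓ]
    rw [le_antisymm h0 (apply_nonneg p _)]
    exact tendsto_const_nhds
  exact tendsto_nhds_unique tendsto_const_nhds this

theorem cauchySeq_of_seminorm {u : ℕ → V} (h : ∀ p : Seminorm ℂ V, Continuous p → ∀ ε > 0,
    ∃ N, ∀ m ≥ N, ∀ n ≥ N, p (u m - u n) < ε) : CauchySeq u := by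
  rw [cauchySeq_iff_tendsto, uniformity_eq_comap_nhds_zero, tendsto_comap_iff,
    tendsto_nhds_iff_seminorm]
  intro p hp
  rw [Metric.tendsto_nhds]
  intro ε hε
  obtain ⟨N, hN⟩ := h p hp ε hε
  filter_upwards [Ici_mem_atTop ((N, N) : ℕ × ℕ)] with x hx
  rw [Real.dist_0_eq_abs, abs_of_nonneg (apply_nonneg p _)]
  simpa using hN x.2 hx.2 x.1 hx.1

theorem exists_seminorm_sub_lt {H : ℝ → V} {a b : ℝ} (hH : ContinuousOn H (Icc a b))
    {p : Seminorm ℂ V} (hp : Continuous p) {ε : ℝ} (hε : 0 < ε) :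
    ∃ δ > 0, ∀ s ∈ Icc a b, ∀ t ∈ Icc a b, |s - t| < δ → p (H s - H t) < ε := by
  have h1 := isCompact_Icc.uniformContinuousOn_of_continuous hH
  have h2 : {x : V × V | p (x.2 - x.1) < ε} ∈ uniformity V := by
    rw [uniformity_eq_comap_nhds_zero]
    exact ⟨{v | p v < ε}, (isOpen_lt hp continuous_const).mem_nhds (by simpa using hε), fun x hx => hx⟩
  have h3 := (Metric.uniformity_basis_dist.inf_principal _).mem_iff.1 (h1 h2)
  obtain ⟨δ, hδ, hsub⟩ := h3
  refine ⟨δ, hδ, fun s hs t ht hst => ?_⟩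
  have : p (H s - H t) < ε := by
    have h4 := @hsub (t, s) ⟨by simpa [Real.dist_eq, abs_sub_comm] using hst, ht, hs⟩
    exact h4
  exact this

end Seminorms

section RiemannSums

variable {V : Type*} [AddCommGroup V] [Module ℂ V]

/-- The Riemann sums of `∫_a^b ρ(t) H(t) dt`, exact in `ρ`. -/
noncomputable def riemannSum (a b : ℝ) (ρ : ℝ → ℂ) (H : ℝ → V) (N : ℕ) : V :=
  ∑ i ∈ Finset.range N, (∫ t in (a + (b - a) * (i / N))..(a + (b - a) * ((i + 1 : ℕ) / N)), ρ t) •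
    H (a + (b - a) * (i / N))

theorem partition_point_mem {a b : ℝ} (hab : a ≤ b) {i N : ℕ} (hi : i ≤ N) :
    a + (b - a) * (i / N) ∈ Icc a b := by
  have h1 : (i : ℝ) / N ≤ 1 := div_le_one_of_le₀ (by exact_mod_cast hi) N.cast_nonneg
  have h2 : (0 : ℝ) ≤ (i : ℝ) / N := by positivity
  constructor <;> nlinarith [sub_nonneg.2 hab]

/-- The density is integrated exactly on each subinterval, so only the oscillation of h enters; this
is what permits an unbounded ρ. -/
theorem norm_riemannSum_sub_le {a b : ℝ} (hab : a ≤ b) {ρ : ℝ → ℂ}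
    (hρ : IntervalIntegrable ρ volume a b) {h : ℝ → ℂ} (hh : ContinuousOn h (Icc a b)) {N : ℕ}
    (hN : N ≠ 0) {ε : ℝ}
    (hε : ∀ s ∈ Icc a b, ∀ t ∈ Icc a b, |s - t| ≤ (b - a) / N → ‖h s - h t‖ ≤ ε) :
    ‖riemannSum a b ρ h N - ∫ t in a..b, ρ t * h t‖ ≤ ε * ∫ t in a..b, ‖ρ t‖ := by
  set x : ℕ → ℝ := fun i => a + (b - a) * (i / N) with hx
  have hx0 : x 0 = a := by simp [hx]
  have hxN : x N = b := by simp [hx, hN]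
  have hmem : ∀ i ≤ N, x i ∈ Icc a b := fun i hi => partition_point_mem hab hi
  have hstep : ∀ i, x (i + 1) - x i = (b - a) / N := by
    intro i
    simp only [hx]
    push_cast
    field_simp
    ring
  have hmono : ∀ i, x i ≤ x (i + 1) := fun i => by
    have := hstep i
    have : 0 ≤ (b - a) / N := div_nonneg (sub_nonneg.2 hab) N.cast_nonneg
    linarith
  have hρh : IntervalIntegrable (fun t => ρ t * h t) volume a b :=
    hρ.mul_continuousOn (by rwa [uIcc_of_le hab])
  have hsub : ∀ i < N, uIcc (x i) (x (i + 1)) ⊆ uIcc a b := fun i hi => by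
    rw [uIcc_of_le hab]
    exact ordConnected_Icc.uIcc_subset (hmem i hi.le) (hmem (i + 1) hi)
  have e1 := intervalIntegral.sum_integral_adjacent_intervals (a := x) (n := N)
    (μ := volume) (f := fun t => ρ t * h t) fun i hi => hρh.mono_set (hsub i hi)
  have e2 := intervalIntegral.sum_integral_adjacent_intervals (a := x) (n := N)
    (μ := volume) (f := fun t => ‖ρ t‖) fun i hi => hρ.norm.mono_set (hsub i hi)
  rw [hx0, hxN] at e1 e2
  rw [← e1, ← e2, Finset.mul_sum]
  change ‖(∑ i ∈ Finset.range N, (∫ t in x i..x (i + 1), ρ t) • h (x i)) - _‖ ≤ _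
  rw [← Finset.sum_sub_distrib]
  refine norm_sum_le_of_le _ fun i hi => ?_
  have hi := Finset.mem_range.1 hi
  have hρi := hρ.mono_set (hsub i hi)
  have hρhi := hρh.mono_set (hsub i hi)
  rw [smul_eq_mul, ← intervalIntegral.integral_mul_const, ← intervalIntegral.integral_sub
    (hρi.mul_const _) hρhi, ← intervalIntegral.integral_const_mul]
  refine intervalIntegral.norm_integral_le_of_norm_le (hmono i) ?_ (hρi.norm.const_mul ε)
  refine Eventually.of_forall fun t ht => ?_
  rw [← mul_sub, norm_mul, mul_comm]
  refine mul_le_mul_of_nonneg_right (hε _ (hmem i hi.le) t ?_ ?_) (norm_nonneg _)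
  · exact ⟨(hmem i hi.le).1.trans ht.1.le, ht.2.trans (hmem (i + 1) hi).2⟩
  · rw [abs_sub_comm, abs_of_nonneg (sub_nonneg.2 ht.1.le), ← hstep i]
    linarith [ht.2]

theorem map_riemannSum {W : Type*} [AddCommGroup W] [Module ℂ W] (ℓ : V →ₗ[ℂ] W) (a b : ℝ)
    (ρ : ℝ → ℂ) (H : ℝ → V) (N : ℕ) :
    ℓ (riemannSum a b ρ H N) = riemannSum a b ρ (fun t => ℓ (H t)) N := by
  simp [riemannSum, map_sum]

variable [UniformSpace V]

/-- The integral `∫_a^b ρ(t) H(t) dt` of a continuous vector valued function `H` against an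
integrable density `ρ`, as a limit of Riemann sums. -/
noncomputable def vint (a b : ℝ) (ρ : ℝ → ℂ) (H : ℝ → V) : V :=
  limUnder atTop (riemannSum a b ρ H)

variable [IsUniformAddGroup V] [ContinuousSMul ℂ V] [PolynormableSpace ℂ V]

/-- The mesh depends on the uniform continuity of H for p alone, so a single N₀ serves all
functionals dominated by p. -/
theorem exists_norm_riemannSum_sub_le {a b : ℝ} (hab : a ≤ b) {ρ : ℝ → ℂ}
    (hρ : IntervalIntegrable ρ volume a b) {H : ℝ → V} (hH : ContinuousOn H (Icc a b))
    {p : Seminorm ℂ V} (hp : Continuous p) {ε : ℝ} (hε : 0 < ε) :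
    ∃ N₀, ∀ N ≥ N₀, ∀ ℓ : V →L[ℂ] ℂ, (∀ y, ‖ℓ y‖ ≤ p y) →
      ‖ℓ (riemannSum a b ρ H N) - ∫ t in a..b, ρ t * ℓ (H t)‖ < ε := by
  have hI : 0 ≤ ∫ t in a..b, ‖ρ t‖ :=
    intervalIntegral.integral_nonneg hab fun _ _ => norm_nonneg _
  set I := ∫ t in a..b, ‖ρ t‖
  obtain ⟨η, hη, hηε⟩ : ∃ η > 0, η * I < ε := ⟨ε / (I + 1), by positivity, by
    rw [div_mul_eq_mul_div, div_lt_iff₀ (by positivity)]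
    linarith⟩
  obtain ⟨δ, hδ, hd⟩ := exists_seminorm_sub_lt hH hp hη
  obtain ⟨N₀, hN₀⟩ := exists_nat_gt ((b - a) / δ)
  refine ⟨N₀ + 1, fun N hN ℓ hℓ => ?_⟩
  have hN0 : N ≠ 0 := by omega
  have h1 : ℓ (riemannSum a b ρ H N) = riemannSum a b ρ (fun t => ℓ (H t)) N :=
    map_riemannSum (ℓ : V →ₗ[ℂ] ℂ) a b ρ H N
  rw [h1]
  refine (norm_riemannSum_sub_le hab hρ (ℓ.continuous.comp_continuousOn hH) hN0
    fun s hs t ht hst => ?_).trans_lt hηε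
  change ‖ℓ (H s) - ℓ (H t)‖ ≤ η
  rw [← map_sub]
  refine (hℓ _).trans (hd s hs t ht (hst.trans_lt ?_)).le
  have h2 : (b - a) / δ < N := hN₀.trans (by exact_mod_cast (by omega : N₀ < N))
  rw [div_lt_iff₀ (by positivity)]
  rw [div_lt_iff₀ hδ] at h2
  linarith

/-- The Riemann sums over equal subdivisions form a sequence, so sequential completeness is enough;
it is Cauchy because under each dominated functional all late terms are near the same scalar
integral. -/
theorem tendsto_vint (hV : ∀ x : ℕ → V, CauchySeq x → ∃ y, Tendsto x atTop (𝓝 y))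
    {a b : ℝ} (hab : a ≤ b) {ρ : ℝ → ℂ}
    (hρ : IntervalIntegrable ρ volume a b) {H : ℝ → V} (hH : ContinuousOn H (Icc a b)) :
    Tendsto (riemannSum a b ρ H) atTop (𝓝 (vint a b ρ H)) := by
  refine tendsto_nhds_limUnder (hV _ (cauchySeq_of_seminorm fun p hp ε hε => ?_))
  obtain ⟨N, hN⟩ := exists_norm_riemannSum_sub_le hab hρ hH hp (ε := ε / 3) (by positivity)
  refine ⟨N, fun m hm n hn => ?_⟩
  have h1 : p (riemannSum a b ρ H m - riemannSum a b ρ H n) ≤ ε / 3 + ε / 3 := by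
    refine seminorm_le_of_dual hp fun ℓ hℓ => ?_
    rw [map_sub]
    have h2 := hN m hm ℓ hℓ
    have h3 := hN n hn ℓ hℓ
    rw [norm_sub_rev] at h3
    refine le_trans ?_ (add_le_add h2.le h3.le)
    exact norm_sub_le_norm_sub_add_norm_sub _ _ _
  linarith

theorem clm_vint (hV : ∀ x : ℕ → V, CauchySeq x → ∃ y, Tendsto x atTop (𝓝 y))
    {a b : ℝ} (hab : a ≤ b) {ρ : ℝ → ℂ}
    (hρ : IntervalIntegrable ρ volume a b) {H : ℝ → V} (hH : ContinuousOn H (Icc a b))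
    (ℓ : V →L[ℂ] ℂ) : ℓ (vint a b ρ H) = ∫ t in a..b, ρ t * ℓ (H t) := by
  have h1 := (ℓ.continuous.tendsto _).comp (tendsto_vint hV hab hρ hH)
  refine tendsto_nhds_unique h1 ?_
  rw [Metric.tendsto_atTop]
  intro ε hε
  have hp : Continuous (ℓ.toSeminorm) := ℓ.continuous.norm
  obtain ⟨N, hN⟩ := exists_norm_riemannSum_sub_le hab hρ hH hp hε
  refine ⟨N, fun n hn => ?_⟩
  rw [dist_eq_norm]
  exact hN n hn ℓ fun y => le_rfl

/-- The pair of Riemann sums is a linear combination of elements of T, and sequential closedness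
admits the limit. Applied to the graph of a resolvent, this moves the resolvent through the
integral. -/
theorem vint_mem (hV : ∀ x : ℕ → V, CauchySeq x → ∃ y, Tendsto x atTop (𝓝 y))
    {a b : ℝ} (hab : a ≤ b) {ρ : ℝ → ℂ}
    (hρ : IntervalIntegrable ρ volume a b) {H H' : ℝ → V} (hH : ContinuousOn H (Icc a b))
    (hH' : ContinuousOn H' (Icc a b)) {T : Submodule ℂ (V × V)} (hT : IsSeqClosed (T : Set (V × V)))
    (h : ∀ t ∈ Icc a b, (H t, H' t) ∈ T) : (vint a b ρ H, vint a b ρ H') ∈ T := by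
  refine hT (x := fun N => (riemannSum a b ρ H N, riemannSum a b ρ H' N)) (fun N => ?_)
    ((tendsto_vint hV hab hρ hH).prodMk_nhds (tendsto_vint hV hab hρ hH'))
  have : (riemannSum a b ρ H N, riemannSum a b ρ H' N) =
      riemannSum a b ρ (fun t => (H t, H' t)) N := by
    simp only [riemannSum, Prod.ext_iff, Prod.fst_sum, Prod.snd_sum, Prod.smul_mk, and_self]
  rw [SetLike.mem_coe, this]
  exact Submodule.sum_mem _ fun i hi => Submodule.smul_mem _ _
    (h _ (partition_point_mem hab (Finset.mem_range.1 hi).le))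

end RiemannSums

end ResolventCalculus

/-! ### Complex measures with endpoint masses and a density -/

namespace ResolventCalculus

section Measures

theorem vectorMeasure_integral_const_mul {X : Type*} [MeasurableSpace X] (μ : VectorMeasure X ℂ)
    (c : ℂ) (f : X → ℂ) : μ.integral (fun x => c * f x) (ContinuousLinearMap.mul ℝ ℂ) =
      c * μ.integral f (ContinuousLinearMap.mul ℝ ℂ) := by
  rw [VectorMeasure.integral_eq_setToFun, VectorMeasure.integral_eq_setToFun]
  refine setToFun_smul _ (fun c s x => ?_) c f
  change (c * x) * μ s = c * (x * μ s)
  ring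

theorem vectorMeasure_integral_indicator {X : Type*} [MeasurableSpace X] (μ : VectorMeasure X ℂ)
    [IsFiniteMeasure μ.variation] (c : ℂ) {s : Set X} (hs : MeasurableSet s) :
    μ.integral (s.indicator fun _ => c) (ContinuousLinearMap.mul ℝ ℂ) = c * μ s := by
  rw [VectorMeasure.integral_eq_setToFun, setToFun_indicator_const _ hs (measure_ne_top _ _)]
  rfl

theorem vectorMeasure_integrable_of_bdd {X : Type*} [MeasurableSpace X] (μ : VectorMeasure X ℂ)
    [IsFiniteMeasure μ.variation] {f : X → ℂ} (hf : StronglyMeasurable f) {C : ℝ}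
    (hC : ∀ x, ‖f x‖ ≤ C) : μ.Integrable f :=
  Integrable.of_bound hf.aestronglyMeasurable C (Eventually.of_forall hC)

theorem isFiniteMeasure_variation_withDensityᵥ {X : Type*} [MeasurableSpace X] {m : Measure X}
    {k : X → ℂ} (hk : Integrable k m) : IsFiniteMeasure (m.withDensityᵥ k).variation := by
  rw [Measure.variation_withDensityᵥ hk]
  exact isFiniteMeasure_withDensity hk.2.ne

/-- Checked on simple functions and passed to the limit by dominated convergence on both sides. -/
theorem vectorMeasure_integral_withDensityᵥ {X : Type*} [MeasurableSpace X] {m : Measure X}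
    {k : X → ℂ} (hk : Integrable k m) {f : X → ℂ} (hf : StronglyMeasurable f) {C : ℝ}
    (hC : ∀ x, ‖f x‖ ≤ C) :
    (m.withDensityᵥ k).integral f (ContinuousLinearMap.mul ℝ ℂ) = ∫ x, k x * f x ∂m := by
  have := isFiniteMeasure_variation_withDensityᵥ hk
  have hsimple : ∀ g : SimpleFunc X ℂ,
      (m.withDensityᵥ k).integral g (ContinuousLinearMap.mul ℝ ℂ) = ∫ x, k x * g x ∂m := by
    intro g
    induction g using SimpleFunc.induction with
    | const c hs =>
      rename_i s
      have e : ⇑(SimpleFunc.piecewise s hs (SimpleFunc.const X c) (SimpleFunc.const X 0)) =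
          s.indicator fun _ => c := by
        ext x
        by_cases hx : x ∈ s <;> simp [SimpleFunc.piecewise_apply, hx]
      rw [e, vectorMeasure_integral_indicator _ _ hs, withDensityᵥ_apply hk hs,
        ← integral_const_mul, ← integral_indicator hs]
      congr 1 with x
      by_cases hx : x ∈ s <;> simp [hx, mul_comm]
    | add _ hf hg =>
      rename_i f g _
      have hbd : ∀ g : SimpleFunc X ℂ, ∃ C, ∀ x, ‖g x‖ ≤ C := fun g => g.exists_forall_norm_le
      obtain ⟨C₁, h₁⟩ := hbd f
      obtain ⟨C₂, h₂⟩ := hbd g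
      rw [SimpleFunc.coe_add, VectorMeasure.integral_add
        (vectorMeasure_integrable_of_bdd _ f.stronglyMeasurable h₁)
        (vectorMeasure_integrable_of_bdd _ g.stronglyMeasurable h₂), hf, hg, ← integral_add]
      · simp only [Pi.add_apply, mul_add]
      · exact hk.mul_bdd f.stronglyMeasurable.aestronglyMeasurable (Eventually.of_forall h₁)
      · exact hk.mul_bdd g.stronglyMeasurable.aestronglyMeasurable (Eventually.of_forall h₂)
  have hC0 : ∀ x, 0 ≤ C := fun x => (norm_nonneg _).trans (hC x)
  rcases isEmpty_or_nonempty X with hX | ⟨⟨x₀⟩⟩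
  · have e : f = fun _ => 0 := Subsingleton.elim _ _
    subst e
    simp
  have h1 : Tendsto (fun n => (m.withDensityᵥ k).integral (hf.approxBounded C n)
      (ContinuousLinearMap.mul ℝ ℂ)) atTop
      (𝓝 ((m.withDensityᵥ k).integral f (ContinuousLinearMap.mul ℝ ℂ))) := by
    refine VectorMeasure.tendsto_integral_of_dominated_convergence (fun _ => C) (fun n =>
      (SimpleFunc.stronglyMeasurable _).aestronglyMeasurable) (integrable_const C) (fun n => ?_) ?_
    · exact Eventually.of_forall fun x => hf.norm_approxBounded_le (hC0 x₀) n x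
    · exact Eventually.of_forall fun x => hf.tendsto_approxBounded_of_norm_le (hC x)
  have h2 : Tendsto (fun n => ∫ x, k x * hf.approxBounded C n x ∂m) atTop
      (𝓝 (∫ x, k x * f x ∂m)) := by
    refine tendsto_integral_of_dominated_convergence (fun x => ‖k x‖ * C) (fun n =>
      hk.1.mul (SimpleFunc.stronglyMeasurable _).aestronglyMeasurable)
      (hk.norm.mul_const C) (fun n => ?_) ?_
    · refine Eventually.of_forall fun x => ?_
      rw [norm_mul]
      exact mul_le_mul_of_nonneg_left (hf.norm_approxBounded_le (hC0 x₀) n x) (norm_nonneg _)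
    · exact Eventually.of_forall fun x => (hf.tendsto_approxBounded_of_norm_le (hC x)).const_mul _
  simp only [hsimple] at h1
  exact tendsto_nhds_unique h1 h2

/-- The measure with atoms at the ends of the arc and a density. -/
theorem exists_complexMeasure {γ : ℝ → ℂ} {a b : ℝ} (hγ : Continuous γ) (hab : a ≤ b) (c d : ℂ)
    {k : ℝ → ℂ} (hk : IntervalIntegrable k volume a b) :
    ∃ μ : ComplexMeasure ℂ, IsFiniteMeasure μ.variation ∧ μ.variation (γ '' Icc a b)ᶜ = 0 ∧
      ∀ g : ℂ → ℂ, ContinuousOn g (γ '' Icc a b) → μ.Integrable g ∧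
        μ.integral g (ContinuousLinearMap.mul ℝ ℂ) =
          c * g (γ a) + d * g (γ b) + ∫ t in a..b, k t * g (γ t) := by
  set Γ := γ '' Icc a b with hΓ
  have hΓc : IsCompact Γ := isCompact_Icc.image hγ
  have hΓm : MeasurableSet Γ := hΓc.isClosed.measurableSet
  have haΓ : γ a ∈ Γ := mem_image_of_mem γ (left_mem_Icc.2 hab)
  have hbΓ : γ b ∈ Γ := mem_image_of_mem γ (right_mem_Icc.2 hab)
  have hki : Integrable k (volume.restrict (Ioc a b)) :=
    (intervalIntegrable_iff_integrableOn_Ioc_of_le hab).1 hk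
  set ν := (volume.restrict (Ioc a b)).withDensityᵥ k with hν
  have hνf : IsFiniteMeasure ν.variation := isFiniteMeasure_variation_withDensityᵥ hki
  set μ₁ : ComplexMeasure ℂ := VectorMeasure.dirac (γ a) c with hμ₁
  set μ₂ : ComplexMeasure ℂ := VectorMeasure.dirac (γ b) d with hμ₂
  set μ₃ : ComplexMeasure ℂ := ν.map γ with hμ₃
  have f1 : IsFiniteMeasure μ₁.variation := by
    rw [hμ₁, VectorMeasure.variation_dirac]
    exact ⟨by simp⟩
  have f2 : IsFiniteMeasure μ₂.variation := by
    rw [hμ₂, VectorMeasure.variation_dirac]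
    exact ⟨by simp⟩
  have f3 : IsFiniteMeasure μ₃.variation :=
    isFiniteMeasure_of_le _ VectorMeasure.variation_map_le
  have f12 : IsFiniteMeasure (μ₁ + μ₂).variation :=
    isFiniteMeasure_of_le _ VectorMeasure.variation_add_le
  have f123 : IsFiniteMeasure (μ₁ + μ₂ + μ₃).variation :=
    isFiniteMeasure_of_le _ VectorMeasure.variation_add_le
  have z1 : μ₁.variation Γᶜ = 0 := by
    rw [hμ₁, VectorMeasure.variation_dirac]
    simp [Measure.dirac_apply' _ hΓm.compl, haΓ]
  have z2 : μ₂.variation Γᶜ = 0 := by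
    rw [hμ₂, VectorMeasure.variation_dirac]
    simp [Measure.dirac_apply' _ hΓm.compl, hbΓ]
  have z3 : μ₃.variation Γᶜ = 0 := by
    refine le_antisymm ((VectorMeasure.variation_map_le _).trans ?_) bot_le
    rw [Measure.map_apply hγ.measurable hΓm.compl, hν, Measure.variation_withDensityᵥ hki]
    refine (withDensity_absolutelyContinuous _ _ ?_).le
    rw [Measure.restrict_apply (hγ.measurable hΓm.compl)]
    convert measure_empty (μ := volume)
    ext t
    simp only [mem_inter_iff, mem_preimage, mem_compl_iff, mem_empty_iff_false, iff_false, not_and]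
    exact fun h1 h2 => h1 (mem_image_of_mem γ (Ioc_subset_Icc_self h2))
  have z123 : (μ₁ + μ₂ + μ₃).variation Γᶜ = 0 := by
    refine le_antisymm ((VectorMeasure.variation_add_le _).trans ?_) bot_le
    rw [Measure.add_apply, z3, add_zero]
    refine (VectorMeasure.variation_add_le _).trans ?_
    rw [Measure.add_apply, z1, z2, add_zero]
  refine ⟨μ₁ + μ₂ + μ₃, f123, z123, fun g hg => ?_⟩
  have hsm : StronglyMeasurable (Γ.indicator g) := by
    classical
    rw [← piecewise_eq_indicator]
    exact (hg.measurable_piecewise continuous_zero.continuousOn hΓm).stronglyMeasurable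
  obtain ⟨C, hC⟩ := hΓc.exists_bound_of_continuousOn hg
  have hC0 : 0 ≤ C := (norm_nonneg _).trans (hC _ haΓ)
  have hbd : ∀ x, ‖Γ.indicator g x‖ ≤ C := by
    intro x
    by_cases hx : x ∈ Γ
    · rw [indicator_of_mem hx]
      exact hC x hx
    · rw [indicator_of_notMem hx, norm_zero]
      exact hC0
  have hae : Γ.indicator g =ᵐ[(μ₁ + μ₂ + μ₃).variation] g := by
    filter_upwards [compl_mem_ae_iff.2 z123] with x hx
    rw [compl_compl] at hx
    exact indicator_of_mem hx g
  have hi := fun (μ : ComplexMeasure ℂ) (_ : IsFiniteMeasure μ.variation) =>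
    vectorMeasure_integrable_of_bdd μ hsm hbd
  refine ⟨(hi _ f123).congr hae, ?_⟩
  rw [← VectorMeasure.integral_congr_ae hae, VectorMeasure.integral_add_vectorMeasure
    (hi _ f12) (hi _ f3), VectorMeasure.integral_add_vectorMeasure (hi _ f1) (hi _ f2),
    VectorMeasure.integral_dirac, VectorMeasure.integral_dirac,
    VectorMeasure.integral_map hγ.measurable hsm.aestronglyMeasurable
      (vectorMeasure_integrable_of_bdd ν (hsm.comp_measurable hγ.measurable) fun x => hbd (γ x)),
    vectorMeasure_integral_withDensityᵥ (f := fun x => Γ.indicator g (γ x)) hki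
      (hsm.comp_measurable hγ.measurable) (fun x => hbd (γ x)), indicator_of_mem haΓ, indicator_of_mem hbΓ,
    intervalIntegral.integral_of_le hab]
  congr 1
  · simp only [ContinuousLinearMap.mul_apply', mul_comm]
  · refine setIntegral_congr_fun measurableSet_Ioc fun t ht => ?_
    change _ = k t * g (γ t)
    rw [indicator_of_mem (mem_image_of_mem γ (Ioc_subset_Icc_self ht))]

end Measures

end ResolventCalculus

/-! ### Resolvents of multivalued operators -/

namespace ResolventCalculus

section Operators

variable {V : Type*} [AddCommGroup V] [Module ℂ V]

theorem mem_resolventOp {A : Submodule ℂ (V × V)} {w : ℂ} {p q : V} :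
    (p, q) ∈ resolventOp w A ↔ (w • p - q, p) ∈ A := by
  simp only [resolventOp, moebius, Submodule.mem_map, Prod.exists]
  constructor
  · rintro ⟨y, x, hxy, h⟩
    simp only [LinearMap.prod_apply, Pi.prod, Prod.mk.injEq, LinearMap.add_apply,
      LinearMap.smul_apply, LinearMap.fst_apply, LinearMap.snd_apply, zero_smul, zero_add,
      one_smul, neg_smul] at h
    obtain ⟨rfl, rfl⟩ := h
    simpa using hxy
  · intro h
    exact ⟨_, _, h, by simp⟩

theorem mem_inverseOp {A : Submodule ℂ (V × V)} {p q : V} :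
    (p, q) ∈ inverseOp A ↔ (q, p) ∈ A := by
  simp only [inverseOp, moebius, Submodule.mem_map, Prod.exists]
  constructor
  · rintro ⟨y, x, hxy, h⟩
    simp only [LinearMap.prod_apply, Pi.prod, Prod.mk.injEq, LinearMap.add_apply,
      LinearMap.smul_apply, LinearMap.fst_apply, LinearMap.snd_apply, zero_smul, zero_add,
      one_smul, add_zero] at h
    obtain ⟨rfl, rfl⟩ := h
    exact hxy
  · intro h
    exact ⟨_, _, h, by simp⟩

theorem isSeqClosed_resolventOp [TopologicalSpace V] [IsTopologicalAddGroup V]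
    [ContinuousSMul ℂ V] {A : Submodule ℂ (V × V)} (hA : IsSeqClosed (A : Set (V × V))) (w : ℂ) :
    IsSeqClosed (resolventOp w A : Set (V × V)) := by
  intro x y hx hxy
  have hc : Continuous fun p : V × V => (w • p.1 - p.2, p.1) := by fun_prop
  have := hA (x := fun n => (w • (x n).1 - (x n).2, (x n).1)) (p := (w • y.1 - y.2, y.1))
    (fun n => mem_resolventOp.1 (hx n)) ((hc.tendsto y).comp hxy)
  exact mem_resolventOp.2 this

theorem HasValue.unique {B : Set (V × V)} {x y y' : V} (h : HasValue B x y)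
    (h' : HasValue B x y') : y = y' := h'.2 y h.1

/-- Two values at the same point differ by a value at 0, so single-valuedness at one point implies
it at every point. Membership in the graph is then all that needs to be shown. -/
theorem hasValue_resolventOp {A : Submodule ℂ (V × V)} {w : ℂ} {x y u v : V}
    (h : HasValue (resolventOp w A : Set (V × V)) u v) (hxy : (y, x) ∈ resolventOp w A) :
    HasValue (resolventOp w A : Set (V × V)) x y := by
  refine ⟨hxy, fun y' hy' => ?_⟩
  have h1 := (resolventOp w A).add_mem h.1 ((resolventOp w A).sub_mem hy' hxy)
  have h2 := h.2 (v + (y' - y)) (by simpa using h1)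
  simpa [sub_eq_zero] using h2

/-- The inverse operator is handled by `(z⁻¹ - A⁻¹)⁻¹ = z - z² (z - A)⁻¹`. -/
theorem HasValue.inverse {A : Submodule ℂ (V × V)} {z : ℂ} (hz : z ≠ 0) {x y : V}
    (h : HasValue (resolventOp z A : Set (V × V)) x y) :
    HasValue (resolventOp z⁻¹ (inverseOp A) : Set (V × V)) x (z • x - z ^ 2 • y) := by
  have key : ∀ p, (p, x) ∈ resolventOp z⁻¹ (inverseOp A) →
      ((z ^ 2)⁻¹ • (z • x - p), x) ∈ resolventOp z A := by
    intro p hp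
    have h1 := mem_inverseOp.1 (mem_resolventOp.1 hp)
    refine mem_resolventOp.2 ?_
    have h2 := A.smul_mem (-z⁻¹) h1
    convert h2 using 1
    rw [Prod.smul_mk, Prod.mk.injEq]
    constructor
    · match_scalars <;> field_simp
      ring
    · match_scalars <;> field_simp
  refine ⟨mem_resolventOp.2 (mem_inverseOp.2 ?_), fun p hp => ?_⟩
  · have h1 := A.smul_mem (-z) (mem_resolventOp.1 h.1)
    convert h1 using 1
    rw [Prod.smul_mk, Prod.mk.injEq]
    constructor
    · match_scalars <;> field_simp
    · match_scalars <;> field_simp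
      ring
  · rw [← h.2 _ (key p hp)]
    match_scalars <;> field_simp
    ring

theorem ResolventChain.unique {A : Submodule ℂ (V × V)} {u : V} : ∀ {l : List ℂ} {y y' : V},
    ResolventChain A u l y → ResolventChain A u l y' → y = y'
  | [], _, _, h, h' => h.trans h'.symm
  | _ :: _, _, _, ⟨_, hx, h⟩, ⟨_, hx', h'⟩ => by
    obtain rfl := hx.unique hx'
    exact h.unique h'

/-- The resolvent equation. -/
theorem HasValue.resolvent_sub {A : Submodule ℂ (V × V)} {z w : ℂ} {u x x' y : V}
    (hx : HasValue (resolventOp w A : Set (V × V)) u x)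
    (hx' : HasValue (resolventOp z A : Set (V × V)) u x')
    (hy : HasValue (resolventOp z A : Set (V × V)) x y) : x' - x = (w - z) • y := by
  have h1 := mem_resolventOp.1 hx.1
  have h2 := A.smul_mem (w - z) (mem_resolventOp.1 hy.1)
  have h3 : (x + (w - z) • y, u) ∈ resolventOp z A := by
    refine mem_resolventOp.2 ?_
    convert A.add_mem h1 h2 using 1
    rw [Prod.smul_mk, Prod.mk_add_mk, Prod.mk.injEq]
    refine ⟨?_, rfl⟩
    match_scalars <;> ring
  rw [← hx'.2 _ h3]
  abel

/-- The value of a chain of resolvents. -/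
noncomputable def chainVal (A : Submodule ℂ (V × V)) (u : V) (l : List ℂ) : V :=
  open Classical in if h : ∃ y, ResolventChain A u l y then h.choose else 0

theorem ResolventChain.eq_chainVal {A : Submodule ℂ (V × V)} {u : V} {l : List ℂ} {y : V}
    (h : ResolventChain A u l y) : y = chainVal A u l := by
  have h1 : ∃ y, ResolventChain A u l y := ⟨y, h⟩
  rw [chainVal, dif_pos h1]
  exact h.unique h1.choose_spec

/-- `φ` is the family `{z₁, …, zₘ} ↦ (z₁ - A)⁻¹ ⋯ (zₘ - A)⁻¹ u`. -/
structure OpFam [TopologicalSpace V] (n : ℕ) (Γ : Set ℂ) (A : Submodule ℂ (V × V)) (u : V)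
    (φ : Multiset ℂ → V) : Prop where
  zero : φ 0 = u
  hasValue : ∀ s z, s.card + 1 ≤ n → (∀ x ∈ s, x ∈ Γ) → z ∈ Γ →
    HasValue (resolventOp z A : Set (V × V)) (φ s) (φ (z ::ₘ s))
  resFam : ResFam n Γ φ

section Chains

variable {n : ℕ} {Γ : Set ℂ} {A : Submodule ℂ (V × V)} {u : V}

theorem chain_of_total (h : ∀ l : List ℂ, l.length ≤ n → (∀ x ∈ l, x ∈ Γ) →
    ∃ y, ResolventChain A u l y) {l : List ℂ} (hl : l.length ≤ n) (hΓ : ∀ x ∈ l, x ∈ Γ) :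
    ResolventChain A u l (chainVal A u l) := by
  obtain ⟨y, hy⟩ := h l hl hΓ
  rwa [← hy.eq_chainVal]

theorem chainVal_hasValue (h : ∀ l : List ℂ, l.length ≤ n → (∀ x ∈ l, x ∈ Γ) →
    ∃ y, ResolventChain A u l y) {l : List ℂ} {z : ℂ} (hl : l.length + 1 ≤ n)
    (hΓ : ∀ x ∈ l, x ∈ Γ) (hz : z ∈ Γ) :
    HasValue (resolventOp z A : Set (V × V)) (chainVal A u l) (chainVal A u (z :: l)) := by
  obtain ⟨x, hx, h1⟩ := chain_of_total h (l := z :: l) hl (by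
    intro y hy
    rcases List.mem_cons.1 hy with rfl | hy
    exacts [hz, hΓ y hy])
  rwa [← hx.eq_chainVal]

theorem chainVal_sub (h : ∀ l : List ℂ, l.length ≤ n → (∀ x ∈ l, x ∈ Γ) →
    ∃ y, ResolventChain A u l y) {l : List ℂ} {z w : ℂ} (hl : l.length + 2 ≤ n)
    (hΓ : ∀ x ∈ l, x ∈ Γ) (hz : z ∈ Γ) (hw : w ∈ Γ) :
    chainVal A u (z :: l) - chainVal A u (w :: l) = (w - z) • chainVal A u (z :: w :: l) := by
  have hΓ' : ∀ x ∈ w :: l, x ∈ Γ := by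
    intro y hy
    rcases List.mem_cons.1 hy with rfl | hy
    exacts [hw, hΓ y hy]
  exact (chainVal_hasValue h (by omega) hΓ hw).resolvent_sub (chainVal_hasValue h (by omega) hΓ hz)
    (chainVal_hasValue h (by simp; omega) hΓ' hz)

/-- Adjacent points z ≠ w commute because the resolvent equation, read in both orders, gives the
same vector times w - z. -/
theorem chainVal_perm (h : ∀ l : List ℂ, l.length ≤ n → (∀ x ∈ l, x ∈ Γ) →
    ∃ y, ResolventChain A u l y) {l l' : List ℂ} (hp : l.Perm l') (hl : l.length ≤ n)
    (hΓ : ∀ x ∈ l, x ∈ Γ) : chainVal A u l = chainVal A u l' := by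
  induction hp with
  | nil => rfl
  | @cons z l₁ l₂ hp ih =>
    rw [List.length_cons] at hl
    have hz := hΓ z List.mem_cons_self
    have hΓ₁ : ∀ x ∈ l₁, x ∈ Γ := fun x hx => hΓ x (List.mem_cons_of_mem z hx)
    have h1 := chainVal_hasValue h hl hΓ₁ hz
    have h2 := chainVal_hasValue h (l := l₂) (hp.length_eq ▸ hl)
      (fun x hx => hΓ₁ x (hp.mem_iff.2 hx)) hz
    rw [ih (by omega) hΓ₁] at h1
    exact h1.unique h2
  | swap z w l =>
    simp only [List.length_cons] at hl
    have hw := hΓ w List.mem_cons_self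
    have hz := hΓ z (List.mem_cons_of_mem w List.mem_cons_self)
    have hΓ₁ : ∀ x ∈ l, x ∈ Γ := fun x hx =>
      hΓ x (List.mem_cons_of_mem w (List.mem_cons_of_mem z hx))
    rcases eq_or_ne z w with rfl | hne
    · rfl
    · have h1 := chainVal_sub h (l := l) (by omega) hΓ₁ hz hw
      have h2 := chainVal_sub h (l := l) (by omega) hΓ₁ hw hz
      have h3 : (w - z) • chainVal A u (w :: z :: l) = (w - z) • chainVal A u (z :: w :: l) := by
        rw [← h1, ← neg_sub z w, neg_smul, ← h2, neg_sub]
      exact smul_right_injective V (sub_ne_zero.2 hne.symm) h3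
  | trans hp₁ hp₂ ih₁ ih₂ =>
    rw [ih₁ hl hΓ, ih₂ (hp₁.length_eq ▸ hl) fun x hx => hΓ x (hp₁.mem_iff.2 hx)]

/-- By permutation invariance the chains depend only on the multiset of points, which turns the
domain condition into a symmetric family with the resolvent equation. -/
theorem exists_opFam [TopologicalSpace V] (hu : u ∈ resolventDomain n Γ A) :
    ∃ φ, OpFam n Γ A u φ := by
  have h : ∀ l : List ℂ, l.length ≤ n → (∀ x ∈ l, x ∈ Γ) → ∃ y, ResolventChain A u l y := by
    intro l hl hΓ
    obtain ⟨⟨R, hR, -⟩, -⟩ := hu l.length hl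
    have := hR l.get fun i => hΓ _ (List.get_mem _ _)
    rw [List.ofFn_get] at this
    exact ⟨_, this⟩
  have hcoe : ∀ l : List ℂ, l.length ≤ n → (∀ x ∈ l, x ∈ Γ) →
      chainVal A u (l : Multiset ℂ).toList = chainVal A u l := by
    intro l hl hΓ
    have hp : (l : Multiset ℂ).toList.Perm l := by
      rw [← Multiset.coe_eq_coe, Multiset.coe_toList]
    exact (chainVal_perm h hp.symm hl hΓ).symm
  refine ⟨fun s => chainVal A u s.toList, ?_, ?_, ?_, ?_⟩
  · have : ResolventChain A u [] u := rfl
    simpa using this.eq_chainVal.symm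
  · intro s z hs hΓ hz
    induction s using Quotient.inductionOn with
    | _ l =>
      have hl : l.length + 1 ≤ n := hs
      have hΓ' : ∀ x ∈ l, x ∈ Γ := hΓ
      change HasValue _ (chainVal A u (l : Multiset ℂ).toList)
        (chainVal A u ((z :: l : List ℂ) : Multiset ℂ).toList)
      rw [hcoe l (by omega) hΓ', hcoe (z :: l) (by simpa using hl) (by
        intro y hy
        rcases List.mem_cons.1 hy with rfl | hy
        exacts [hz, hΓ' y hy])]
      exact chainVal_hasValue h hl hΓ' hz
  · intro m hm
    obtain ⟨⟨R, hR, hRc⟩, -⟩ := hu m hm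
    refine hRc.congr fun z hz => ?_
    rw [(hR z hz).eq_chainVal]
    refine hcoe _ (by simpa using hm) ?_
    intro x hx
    obtain ⟨i, rfl⟩ := List.mem_ofFn.1 hx
    exact hz i
  · intro s z w hs hΓ hz hw
    induction s using Quotient.inductionOn with
    | _ l =>
      have hl : l.length + 2 ≤ n := hs
      have hΓ' : ∀ x ∈ l, x ∈ Γ := hΓ
      have hw' : ∀ x ∈ w :: l, x ∈ Γ := by
        intro y hy
        rcases List.mem_cons.1 hy with rfl | hy
        exacts [hw, hΓ' y hy]
      have hz' : ∀ x ∈ z :: l, x ∈ Γ := by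
        intro y hy
        rcases List.mem_cons.1 hy with rfl | hy
        exacts [hz, hΓ' y hy]
      have hzw' : ∀ x ∈ z :: w :: l, x ∈ Γ := by
        intro y hy
        rcases List.mem_cons.1 hy with rfl | hy
        exacts [hz, hw' y hy]
      change chainVal A u ((z :: l : List ℂ) : Multiset ℂ).toList -
        chainVal A u ((w :: l : List ℂ) : Multiset ℂ).toList = (w - z) •
        chainVal A u ((z :: w :: l : List ℂ) : Multiset ℂ).toList
      rw [hcoe _ (by simp; omega) hz', hcoe _ (by simp; omega) hw', hcoe _ (by simp; omega) hzw']
      exact chainVal_sub h hl hΓ' hz hw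

end Chains

namespace OpFam

variable [TopologicalSpace V] {n : ℕ} {Γ : Set ℂ} {A : Submodule ℂ (V × V)} {u : V}
  {φ : Multiset ℂ → V}

theorem of_le {m : ℕ} (h : OpFam n Γ A u φ) (hm : m ≤ n) : OpFam m Γ A u φ :=
  ⟨h.zero, fun s z hs => h.hasValue s z (hs.trans hm), h.resFam.of_le hm⟩

theorem chain (h : OpFam n Γ A u φ) : ∀ (l : List ℂ), l.length ≤ n → (∀ x ∈ l, x ∈ Γ) →
    ResolventChain A u l (φ l)
  | [], _, _ => h.zero
  | z :: l, hl, hΓ => by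
    have hΓ' : ∀ x ∈ l, x ∈ Γ := fun x hx => hΓ x (List.mem_cons_of_mem z hx)
    rw [List.length_cons] at hl
    exact ⟨_, h.chain l (by omega) hΓ', h.hasValue l z hl hΓ' (hΓ z List.mem_cons_self)⟩

/-- The family belonging to chains of the form `(z₁⁻¹ - A⁻¹)⁻¹ ⋯ (zₘ⁻¹ - A⁻¹)⁻¹`. -/
def invFam (φ : Multiset ℂ → V) : List ℂ → Multiset ℂ → V
  | [], s => φ s
  | z :: l, s => z • invFam φ l s - z ^ 2 • invFam φ l (z ::ₘ s)

/-- The family of a partial inverse chain still satisfies the graph relation of the resolvents, by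
linearity; this supplies the next factor of the inverse chain. -/
theorem invFam_mem (h : OpFam n Γ A u φ) : ∀ (l : List ℂ) (s : Multiset ℂ) (z : ℂ),
    l.length + s.card + 1 ≤ n → (∀ x ∈ l, x ∈ Γ) → (∀ x ∈ s, x ∈ Γ) → z ∈ Γ →
    (invFam φ l (z ::ₘ s), invFam φ l s) ∈ resolventOp z A
  | [], s, z, hn, _, hs, hz => (h.hasValue s z (by simpa using hn) hs hz).1
  | w :: l, s, z, hn, hl, hs, hz => by
    have hw := hl w List.mem_cons_self
    have hl' : ∀ x ∈ l, x ∈ Γ := fun x hx => hl x (List.mem_cons_of_mem w hx)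
    have h1 := invFam_mem h l s z (by simp at hn; omega) hl' hs hz
    have h2 := invFam_mem h l (w ::ₘ s) z (by simp at hn ⊢; omega) hl' (by
      intro x hx
      rcases Multiset.mem_cons.1 hx with rfl | hx
      exacts [hw, hs x hx]) hz
    have h3 := (resolventOp z A).sub_mem ((resolventOp z A).smul_mem w h1)
      ((resolventOp z A).smul_mem (w ^ 2) h2)
    rw [Multiset.cons_swap z w] at h3
    exact h3

theorem invFam_chain (h : OpFam n Γ A u φ) : ∀ (l : List ℂ), l.length ≤ n →
    (∀ x ∈ l, x ∈ Γ \ {0}) →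
    ResolventChain (inverseOp A) u (l.map fun z => z⁻¹) (invFam φ l 0)
  | [], _, _ => h.zero
  | z :: l, hl, hΓ => by
    have hΓ' : ∀ x ∈ l, x ∈ Γ \ {0} := fun x hx => hΓ x (List.mem_cons_of_mem z hx)
    have hz := hΓ z List.mem_cons_self
    rw [List.length_cons] at hl
    refine ⟨_, h.invFam_chain l (by omega) hΓ', ?_⟩
    have h1 := h.invFam_mem l 0 z (by simpa using hl) (fun x hx => (hΓ' x hx).1) (by simp) hz.1
    have h2 := h.hasValue 0 z (by simp; omega) (by simp) hz.1
    exact (hasValue_resolventOp h2 h1).inverse hz.2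

theorem continuousOn_invFam [IsTopologicalAddGroup V] [ContinuousSMul ℂ V] (h : OpFam n Γ A u φ)
    {X : Type*} [TopologicalSpace X] {S : Set X} : ∀ (l l' : List (X → ℂ)),
    l.length + l'.length ≤ n → (∀ g ∈ l, ContinuousOn g S) → (∀ g ∈ l, MapsTo g S Γ) →
    (∀ g ∈ l', ContinuousOn g S) → (∀ g ∈ l', MapsTo g S Γ) →
    ContinuousOn (fun x => invFam φ (l.map fun g => g x) (l'.map fun g => g x : List ℂ)) S
  | [], l', hn, _, _, hc, hm => h.resFam.continuousOn_map l' (by simpa using hn) hc hm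
  | f :: l, l', hn, hc, hm, hc', hm' => by
    have hcl : ∀ g ∈ l, ContinuousOn g S := fun g hg => hc g (List.mem_cons_of_mem f hg)
    have hml : ∀ g ∈ l, MapsTo g S Γ := fun g hg => hm g (List.mem_cons_of_mem f hg)
    have hcf := hc f List.mem_cons_self
    have hmf := hm f List.mem_cons_self
    have h1 := continuousOn_invFam h l l' (by simp at hn; omega) hcl hml hc' hm'
    have h2 := continuousOn_invFam h l (f :: l') (by simp at hn ⊢; omega) hcl hml (by
      intro g hg
      rcases List.mem_cons.1 hg with rfl | hg
      exacts [hcf, hc' g hg]) (by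
      intro g hg
      rcases List.mem_cons.1 hg with rfl | hg
      exacts [hmf, hm' g hg])
    exact (hcf.smul h1).sub ((hcf.pow 2).smul h2)

/-- Because (z⁻¹-A⁻¹)⁻¹ = z - z²(z-A)⁻¹, the chains for A⁻¹ are polynomial combinations of those for
A; a family for A therefore yields both halves of the domain condition. -/
theorem mem_resolventDomain [IsTopologicalAddGroup V] [ContinuousSMul ℂ V]
    (h : OpFam n Γ A u φ) : u ∈ resolventDomain n Γ A := by
  refine fun m hm => ⟨⟨fun z => φ (List.ofFn z), fun z hz => ?_, h.resFam.cont m hm⟩,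
    ⟨fun z => invFam φ (List.ofFn z) 0, fun z hz => ?_, ?_⟩⟩
  · refine h.chain _ (by simpa using hm) fun x hx => ?_
    obtain ⟨i, rfl⟩ := List.mem_ofFn.1 hx
    exact hz i
  · have := h.invFam_chain (List.ofFn z) (by simpa using hm) (fun x hx => by
      obtain ⟨i, rfl⟩ := List.mem_ofFn.1 hx
      exact hz i)
    rwa [List.map_ofFn] at this
  · have := h.continuousOn_invFam (X := Fin m → ℂ) (S := {z | ∀ i, z i ∈ Γ \ {0}})
      (List.ofFn fun i z => z i) [] (by simpa using hm) (by
        intro g hg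
        obtain ⟨i, rfl⟩ := List.mem_ofFn.1 hg
        exact (continuous_apply i).continuousOn) (by
        intro g hg
        obtain ⟨i, rfl⟩ := List.mem_ofFn.1 hg
        exact fun z hz => (hz i).1) (by simp) (by simp)
    simpa [List.map_ofFn, Function.comp_def] using this

end OpFam

end Operators

end ResolventCalculus

namespace ResolventCalculus

/-! ### Bounded functionals given by normal forms -/

theorem vectorMeasure_integrable_of_continuousOn {μ : ComplexMeasure ℂ}
    (hμ : IsFiniteMeasure μ.variation) {K : Set ℂ} (hK : IsCompact K) (h0 : μ.variation Kᶜ = 0)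
    {g : ℂ → ℂ} (hg : ContinuousOn g K) : μ.Integrable g := by
  have h1 : IntegrableOn g K μ.variation := hg.integrableOn_compact hK
  have h2 : μ.variation.restrict K = μ.variation := Measure.restrict_eq_self_of_ae_mem (by
    rw [ae_iff]
    exact h0)
  rwa [IntegrableOn, h2] at h1

section Functionals

variable {n : ℕ} {Γ : Set ℂ}

theorem ResFam.continuousOn_replicate {V : Type*} [AddCommGroup V] [Module ℂ V]
    [TopologicalSpace V] {φ : Multiset ℂ → V} (h : ResFam n Γ φ) {j : ℕ} (hj : j ≤ n) :
    ContinuousOn (fun w => φ (Multiset.replicate j w)) Γ := by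
  simpa using h.continuousOn_add_replicate (s := 0) (k := j) (by simp) (by simpa using hj)
    continuousOn_id (mapsTo_id Γ)

theorem isBddFunctional_const_mul_apply (c : ℂ) {w : ℂ} (hw : w ∈ Γ) {j : ℕ} (hj : j ≤ n) :
    IsBddFunctional n Γ fun φ => c * φ (Multiset.replicate j w) := by
  refine ⟨fun φ ψ _ _ => mul_add _ _ _, fun e φ _ => by ring, ‖c‖, fun φ _ δ hδ => ?_⟩
  rw [norm_mul]
  refine mul_le_mul_of_nonneg_left (hδ _ (by simpa using hj) fun x hx => ?_) (norm_nonneg c)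
  rwa [Multiset.eq_of_mem_replicate hx]

theorem isBddFunctional_measure {μ : ComplexMeasure ℂ} (hμ : IsFiniteMeasure μ.variation)
    (hΓ : IsCompact Γ) (h0 : μ.variation Γᶜ = 0) {j : ℕ} (hj : j ≤ n) :
    IsBddFunctional n Γ fun φ => μ.integral (fun w => φ (Multiset.replicate j w))
      (ContinuousLinearMap.mul ℝ ℂ) := by
  have hi : ∀ φ : Multiset ℂ → ℂ, ResFam n Γ φ → μ.Integrable fun w => φ (Multiset.replicate j w) :=
    fun φ hφ => vectorMeasure_integrable_of_continuousOn hμ hΓ h0 (hφ.continuousOn_replicate hj)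
  refine ⟨fun φ ψ hφ hψ => VectorMeasure.integral_fun_add (hi φ hφ) (hi ψ hψ),
    fun e φ _ => vectorMeasure_integral_const_mul μ e _,
    ‖ContinuousLinearMap.mul ℝ ℂ‖ * μ.variation.real univ, fun φ hφ δ hδ => ?_⟩
  have h1 : ∀ᵐ w ∂μ.variation, ‖φ (Multiset.replicate j w)‖ ≤ δ := by
    filter_upwards [compl_mem_ae_iff.2 h0] with w hw
    rw [compl_compl] at hw
    refine hδ _ (by simpa using hj) fun x hx => ?_
    rwa [Multiset.eq_of_mem_replicate hx]
  refine (VectorMeasure.norm_integral_le_of_norm_le_const h1).trans (le_of_eq ?_)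
  ring

theorem IsBddFunctional.finsetSum {ι : Type*} (s : Finset ι)
    {Λ : ι → (Multiset ℂ → ℂ) → ℂ} (h : ∀ i ∈ s, IsBddFunctional n Γ (Λ i)) :
    IsBddFunctional n Γ fun φ => ∑ i ∈ s, Λ i φ := by
  choose! C hC using fun i hi => (h i hi).bound
  refine ⟨fun φ ψ hφ hψ => ?_, fun e φ hφ => ?_, ∑ i ∈ s, C i, fun φ hφ δ hδ => ?_⟩
  · rw [← Finset.sum_add_distrib]
    exact Finset.sum_congr rfl fun i hi => (h i hi).add φ ψ hφ hψ
  · rw [Finset.mul_sum]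
    exact Finset.sum_congr rfl fun i hi => (h i hi).smul e φ hφ
  · rw [Finset.sum_mul]
    exact norm_sum_le_of_le _ fun i hi => hC i hi φ hφ δ hδ

theorem IsBddFunctional.add_functional {Λ Λ' : (Multiset ℂ → ℂ) → ℂ} (h : IsBddFunctional n Γ Λ)
    (h' : IsBddFunctional n Γ Λ') : IsBddFunctional n Γ fun φ => Λ φ + Λ' φ := by
  simpa using IsBddFunctional.finsetSum (Finset.univ : Finset Bool)
    (Λ := fun i => bif i then Λ else Λ') (by simp [h, h'])

theorem IsBddFunctional.of_le {m : ℕ} {Λ : (Multiset ℂ → ℂ) → ℂ} (h : IsBddFunctional m Γ Λ)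
    (hm : m ≤ n) : IsBddFunctional n Γ Λ := by
  obtain ⟨C, hC⟩ := h.bound
  exact ⟨fun φ ψ hφ hψ => h.add φ ψ (hφ.of_le hm) (hψ.of_le hm),
    fun e φ hφ => h.smul e φ (hφ.of_le hm), C, fun φ hφ δ hδ => hC φ (hφ.of_le hm) δ
      fun s hs => hδ s (hs.trans hm)⟩

theorem isBddFunctional_intervalIntegral {γ : ℝ → ℂ} {a b : ℝ} (hab : a ≤ b)
    (hγ : ContinuousOn γ (Icc a b)) {k : ℝ → ℂ} (hk : IntervalIntegrable k volume a b)
    {j : ℕ} (hj : j ≤ n) : IsBddFunctional n (γ '' Icc a b) fun φ =>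
      ∫ t in a..b, k t * φ (Multiset.replicate j (γ t)) := by
  have hi : ∀ φ : Multiset ℂ → ℂ, ResFam n (γ '' Icc a b) φ →
      IntervalIntegrable (fun t => k t * φ (Multiset.replicate j (γ t))) volume a b := by
    intro φ hφ
    refine hk.mul_continuousOn ?_
    rw [uIcc_of_le hab]
    exact (hφ.continuousOn_replicate hj).comp hγ (mapsTo_image γ _)
  refine ⟨fun φ ψ hφ hψ => ?_, fun e φ _ => ?_, ∫ t in a..b, ‖k t‖, fun φ hφ δ hδ => ?_⟩
  · simp only [mul_add]
    exact intervalIntegral.integral_add (hi φ hφ) (hi ψ hψ)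
  · rw [← intervalIntegral.integral_const_mul]
    congr 1
    ext t
    ring
  · rw [← intervalIntegral.integral_mul_const]
    refine intervalIntegral.norm_integral_le_of_norm_le hab ?_ (hk.norm.mul_const δ)
    refine Eventually.of_forall fun t ht => ?_
    rw [norm_mul]
    refine mul_le_mul_of_nonneg_left (hδ _ (by simpa using hj) fun x hx => ?_) (norm_nonneg _)
    rw [Multiset.eq_of_mem_replicate hx]
    exact mem_image_of_mem γ (Ioc_subset_Icc_self ht)

end Functionals

/-- Data of a normal form along a curve whose measures have point masses at the two endpoints and
are otherwise absolutely continuous in the parameter. -/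
structure CurveForm where
  left : ℕ → ℂ
  right : ℕ → ℂ
  density : ℕ → ℝ → ℂ

namespace CurveForm

/-- Application of the form to a scalar family. -/
noncomputable def apply (θ : CurveForm) (γ : ℝ → ℂ) (a b : ℝ) (n : ℕ) (φ : Multiset ℂ → ℂ) : ℂ :=
  ∑ j ∈ Finset.range (n + 1), (θ.left j * φ (Multiset.replicate j (γ a)) +
    θ.right j * φ (Multiset.replicate j (γ b)) +
    ∫ t in a..b, θ.density j t * φ (Multiset.replicate j (γ t)))

/-- Application of the form to a vector valued family. -/
noncomputable def eval {V : Type*} [AddCommGroup V] [Module ℂ V] [UniformSpace V] (θ : CurveForm)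
    (γ : ℝ → ℂ) (a b : ℝ) (n : ℕ) (φ : Multiset ℂ → V) : V :=
  ∑ j ∈ Finset.range (n + 1), (θ.left j • φ (Multiset.replicate j (γ a)) +
    θ.right j • φ (Multiset.replicate j (γ b)) +
    vint a b (θ.density j) fun t => φ (Multiset.replicate j (γ t)))

/-- `θ` represents `f` as an `n`-normal form. -/
structure Represents (θ : CurveForm) (γ : ℝ → ℂ) (a b : ℝ) (n : ℕ) (f : ℂ → ℂ) : Prop where
  integrable : ∀ j ≤ n, IntervalIntegrable (θ.density j) volume a b
  eq : ∀ z ∉ γ '' Icc a b, f z = θ.apply γ a b n (poleFam z)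

variable {γ : ℝ → ℂ} {a b C₁ C₂ : ℝ} {n : ℕ} {θ : CurveForm} {f : ℂ → ℂ}

theorem isBddFunctional (hγ : BiLipArc γ a b C₁ C₂)
    (hθ : ∀ j ≤ n, IntervalIntegrable (θ.density j) volume a b) :
    IsBddFunctional n (γ '' Icc a b) (θ.apply γ a b n) := by
  refine IsBddFunctional.finsetSum _ fun j hj => ?_
  have hj : j ≤ n := by simpa [Nat.lt_succ_iff] using hj
  exact ((isBddFunctional_const_mul_apply _ (mem_image_of_mem γ (left_mem_Icc.2 hγ.lt.le))
    hj).add_functional (isBddFunctional_const_mul_apply _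
      (mem_image_of_mem γ (right_mem_Icc.2 hγ.lt.le)) hj)).add_functional
    (isBddFunctional_intervalIntegral hγ.lt.le hγ.continuous.continuousOn (hθ j hj) hj)

theorem apply_congr (hab : a ≤ b) {φ ψ : Multiset ℂ → ℂ} (h : ∀ j ≤ n, ∀ w ∈ γ '' Icc a b,
    φ (Multiset.replicate j w) = ψ (Multiset.replicate j w)) :
    θ.apply γ a b n φ = θ.apply γ a b n ψ := by
  refine Finset.sum_congr rfl fun j hj => ?_
  have hj : j ≤ n := by simpa [Nat.lt_succ_iff] using hj
  rw [h j hj _ (mem_image_of_mem γ (left_mem_Icc.2 hab)),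
    h j hj _ (mem_image_of_mem γ (right_mem_Icc.2 hab))]
  congr 1
  refine intervalIntegral.integral_congr fun t ht => ?_
  rw [uIcc_of_le hab] at ht
  rw [h j hj _ (mem_image_of_mem γ ht)]

variable {V : Type*} [AddCommGroup V] [Module ℂ V] [UniformSpace V] [IsUniformAddGroup V]
  [ContinuousSMul ℂ V] [PolynormableSpace ℂ V] {A : Submodule ℂ (V × V)} {u : V}
  {Φ : Multiset ℂ → V}

theorem _root_.ResolventCalculus.ResFam.continuousOn_curve {W : Type*} [AddCommGroup W]
    [Module ℂ W] [TopologicalSpace W] {Φ : Multiset ℂ → W} (hγ : BiLipArc γ a b C₁ C₂)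
    (hΦ : ResFam n (γ '' Icc a b) Φ) {j : ℕ} (hj : j ≤ n) :
    ContinuousOn (fun t => Φ (Multiset.replicate j (γ t))) (Icc a b) :=
  (hΦ.continuousOn_replicate hj).comp hγ.continuous.continuousOn (mapsTo_image γ _)

theorem clm_eval (hV : ∀ x : ℕ → V, CauchySeq x → ∃ y, Tendsto x atTop (𝓝 y))
    (hγ : BiLipArc γ a b C₁ C₂) (hθ : ∀ j ≤ n, IntervalIntegrable (θ.density j) volume a b)
    (hΦ : ResFam n (γ '' Icc a b) Φ) (ℓ : V →L[ℂ] ℂ) :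
    ℓ (θ.eval γ a b n Φ) = θ.apply γ a b n fun s => ℓ (Φ s) := by
  rw [eval, apply, map_sum]
  refine Finset.sum_congr rfl fun j hj => ?_
  have hj : j ≤ n := by simpa [Nat.lt_succ_iff] using hj
  rw [map_add, map_add, map_smul, map_smul, smul_eq_mul, smul_eq_mul,
    clm_vint hV hγ.lt.le (hθ j hj) (hΦ.continuousOn_curve hγ hj)]

/-- A linear relation that holds on the diagonals survives application of a form; used with T the
graph of a resolvent. -/
theorem eval_mem (hV : ∀ x : ℕ → V, CauchySeq x → ∃ y, Tendsto x atTop (𝓝 y))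
    (hγ : BiLipArc γ a b C₁ C₂) (hθ : ∀ j ≤ n, IntervalIntegrable (θ.density j) volume a b)
    {Φ' : Multiset ℂ → V} (hΦ : ResFam n (γ '' Icc a b) Φ) (hΦ' : ResFam n (γ '' Icc a b) Φ')
    {T : Submodule ℂ (V × V)} (hT : IsSeqClosed (T : Set (V × V)))
    (h : ∀ j ≤ n, ∀ w ∈ γ '' Icc a b, (Φ (Multiset.replicate j w), Φ' (Multiset.replicate j w)) ∈ T) :
    (θ.eval γ a b n Φ, θ.eval γ a b n Φ') ∈ T := by
  have hsum : ∀ (g g' : ℕ → V) (s : Finset ℕ),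
      (∑ j ∈ s, g j, ∑ j ∈ s, g' j) = ∑ j ∈ s, (g j, g' j) := fun g g' s =>
    Prod.ext (by rw [Prod.fst_sum]) (by rw [Prod.snd_sum])
  rw [eval, eval, hsum]
  refine T.sum_mem fun j hj => ?_
  have hj : j ≤ n := by simpa [Nat.lt_succ_iff] using hj
  exact T.add_mem (T.add_mem
    (T.smul_mem (θ.left j) (h j hj _ (mem_image_of_mem γ (left_mem_Icc.2 hγ.lt.le))))
    (T.smul_mem (θ.right j) (h j hj _ (mem_image_of_mem γ (right_mem_Icc.2 hγ.lt.le)))))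
    (vint_mem hV hγ.lt.le (hθ j hj) (hΦ.continuousOn_curve hγ hj) (hΦ'.continuousOn_curve hγ hj) hT
      fun t ht => h j hj _ (mem_image_of_mem γ ht))

/-- A form representing `f` computes `f(A)`. -/
theorem Represents.hasValue [T2Space V]
    (hV : ∀ x : ℕ → V, CauchySeq x → ∃ y, Tendsto x atTop (𝓝 y))
    (hγ : BiLipArc γ a b C₁ C₂) (hΦ : OpFam n (γ '' Icc a b) A u Φ)
    (hθ : θ.Represents γ a b n f) :
    HasValue (funCalc (γ '' Icc a b) A f) u (θ.eval γ a b n Φ) := by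
  have hrep : ∀ (j : ℕ) (w : ℂ), (Multiset.replicate j w) = (List.replicate j w : Multiset ℂ) :=
    fun j w => (Multiset.coe_replicate j w).symm
  refine ⟨?_, ?_⟩
  · choose! μ hμ1 hμ2 hμ3 using fun j (hj : j ≤ n) =>
      exists_complexMeasure hγ.continuous hγ.lt.le (θ.left j) (θ.right j) (hθ.integrable j hj)
    refine ⟨n, μ, fun j w => Φ (Multiset.replicate j w), fun j =>
      θ.left j • Φ (Multiset.replicate j (γ a)) + θ.right j • Φ (Multiset.replicate j (γ b)) +
        vint a b (θ.density j) fun t => Φ (Multiset.replicate j (γ t)),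
      ⟨fun j hj => ⟨hμ1 j hj, hμ2 j hj⟩, fun z hz => ?_⟩, hΦ.mem_resolventDomain,
      fun j hj w hw => ?_, fun j hj ℓ => ?_, rfl⟩
    · rw [hθ.eq z hz, apply]
      refine Finset.sum_congr rfl fun j hj => ?_
      have hj : j ≤ n := by simpa [Nat.lt_succ_iff] using hj
      have h1 := ((ResFam.poleFam n hz).continuousOn_replicate hj)
      simp only [poleFam_replicate] at h1 ⊢
      rw [(hμ3 j hj _ h1).2]
    · change ResolventChain A u _ (Φ (Multiset.replicate j w))
      rw [hrep]
      refine hΦ.chain _ (by simpa using hj) fun x hx => ?_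
      rwa [List.eq_of_mem_replicate hx]
    · have h1 := hμ3 j hj (fun w => ℓ (Φ (Multiset.replicate j w)))
        (ℓ.continuous.comp_continuousOn (hΦ.resFam.continuousOn_replicate hj))
      refine ⟨h1.1, ?_⟩
      rw [h1.2, map_add, map_add, map_smul, map_smul, smul_eq_mul, smul_eq_mul,
        clm_vint hV hγ.lt.le (hθ.integrable j hj) (hΦ.resFam.continuousOn_curve hγ hj)]
  · rintro y ⟨n', μ, R, x, ⟨hμ, hf⟩, hu, hR, hx, hy⟩
    simp only at hu hR hy
    -- The two normal forms may have different orders; the comparison takes place at the larger one,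
    -- where u belongs to the domain.
    obtain ⟨N, Φ', hΦ', hnN, hn'N⟩ : ∃ N Φ', OpFam N (γ '' Icc a b) A u Φ' ∧ n ≤ N ∧ n' ≤ N := by
      rcases le_total n n' with h | h
      · obtain ⟨Φ', hΦ'⟩ := exists_opFam hu
        exact ⟨n', Φ', hΦ', h, le_rfl⟩
      · exact ⟨n, Φ, hΦ, le_rfl, h⟩
    have heq : ∀ j ≤ n, ∀ w ∈ γ '' Icc a b,
        Φ (Multiset.replicate j w) = Φ' (Multiset.replicate j w) := by
      intro j hj w hw
      rw [hrep]
      have hm : ∀ x ∈ List.replicate j w, x ∈ γ '' Icc a b := fun x hx => by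
        rwa [List.eq_of_mem_replicate hx]
      exact (hΦ.chain _ (by simpa using hj) hm).unique
        (hΦ'.chain _ (by simpa using hj.trans hnN) hm)
    have heq' : ∀ j ≤ n', ∀ w ∈ γ '' Icc a b, R j w = Φ' (Multiset.replicate j w) := by
      intro j hj w hw
      rw [hrep]
      exact (hR j hj w hw).unique (hΦ'.chain _ (by simpa using hj.trans hn'N) fun x hx => by
        rwa [List.eq_of_mem_replicate hx])
    refine eq_of_forall_dual fun ℓ => ?_
    rw [hy, map_sum, clm_eval hV hγ hθ.integrable hΦ.resFam]
    -- Both normal forms are bounded functionals of order N with the value f(z) on the pole family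
    -- at z, hence they agree on ℓ∘Φ'.
    have h1 : IsBddFunctional N (γ '' Icc a b) fun φ => ∑ j ∈ Finset.range (n' + 1),
        (μ j).integral (fun w => φ (Multiset.replicate j w)) (ContinuousLinearMap.mul ℝ ℂ) := by
      refine IsBddFunctional.finsetSum _ fun j hj => ?_
      have hj : j ≤ n' := by simpa [Nat.lt_succ_iff] using hj
      exact isBddFunctional_measure (hμ j hj).1 hγ.isCompact (hμ j hj).2 (hj.trans hn'N)
    have h2 := (θ.isBddFunctional hγ hθ.integrable).of_le hnN
    have h3 := h1.eq_of_poleFam hγ h2 (fun z hz => by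
      simp only [poleFam_replicate]
      rw [← hf z hz, hθ.eq z hz]) (hΦ'.resFam.clm ℓ)
    have h4 : θ.apply γ a b n (fun s => ℓ (Φ s)) = θ.apply γ a b n (fun s => ℓ (Φ' s)) :=
      apply_congr hγ.lt.le fun j hj w hw => by rw [heq j hj w hw]
    rw [h4, ← h3]
    refine Finset.sum_congr rfl fun j hj => ?_
    have hj : j ≤ n' := by simpa [Nat.lt_succ_iff] using hj
    rw [((hx j hj) ℓ).2]
    refine VectorMeasure.integral_congr_ae ?_
    filter_upwards [compl_mem_ae_iff.2 (hμ j hj).2] with w hw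
    rw [compl_compl] at hw
    rw [heq' j hj w hw]

end CurveForm

end ResolventCalculus

namespace ResolventCalculus

/-! ### The families generated by a form -/

theorem IsBddFunctional.map_sub {n : ℕ} {Γ : Set ℂ} {Λ : (Multiset ℂ → ℂ) → ℂ}
    (h : IsBddFunctional n Γ Λ) {φ ψ : Multiset ℂ → ℂ} (hφ : ResFam n Γ φ) (hψ : ResFam n Γ ψ) :
    Λ (fun s => φ s - ψ s) = Λ φ - Λ ψ := by
  have h1 := h.add φ (fun s => (-1) * ψ s) hφ (hψ.const_mul (-1))
  rw [h.smul (-1) ψ hψ] at h1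
  simp only [neg_mul, one_mul, ← sub_eq_add_neg] at h1
  exact h1

theorem ResFam.continuousOn_append {V : Type*} [AddCommGroup V] [Module ℂ V] [TopologicalSpace V]
    {n m i : ℕ} {Γ : Set ℂ} {Φ : Multiset ℂ → V} (h : ResFam n Γ Φ) (hmi : m + i ≤ n) :
    ContinuousOn (Function.uncurry fun (z : Fin m → ℂ) (w : Fin i → ℂ) =>
      Φ ((List.ofFn z : Multiset ℂ) + (List.ofFn w : Multiset ℂ)))
      ({z | ∀ i, z i ∈ Γ} ×ˢ {w | ∀ i, w i ∈ Γ}) := by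
  have h1 : Continuous fun p : (Fin m → ℂ) × (Fin i → ℂ) => Fin.append p.1 p.2 := by
    refine continuous_pi fun j => ?_
    refine Fin.addCases (fun j => ?_) (fun j => ?_) j
    · simp only [Fin.append_left]
      fun_prop
    · simp only [Fin.append_right]
      fun_prop
  refine ((h.cont (m + i) hmi).comp h1.continuousOn ?_).congr ?_
  · rintro ⟨z, w⟩ ⟨hz, hw⟩ j
    refine Fin.addCases (fun j => ?_) (fun j => ?_) j
    · simpa using hz j
    · simpa using hw j
  · rintro ⟨z, w⟩ _
    simp [Function.uncurry, List.ofFn_fin_append]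

theorem exists_eq_ofFn (s : Multiset ℂ) : ∃ w : Fin s.card → ℂ, s = List.ofFn w := by
  induction s using Quotient.inductionOn with
  | _ l => exact ⟨l.get, congrArg (fun l : List ℂ => (l : Multiset ℂ)) (List.ofFn_get l).symm⟩

namespace CurveForm

variable {γ : ℝ → ℂ} {a b C₁ C₂ : ℝ} {n m k : ℕ} {θ : CurveForm} {f : ℂ → ℂ}
  {V : Type*} [AddCommGroup V] [Module ℂ V] [UniformSpace V] [IsUniformAddGroup V]
  [ContinuousSMul ℂ V] [PolynormableSpace ℂ V] [T2Space V] {A : Submodule ℂ (V × V)} {u : V}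
  {Φ : Multiset ℂ → V}

/-- The form consumes k of the n arguments. Continuity in the remaining ones needs uniformity in the
consumed ones, supplied by compactness of Γ; the resolvent equation passes through the form by
linearity, after application of functionals. -/
theorem resFam_eval (hV : ∀ x : ℕ → V, CauchySeq x → ∃ y, Tendsto x atTop (𝓝 y))
    (hγ : BiLipArc γ a b C₁ C₂) (hθ : ∀ j ≤ k, IntervalIntegrable (θ.density j) volume a b)
    (hΦ : ResFam n (γ '' Icc a b) Φ) (hmk : m + k ≤ n) :
    ResFam m (γ '' Icc a b) fun s => θ.eval γ a b k fun t => Φ (s + t) := by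
  set Γ := γ '' Icc a b with hΓ
  have hb := θ.isBddFunctional hγ hθ
  have hsh : ∀ s : Multiset ℂ, s.card ≤ m → (∀ x ∈ s, x ∈ Γ) → ResFam k Γ fun t => Φ (s + t) :=
    fun s hs hsΓ => hΦ.shift hsΓ (by omega)
  obtain ⟨C, hC⟩ := hb.bound
  refine ⟨fun m' hm' z₀ hz₀ => ?_, fun s z w hs hsΓ hz hw => ?_⟩
  · refine tendsto_nhds_iff_seminorm.2 fun p hp => ?_
    rw [Metric.tendsto_nhds]
    intro ε hε
    obtain ⟨δ, hδ, hδε⟩ : ∃ δ > 0, C * δ < ε := by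
      refine ⟨ε / (|C| + 1), by positivity, ?_⟩
      rw [mul_div_assoc', div_lt_iff₀ (by positivity)]
      nlinarith [le_abs_self C]
    have hu : {x : V × V | p (x.1 - x.2) < δ} ∈ uniformity V := by
      have h2 : {x : V × V | p (x.2 - x.1) < δ} ∈ uniformity V := by
        rw [uniformity_eq_comap_nhds_zero]
        exact ⟨{v | p v < δ}, (isOpen_lt hp continuous_const).mem_nhds (by simpa using hδ),
          fun x hx => hx⟩
      filter_upwards [h2] with x hx
      change p (x.1 - x.2) < δ
      rw [map_sub_rev]
      exact hx
    -- For z near z₀ the difference is p-small simultaneously for all choices of the i consumed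
    -- points in the compact set Γⁱ.
    have hev : ∀ i ∈ Finset.range (k + 1), ∀ᶠ z in 𝓝[{z : Fin m' → ℂ | ∀ i, z i ∈ Γ}] z₀,
        ∀ w : Fin i → ℂ, (∀ j, w j ∈ Γ) → p (Φ ((List.ofFn z : Multiset ℂ) + (List.ofFn w)) -
          Φ ((List.ofFn z₀ : Multiset ℂ) + (List.ofFn w))) < δ := by
      intro i hi
      have hi : i ≤ k := by simpa [Nat.lt_succ_iff] using hi
      have hK : IsCompact {w : Fin i → ℂ | ∀ j, w j ∈ Γ} := isCompact_pi_infinite fun _ =>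
        hγ.isCompact
      obtain ⟨v, hv, hv'⟩ := hK.mem_uniformity_of_prod
        (hΦ.continuousOn_append (m := m') (i := i) (by omega)) hz₀ hu
      filter_upwards [hv] with z hz w hw using hv' z hz w hw
    filter_upwards [(Filter.eventually_all_finset _).2 hev, self_mem_nhdsWithin] with z hz hzΓ
    rw [Real.dist_0_eq_abs, abs_of_nonneg (apply_nonneg p _)]
    refine lt_of_le_of_lt (seminorm_le_of_dual hp fun ℓ hℓ => ?_) hδε
    have hm : ∀ y : Fin m' → ℂ, y ∈ {z : Fin m' → ℂ | ∀ i, z i ∈ Γ} →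
        ResFam k Γ fun t => Φ ((List.ofFn y : Multiset ℂ) + t) := fun y hy =>
      hsh _ (by simpa using hm') fun x hx => by
        obtain ⟨i, rfl⟩ := List.mem_ofFn.1 (Multiset.mem_coe.1 hx)
        exact hy i
    rw [map_sub, clm_eval hV hγ hθ (hm z hzΓ), clm_eval hV hγ hθ (hm z₀ hz₀),
      ← hb.map_sub ((hm z hzΓ).clm ℓ) ((hm z₀ hz₀).clm ℓ)]
    refine hC _ (((hm z hzΓ).clm ℓ).sub ((hm z₀ hz₀).clm ℓ)) δ fun s hs hsΓ => ?_
    obtain ⟨w, hw⟩ := exists_eq_ofFn s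
    rw [← map_sub]
    refine (hℓ _).trans ?_
    rw [hw]
    refine (hz s.card (Finset.mem_range.2 (by omega)) w fun j => hsΓ _ ?_).le
    rw [hw]
    exact List.mem_ofFn.2 ⟨j, rfl⟩
  · have hz' : ∀ x ∈ z ::ₘ s, x ∈ Γ := by
      intro x hx
      rcases Multiset.mem_cons.1 hx with rfl | hx
      exacts [hz, hsΓ x hx]
    have hw' : ∀ x ∈ w ::ₘ s, x ∈ Γ := by
      intro x hx
      rcases Multiset.mem_cons.1 hx with rfl | hx
      exacts [hw, hsΓ x hx]
    have hzw' : ∀ x ∈ z ::ₘ w ::ₘ s, x ∈ Γ := by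
      intro x hx
      rcases Multiset.mem_cons.1 hx with rfl | hx
      exacts [hz, hw' x hx]
    have r1 := hsh (z ::ₘ s) (by simp; omega) hz'
    have r2 := hsh (w ::ₘ s) (by simp; omega) hw'
    have r3 := hsh (z ::ₘ w ::ₘ s) (by simp; omega) hzw'
    refine eq_of_forall_dual fun ℓ => ?_
    rw [map_sub, map_smul, clm_eval hV hγ hθ r1, clm_eval hV hγ hθ r2, clm_eval hV hγ hθ r3,
      ← hb.map_sub (r1.clm ℓ) (r2.clm ℓ), smul_eq_mul, ← hb.smul _ _ (r3.clm ℓ)]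
    refine apply_congr hγ.lt.le fun j hj v hv => ?_
    have hvΓ : ∀ x ∈ s + Multiset.replicate j v, x ∈ Γ := by
      intro x hx
      rcases Multiset.mem_add.1 hx with hx | hx
      · exact hsΓ x hx
      · rwa [Multiset.eq_of_mem_replicate hx]
    simp only [Multiset.cons_add]
    rw [← map_sub, hΦ.sub_eq _ z w (by simp; omega) hvΓ hz hw, map_smul, smul_eq_mul]

/-- The resolvents of v = f(A)u are the same form applied to the shifted families of u: the
resolvent passes through the integral since `A` is sequentially closed. In particular v has order n
- k. -/
theorem opFam_eval (hV : ∀ x : ℕ → V, CauchySeq x → ∃ y, Tendsto x atTop (𝓝 y))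
    (hA : IsSeqClosed (A : Set (V × V)))
    (hγ : BiLipArc γ a b C₁ C₂) (hθ : ∀ j ≤ k, IntervalIntegrable (θ.density j) volume a b)
    (hΦ : OpFam n (γ '' Icc a b) A u Φ) (hmk : m + k ≤ n) :
    OpFam m (γ '' Icc a b) A (θ.eval γ a b k Φ) fun s => θ.eval γ a b k fun t => Φ (s + t) := by
  refine ⟨by simp, fun s z hs hsΓ hz => ?_, resFam_eval hV hγ hθ hΦ.resFam hmk⟩
  have hz' : ∀ x ∈ z ::ₘ s, x ∈ γ '' Icc a b := Multiset.forall_mem_cons.2 ⟨hz, hsΓ⟩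
  refine hasValue_resolventOp (hΦ.hasValue 0 z (by simp; omega) (by simp) hz)
    (eval_mem hV hγ hθ (hΦ.resFam.shift hz' (by simp; omega)) (hΦ.resFam.shift hsΓ (by omega))
      (isSeqClosed_resolventOp hA z) fun j hj w hw => ?_)
  rw [Multiset.cons_add]
  refine (hΦ.hasValue _ z (by simp; omega) (fun x hx => ?_) hz).1
  rcases Multiset.mem_add.1 hx with hx | hx
  · exact hsΓ x hx
  · rwa [Multiset.eq_of_mem_replicate hx]

theorem apply_eq_eval (hγ : BiLipArc γ a b C₁ C₂)
    (hθ : ∀ j ≤ n, IntervalIntegrable (θ.density j) volume a b) {φ : Multiset ℂ → ℂ}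
    (hφ : ResFam n (γ '' Icc a b) φ) : θ.apply γ a b n φ = θ.eval γ a b n φ :=
  (clm_eval (fun _ hx => cauchySeq_tendsto_of_complete hx) hγ hθ hφ
    (ContinuousLinearMap.id ℂ ℂ)).symm

theorem resFam_apply (hγ : BiLipArc γ a b C₁ C₂)
    (hθ : ∀ j ≤ k, IntervalIntegrable (θ.density j) volume a b) {φ : Multiset ℂ → ℂ}
    (hφ : ResFam n (γ '' Icc a b) φ) (hmk : m + k ≤ n) :
    ResFam m (γ '' Icc a b) fun s => θ.apply γ a b k fun t => φ (s + t) := by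
  have h := resFam_eval (fun _ hx => cauchySeq_tendsto_of_complete hx) hγ hθ hφ hmk
  have heq : ∀ s : Multiset ℂ, s.card ≤ m → (∀ x ∈ s, x ∈ γ '' Icc a b) →
      (θ.apply γ a b k fun t => φ (s + t)) = θ.eval γ a b k fun t => φ (s + t) :=
    fun s hs hsΓ => apply_eq_eval hγ hθ (hφ.shift hsΓ (by omega))
  refine ⟨fun m' hm' => (h.cont m' hm').congr fun z hz => heq _ (by simpa using hm') ?_,
    fun s z w hs hsΓ hz hw => ?_⟩
  · intro x hx
    obtain ⟨i, rfl⟩ := List.mem_ofFn.1 (Multiset.mem_coe.1 hx)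
    exact hz i
  · rw [heq _ (by simp; omega) (Multiset.forall_mem_cons.2 ⟨hz, hsΓ⟩),
      heq _ (by simp; omega) (Multiset.forall_mem_cons.2 ⟨hw, hsΓ⟩),
      heq _ (by simp; omega) (Multiset.forall_mem_cons.2
        ⟨hz, Multiset.forall_mem_cons.2 ⟨hw, hsΓ⟩⟩)]
    exact h.sub_eq s z w hs hsΓ hz hw

theorem Represents.of_eqOn (h : θ.Represents γ a b n f) {g : ℂ → ℂ}
    (hfg : ∀ z ∉ γ '' Icc a b, g z = f z) : θ.Represents γ a b n g :=
  ⟨h.integrable, fun z hz => (hfg z hz).trans (h.eq z hz)⟩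

/-- Two forms of the same function agree on all families of sufficiently high order. -/
theorem Represents.eval_eq (hV : ∀ x : ℕ → V, CauchySeq x → ∃ y, Tendsto x atTop (𝓝 y))
    (hγ : BiLipArc γ a b C₁ C₂) {θ₁ θ₂ : CurveForm} {n₁ n₂ : ℕ} (h₁ : θ₁.Represents γ a b n₁ f)
    (h₂ : θ₂.Represents γ a b n₂ f) (hΦ : ResFam n (γ '' Icc a b) Φ) (hn₁ : n₁ ≤ n)
    (hn₂ : n₂ ≤ n) : θ₁.eval γ a b n₁ Φ = θ₂.eval γ a b n₂ Φ := by
  refine eq_of_forall_dual fun ℓ => ?_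
  rw [clm_eval hV hγ h₁.integrable (hΦ.of_le hn₁), clm_eval hV hγ h₂.integrable (hΦ.of_le hn₂)]
  exact ((θ₁.isBddFunctional hγ h₁.integrable).of_le hn₁).eq_of_poleFam hγ
    ((θ₂.isBddFunctional hγ h₂.integrable).of_le hn₂)
    (fun z hz => (h₁.eq z hz).symm.trans (h₂.eq z hz)) (hΦ.clm ℓ)

theorem isBddFunctional_apply_apply (hγ : BiLipArc γ a b C₁ C₂) {θ₁ θ₂ : CurveForm} {n₁ n₂ : ℕ}
    (i₁ : ∀ j ≤ n₁, IntervalIntegrable (θ₁.density j) volume a b)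
    (i₂ : ∀ j ≤ n₂, IntervalIntegrable (θ₂.density j) volume a b) (hn : n₁ + n₂ ≤ n) :
    IsBddFunctional n (γ '' Icc a b) fun φ => θ₁.apply γ a b n₁ fun s =>
      θ₂.apply γ a b n₂ fun t => φ (s + t) := by
  set Γ := γ '' Icc a b with hΓ
  have b₁ := θ₁.isBddFunctional hγ i₁
  have b₂ := θ₂.isBddFunctional hγ i₂
  obtain ⟨K₁, hK₁⟩ := b₁.bound
  obtain ⟨K₂, hK₂⟩ := b₂.bound
  have hsh : ∀ φ : Multiset ℂ → ℂ, ResFam n Γ φ → ∀ s : Multiset ℂ, s.card ≤ n₁ →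
      (∀ x ∈ s, x ∈ Γ) → ResFam n₂ Γ fun t => φ (s + t) :=
    fun φ hφ s hs hsΓ => hφ.shift hsΓ (by omega)
  have hrep : ∀ j ≤ n₁, ∀ w ∈ Γ, (Multiset.replicate j w).card ≤ n₁ ∧
      ∀ x ∈ Multiset.replicate j w, x ∈ Γ := fun j hj w hw =>
    ⟨by simpa using hj, fun x hx => by rwa [Multiset.eq_of_mem_replicate hx]⟩
  refine ⟨fun φ ψ hφ hψ => ?_, fun e φ hφ => ?_, K₁ * K₂, fun φ hφ δ hδ => ?_⟩
  · rw [← b₁.add _ _ (resFam_apply hγ i₂ hφ hn)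
      (resFam_apply hγ i₂ hψ hn)]
    refine apply_congr hγ.lt.le fun j hj w hw => ?_
    obtain ⟨h1, h2⟩ := hrep j hj w hw
    exact b₂.add _ _ (hsh φ hφ _ h1 h2) (hsh ψ hψ _ h1 h2)
  · rw [← b₁.smul _ _ (resFam_apply hγ i₂ hφ hn)]
    refine apply_congr hγ.lt.le fun j hj w hw => ?_
    obtain ⟨h1, h2⟩ := hrep j hj w hw
    exact b₂.smul _ _ (hsh φ hφ _ h1 h2)
  · rw [mul_assoc]
    refine hK₁ _ (resFam_apply hγ i₂ hφ hn) _ fun s hs hsΓ => ?_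
    refine hK₂ _ (hsh φ hφ s hs hsΓ) δ fun t ht htΓ => hδ _ (by simp; omega) fun x hx => ?_
    rcases Multiset.mem_add.1 hx with hx | hx
    exacts [hsΓ x hx, htΓ x hx]

/-- The multiplicativity of the calculus. -/
theorem Represents.eval_eval (hV : ∀ x : ℕ → V, CauchySeq x → ∃ y, Tendsto x atTop (𝓝 y))
    (hγ : BiLipArc γ a b C₁ C₂) {θ₁ θ₂ θ₃ : CurveForm} {n₁ n₂ n₃ : ℕ} {f₁ f₂ : ℂ → ℂ}
    (h₁ : θ₁.Represents γ a b n₁ f₁) (h₂ : θ₂.Represents γ a b n₂ f₂)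
    (h₃ : θ₃.Represents γ a b n₃ f) (hf : ∀ z ∉ γ '' Icc a b, f z = f₁ z * f₂ z)
    (hΦ : ResFam n (γ '' Icc a b) Φ) (hn : n₁ + n₂ ≤ n) (hn₃ : n₃ ≤ n) :
    θ₁.eval γ a b n₁ (fun s => θ₂.eval γ a b n₂ fun t => Φ (s + t)) = θ₃.eval γ a b n₃ Φ := by
  set Γ := γ '' Icc a b with hΓ
  have b₁ := θ₁.isBddFunctional hγ h₁.integrable
  have b₂ := θ₂.isBddFunctional hγ h₂.integrable
  have b₃ := (θ₃.isBddFunctional hγ h₃.integrable).of_le hn₃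
  have hb := isBddFunctional_apply_apply hγ h₁.integrable h₂.integrable hn
  refine eq_of_forall_dual fun ℓ => ?_
  rw [clm_eval hV hγ h₁.integrable (resFam_eval hV hγ h₂.integrable hΦ hn),
    clm_eval hV hγ h₃.integrable (hΦ.of_le hn₃)]
  have h4 : (θ₁.apply γ a b n₁ fun s => ℓ (θ₂.eval γ a b n₂ fun t => Φ (s + t))) =
      θ₁.apply γ a b n₁ fun s => θ₂.apply γ a b n₂ fun t => ℓ (Φ (s + t)) := by
    refine apply_congr hγ.lt.le fun j hj w hw => ?_
    refine clm_eval hV hγ h₂.integrable (hΦ.shift (fun x hx => ?_) (by simp; omega)) ℓ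
    rwa [Multiset.eq_of_mem_replicate hx]
  rw [h4]
  -- On a pole family the arguments separate, so the nested evaluation is f₁(z)f₂(z); density
  -- extends the identity to all families.
  have h5 : ∀ z ∉ Γ, (θ₁.apply γ a b n₁ fun s => θ₂.apply γ a b n₂ fun t => poleFam z (s + t)) =
      θ₃.apply γ a b n₃ (poleFam z) := by
    intro z hz
    have h6 : ∀ s, (θ₂.apply γ a b n₂ fun t => poleFam z (s + t)) = f₂ z * poleFam z s := by
      intro s
      simp only [poleFam_add]
      have h7 := b₂.smul (poleFam z s) (poleFam z) (ResFam.poleFam n₂ hz)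
      rw [h7, ← h₂.eq z hz, mul_comm]
    have h8 := b₁.smul (f₂ z) (poleFam z) (ResFam.poleFam n₁ hz)
    simp only [h6]
    rw [h8, ← h₁.eq z hz, ← h₃.eq z hz, hf z hz, mul_comm]
  have h9 := hb.eq_of_poleFam hγ b₃ h5 (hΦ.clm ℓ)
  beta_reduce at h9
  rw [h9]

end CurveForm

end ResolventCalculus

namespace ResolventCalculus

/-! ### Logarithms along a curve -/

/-- Near w the continuous logarithm is the principal logarithm of r/r(w) plus the constant Λ(w), the
imaginary part having varied by less than π. -/
theorem hasDerivWithinAt_of_exp_eq {Λ r : ℂ → ℂ} {r' w : ℂ} {S : Set ℂ}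
    (hc : ContinuousWithinAt Λ S w) (hw : w ∈ S) (hexp : ∀ᶠ x in 𝓝[S] w, Complex.exp (Λ x) = r x)
    (hr : HasDerivWithinAt r r' S w) : HasDerivWithinAt Λ (r' / r w) S w := by
  have hw' : Complex.exp (Λ w) = r w := hexp.self_of_nhdsWithin hw
  have hr0 : r w ≠ 0 := by rw [← hw']; exact Complex.exp_ne_zero _
  have h1 : HasDerivWithinAt (fun x => Complex.log (r x / r w) + Λ w) (r' / r w) S w := by
    have h2 := (hr.div_const (r w)).clog (by rw [div_self hr0]; exact Complex.one_mem_slitPlane)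
    rw [div_self hr0, div_one] at h2
    exact h2.add_const _
  refine h1.congr_of_eventuallyEq ?_ (by simp [div_self hr0])
  have h3 : ∀ᶠ x in 𝓝[S] w, ‖Λ x - Λ w‖ < 1 := by
    have := hc.sub (continuousWithinAt_const (b := Λ w))
    have h4 : Tendsto (fun x => ‖Λ x - Λ w‖) (𝓝[S] w) (𝓝 ‖Λ w - Λ w‖) := this.norm
    rw [sub_self, norm_zero] at h4
    exact h4.eventually (gt_mem_nhds one_pos)
  filter_upwards [hexp, h3] with x hx hx'
  have h5 : |(Λ x - Λ w).im| < 1 := (Complex.abs_im_le_norm _).trans_lt hx'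
  rw [← hx, ← hw', ← Complex.exp_sub, Complex.log_exp, sub_add_cancel]
  · linarith [(abs_lt.1 h5).1, Real.pi_gt_three]
  · linarith [(abs_lt.1 h5).2, Real.pi_gt_three]

namespace BiLipArc

variable {γ : ℝ → ℂ} {a b C₁ C₂ : ℝ}

theorem subarc (h : BiLipArc γ a b C₁ C₂) {s t : ℝ} (hs : s ∈ Icc a b) (ht : t ∈ Icc a b)
    (hst : s < t) : BiLipArc γ s t C₁ C₂ :=
  ⟨hst, h.pos₁, h.pos₂, fun x hx y hy => h.lower x ⟨hs.1.trans hx.1, hx.2.trans ht.2⟩ y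
    ⟨hs.1.trans hy.1, hy.2.trans ht.2⟩, h.upper⟩

theorem left_mem (h : BiLipArc γ a b C₁ C₂) : γ a ∈ γ '' Icc a b :=
  mem_image_of_mem γ (left_mem_Icc.2 h.lt.le)

theorem right_mem (h : BiLipArc γ a b C₁ C₂) : γ b ∈ γ '' Icc a b :=
  mem_image_of_mem γ (right_mem_Icc.2 h.lt.le)

theorem left_ne_right (h : BiLipArc γ a b C₁ C₂) : γ a ≠ γ b := fun h' =>
  h.lt.ne (h.injOn (left_mem_Icc.2 h.lt.le) (right_mem_Icc.2 h.lt.le) h')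

theorem norm_deriv_le (h : BiLipArc γ a b C₁ C₂) (t : ℝ) : ‖deriv γ t‖ ≤ C₂ := by
  have := norm_deriv_le_of_lipschitz (x₀ := t) h.lipschitz
  rwa [Real.coe_toNNReal _ h.pos₂.le] at this

theorem measurable_deriv (h : BiLipArc γ a b C₁ C₂) : Measurable (deriv γ) :=
  _root_.measurable_deriv γ

theorem intervalIntegrable_mul_deriv (h : BiLipArc γ a b C₁ C₂) {k : ℝ → ℂ} {s t : ℝ}
    (hk : IntervalIntegrable k volume s t) :
    IntervalIntegrable (fun x => k x * deriv γ x) volume s t :=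
  ⟨hk.1.mul_bdd h.measurable_deriv.aestronglyMeasurable
      (Eventually.of_forall h.norm_deriv_le),
    hk.2.mul_bdd h.measurable_deriv.aestronglyMeasurable
      (Eventually.of_forall h.norm_deriv_le)⟩

theorem intervalIntegrable_deriv (h : BiLipArc γ a b C₁ C₂) (s t : ℝ) :
    IntervalIntegrable (deriv γ) volume s t := by
  simpa using h.intervalIntegrable_mul_deriv (k := fun _ => 1) (s := s) (t := t)
    intervalIntegrable_const

theorem continuousOn_inv_sub_pow (h : BiLipArc γ a b C₁ C₂) {z : ℂ} (hz : z ∉ γ '' Icc a b)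
    (j : ℕ) : ContinuousOn (fun t => ((γ t - z) ^ j)⁻¹) (Icc a b) := by
  refine ContinuousOn.inv₀ ((h.continuous.continuousOn.sub continuousOn_const).pow j) ?_
  exact fun t ht => pow_ne_zero j (sub_ne_zero.2 fun h0 => hz ⟨t, ht, h0⟩)

theorem sub_ne_zero_of_notMem {z : ℂ} (hz : z ∉ γ '' Icc a b) {w : ℂ} (hw : w ∈ γ '' Icc a b) :
    w - z ≠ 0 := sub_ne_zero.2 fun h0 => hz (h0 ▸ hw)

/-- The derivative of a Cauchy integral along the curve. -/
theorem hasDerivAt_cauchy (h : BiLipArc γ a b C₁ C₂) {k : ℝ → ℂ}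
    (hk : IntervalIntegrable k volume a b) {z : ℂ} (hz : z ∉ γ '' Icc a b) :
    HasDerivAt (fun z => ∫ t in a..b, k t * (γ t - z)⁻¹)
      (∫ t in a..b, k t * ((γ t - z) ^ 2)⁻¹) z := by
  obtain ⟨δ, hδ, hδz⟩ := Metric.isOpen_iff.1 h.isCompact.isClosed.isOpen_compl z hz
  have hIoc : uIoc a b = Ioc a b := uIoc_of_le h.lt.le
  have hdist : ∀ x ∈ Metric.ball z (δ / 2), ∀ t ∈ Ioc a b, δ / 2 ≤ ‖γ t - x‖ := by
    intro x hx t ht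
    by_contra hc
    push Not at hc
    refine hδz (a := γ t) ?_ (mem_image_of_mem γ (Ioc_subset_Icc_self ht))
    rw [mem_ball_iff_norm] at hx ⊢
    calc ‖γ t - z‖ = ‖(γ t - x) + (x - z)‖ := by ring_nf
      _ ≤ ‖γ t - x‖ + ‖x - z‖ := norm_add_le _ _
      _ < δ := by linarith
  have hm : ∀ x (j : ℕ), AEStronglyMeasurable (fun t => k t * ((γ t - x) ^ j)⁻¹)
      (volume.restrict (uIoc a b)) := fun x j => by
    rw [hIoc]
    exact hk.1.aestronglyMeasurable.mul
      (((h.continuous.measurable.sub_const x).pow_const j).inv).aestronglyMeasurable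
  have hi := hk.mul_continuousOn (g := fun t => ((γ t - z) ^ 1)⁻¹) (by
    rw [uIcc_of_le h.lt.le]
    exact h.continuousOn_inv_sub_pow hz 1)
  refine (intervalIntegral.hasDerivAt_integral_of_dominated_loc_of_deriv_le
    (F := fun z t => k t * (γ t - z)⁻¹) (F' := fun z t => k t * ((γ t - z) ^ 2)⁻¹)
    (bound := fun t => ‖k t‖ * ((δ / 2) ^ 2)⁻¹) (Metric.ball_mem_nhds z (half_pos hδ))
    (Eventually.of_forall fun x => by simpa using hm x 1) (by simpa using hi) (hm z 2) ?_
    (hk.norm.mul_const _) ?_).2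
  · refine Eventually.of_forall fun t ht x hx => ?_
    rw [hIoc] at ht
    rw [norm_mul, norm_inv, norm_pow]
    have := hdist x hx t ht
    gcongr
  · refine Eventually.of_forall fun t ht x hx => ?_
    rw [hIoc] at ht
    have h1 : γ t - x ≠ 0 := norm_pos_iff.1 ((half_pos hδ).trans_le (hdist x hx t ht))
    have h2 := ((hasDerivAt_id x).const_sub (γ t)).inv h1
    refine (h2.const_mul (k t)).congr_deriv ?_
    simp

theorem tendsto_cauchy (h : BiLipArc γ a b C₁ C₂) {k : ℝ → ℂ}
    (hk : IntervalIntegrable k volume a b) :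
    Tendsto (fun z => ∫ t in a..b, k t * (γ t - z)⁻¹) (Bornology.cobounded ℂ) (𝓝 0) := by
  obtain ⟨R, hR⟩ := h.isCompact.isBounded.exists_norm_le
  have h1 : Tendsto (fun z : ℂ => (∫ t in a..b, ‖k t‖) * (‖z‖ - R)⁻¹) (Bornology.cobounded ℂ)
      (𝓝 0) := by
    have h2 : Tendsto (fun z : ℂ => ‖z‖ - R) (Bornology.cobounded ℂ) atTop :=
      tendsto_atTop_add_const_right _ _ tendsto_norm_cobounded_atTop
    simpa using h2.inv_tendsto_atTop.const_mul (∫ t in a..b, ‖k t‖)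
  refine squeeze_zero_norm' ?_ h1
  filter_upwards [tendsto_norm_cobounded_atTop.eventually_gt_atTop R] with z hz
  rw [← intervalIntegral.integral_mul_const]
  refine intervalIntegral.norm_integral_le_of_norm_le h.lt.le ?_ (hk.norm.mul_const _)
  refine Eventually.of_forall fun t ht => ?_
  rw [norm_mul, norm_inv]
  have h3 := hR _ (mem_image_of_mem γ (Ioc_subset_Icc_self ht))
  have h4 : ‖z‖ - R ≤ ‖γ t - z‖ := by
    have := norm_sub_norm_le z (γ t)
    rw [norm_sub_rev] at this
    linarith
  have h5 : 0 < ‖z‖ - R := sub_pos.2 hz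
  gcongr

theorem curveLog_eq (γ : ℝ → ℂ) (a b : ℝ) (z : ℂ) :
    curveLog γ a b z = ∫ t in a..b, deriv γ t * (γ t - z)⁻¹ := by
  simp only [curveLog, div_eq_mul_inv]

/-- A continuous logarithm of w - z on Γ is a primitive of (w-z)⁻¹ along the arc, so curveLog is its
increment. -/
theorem exp_curveLog (h : BiLipArc γ a b C₁ C₂) {z : ℂ} (hz : z ∉ γ '' Icc a b) :
    Complex.exp (curveLog γ a b z) = (γ b - z) / (γ a - z) := by
  obtain ⟨g, hg, hexp⟩ := h.exists_continuous_log hz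
  have hd : ∀ w ∈ γ '' Icc a b, HasDerivWithinAt g ((w - z)⁻¹) (γ '' Icc a b) w := fun w hw => by
    have h2 : HasDerivWithinAt (fun x : ℂ => x - z) 1 (γ '' Icc a b) w :=
      ((hasDerivAt_id w).sub_const z).hasDerivWithinAt
    have h3 := hasDerivWithinAt_of_exp_eq (r := fun x => x - z) hg.continuousWithinAt hw
      (eventually_mem_nhdsWithin.mono fun x hx => hexp x hx) h2
    rwa [one_div] at h3
  have h1 := (h.integral_comp_mul_deriv hd (ContinuousOn.inv₀ (by fun_prop)
    fun w hw => sub_ne_zero_of_notMem hz hw) (left_mem_Icc.2 h.lt.le) (right_mem_Icc.2 h.lt.le)).2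
  rw [curveLog_eq]
  simp only [mul_comm (deriv γ _)]
  rw [h1, Complex.exp_sub, hexp _ h.right_mem, hexp _ h.left_mem]

theorem hasDerivAt_curveLog (h : BiLipArc γ a b C₁ C₂) {z : ℂ} (hz : z ∉ γ '' Icc a b) :
    HasDerivAt (curveLog γ a b) ((γ b - γ a) / ((γ a - z) * (γ b - z))) z := by
  have h1 := h.hasDerivAt_cauchy (h.intervalIntegrable_deriv a b) hz
  have hd : ∀ w ∈ γ '' Icc a b, HasDerivWithinAt (fun w => -(w - z)⁻¹) (((w - z) ^ 2)⁻¹)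
      (γ '' Icc a b) w := fun w hw => by
    have h2 := (((hasDerivAt_id w).sub_const z).inv (sub_ne_zero_of_notMem hz hw)).neg
    refine (h2.congr_deriv ?_).hasDerivWithinAt
    simp [neg_div]
  have h3 := (h.integral_comp_mul_deriv hd (ContinuousOn.inv₀ (by fun_prop)
    fun w hw => pow_ne_zero 2 (sub_ne_zero_of_notMem hz hw)) (left_mem_Icc.2 h.lt.le)
    (right_mem_Icc.2 h.lt.le)).2
  have h4 : (fun z => ∫ t in a..b, deriv γ t * (γ t - z)⁻¹) = curveLog γ a b :=
    funext fun z => (curveLog_eq γ a b z).symm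
  rw [h4] at h1
  refine h1.congr_deriv ?_
  simp only [mul_comm (deriv γ _)]
  rw [h3]
  have := sub_ne_zero_of_notMem hz h.left_mem
  have := sub_ne_zero_of_notMem hz h.right_mem
  field_simp
  ring

theorem tendsto_curveLog (h : BiLipArc γ a b C₁ C₂) :
    Tendsto (curveLog γ a b) (Bornology.cobounded ℂ) (𝓝 0) :=
  (h.tendsto_cauchy (h.intervalIntegrable_deriv a b)).congr fun z => (curveLog_eq γ a b z).symm

/-- Integration along the open arc, for a primitive with limits at the endpoints. -/
theorem integral_Ioo_comp_mul_deriv (h : BiLipArc γ a b C₁ C₂) {F F' : ℂ → ℂ} {A B : ℂ}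
    (hF : ∀ t ∈ Ioo a b, HasDerivWithinAt F (F' (γ t)) (γ '' Icc a b) (γ t))
    (hF' : ContinuousOn F' (γ '' Ioo a b))
    (hi : IntervalIntegrable (fun t => F' (γ t) * deriv γ t) volume a b)
    (ha : Tendsto (fun t => F (γ t)) (𝓝[>] a) (𝓝 A))
    (hb : Tendsto (fun t => F (γ t)) (𝓝[<] b) (𝓝 B)) :
    ∫ t in a..b, F' (γ t) * deriv γ t = B - A := by
  have hab := h.lt
  set c := (a + b) / 2 with hc
  have hcm : c ∈ Ioo a b := ⟨by linarith, by linarith⟩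
  have key : ∀ t ∈ Ioo a b, ∫ x in c..t, F' (γ x) * deriv γ x = F (γ t) - F (γ c) := by
    intro t ht
    have hlo : a < min c t := lt_min hcm.1 ht.1
    have hhi : max c t < b := max_lt hcm.2 ht.2
    have h1 := min_le_left c t
    have h2 := min_le_right c t
    have h3 := le_max_left c t
    have h4 := le_max_right c t
    have hsub : Icc ((a + min c t) / 2) ((b + max c t) / 2) ⊆ Ioo a b := fun x hx =>
      ⟨by linarith [hx.1], by linarith [hx.2]⟩
    have hs := h.subarc (s := (a + min c t) / 2) (t := (b + max c t) / 2)
      ⟨by linarith, by linarith⟩ ⟨by linarith, by linarith⟩ (by linarith)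
    refine (hs.integral_comp_mul_deriv (F := F) (F' := F') ?_ (hF'.mono (image_mono hsub))
      ⟨by linarith, by linarith⟩ ⟨by linarith, by linarith⟩).2
    rintro _ ⟨x, hx, rfl⟩
    exact (hF x (hsub hx)).mono (image_mono (hsub.trans Ioo_subset_Icc_self))
  have hcont := intervalIntegral.continuousOn_primitive_interval' hi (a := c)
    (by rw [uIcc_of_le hab.le]; exact Ioo_subset_Icc_self hcm)
  rw [uIcc_of_le hab.le] at hcont
  have hB : ∫ x in c..b, F' (γ x) * deriv γ x = B - F (γ c) := by
    have h1 := (hcont b (right_mem_Icc.2 hab.le)).mono_left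
      (nhdsWithin_mono b (Ioo_subset_Icc_self (a := a) (b := b)))
    rw [nhdsWithin_Ioo_eq_nhdsLT hab] at h1
    refine tendsto_nhds_unique h1 ((hb.sub_const _).congr' ?_)
    filter_upwards [Ioo_mem_nhdsLT hab] with t ht using (key t ht).symm
  have hA : ∫ x in c..a, F' (γ x) * deriv γ x = A - F (γ c) := by
    have h1 := (hcont a (left_mem_Icc.2 hab.le)).mono_left
      (nhdsWithin_mono a (Ioo_subset_Icc_self (a := a) (b := b)))
    rw [nhdsWithin_Ioo_eq_nhdsGT hab] at h1
    refine tendsto_nhds_unique h1 ((ha.sub_const _).congr' ?_)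
    filter_upwards [Ioo_mem_nhdsGT hab] with t ht using (key t ht).symm
  have hic : ∀ x ∈ Icc a b, IntervalIntegrable (fun t => F' (γ t) * deriv γ t) volume c x :=
    fun x hx => hi.mono_set (by
      rw [uIcc_of_le hab.le]
      exact uIcc_subset_Icc (Ioo_subset_Icc_self hcm) hx)
  rw [← intervalIntegral.integral_interval_sub_left (hic b (right_mem_Icc.2 hab.le))
    (hic a (left_mem_Icc.2 hab.le)), hB, hA]
  ring

end BiLipArc

end ResolventCalculus

namespace ResolventCalculus

/-! ### The logarithm on the arc -/

/-- If the imaginary part moved by π or more, the intermediate value theorem would give two points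
with imaginary parts exactly π apart, which is not a multiple of 2π. -/
theorem abs_im_sub_lt_pi_of_exp_eq {S : Set ℝ} (hS : IsPreconnected S) {f : ℝ → ℂ}
    (hf : ContinuousOn f S) {c : ℂ} (hc : ∀ x ∈ S, Complex.exp (f x) = c) {x y : ℝ} (hx : x ∈ S)
    (hy : y ∈ S) : |(f x).im - (f y).im| < Real.pi := by
  have key : ∀ x ∈ S, ∀ y ∈ S, (f y).im + Real.pi ≤ (f x).im → False := by
    intro x hx y hy hxy
    obtain ⟨z, hz, hzy⟩ := hS.intermediate_value hy hx
      (Complex.continuous_im.comp_continuousOn hf)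
      (show (f y).im + Real.pi ∈ Icc (f y).im (f x).im from ⟨by linarith [Real.pi_pos], hxy⟩)
    obtain ⟨n, hn⟩ := Complex.exp_eq_exp_iff_exists_int.1 ((hc z hz).trans (hc y hy).symm)
    have h1 := congrArg Complex.im hn
    simp only [Function.comp_apply] at hzy
    rw [hzy] at h1
    have h2 : Real.pi = n * (2 * Real.pi) := by
      have h3 : ((n : ℂ) * (2 * Real.pi * Complex.I)).im = n * (2 * Real.pi) := by
        simp [Complex.mul_im]
      rw [Complex.add_im, h3] at h1
      linarith
    have h3 : (1 : ℝ) = ((n * 2 : ℤ) : ℝ) := by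
      push_cast
      have := Real.pi_pos.ne'
      apply mul_right_cancel₀ this
      linarith
    have h4 : (1 : ℤ) = n * 2 := by exact_mod_cast h3
    omega
  rw [abs_lt]
  constructor
  · by_contra hcon
    exact key y hy x hx (by linarith)
  · by_contra hcon
    exact key x hx y hy (by linarith)

/-- `Γ` is the graph of a Lipschitz function near `w₀`, in rotated coordinates. -/
def LipGraphAt (Γ : Set ℂ) (w₀ : ℂ) : Prop :=
  ∃ (ξ : ℂ) (K : NNReal) (φ : ℝ → ℝ) (U : Set ℂ), ‖ξ‖ = 1 ∧ LipschitzWith K φ ∧ U ∈ 𝓝 w₀ ∧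
    ∀ w ∈ Γ ∩ U, (w * ξ).im = φ (w * ξ).re

namespace BiLipArc

variable {γ : ℝ → ℂ} {a b C₁ C₂ : ℝ}

theorem reverse (h : BiLipArc γ a b C₁ C₂) : BiLipArc (fun t => γ (a + b - t)) a b C₁ C₂ := by
  refine ⟨h.lt, h.pos₁, h.pos₂, fun s hs t ht => ?_, fun s t => ?_⟩
  · have := h.lower (a + b - s) ⟨by linarith [hs.2], by linarith [hs.1]⟩ (a + b - t)
      ⟨by linarith [ht.2], by linarith [ht.1]⟩
    rwa [show a + b - t - (a + b - s) = -(t - s) by ring, abs_neg] at this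
  · have := h.upper (a + b - s) (a + b - t)
    rwa [show a + b - t - (a + b - s) = -(t - s) by ring, abs_neg] at this

theorem image_reverse (γ : ℝ → ℂ) (a b : ℝ) :
    (fun t => γ (a + b - t)) '' Icc a b = γ '' Icc a b := by
  rw [show (fun t => γ (a + b - t)) = γ ∘ fun t => a + b - t from rfl, image_comp]
  congr 1
  rw [image_const_sub_Icc]
  congr 1 <;> ring

theorem sub_left_ne_zero (h : BiLipArc γ a b C₁ C₂) {t : ℝ} (ht : t ∈ Ioc a b) :
    γ t - γ a ≠ 0 := sub_ne_zero.2 fun h' =>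
  ht.1.ne' (h.injOn (Ioc_subset_Icc_self ht) (left_mem_Icc.2 h.lt.le) h')

theorem right_sub_ne_zero (h : BiLipArc γ a b C₁ C₂) {t : ℝ} (ht : t ∈ Ico a b) :
    γ b - γ t ≠ 0 := sub_ne_zero.2 fun h' =>
  ht.2.ne' (h.injOn (right_mem_Icc.2 h.lt.le) (Ico_subset_Icc_self ht) h')

/-- The graph condition excludes spiralling at the endpoint: in rotated coordinates the real part of
γ(t) - γ(a) does not vanish, so it keeps its sign, and after a rotation γ(t) - γ(a) stays in a
half-plane where the principal argument is bounded. -/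
theorem eventually_abs_im_le (h : BiLipArc γ a b C₁ C₂) (hg : LipGraphAt (γ '' Icc a b) (γ a))
    {lam : ℝ → ℂ} (hc : ContinuousOn lam (Ioo a b))
    (he : ∀ t ∈ Ioo a b, Complex.exp (lam t) = (γ b - γ t) / (γ t - γ a)) :
    ∃ B, ∀ᶠ t in 𝓝[>] a, |(lam t).im| ≤ B := by
  obtain ⟨ξ, K, φ, U, hξ, hφ, hU, hgr⟩ := hg
  have hξ0 : ξ ≠ 0 := fun h0 => by simp [h0] at hξ
  have hpq : γ b - γ a ≠ 0 := sub_ne_zero.2 h.left_ne_right.symm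
  have hcont : Tendsto γ (𝓝[>] a) (𝓝 (γ a)) := h.continuous.continuousAt.mono_left inf_le_left
  have h1 : ∀ᶠ t in 𝓝[>] a, γ t ∈ U := hcont.eventually hU
  have h2 : ∀ᶠ t in 𝓝[>] a, (γ b - γ t) / (γ b - γ a) ∈ Complex.slitPlane := by
    have h3 : Tendsto (fun t => (γ b - γ t) / (γ b - γ a)) (𝓝[>] a)
        (𝓝 ((γ b - γ a) / (γ b - γ a))) := (hcont.const_sub _).div_const _
    rw [div_self hpq] at h3
    exact h3.eventually (Complex.isOpen_slitPlane.mem_nhds Complex.one_mem_slitPlane)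
  obtain ⟨u, hu, hI⟩ := mem_nhdsGT_iff_exists_Ioo_subset.1
    ((h1.and h2).and (Ioo_mem_nhdsGT h.lt))
  have hpU : γ a ∈ U := mem_of_mem_nhds hU
  have hre : ∀ t ∈ Ioo a u, ((γ t - γ a) * ξ).re ≠ 0 := by
    intro t ht h0
    obtain ⟨⟨htU, -⟩, htab⟩ := hI ht
    have e1 := hgr (γ t) ⟨mem_image_of_mem γ (Ioo_subset_Icc_self htab), htU⟩
    have e2 := hgr (γ a) ⟨h.left_mem, hpU⟩
    rw [sub_mul, Complex.sub_re, sub_eq_zero] at h0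
    rw [h0, ← e2] at e1
    have e3 : γ t * ξ = γ a * ξ := Complex.ext h0 e1
    exact h.sub_left_ne_zero (Ioo_subset_Ioc_self htab)
      (sub_eq_zero.2 (mul_right_cancel₀ hξ0 e3))
  set t₁ := (a + u) / 2 with ht₁
  have hau : a < u := hu
  have ht₁m : t₁ ∈ Ioo a u := ⟨by linarith, by linarith⟩
  set r := ((γ t₁ - γ a) * ξ).re with hr
  have hr0 : r ≠ 0 := hre t₁ ht₁m
  have hpos : ∀ t ∈ Ioo a u, 0 < ((γ t - γ a) * (ξ * r)).re := by
    have hval : ∀ t, ((γ t - γ a) * (ξ * r)).re = ((γ t - γ a) * ξ).re * r := fun t => by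
      rw [← mul_assoc, Complex.re_mul_ofReal]
    intro t ht
    by_contra hcon
    push Not at hcon
    have hcts : Continuous fun t => ((γ t - γ a) * (ξ * r)).re :=
      Complex.continuous_re.comp ((h.continuous.sub continuous_const).mul continuous_const)
    obtain ⟨s, hs, hs0⟩ := isPreconnected_Ioo.intermediate_value ht ht₁m hcts.continuousOn
      (show (0 : ℝ) ∈ Icc _ _ from ⟨hcon, by
        simp only [hval]
        exact (mul_self_pos.2 hr0).le⟩)
    simp only [hval] at hs0
    exact (mul_ne_zero (hre s hs) hr0) hs0
  -- The function D is lam corrected by principal logarithms so that exp(D) is constant; its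
  -- imaginary part then varies by less than π, and each correction is bounded by π.
  set η : ℂ := ξ * r with hη
  have hη0 : η ≠ 0 := mul_ne_zero hξ0 (by exact_mod_cast hr0)
  set D : ℝ → ℂ := fun t => lam t + Complex.log ((γ t - γ a) * η) -
    Complex.log ((γ b - γ t) / (γ b - γ a)) with hD
  have hDc : ContinuousOn D (Ioo a u) := by
    refine ((hc.mono fun t ht => (hI ht).2).add (ContinuousOn.clog ?_ fun t ht =>
      Or.inl (hpos t ht))).sub (ContinuousOn.clog ?_ fun t ht => (hI ht).1.2)
    · exact ((h.continuous.sub continuous_const).mul continuous_const).continuousOn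
    · exact ((continuous_const.sub h.continuous).div_const _).continuousOn
  have hDe : ∀ t ∈ Ioo a u, Complex.exp (D t) = η * (γ b - γ a) := by
    intro t ht
    have htab := (hI ht).2
    have e1 := h.sub_left_ne_zero (Ioo_subset_Ioc_self htab)
    have e2 := h.right_sub_ne_zero (Ioo_subset_Ico_self htab)
    rw [hD]
    simp only
    rw [Complex.exp_sub, Complex.exp_add, he t htab, Complex.exp_log (mul_ne_zero e1 hη0),
      Complex.exp_log (div_ne_zero e2 hpq)]
    field_simp
  refine ⟨|(D t₁).im| + Real.pi + Real.pi + Real.pi, ?_⟩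
  filter_upwards [Ioo_mem_nhdsGT hau] with t ht
  have e1 := abs_im_sub_lt_pi_of_exp_eq isPreconnected_Ioo hDc hDe ht ht₁m
  have e2 : (lam t).im = (D t).im - (Complex.log ((γ t - γ a) * η)).im +
      (Complex.log ((γ b - γ t) / (γ b - γ a))).im := by
    simp only [hD, Complex.add_im, Complex.sub_im]
    ring
  rw [e2, Complex.log_im, Complex.log_im]
  have e3 := Complex.abs_arg_le_pi ((γ t - γ a) * η)
  have e4 := Complex.abs_arg_le_pi ((γ b - γ t) / (γ b - γ a))
  rw [abs_le] at e3 e4 ⊢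
  rw [abs_lt] at e1
  have e5 := le_abs_self (D t₁).im
  have e6 := neg_abs_le (D t₁).im
  constructor <;> linarith

end BiLipArc

/-- `lam` is a logarithm of `(γ(b) - γ) / (γ - γ(a))` on the open arc, with logarithmic growth and
bounded imaginary part. -/
structure ArcLog (γ : ℝ → ℂ) (a b K : ℝ) (lam : ℝ → ℂ) : Prop where
  cont : ContinuousOn lam (Ioo a b)
  exp_eq : ∀ t ∈ Ioo a b, Complex.exp (lam t) = (γ b - γ t) / (γ t - γ a)
  norm_le : ∀ t ∈ Ioo a b, ‖lam t‖ ≤ K - Real.log (t - a) - Real.log (b - t)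
  im_le : ∀ t ∈ Ioo a b, |(lam t).im| ≤ K

namespace BiLipArc

variable {γ : ℝ → ℂ} {a b C₁ C₂ : ℝ}

theorem exists_abs_log_norm_le (h : BiLipArc γ a b C₁ C₂) : ∃ K, ∀ s ∈ Icc a b, ∀ t ∈ Icc a b,
    s < t → |Real.log ‖γ t - γ s‖| ≤ K - Real.log (t - s) ∧ Real.log (t - s) ≤ K := by
  have h1 := h.pos₁
  have h2 := h.pos₂
  refine ⟨|Real.log C₁| + |Real.log C₂| + 2 * |Real.log (b - a)|, fun s hs t ht hst => ?_⟩
  have hts : 0 < t - s := sub_pos.2 hst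
  have hlo := h.lower s hs t ht
  have hhi := h.upper s t
  rw [abs_of_pos hts] at hlo hhi
  have e1 := Real.log_le_log (mul_pos h1 hts) hlo
  have e2 := Real.log_le_log ((mul_pos h1 hts).trans_le hlo) hhi
  rw [Real.log_mul h1.ne' hts.ne'] at e1
  rw [Real.log_mul h2.ne' hts.ne'] at e2
  have e3 : Real.log (t - s) ≤ |Real.log (b - a)| :=
    (Real.log_le_log hts (by linarith [hs.1, ht.2])).trans (le_abs_self _)
  have e4 := le_abs_self (Real.log C₂)
  have e5 := neg_abs_le (Real.log C₁)
  have e6 := abs_nonneg (Real.log C₁)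
  have e7 := abs_nonneg (Real.log C₂)
  have e8 := abs_nonneg (Real.log (b - a))
  refine ⟨abs_le.2 ⟨?_, ?_⟩, ?_⟩ <;> linarith

/-- A continuous logarithm exists on the open interval. Its imaginary part is bounded near a by the
graph condition, near b by reversal of the arc (which replaces the quotient by its inverse), and in
between by compactness. The real part grows logarithmically by the bi-Lipschitz bounds. -/
theorem exists_arcLog (h : BiLipArc γ a b C₁ C₂) (hga : LipGraphAt (γ '' Icc a b) (γ a))
    (hgb : LipGraphAt (γ '' Icc a b) (γ b)) : ∃ K lam, ArcLog γ a b K lam := by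
  have hab := h.lt
  have hne1 : ∀ t ∈ Ioo a b, γ t - γ a ≠ 0 := fun t ht =>
    h.sub_left_ne_zero (Ioo_subset_Ioc_self ht)
  have hne2 : ∀ t ∈ Ioo a b, γ b - γ t ≠ 0 := fun t ht =>
    h.right_sub_ne_zero (Ioo_subset_Ico_self ht)
  have hsc : IsSimplyConnected (Ioo a b) := by
    have : ContractibleSpace (Ioo a b) := (convex_Ioo a b).contractibleSpace (nonempty_Ioo.2 hab)
    exact SimplyConnectedSpace.ofContractible (Ioo a b)
  obtain ⟨lam, hc, he⟩ := Complex.exists_continuousOn_eqOn_exp_comp hsc isOpen_Ioo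
    (g := fun t => (γ b - γ t) / (γ t - γ a))
    (ContinuousOn.div (continuous_const.sub h.continuous).continuousOn
      (h.continuous.sub continuous_const).continuousOn hne1) (by
      rintro ⟨t, ht, h0⟩
      exact div_ne_zero (hne2 t ht) (hne1 t ht) h0)
  have he' : ∀ t ∈ Ioo a b, Complex.exp (lam t) = (γ b - γ t) / (γ t - γ a) := fun t ht => he ht
  obtain ⟨B₁, hB₁⟩ := h.eventually_abs_im_le hga hc he'
  have hrev : Tendsto (fun t => a + b - t) (𝓝[<] b) (𝓝[>] a) := by
    refine tendsto_nhdsWithin_iff.2 ⟨?_, ?_⟩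
    · have : Tendsto (fun t : ℝ => a + b - t) (𝓝 b) (𝓝 (a + b - b)) :=
        (continuous_const.sub continuous_id).tendsto b
      rw [add_sub_cancel_right] at this
      exact this.mono_left inf_le_left
    · filter_upwards [self_mem_nhdsWithin] with t ht
      have : t < b := ht
      simp only [mem_Ioi]
      linarith
  obtain ⟨B₂, hB₂⟩ := h.reverse.eventually_abs_im_le (lam := fun t => -lam (a + b - t)) (by
      rw [image_reverse]
      simpa using hgb) (by
      refine (hc.comp (continuous_const.sub continuous_id).continuousOn fun t ht => ?_).neg
      exact show a + b - t ∈ Ioo a b from ⟨by linarith [ht.2], by linarith [ht.1]⟩) (by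
      intro t ht
      have hm : a + b - t ∈ Ioo a b := ⟨by linarith [ht.2], by linarith [ht.1]⟩
      rw [Complex.exp_neg, he' _ hm, inv_div, add_sub_cancel_right, add_sub_cancel_left,
        ← neg_sub (γ a) (γ (a + b - t)), ← neg_sub (γ (a + b - t)) (γ b), neg_div_neg_eq])
  have hB₂' := hrev.eventually hB₂
  obtain ⟨u, hu, hIu⟩ := mem_nhdsGT_iff_exists_Ioo_subset.1 (hB₁.and (Ioo_mem_nhdsGT hab))
  obtain ⟨v, hv, hIv⟩ := mem_nhdsLT_iff_exists_Ioo_subset.1 (hB₂'.and (Ioo_mem_nhdsLT hab))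
  have hu' : a < u := hu
  have hv' : v < b := hv
  have hsub : Icc ((a + u) / 2) ((v + b) / 2) ⊆ Ioo a b := fun t ht =>
    ⟨by linarith [ht.1], by linarith [ht.2]⟩
  obtain ⟨B₃, hB₃⟩ := isCompact_Icc.exists_bound_of_continuousOn (hc.mono hsub)
  have him : ∀ t ∈ Ioo a b, |(lam t).im| ≤ |B₁| + |B₂| + |B₃| := by
    intro t ht
    have e1 := abs_nonneg B₁
    have e2 := abs_nonneg B₂
    have e3 := abs_nonneg B₃
    rcases lt_or_ge t ((a + u) / 2) with h1 | h1
    · have := (hIu (show t ∈ Ioo a u from ⟨ht.1, by linarith⟩)).1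
      linarith [le_abs_self B₁]
    rcases lt_or_ge ((v + b) / 2) t with h2 | h2
    · have := (hIv (show t ∈ Ioo v b from ⟨by linarith, ht.2⟩)).1
      simp only [mem_ofPred_eq, sub_sub_cancel, Complex.neg_im, abs_neg] at this
      linarith [le_abs_self B₂]
    · have := (Complex.abs_im_le_norm _).trans (hB₃ t ⟨h1, h2⟩)
      linarith [le_abs_self B₃]
  obtain ⟨K, hK⟩ := h.exists_abs_log_norm_le
  refine ⟨2 * |K| + (|B₁| + |B₂| + |B₃|), lam, hc, he', fun t ht => ?_, fun t ht => ?_⟩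
  · have e1 := hK a (left_mem_Icc.2 hab.le) t (Ioo_subset_Icc_self ht) ht.1
    have e2 := hK t (Ioo_subset_Icc_self ht) b (right_mem_Icc.2 hab.le) ht.2
    have e3 : (lam t).re = Real.log ‖γ b - γ t‖ - Real.log ‖γ t - γ a‖ := by
      have := congrArg (fun z => Real.log ‖z‖) (he' t ht)
      simp only [Complex.norm_exp, Real.log_exp, norm_div] at this
      rw [this, Real.log_div (norm_ne_zero_iff.2 (hne2 t ht)) (norm_ne_zero_iff.2 (hne1 t ht))]
    have e4 := Complex.norm_le_abs_re_add_abs_im (lam t)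
    have e5 := him t ht
    have e6 : |(lam t).re| ≤ |Real.log ‖γ b - γ t‖| + |Real.log ‖γ t - γ a‖| := by
      rw [e3]
      exact abs_sub _ _
    linarith [le_abs_self K, e1.1, e2.1]
  · have := him t ht
    linarith [abs_nonneg K]

end BiLipArc

end ResolventCalculus

/-! ### Moments of the arc logarithm -/

namespace ResolventCalculus

theorem intervalIntegrable_rpow_mul_rpow {a b s : ℝ} (hab : a < b) (hs : -1 < s) :
    IntervalIntegrable (fun t => (t - a) ^ s * (b - t) ^ s) volume a b := by
  set c := (a + b) / 2 with hc
  have hac : a < c := by linarith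
  have hcb : c < b := by linarith
  have h1 : IntervalIntegrable (fun t => (t - a) ^ s) volume a c := by
    have := (intervalIntegral.intervalIntegrable_rpow' (a := 0) (b := c - a) hs).comp_sub_right a
    simpa using this
  have h2 : IntervalIntegrable (fun t => (b - t) ^ s) volume c b := by
    have := (intervalIntegral.intervalIntegrable_rpow' (a := b - c) (b := 0) hs).comp_sub_left b
    simpa using this
  refine (h1.mul_continuousOn ?_).trans (h2.continuousOn_mul ?_)
  · rw [uIcc_of_le hac.le]
    exact (continuousOn_const.sub continuousOn_id).rpow_const fun t ht =>
      Or.inl (sub_pos.2 (ht.2.trans_lt hcb)).ne'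
  · rw [uIcc_of_le hcb.le]
    exact (continuousOn_id.sub continuousOn_const).rpow_const fun t ht =>
      Or.inl (sub_pos.2 (hac.trans_le ht.1)).ne'

theorem ae_mem_Ioo_of_mem_uIoc {a b : ℝ} (hab : a ≤ b) :
    ∀ᵐ t : ℝ, t ∈ uIoc a b → t ∈ Ioo a b := by
  have hne : ∀ᵐ t : ℝ, t ≠ b := by simp [ae_iff, measure_singleton]
  filter_upwards [hne] with t ht hm
  rw [uIoc_of_le hab] at hm
  exact ⟨hm.1, lt_of_le_of_ne hm.2 ht⟩

namespace ArcLog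

variable {γ : ℝ → ℂ} {a b C₁ C₂ K : ℝ} {lam : ℝ → ℂ}

theorem exp_mul_norm_le (hl : ArcLog γ a b K lam) {r : ℝ} (hr : 0 ≤ r) {t : ℝ}
    (ht : t ∈ Ioo a b) :
    Real.exp (r * ‖lam t‖) ≤ Real.exp (r * K) * ((t - a) ^ (-r) * (b - t) ^ (-r)) := by
  rw [Real.rpow_def_of_pos (sub_pos.2 ht.1), Real.rpow_def_of_pos (sub_pos.2 ht.2), ← Real.exp_add,
    ← Real.exp_add]
  refine Real.exp_le_exp.2 ?_
  have := mul_le_mul_of_nonneg_left (hl.norm_le t ht) hr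
  linarith

/-- Only |Re α| multiplies the unbounded part of the logarithm, since its imaginary part is bounded;
hence the condition |Re α| < 1 for integrability instead of one on |α|. -/
theorem norm_exp_le (hl : ArcLog γ a b K lam) (α : ℂ) {t : ℝ} (ht : t ∈ Ioo a b) :
    ‖Complex.exp (α * lam t)‖ ≤ Real.exp (|α.im| * K) * Real.exp (|α.re| * ‖lam t‖) := by
  rw [Complex.norm_exp, ← Real.exp_add]
  refine Real.exp_le_exp.2 ?_
  rw [Complex.mul_re]
  have h1 : α.re * (lam t).re ≤ |α.re| * ‖lam t‖ := (le_abs_self _).trans (by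
    rw [abs_mul]
    exact mul_le_mul_of_nonneg_left (Complex.abs_re_le_norm _) (abs_nonneg _))
  have h2 : -(α.im * (lam t).im) ≤ |α.im| * K := (neg_le_abs _).trans (by
    rw [abs_mul]
    exact mul_le_mul_of_nonneg_left (hl.im_le t ht) (abs_nonneg _))
  linarith

theorem aestronglyMeasurable (hl : ArcLog γ a b K lam) (hab : a ≤ b) :
    AEStronglyMeasurable lam (volume.restrict (uIoc a b)) := by
  have h1 := hl.cont.aestronglyMeasurable (μ := volume) measurableSet_Ioo
  rwa [uIoc_of_le hab, ← restrict_Ioo_eq_restrict_Ioc]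

/-- A common integrable bound for `λᵐ exp(α λ)`, `α` in a rectangle. -/
theorem exists_bound (hl : ArcLog γ a b K lam) (hab : a < b) (m : ℕ) {r : ℝ} (hr0 : 0 ≤ r)
    (hr : r < 1) (R : ℝ) : ∃ g : ℝ → ℝ, IntervalIntegrable g volume a b ∧
    ∀ α : ℂ, |α.re| ≤ r → |α.im| ≤ R → ∀ t ∈ Ioo a b,
      ‖lam t ^ m * Complex.exp (α * lam t)‖ ≤ g t := by
  -- Half of the room between r and 1 absorbs the powers of the logarithm into exp(ε‖lam‖); the
  -- exponent r + ε remains below 1.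
  set ε := (1 - r) / 2 with hε
  have hε0 : 0 < ε := by linarith
  have hrε : 0 ≤ r + ε := by linarith
  refine ⟨fun t => m.factorial / ε ^ m * Real.exp (R * |K|) * Real.exp ((r + ε) * K) *
    ((t - a) ^ (-(r + ε)) * (b - t) ^ (-(r + ε))), (intervalIntegrable_rpow_mul_rpow hab
      (by linarith)).const_mul _, fun α hα hα' t ht => ?_⟩
  have hx := norm_nonneg (lam t)
  have h1 : ‖lam t‖ ^ m ≤ m.factorial / ε ^ m * Real.exp (ε * ‖lam t‖) := by
    have := Real.pow_div_factorial_le_exp (ε * ‖lam t‖) (by positivity) m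
    rw [div_le_iff₀ (by positivity), mul_pow] at this
    rw [div_mul_eq_mul_div, le_div_iff₀ (by positivity)]
    linarith
  have h2 : Real.exp (|α.im| * K) ≤ Real.exp (R * |K|) := Real.exp_le_exp.2
    ((mul_le_mul_of_nonneg_left (le_abs_self K) (abs_nonneg _)).trans
      (mul_le_mul_of_nonneg_right hα' (abs_nonneg _)))
  have h3 : Real.exp (|α.re| * ‖lam t‖) ≤ Real.exp (r * ‖lam t‖) := Real.exp_le_exp.2
    (mul_le_mul_of_nonneg_right hα hx)
  calc ‖lam t ^ m * Complex.exp (α * lam t)‖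
      ≤ (m.factorial / ε ^ m * Real.exp (ε * ‖lam t‖)) *
        (Real.exp (R * |K|) * Real.exp (r * ‖lam t‖)) := by
        rw [norm_mul, norm_pow]
        refine mul_le_mul h1 ((hl.norm_exp_le α ht).trans (mul_le_mul h2 h3 (Real.exp_nonneg _)
          (Real.exp_nonneg _))) (norm_nonneg _) (by positivity)
    _ = m.factorial / ε ^ m * Real.exp (R * |K|) * Real.exp ((r + ε) * ‖lam t‖) := by
        rw [add_mul, Real.exp_add]
        ring
    _ ≤ _ := by
        refine (mul_le_mul_of_nonneg_left (hl.exp_mul_norm_le hrε ht) (by positivity)).trans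
          (le_of_eq ?_)
        simp only
        ring

theorem aestronglyMeasurable_term (hl : ArcLog γ a b K lam) (hab : a ≤ b) (m : ℕ) (α : ℂ) :
    AEStronglyMeasurable (fun t => lam t ^ m * Complex.exp (α * lam t))
      (volume.restrict (uIoc a b)) := by
  have h1 := hl.aestronglyMeasurable hab
  exact (h1.pow m).mul (Complex.continuous_exp.comp_aestronglyMeasurable (h1.const_mul α))

theorem intervalIntegrable_term (hl : ArcLog γ a b K lam) (hab : a < b) (m : ℕ) {α : ℂ}
    (hα : |α.re| < 1) :
    IntervalIntegrable (fun t => lam t ^ m * Complex.exp (α * lam t)) volume a b := by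
  obtain ⟨g, hg, hb⟩ := hl.exists_bound hab m (abs_nonneg α.re) hα |α.im|
  refine hg.mono_fun (hl.aestronglyMeasurable_term hab.le m α) ?_
  refine (ae_restrict_iff' measurableSet_uIoc).2 ?_
  filter_upwards [ae_mem_Ioo_of_mem_uIoc hab.le] with t ht hm
  exact (hb α le_rfl le_rfl t (ht hm)).trans (le_abs_self _)

/-- Differentiation under the integral; the rectangle is taken halfway between |Re α| and 1 so that
one integrable bound serves a neighbourhood of α. -/
theorem hasDerivAt_moment (hl : ArcLog γ a b K lam) (hab : a < b) (m : ℕ) {g : ℝ → ℂ} {G : ℝ}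
    (hg : AEStronglyMeasurable g (volume.restrict (uIoc a b))) (hG : ∀ t ∈ Ioo a b, ‖g t‖ ≤ G)
    {α : ℂ} (hα : |α.re| < 1) :
    IntervalIntegrable (fun t => lam t ^ m * Complex.exp (α * lam t) * g t) volume a b ∧
    HasDerivAt (fun α => ∫ t in a..b, lam t ^ m * Complex.exp (α * lam t) * g t)
      (∫ t in a..b, lam t ^ (m + 1) * Complex.exp (α * lam t) * g t) α := by
  set r := (1 + |α.re|) / 2 with hr
  have hr1 : r < 1 := by linarith
  have hr0 : 0 ≤ r := by linarith [abs_nonneg α.re]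
  obtain ⟨B, hB, hBb⟩ := hl.exists_bound hab (m + 1) hr0 hr1 (|α.im| + 1)
  have hs : {β : ℂ | |β.re| < r ∧ |β.im| < |α.im| + 1} ∈ 𝓝 α :=
    ((isOpen_lt (continuous_abs.comp Complex.continuous_re) continuous_const).inter
      (isOpen_lt (continuous_abs.comp Complex.continuous_im) continuous_const)).mem_nhds
      ⟨by simp only [mem_ofPred_eq, Function.comp_apply]; linarith, by simp⟩
  have hG0 : 0 ≤ G := by
    obtain ⟨t, ht⟩ := nonempty_Ioo.2 hab
    exact (norm_nonneg _).trans (hG t ht)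
  have hi : IntervalIntegrable (fun t => lam t ^ m * Complex.exp (α * lam t) * g t) volume a b := by
    refine ((hl.intervalIntegrable_term hab m hα).norm.mul_const G).mono_fun
      ((hl.aestronglyMeasurable_term hab.le m α).mul hg) ?_
    refine (ae_restrict_iff' measurableSet_uIoc).2 ?_
    filter_upwards [ae_mem_Ioo_of_mem_uIoc hab.le] with t ht hm
    rw [norm_mul, Real.norm_of_nonneg (by positivity)]
    exact mul_le_mul_of_nonneg_left (hG t (ht hm)) (norm_nonneg _)
  refine ⟨hi, (intervalIntegral.hasDerivAt_integral_of_dominated_loc_of_deriv_le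
    (F := fun α t => lam t ^ m * Complex.exp (α * lam t) * g t)
    (F' := fun α t => lam t ^ (m + 1) * Complex.exp (α * lam t) * g t)
    (bound := fun t => B t * G) hs
    (Eventually.of_forall fun β => (hl.aestronglyMeasurable_term hab.le m β).mul hg) hi
    ((hl.aestronglyMeasurable_term hab.le (m + 1) α).mul hg) ?_ (hB.mul_const G) ?_).2⟩
  · filter_upwards [ae_mem_Ioo_of_mem_uIoc hab.le] with t ht hm β hβ
    rw [norm_mul]
    exact mul_le_mul (hBb β hβ.1.le hβ.2.le t (ht hm)) (hG t (ht hm)) (norm_nonneg _)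
      ((norm_nonneg _).trans (hBb β hβ.1.le hβ.2.le t (ht hm)))
  · refine Eventually.of_forall fun t _ β _ => ?_
    have h1 : HasDerivAt (fun β : ℂ => Complex.exp (β * lam t))
        (Complex.exp (β * lam t) * (1 * lam t)) β := ((hasDerivAt_id β).mul_const (lam t)).cexp
    refine ((h1.const_mul (lam t ^ m)).mul_const (g t)).congr_deriv ?_
    ring

/-! The logarithm as a function on the open arc -/

/-- The parameter of a point of the curve. -/
noncomputable def _root_.ResolventCalculus.arcParam (γ : ℝ → ℂ) (a b : ℝ) : ℂ → ℝ :=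
  Function.invFunOn γ (Icc a b)

theorem _root_.ResolventCalculus.BiLipArc.arcParam_apply (hγ : BiLipArc γ a b C₁ C₂) {t : ℝ}
    (ht : t ∈ Icc a b) : arcParam γ a b (γ t) = t :=
  hγ.injOn.leftInvOn_invFunOn ht

theorem _root_.ResolventCalculus.BiLipArc.continuousOn_arcParam (hγ : BiLipArc γ a b C₁ C₂) :
    ContinuousOn (arcParam γ a b) (γ '' Icc a b) := by
  refine LipschitzOnWith.continuousOn (K := C₁⁻¹.toNNReal)
    (LipschitzOnWith.of_dist_le_mul ?_)
  rintro _ ⟨s, hs, rfl⟩ _ ⟨t, ht, rfl⟩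
  rw [hγ.arcParam_apply hs, hγ.arcParam_apply ht, Real.dist_eq, dist_eq_norm,
    Real.coe_toNNReal _ (inv_nonneg.2 hγ.pos₁.le), inv_mul_eq_div, le_div_iff₀ hγ.pos₁, mul_comm]
  exact hγ.lower t ht s hs

theorem hasDerivWithinAt (hl : ArcLog γ a b K lam) (hγ : BiLipArc γ a b C₁ C₂) {t : ℝ}
    (ht : t ∈ Ioo a b) : HasDerivWithinAt (fun w => lam (arcParam γ a b w))
      ((γ t - γ b)⁻¹ - (γ t - γ a)⁻¹) (γ '' Icc a b) (γ t) := by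
  have htI := Ioo_subset_Icc_self ht
  have h1 : ContinuousWithinAt (arcParam γ a b) (γ '' Icc a b) (γ t) :=
    hγ.continuousOn_arcParam _ (mem_image_of_mem γ htI)
  have hnear : ∀ᶠ w in 𝓝[γ '' Icc a b] (γ t), arcParam γ a b w ∈ Ioo a b :=
    h1.eventually (by rw [hγ.arcParam_apply htI]; exact isOpen_Ioo.mem_nhds ht)
  have hc : ContinuousWithinAt (fun w => lam (arcParam γ a b w)) (γ '' Icc a b) (γ t) := by
    refine ContinuousAt.comp_continuousWithinAt (g := lam) ?_ h1
    rw [hγ.arcParam_apply htI]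
    exact hl.cont.continuousAt (isOpen_Ioo.mem_nhds ht)
  have hne1 := hγ.sub_left_ne_zero (Ioo_subset_Ioc_self ht)
  have hne2 := hγ.right_sub_ne_zero (Ioo_subset_Ico_self ht)
  have hr : HasDerivWithinAt (fun w => (γ b - w) / (w - γ a))
      ((-1 * (γ t - γ a) - (γ b - γ t) * 1) / (γ t - γ a) ^ 2) (γ '' Icc a b) (γ t) :=
    (((hasDerivAt_id (γ t)).const_sub (γ b)).div ((hasDerivAt_id (γ t)).sub_const (γ a))
      hne1).hasDerivWithinAt
  have h2 := hasDerivWithinAt_of_exp_eq (r := fun w => (γ b - w) / (w - γ a)) hc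
    (mem_image_of_mem γ htI) (by
      filter_upwards [hnear, self_mem_nhdsWithin] with w hw hwΓ
      obtain ⟨s, hs, rfl⟩ := hwΓ
      rw [hγ.arcParam_apply hs] at hw ⊢
      exact hl.exp_eq s hw) hr
  refine h2.congr_deriv ?_
  have hne3 : γ t - γ b ≠ 0 := by rw [← neg_sub]; exact neg_ne_zero.2 hne2
  field_simp
  ring

end ArcLog

end ResolventCalculus

/-! ### The Cauchy integral of exp(αΛ) along the arc -/

namespace ResolventCalculus
namespace ArcLog

variable {γ : ℝ → ℂ} {a b C₁ C₂ K : ℝ} {lam : ℝ → ℂ}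

theorem norm_exp_le_rpow (hl : ArcLog γ a b K lam) (α : ℂ) {t : ℝ} (ht : t ∈ Ioo a b) :
    ‖Complex.exp (α * lam t)‖ ≤ Real.exp (|α.im| * K) * Real.exp (|α.re| * K) *
      ((t - a) ^ (-|α.re|) * (b - t) ^ (-|α.re|)) := by
  refine (hl.norm_exp_le α ht).trans ?_
  rw [mul_assoc]
  exact mul_le_mul_of_nonneg_left (hl.exp_mul_norm_le (abs_nonneg _) ht) (Real.exp_nonneg _)

theorem tendsto_left (hl : ArcLog γ a b K lam) (hγ : BiLipArc γ a b C₁ C₂) {α : ℂ}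
    (hα : |α.re| < 1) :
    Tendsto (fun t => Complex.exp (α * lam t) * (γ t - γ a)) (𝓝[>] a) (𝓝 0) := by
  have hab := hγ.lt
  set r := |α.re|
  set C := Real.exp (|α.im| * K) * Real.exp (r * K)
  have h1 : Tendsto (fun t => C * C₂ * ((t - a) ^ (1 - r) * (b - t) ^ (-r))) (𝓝[>] a) (𝓝 0) := by
    have h2 : Tendsto (fun t => (t - a) ^ (1 - r)) (𝓝[>] a) (𝓝 ((a - a) ^ (1 - r))) :=
      (((continuous_id.sub continuous_const).tendsto a).mono_left inf_le_left).rpow_const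
        (Or.inr (by linarith))
    have h3 : Tendsto (fun t => (b - t) ^ (-r)) (𝓝[>] a) (𝓝 ((b - a) ^ (-r))) :=
      (((continuous_const.sub continuous_id).tendsto a).mono_left inf_le_left).rpow_const
        (Or.inl (sub_pos.2 hab).ne')
    rw [sub_self, Real.zero_rpow (by linarith)] at h2
    simpa using (h2.mul h3).const_mul (C * C₂)
  refine squeeze_zero_norm' ?_ h1
  filter_upwards [Ioo_mem_nhdsGT hab] with t ht
  have hta := sub_pos.2 ht.1
  have h4 := hγ.upper a t
  rw [abs_of_pos hta] at h4
  have h5 := mul_le_mul (hl.norm_exp_le_rpow α ht) h4 (norm_nonneg _) (by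
    have := Real.rpow_nonneg hta.le (-r)
    have := Real.rpow_nonneg (sub_pos.2 ht.2).le (-r)
    positivity)
  rw [norm_mul]
  refine h5.trans (le_of_eq ?_)
  rw [sub_eq_add_neg 1 r, Real.rpow_add hta, Real.rpow_one]
  ring

theorem tendsto_right (hl : ArcLog γ a b K lam) (hγ : BiLipArc γ a b C₁ C₂) {α : ℂ}
    (hα : |α.re| < 1) :
    Tendsto (fun t => Complex.exp (α * lam t) * (γ t - γ b)) (𝓝[<] b) (𝓝 0) := by
  have hab := hγ.lt
  set r := |α.re|
  set C := Real.exp (|α.im| * K) * Real.exp (r * K)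
  have h1 : Tendsto (fun t => C * C₂ * ((t - a) ^ (-r) * (b - t) ^ (1 - r))) (𝓝[<] b) (𝓝 0) := by
    have h2 : Tendsto (fun t => (t - a) ^ (-r)) (𝓝[<] b) (𝓝 ((b - a) ^ (-r))) :=
      (((continuous_id.sub continuous_const).tendsto b).mono_left inf_le_left).rpow_const
        (Or.inl (sub_pos.2 hab).ne')
    have h3 : Tendsto (fun t => (b - t) ^ (1 - r)) (𝓝[<] b) (𝓝 ((b - b) ^ (1 - r))) :=
      (((continuous_const.sub continuous_id).tendsto b).mono_left inf_le_left).rpow_const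
        (Or.inr (by linarith))
    rw [sub_self, Real.zero_rpow (by linarith)] at h3
    simpa using (h2.mul h3).const_mul (C * C₂)
  refine squeeze_zero_norm' ?_ h1
  filter_upwards [Ioo_mem_nhdsLT hab] with t ht
  have htb := sub_pos.2 ht.2
  have h4 := hγ.upper t b
  rw [abs_of_pos htb, norm_sub_rev] at h4
  have h5 := mul_le_mul (hl.norm_exp_le_rpow α ht) h4 (norm_nonneg _) (by
    have := Real.rpow_nonneg htb.le (-r)
    have := Real.rpow_nonneg (sub_pos.2 ht.1).le (-r)
    positivity)
  rw [norm_mul]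
  refine h5.trans (le_of_eq ?_)
  rw [sub_eq_add_neg 1 r, Real.rpow_add htb, Real.rpow_one]
  ring

theorem intervalIntegrable_exp (hl : ArcLog γ a b K lam) (hγ : BiLipArc γ a b C₁ C₂) {α : ℂ}
    (hα : |α.re| < 1) :
    IntervalIntegrable (fun t => Complex.exp (α * lam t) * deriv γ t) volume a b := by
  have := hl.intervalIntegrable_term hγ.lt 0 hα
  simp only [pow_zero, one_mul] at this
  exact hγ.intervalIntegrable_mul_deriv this

/-- Integration of the derivative of `exp(α Λ) R` along the arc. -/
theorem integral_exp_mul (hl : ArcLog γ a b K lam) (hγ : BiLipArc γ a b C₁ C₂) {α : ℂ}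
    (hα : |α.re| < 1) {R R' S : ℂ → ℂ}
    (hR : ∀ t ∈ Ioo a b, HasDerivWithinAt R (R' (γ t)) (γ '' Icc a b) (γ t))
    (hS : ∀ t ∈ Ioo a b, α * ((γ t - γ b)⁻¹ - (γ t - γ a)⁻¹) * R (γ t) + R' (γ t) = S (γ t))
    (hSc : ContinuousOn S (γ '' Ioo a b))
    (hi : IntervalIntegrable (fun t => Complex.exp (α * lam t) * deriv γ t * S (γ t)) volume a b)
    (ha : Tendsto (fun t => Complex.exp (α * lam t) * R (γ t)) (𝓝[>] a) (𝓝 0))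
    (hb : Tendsto (fun t => Complex.exp (α * lam t) * R (γ t)) (𝓝[<] b) (𝓝 0)) :
    ∫ t in a..b, Complex.exp (α * lam t) * deriv γ t * S (γ t) = 0 := by
  have hab := hγ.lt
  have hpar : ∀ t ∈ Icc a b, lam (arcParam γ a b (γ t)) = lam t := fun t ht => by
    rw [hγ.arcParam_apply ht]
  have hd := fun t ht => hl.hasDerivWithinAt hγ (t := t) ht
  have heq : ∀ t ∈ Icc a b, Complex.exp (α * lam (arcParam γ a b (γ t))) * S (γ t) * deriv γ t =
      Complex.exp (α * lam t) * deriv γ t * S (γ t) := fun t ht => by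
    rw [hpar t ht]
    ring
  have h1 := hγ.integral_Ioo_comp_mul_deriv
    (F := fun w => Complex.exp (α * lam (arcParam γ a b w)) * R w)
    (F' := fun w => Complex.exp (α * lam (arcParam γ a b w)) * S w) (A := 0) (B := 0)
    (fun t ht => by
      refine ((((hd t ht).const_mul α).cexp).mul (hR t ht)).congr_deriv ?_
      rw [← hS t ht]
      ring) (by
      refine ContinuousOn.mul ?_ hSc
      rintro _ ⟨t, ht, rfl⟩
      exact ((((hd t ht).const_mul α).cexp).continuousWithinAt).mono
        (image_mono Ioo_subset_Icc_self)) (by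
      refine hi.congr fun t ht => ?_
      rw [uIoc_of_le hab.le] at ht
      exact (heq t (Ioc_subset_Icc_self ht)).symm) (by
      refine ha.congr' ?_
      filter_upwards [Ioo_mem_nhdsGT hab] with t ht
      rw [hpar t (Ioo_subset_Icc_self ht)]) (by
      refine hb.congr' ?_
      filter_upwards [Ioo_mem_nhdsLT hab] with t ht
      rw [hpar t (Ioo_subset_Icc_self ht)])
  rw [sub_zero] at h1
  rw [← h1]
  refine intervalIntegral.integral_congr fun t ht => ?_
  rw [uIcc_of_le hab.le] at ht
  exact (heq t ht).symm

/-- The differential equation of the Cauchy integral of `exp(α Λ)`. -/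
theorem cauchy_ode (hl : ArcLog γ a b K lam) (hγ : BiLipArc γ a b C₁ C₂) {α : ℂ}
    (hα : |α.re| < 1) {z : ℂ} (hz : z ∉ γ '' Icc a b) :
    (z - γ a) * (z - γ b) * (∫ t in a..b, Complex.exp (α * lam t) * deriv γ t * ((γ t - z) ^ 2)⁻¹) =
      α * (γ b - γ a) * (∫ t in a..b, Complex.exp (α * lam t) * deriv γ t * (γ t - z)⁻¹) +
        ∫ t in a..b, Complex.exp (α * lam t) * deriv γ t := by
  have hab := hγ.lt
  have hk := hl.intervalIntegrable_exp hγ hα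
  have hzne : ∀ t ∈ Icc a b, γ t - z ≠ 0 := fun t ht =>
    BiLipArc.sub_ne_zero_of_notMem hz (mem_image_of_mem γ ht)
  have i1 : IntervalIntegrable (fun t => Complex.exp (α * lam t) * deriv γ t * (γ t - z)⁻¹)
      volume a b := hk.mul_continuousOn (by
    rw [uIcc_of_le hab.le]
    simpa using hγ.continuousOn_inv_sub_pow hz 1)
  have i2 : IntervalIntegrable (fun t => Complex.exp (α * lam t) * deriv γ t * ((γ t - z) ^ 2)⁻¹)
      volume a b := hk.mul_continuousOn (by
    rw [uIcc_of_le hab.le]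
    exact hγ.continuousOn_inv_sub_pow hz 2)
  have hsum : ∀ t, Complex.exp (α * lam t) * deriv γ t *
      (α * (γ b - γ a) * (γ t - z)⁻¹ + 1 - (z - γ a) * (z - γ b) * ((γ t - z) ^ 2)⁻¹) =
      α * (γ b - γ a) * (Complex.exp (α * lam t) * deriv γ t * (γ t - z)⁻¹) +
      Complex.exp (α * lam t) * deriv γ t -
      (z - γ a) * (z - γ b) * (Complex.exp (α * lam t) * deriv γ t * ((γ t - z) ^ 2)⁻¹) := fun t => by
    ring
  have hcz : ContinuousOn (fun w => (w - z)⁻¹) (γ '' Icc a b) := ContinuousOn.inv₀ (by fun_prop)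
    fun w hw => BiLipArc.sub_ne_zero_of_notMem hz hw
  -- The factor (w-γ(a))(w-γ(b)) cancels the poles of Λ' and makes the boundary terms vanish; S
  -- consists exactly of the three integrands of the equation.
  have h1 := hl.integral_exp_mul hγ hα (R := fun w => (w - γ a) * (w - γ b) * (w - z)⁻¹)
    (R' := fun w => ((w - γ b) + (w - γ a)) * (w - z)⁻¹ - (w - γ a) * (w - γ b) * ((w - z) ^ 2)⁻¹)
    (S := fun w => α * (γ b - γ a) * (w - z)⁻¹ + 1 - (z - γ a) * (z - γ b) * ((w - z) ^ 2)⁻¹)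
    (fun t ht => by
      have hne := hzne t (Ioo_subset_Icc_self ht)
      have e1 : HasDerivAt (fun w : ℂ => (w - γ a) * (w - γ b))
          (1 * (γ t - γ b) + (γ t - γ a) * 1) (γ t) :=
        ((hasDerivAt_id (γ t)).sub_const (γ a)).mul ((hasDerivAt_id (γ t)).sub_const (γ b))
      have e2 := e1.mul (((hasDerivAt_id (γ t)).sub_const z).inv hne)
      refine (e2.congr_deriv ?_).hasDerivWithinAt
      simp only [id, Pi.inv_apply]
      field_simp
      ring) (fun t ht => by
      have hne := hzne t (Ioo_subset_Icc_self ht)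
      have hne1 := hγ.sub_left_ne_zero (Ioo_subset_Ioc_self ht)
      have hne2 : γ t - γ b ≠ 0 := by
        rw [← neg_sub]
        exact neg_ne_zero.2 (hγ.right_sub_ne_zero (Ioo_subset_Ico_self ht))
      field_simp
      ring) (by
      have hc' := hcz.mono (image_mono (f := γ) (Ioo_subset_Icc_self (a := a) (b := b)))
      refine ContinuousOn.sub ((continuousOn_const.mul hc').add continuousOn_const)
        (continuousOn_const.mul ?_)
      exact (hc'.pow 2).congr fun w _ => by simp) (by
      simp only [hsum]
      exact ((i1.const_mul _).add hk).sub (i2.const_mul _)) (by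
      have h2 : Tendsto (fun t => (γ t - γ b) * (γ t - z)⁻¹) (𝓝[>] a)
          (𝓝 ((γ a - γ b) * (γ a - z)⁻¹)) :=
        ((hγ.continuous.tendsto a).mono_left inf_le_left |>.sub_const _).mul
          (((hγ.continuous.tendsto a).mono_left inf_le_left |>.sub_const _).inv₀
            (hzne a (left_mem_Icc.2 hab.le)))
      have h3 := (hl.tendsto_left hγ hα).mul h2
      rw [zero_mul] at h3
      exact h3.congr fun t => by ring) (by
      have h2 : Tendsto (fun t => (γ t - γ a) * (γ t - z)⁻¹) (𝓝[<] b)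
          (𝓝 ((γ b - γ a) * (γ b - z)⁻¹)) :=
        ((hγ.continuous.tendsto b).mono_left inf_le_left |>.sub_const _).mul
          (((hγ.continuous.tendsto b).mono_left inf_le_left |>.sub_const _).inv₀
            (hzne b (right_mem_Icc.2 hab.le)))
      have h3 := (hl.tendsto_right hγ hα).mul h2
      rw [zero_mul] at h3
      exact h3.congr fun t => by ring)
  simp only [hsum] at h1
  rw [intervalIntegral.integral_sub ((i1.const_mul _).add hk) (i2.const_mul _),
    intervalIntegral.integral_add (i1.const_mul _) hk, intervalIntegral.integral_const_mul,
    intervalIntegral.integral_const_mul, sub_eq_zero] at h1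
  exact h1.symm

/-- The relation between c and N makes c + N·J(z) satisfy the homogeneous equation of exp(α log(γ,
z)). The quotient is constant on the connected complement of the arc, and at infinity it equals c.
-/
theorem add_mul_cauchy_eq (hl : ArcLog γ a b K lam) (hγ : BiLipArc γ a b C₁ C₂) {α c N : ℂ}
    (hα : |α.re| < 1)
    (hN : c * (α * (γ b - γ a)) = N * ∫ t in a..b, Complex.exp (α * lam t) * deriv γ t)
    {z : ℂ} (hz : z ∉ γ '' Icc a b) :
    c + N * (∫ t in a..b, Complex.exp (α * lam t) * deriv γ t * (γ t - z)⁻¹) =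
      c * Complex.exp (α * curveLog γ a b z) := by
  have hk := hl.intervalIntegrable_exp hγ hα
  set J : ℂ → ℂ := fun z => ∫ t in a..b, Complex.exp (α * lam t) * deriv γ t * (γ t - z)⁻¹ with hJ
  set G : ℂ → ℂ := fun z => (c + N * J z) * Complex.exp (-(α * curveLog γ a b z)) with hG
  have hd : ∀ z ∉ γ '' Icc a b, HasDerivAt G 0 z := by
    intro z hz
    have h1 := ((hγ.hasDerivAt_cauchy hk hz).const_mul N).const_add c
    have h2 := ((hγ.hasDerivAt_curveLog hz).const_mul α).neg.cexp
    refine (h1.mul h2).congr_deriv ?_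
    have h3 := hl.cauchy_ode hγ hα hz
    have e1 := BiLipArc.sub_ne_zero_of_notMem hz hγ.left_mem
    have e2 := BiLipArc.sub_ne_zero_of_notMem hz hγ.right_mem
    set D := ∫ t in a..b, Complex.exp (α * lam t) * deriv γ t * ((γ t - z) ^ 2)⁻¹
    set M := ∫ t in a..b, Complex.exp (α * lam t) * deriv γ t
    change N * D * Complex.exp (-(α * curveLog γ a b z)) + (c + N * J z) *
      (Complex.exp (-(α * curveLog γ a b z)) *
        -(α * ((γ b - γ a) / ((γ a - z) * (γ b - z))))) = 0
    have h4 : N * D = (c + N * J z) * (α * ((γ b - γ a) / ((γ a - z) * (γ b - z)))) := by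
      field_simp
      have h5 : (γ a - z) * (γ b - z) * D = α * (γ b - γ a) * J z + M := by
        rw [← h3]
        ring
      calc N * D * (γ a - z) * (γ b - z) = N * ((γ a - z) * (γ b - z) * D) := by ring
        _ = N * (α * (γ b - γ a) * J z) + N * M := by rw [h5]; ring
        _ = _ := by rw [← hN]; ring
    rw [h4]
    ring
  have hopen : IsOpen (γ '' Icc a b)ᶜ := hγ.isCompact.isClosed.isOpen_compl
  have hconst : ∀ w ∉ γ '' Icc a b, G w = G z := fun w hw =>
    hopen.is_const_of_deriv_eq_zero hγ.isPreconnected_compl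
      (fun x hx => (hd x hx).differentiableAt.differentiableWithinAt)
      (fun x hx => (hd x hx).deriv) hw hz
  have hlim : Tendsto G (Bornology.cobounded ℂ) (𝓝 ((c + N * 0) * Complex.exp (-(α * 0)))) :=
    (((hγ.tendsto_cauchy hk).const_mul N).const_add c).mul
      ((hγ.tendsto_curveLog.const_mul α).neg.cexp)
  have hev : ∀ᶠ w in Bornology.cobounded ℂ, w ∉ γ '' Icc a b :=
    Bornology.isBounded_def.1 hγ.isCompact.isBounded
  have h1 : G z = c := by
    have h2 := tendsto_nhds_unique (tendsto_const_nhds.congr' (by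
      filter_upwards [hev] with w hw using (hconst w hw).symm)) hlim
    simpa using h2
  have h2 : c + N * J z = G z * Complex.exp (α * curveLog γ a b z) := by
    rw [hG]
    simp only
    rw [mul_assoc, ← Complex.exp_add, neg_add_cancel, Complex.exp_zero, mul_one]
  rw [h1] at h2
  exact h2

/-- The scalar family of order one with prescribed values on points. -/
theorem _root_.ResolventCalculus.resFam_one {Γ : Set ℂ} {g : ℂ → ℂ} (hg : ContinuousOn g Γ) :
    ResFam 1 Γ fun s => if s.card = 1 then g s.sum else 0 := by
  refine ⟨fun m hm => ?_, fun s z w hs => by omega⟩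
  interval_cases m
  · exact (continuousOn_const (c := (0 : ℂ))).congr fun z _ => by simp
  · exact (hg.comp (s := {z : Fin 1 → ℂ | ∀ i, z i ∈ Γ}) (continuous_apply 0).continuousOn
      fun z hz => hz 0).congr fun z _ => by simp

/-- Were the integral zero, the preceding identity with c = 0 and N = 1 would make the Cauchy
integral vanish off Γ, so e^{αΛ}dw would annihilate all continuous functions on Γ. Tested on
e^{-αΛ}(w-γ(a))(w-γ(b)), which is continuous up to the endpoints, it gives -(γ(b)-γ(a))³/6 ≠ 0. -/
theorem integral_exp_ne_zero (hl : ArcLog γ a b K lam) (hγ : BiLipArc γ a b C₁ C₂) {α : ℂ}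
    (hα : |α.re| < 1) : ∫ t in a..b, Complex.exp (α * lam t) * deriv γ t ≠ 0 := by
  intro hM
  have hab := hγ.lt
  have hk := hl.intervalIntegrable_exp hγ hα
  have hJ : ∀ z ∉ γ '' Icc a b,
      ∫ t in a..b, Complex.exp (α * lam t) * deriv γ t * (γ t - z)⁻¹ = 0 := fun z hz => by
    have := hl.add_mul_cauchy_eq hγ hα (c := 0) (N := 1) (by rw [hM]; ring) hz
    simpa using this
  set g : ℂ → ℂ := fun w =>
    Complex.exp (-α * lam (arcParam γ a b w)) * (w - γ a) * (w - γ b) with hg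
  have hgγ : ∀ t ∈ Icc a b, g (γ t) = Complex.exp (-α * lam t) * (γ t - γ a) * (γ t - γ b) :=
    fun t ht => by rw [hg]; simp only; rw [hγ.arcParam_apply ht]
  have hα' : |(-α).re| < 1 := by simpa using hα
  have hcγ : ContinuousOn (fun t => Complex.exp (-α * lam t) * (γ t - γ a) * (γ t - γ b))
      (Icc a b) := by
    intro t ht
    have c1 : Continuous fun t => γ t - γ a := hγ.continuous.sub continuous_const
    have c2 : Continuous fun t => γ t - γ b := hγ.continuous.sub continuous_const
    rcases eq_or_lt_of_le ht.1 with rfl | hta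
    · have h1 := (hl.tendsto_left hγ hα').mul ((c2.tendsto a).mono_left inf_le_left)
      rw [zero_mul] at h1
      have h2 : ContinuousWithinAt (fun t => Complex.exp (-α * lam t) * (γ t - γ a) * (γ t - γ b))
          (Ioi a) a := by
        simpa [ContinuousWithinAt] using h1
      exact (continuousWithinAt_Ioi_iff_Ici.1 h2).mono fun x hx => hx.1
    rcases eq_or_lt_of_le ht.2 with rfl | htb
    · have h1 := (hl.tendsto_right hγ hα').mul ((c1.tendsto t).mono_left inf_le_left)
      rw [zero_mul] at h1
      have h2 : ContinuousWithinAt (fun s => Complex.exp (-α * lam s) * (γ s - γ a) * (γ s - γ t))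
          (Iio t) t := by
        simp only [ContinuousWithinAt, sub_self, mul_zero]
        exact h1.congr fun s => by ring
      exact (continuousWithinAt_Iio_iff_Iic.1 h2).mono fun x hx => hx.2
    · have h1 : ContinuousAt lam t := hl.cont.continuousAt (isOpen_Ioo.mem_nhds ⟨hta, htb⟩)
      exact (((continuousAt_const.mul h1).cexp.mul c1.continuousAt).mul
        c2.continuousAt).continuousWithinAt
  have hgc : ContinuousOn g (γ '' Icc a b) := by
    have h1 := hcγ.comp hγ.continuousOn_arcParam (by
      rintro _ ⟨t, ht, rfl⟩
      rwa [hγ.arcParam_apply ht])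
    refine h1.congr ?_
    rintro _ ⟨t, ht, rfl⟩
    simp only [Function.comp_apply, hg, hγ.arcParam_apply ht]
  have hb := isBddFunctional_intervalIntegral (n := 1) hab.le hγ.continuous.continuousOn hk le_rfl
  have h0 : IsBddFunctional 1 (γ '' Icc a b) fun _ => 0 :=
    ⟨fun _ _ _ _ => by simp, fun _ _ _ => by simp, 0, fun _ _ _ _ => by simp⟩
  -- In order one the resolvent equation is vacuous, so any continuous function is the value of a
  -- family on single points.
  have h1 := hb.eq_of_poleFam hγ h0 (fun z hz => by
    simpa only [poleFam_replicate, pow_one] using hJ z hz) (resFam_one hgc)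
  beta_reduce at h1
  have hP : ∀ w ∈ γ '' Icc a b, HasDerivWithinAt
      (fun w : ℂ => w ^ 3 / 3 - (γ a + γ b) * w ^ 2 / 2 + γ a * γ b * w)
      ((w - γ a) * (w - γ b)) (γ '' Icc a b) w := fun w _ => by
    have h2 := (((hasDerivAt_pow 3 w).div_const 3).sub
      (((hasDerivAt_pow 2 w).const_mul (γ a + γ b)).div_const 2)).add
      ((hasDerivAt_id w).const_mul (γ a * γ b))
    refine (h2.congr_deriv ?_).hasDerivWithinAt
    norm_num
    ring
  have h3 := (hγ.integral_comp_mul_deriv hP (by fun_prop) (left_mem_Icc.2 hab.le)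
    (right_mem_Icc.2 hab.le)).2
  have h4 : ∫ t in a..b, (γ t - γ a) * (γ t - γ b) * deriv γ t = 0 := by
    rw [← h1]
    refine intervalIntegral.integral_congr fun t ht => ?_
    rw [uIcc_of_le hab.le] at ht
    have h5 : Complex.exp (α * lam t) * Complex.exp (-α * lam t) = 1 := by
      rw [← Complex.exp_add, neg_mul, add_neg_cancel, Complex.exp_zero]
    simp only [Multiset.card_replicate, if_true, Multiset.sum_replicate, one_smul]
    rw [hgγ t ht]
    linear_combination (-(γ t - γ a) * (γ t - γ b) * deriv γ t) * h5
  rw [h4] at h3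
  have h5 : (γ b - γ a) ^ 3 = 0 := by linear_combination (6 : ℂ) * h3
  exact hγ.left_ne_right (sub_eq_zero.1 (pow_eq_zero_iff (by norm_num) |>.1 h5)).symm

/-- The derivative of e^{αΛ}(w-γ(a)) integrates to zero. Since e^Λ(w-γ(a)) = -(w-γ(b)), this
function also equals -e^{(α-1)Λ}(w-γ(b)), which settles the boundary term at b and brings in the
exponent α - 1. -/
theorem integral_exp_recurrence (hl : ArcLog γ a b K lam) (hγ : BiLipArc γ a b C₁ C₂) {α : ℂ}
    (h0 : 0 < α.re) (h1 : α.re < 1) :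
    α * (∫ t in a..b, Complex.exp ((α - 1) * lam t) * deriv γ t) +
      (α - 1) * ∫ t in a..b, Complex.exp (α * lam t) * deriv γ t = 0 := by
  have hab := hγ.lt
  have hα : |α.re| < 1 := by rw [abs_of_pos h0]; exact h1
  have hα' : |(α - 1).re| < 1 := by
    rw [Complex.sub_re, Complex.one_re, abs_lt]
    constructor <;> linarith
  have hk := hl.intervalIntegrable_exp hγ hα
  have hk' := hl.intervalIntegrable_exp hγ hα'
  have hshift : ∀ t ∈ Ioo a b, Complex.exp (α * lam t) * (γ t - γ a) =
      -(Complex.exp ((α - 1) * lam t) * (γ t - γ b)) := by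
    intro t ht
    have e1 := hγ.sub_left_ne_zero (Ioo_subset_Ioc_self ht)
    rw [show α * lam t = (α - 1) * lam t + lam t by ring, Complex.exp_add, hl.exp_eq t ht]
    field_simp
    ring
  have hS : ∀ t ∈ Ioo a b, Complex.exp (α * lam t) * deriv γ t *
      (1 + α * (γ b - γ a) * (γ t - γ b)⁻¹) =
      (1 - α) * (Complex.exp (α * lam t) * deriv γ t) -
        α * (Complex.exp ((α - 1) * lam t) * deriv γ t) := by
    intro t ht
    have hne2 : γ t - γ b ≠ 0 := by
      rw [← neg_sub]
      exact neg_ne_zero.2 (hγ.right_sub_ne_zero (Ioo_subset_Ico_self ht))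
    have e1 : Complex.exp ((α - 1) * lam t) =
        -(Complex.exp (α * lam t) * (γ t - γ a) * (γ t - γ b)⁻¹) := by
      rw [hshift t ht]
      field_simp
    rw [e1]
    field_simp
    ring
  have hS' : ∀ᵐ t : ℝ, t ∈ uIoc a b → Complex.exp (α * lam t) * deriv γ t *
      (1 + α * (γ b - γ a) * (γ t - γ b)⁻¹) =
      (1 - α) * (Complex.exp (α * lam t) * deriv γ t) -
        α * (Complex.exp ((α - 1) * lam t) * deriv γ t) := by
    filter_upwards [ae_mem_Ioo_of_mem_uIoc hab.le] with t ht hm using hS t (ht hm)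
  have hi := (hk.const_mul (1 - α)).sub (hk'.const_mul α)
  have h2 := hl.integral_exp_mul hγ hα (R := fun w => w - γ a) (R' := fun _ => 1)
    (S := fun w => 1 + α * (γ b - γ a) * (w - γ b)⁻¹)
    (fun t _ => ((hasDerivAt_id (γ t)).sub_const (γ a)).hasDerivWithinAt) (fun t ht => by
      have hne1 := hγ.sub_left_ne_zero (Ioo_subset_Ioc_self ht)
      have hne2 : γ t - γ b ≠ 0 := by
        rw [← neg_sub]
        exact neg_ne_zero.2 (hγ.right_sub_ne_zero (Ioo_subset_Ico_self ht))
      field_simp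
      ring) (by
      refine continuousOn_const.add (continuousOn_const.mul (ContinuousOn.inv₀ (by fun_prop) ?_))
      rintro _ ⟨t, ht, rfl⟩
      rw [← neg_sub]
      exact neg_ne_zero.2 (hγ.right_sub_ne_zero (Ioo_subset_Ico_self ht)))
    (hi.congr_ae (by
      rw [EventuallyEq, ae_restrict_iff' measurableSet_uIoc]
      filter_upwards [hS'] with t ht hm using (ht hm).symm))
    (hl.tendsto_left hγ hα) (by
      have h3 := (hl.tendsto_right hγ hα').neg
      rw [neg_zero] at h3
      refine h3.congr' ?_
      filter_upwards [Ioo_mem_nhdsLT hab] with t ht using (hshift t ht).symm)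
  rw [intervalIntegral.integral_congr_ae hS', intervalIntegral.integral_sub (hk.const_mul _)
    (hk'.const_mul _), intervalIntegral.integral_const_mul, intervalIntegral.integral_const_mul] at h2
  linear_combination -h2

end ArcLog
end ResolventCalculus

/-! ### The entire jump factor -/

namespace ResolventCalculus

/-- Translates of f by integers, with alternating signs, agree on the overlaps of the strips of
width two; locally the floor in the definition may be replaced by a fixed integer, which gives
differentiability also across the lines Re α ∈ ℤ. -/
theorem exists_antiperiodic_extension {f : ℂ → ℂ} (hd : ∀ α : ℂ, |α.re| < 1 → DifferentiableAt ℂ f α)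
    (hf : ∀ α : ℂ, 0 < α.re → α.re < 1 → f (α - 1) = -f α) :
    ∃ N : ℂ → ℂ, Differentiable ℂ N ∧ (∀ α : ℂ, |α.re| < 1 → N α = f α) ∧
      ∀ m : ℤ, N m = (-1) ^ m * f 0 := by
  set N : ℂ → ℂ := fun α => (-1) ^ ⌊α.re⌋ * f (α - ⌊α.re⌋) with hN
  have key : ∀ (m : ℤ) (α : ℂ), |α.re - m| < 1 → N α = (-1) ^ m * f (α - m) := by
    intro m α hα
    rw [abs_lt] at hα
    rcases le_or_gt (m : ℝ) α.re with h | h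
    · have : ⌊α.re⌋ = m := Int.floor_eq_iff.2 ⟨h, by linarith⟩
      rw [hN]
      simp only [this]
    · have h1 : ⌊α.re⌋ = m - 1 := Int.floor_eq_iff.2 ⟨by push_cast; linarith, by
        push_cast; linarith⟩
      have h2 := hf (α - m + 1) (by simp; linarith) (by simp; linarith)
      rw [add_sub_cancel_right] at h2
      rw [hN]
      simp only [h1]
      rw [h2, zpow_sub_one₀ (by norm_num)]
      push_cast
      rw [show α - (m - 1 : ℂ) = α - m + 1 by ring]
      norm_num
  refine ⟨N, fun α => ?_, fun α hα => ?_, fun m => ?_⟩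
  · have h1 : |α.re - ⌊α.re⌋| < 1 := by
      rw [abs_of_nonneg (sub_nonneg.2 (Int.floor_le _))]
      linarith [Int.lt_floor_add_one α.re]
    have h2 : ∀ᶠ β in 𝓝 α, N β = (-1) ^ ⌊α.re⌋ * f (β - ⌊α.re⌋) := by
      have hc : Continuous fun β : ℂ => |β.re - ⌊α.re⌋| := by fun_prop
      filter_upwards [(isOpen_lt hc continuous_const).mem_nhds h1] with β hβ using key _ β hβ
    refine DifferentiableAt.congr_of_eventuallyEq ?_ h2
    have h3 : DifferentiableAt ℂ f (α - ⌊α.re⌋) := hd _ (by simpa using h1)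
    exact (h3.comp α (differentiableAt_id.sub_const _)).const_mul _
  · simpa using key 0 α (by simpa using hα)
  · simpa using key m m (by simp)

namespace ArcLog

variable {γ : ℝ → ℂ} {a b C₁ C₂ K : ℝ} {lam : ℝ → ℂ}

/-- The representation of `f_α` as a Cauchy integral over the arc; the factor `N` is entire and
vanishes at the integers. -/
theorem exists_jump (hl : ArcLog γ a b K lam) (hγ : BiLipArc γ a b C₁ C₂) :
    ∃ N : ℂ → ℂ, Differentiable ℂ N ∧ (∀ m : ℤ, N m = 0) ∧
      ∀ α : ℂ, |α.re| < 1 → ∀ z ∉ γ '' Icc a b, curvePow γ a b α z =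
        1 + N α * ∫ t in a..b, Complex.exp (α * lam t) * deriv γ t * (γ t - z)⁻¹ := by
  set M : ℂ → ℂ := fun α => ∫ t in a..b, Complex.exp (α * lam t) * deriv γ t with hM
  have hM0 : ∀ α : ℂ, |α.re| < 1 → M α ≠ 0 := fun α hα => hl.integral_exp_ne_zero hγ hα
  have hMd : ∀ α : ℂ, |α.re| < 1 → DifferentiableAt ℂ M α := fun α hα => by
    have := (hl.hasDerivAt_moment hγ.lt 0 hγ.measurable_deriv.aestronglyMeasurable
      (fun t _ => hγ.norm_deriv_le t) hα).2.differentiableAt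
    simpa only [pow_zero, one_mul] using this
  -- In the strip N(α) = α(γ(b)-γ(a))/M(α), the normalization demanded by the value 1 at infinity;
  -- the recurrence for M becomes N(α-1) = -N(α). The zero of N at 0 propagates to all integers.
  obtain ⟨N, hN, hN1, hN2⟩ := exists_antiperiodic_extension (f := fun α => α * (γ b - γ a) / M α)
    (fun α hα => (differentiableAt_id.mul_const _).div (hMd α hα) (hM0 α hα)) (fun α h0 h1 => by
      have hα : |α.re| < 1 := by rw [abs_of_pos h0]; exact h1
      have hα' : |(α - 1).re| < 1 := by
        rw [Complex.sub_re, Complex.one_re, abs_lt]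
        constructor <;> linarith
      have h2 : α * M (α - 1) + (α - 1) * M α = 0 := hl.integral_exp_recurrence hγ h0 h1
      have e1 := hM0 α hα
      have e2 := hM0 _ hα'
      beta_reduce
      field_simp
      linear_combination (γ b - γ a) * h2)
  refine ⟨N, hN, fun m => by rw [hN2]; simp, fun α hα z hz => ?_⟩
  rw [hN1 α hα]
  have h1 := hl.add_mul_cauchy_eq hγ hα (c := 1) (N := α * (γ b - γ a) / M α) (by
    change _ = α * (γ b - γ a) / M α * M α
    rw [div_mul_cancel₀ _ (hM0 α hα), one_mul]) hz
  rw [h1, one_mul]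
  rfl

/-- The derivatives of `α ↦ N(α) exp(α λ)`. -/
noncomputable def density (N : ℂ → ℂ) (lam : ℝ → ℂ) (k : ℕ) (β : ℂ) (t : ℝ) : ℂ :=
  ∑ ij ∈ Finset.HasAntidiagonal.antidiagonal k,
    k.choose ij.1 * iteratedDeriv ij.1 N β * (lam t ^ ij.2 * Complex.exp (β * lam t))

theorem intervalIntegrable_density (hl : ArcLog γ a b K lam) (hab : a < b) (N : ℂ → ℂ) (k : ℕ)
    {β : ℂ} (hβ : |β.re| < 1) : IntervalIntegrable (density N lam k β) volume a b := by
  have := IntervalIntegrable.sum (Finset.HasAntidiagonal.antidiagonal k) fun ij _ =>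
    (hl.intervalIntegrable_term hab ij.2 hβ).const_mul (k.choose ij.1 * iteratedDeriv ij.1 N β)
  refine this.congr fun t _ => ?_
  simp [density]

/-- The integral formula for f_β is differentiated k times in β: the left side acquires log(γ, z)^k,
the right side the Leibniz expansion in derivatives of N and moments of the logarithm. The constant
1 survives only for k = 0. -/
theorem curveLog_pow_mul_curvePow (hl : ArcLog γ a b K lam) (hγ : BiLipArc γ a b C₁ C₂) {N : ℂ → ℂ}
    (hN : Differentiable ℂ N) (hf : ∀ α : ℂ, |α.re| < 1 → ∀ z ∉ γ '' Icc a b,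
      curvePow γ a b α z =
        1 + N α * ∫ t in a..b, Complex.exp (α * lam t) * deriv γ t * (γ t - z)⁻¹)
    (k : ℕ) {β : ℂ} (hβ : |β.re| < 1) {z : ℂ} (hz : z ∉ γ '' Icc a b) :
    curveLog γ a b z ^ k * curvePow γ a b β z = (if k = 0 then 1 else 0) +
      ∫ t in a..b, density N lam k β t * deriv γ t * (γ t - z)⁻¹ := by
  have hab := hγ.lt
  set g : ℝ → ℂ := fun t => deriv γ t * (γ t - z)⁻¹ with hg
  obtain ⟨G, hG⟩ := isCompact_Icc.exists_bound_of_continuousOn (hγ.continuousOn_inv_sub_pow hz 1)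
  have hgb : ∀ t ∈ Ioo a b, ‖g t‖ ≤ C₂ * G := fun t ht => by
    have h1 := hG t (Ioo_subset_Icc_self ht)
    rw [pow_one] at h1
    rw [hg, norm_mul]
    exact mul_le_mul (hγ.norm_deriv_le t) h1 (norm_nonneg _) hγ.pos₂.le
  have hgm : AEStronglyMeasurable g (volume.restrict (uIoc a b)) :=
    (hγ.measurable_deriv.mul
      ((hγ.continuous.measurable.sub_const z).inv)).aestronglyMeasurable
  set I : ℕ → ℂ → ℂ := fun m β => ∫ t in a..b, lam t ^ m * Complex.exp (β * lam t) * g t with hI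
  have hId : ∀ m (β : ℂ), |β.re| < 1 → HasDerivAt (I m) (I (m + 1) β) β := fun m β hβ =>
    (hl.hasDerivAt_moment hab m hgm hgb hβ).2
  have hNd : ∀ i β, HasDerivAt (iteratedDeriv i N) (iteratedDeriv (i + 1) N β) β := fun i β => by
    rw [iteratedDeriv_succ]
    exact ((hN.contDiff (n := ⊤)).differentiable_iteratedDeriv i (by
      exact_mod_cast WithTop.coe_lt_top _) β).hasDerivAt
  have key : ∀ k (β : ℂ), |β.re| < 1 → curveLog γ a b z ^ k * curvePow γ a b β z =
      (if k = 0 then 1 else 0) + ∑ ij ∈ Finset.HasAntidiagonal.antidiagonal k,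
        (k.choose ij.1 : ℂ) * (iteratedDeriv ij.1 N β * I ij.2 β) := by
    intro k
    induction k with
    | zero =>
      intro β hβ
      rw [pow_zero, one_mul, hf β hβ z hz]
      simp [hI, hg, mul_assoc]
    | succ k ih =>
      intro β hβ
      have hev : ∀ᶠ α : ℂ in 𝓝 β, |α.re| < 1 :=
        (isOpen_lt (continuous_abs.comp Complex.continuous_re) continuous_const).mem_nhds hβ
      have h1 : HasDerivAt (fun α => curveLog γ a b z ^ k * curvePow γ a b α z)
          (curveLog γ a b z ^ k * (curvePow γ a b β z * (1 * curveLog γ a b z))) β :=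
        (((hasDerivAt_id β).mul_const (curveLog γ a b z)).cexp).const_mul _
      have h2 : HasDerivAt (fun β => (if k = 0 then 1 else 0) + ∑ ij ∈ Finset.HasAntidiagonal.antidiagonal k,
          (k.choose ij.1 : ℂ) * (iteratedDeriv ij.1 N β * I ij.2 β))
          (∑ ij ∈ Finset.HasAntidiagonal.antidiagonal k, (k.choose ij.1 : ℂ) *
            (iteratedDeriv (ij.1 + 1) N β * I ij.2 β + iteratedDeriv ij.1 N β * I (ij.2 + 1) β))
          β := by
        refine (HasDerivAt.fun_sum fun ij _ => ?_).const_add _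
        exact ((hNd ij.1 β).mul (hId ij.2 β hβ)).const_mul _
      have h3 := h1.unique (h2.congr_of_eventuallyEq (hev.mono fun α hα => ih α hα))
      rw [if_neg (Nat.succ_ne_zero k), zero_add,
        Finset.sum_antidiagonal_choose_succ_mul fun i j => iteratedDeriv i N β * I j β,
        pow_succ, mul_assoc, ← Finset.sum_add_distrib]
      rw [one_mul, mul_comm (curvePow γ a b β z)] at h3
      rw [h3]
      refine Finset.sum_congr rfl fun ij hij => ?_
      rw [← Nat.choose_symm_of_eq_add (Finset.HasAntidiagonal.mem_antidiagonal.1 hij).symm]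
      ring
  rw [key k β hβ]
  congr 1
  have hterm : ∀ ij ∈ Finset.HasAntidiagonal.antidiagonal k, IntervalIntegrable (fun t => k.choose ij.1 *
      iteratedDeriv ij.1 N β * (lam t ^ ij.2 * Complex.exp (β * lam t) * g t)) volume a b :=
    fun ij _ => (hl.hasDerivAt_moment hab ij.2 hgm hgb hβ).1.const_mul _
  have h4 : ∀ t, density N lam k β t * deriv γ t * (γ t - z)⁻¹ =
      ∑ ij ∈ Finset.HasAntidiagonal.antidiagonal k, k.choose ij.1 * iteratedDeriv ij.1 N β *
        (lam t ^ ij.2 * Complex.exp (β * lam t) * g t) := fun t => by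
    rw [density, mul_assoc, Finset.sum_mul]
    exact Finset.sum_congr rfl fun ij _ => by ring
  simp only [h4]
  rw [intervalIntegral.integral_finsetSum hterm]
  refine Finset.sum_congr rfl fun ij _ => ?_
  rw [intervalIntegral.integral_const_mul, ← mul_assoc]

end ArcLog
end ResolventCalculus

/-! ### Operations on normal forms along the curve -/

namespace ResolventCalculus

/-- `f` has an `n`-normal form along the curve. -/
def HasForm (γ : ℝ → ℂ) (a b : ℝ) (n : ℕ) (f : ℂ → ℂ) : Prop :=
  ∃ θ : CurveForm, θ.Represents γ a b n f

/-- The form with a single nonzero index. -/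
noncomputable def CurveForm.single (j : ℕ) (c d : ℂ) (k : ℝ → ℂ) : CurveForm where
  left := Pi.single j c
  right := Pi.single j d
  density := Pi.single j k

namespace HasForm

variable {γ : ℝ → ℂ} {a b C₁ C₂ : ℝ} {n m : ℕ} {f g : ℂ → ℂ}

theorem of_eqOn (h : HasForm γ a b n f) (hfg : ∀ z ∉ γ '' Icc a b, g z = f z) :
    HasForm γ a b n g := by
  obtain ⟨θ, hθ⟩ := h
  exact ⟨θ, hθ.of_eqOn hfg⟩

theorem add (hγ : BiLipArc γ a b C₁ C₂) (hf : HasForm γ a b n f) (hg : HasForm γ a b n g) :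
    HasForm γ a b n fun z => f z + g z := by
  obtain ⟨θ, hθ⟩ := hf
  obtain ⟨η, hη⟩ := hg
  refine ⟨⟨fun j => θ.left j + η.left j, fun j => θ.right j + η.right j,
    fun j t => θ.density j t + η.density j t⟩,
    fun j hj => (hθ.integrable j hj).add (hη.integrable j hj), fun z hz => ?_⟩
  rw [hθ.eq z hz, hη.eq z hz, CurveForm.apply, CurveForm.apply, CurveForm.apply,
    ← Finset.sum_add_distrib]
  refine Finset.sum_congr rfl fun j hj => ?_
  have hj : j ≤ n := by simpa [Nat.lt_succ_iff] using hj
  have hc : ContinuousOn (fun t => poleFam z (Multiset.replicate j (γ t))) (uIcc a b) := by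
    rw [uIcc_of_le hγ.lt.le]
    simpa only [poleFam_replicate] using hγ.continuousOn_inv_sub_pow hz j
  simp only [add_mul]
  rw [intervalIntegral.integral_add ((hθ.integrable j hj).mul_continuousOn hc)
    ((hη.integrable j hj).mul_continuousOn hc)]
  ring

theorem const_mul (c : ℂ) (hf : HasForm γ a b n f) : HasForm γ a b n fun z => c * f z := by
  obtain ⟨θ, hθ⟩ := hf
  refine ⟨⟨fun j => c * θ.left j, fun j => c * θ.right j, fun j t => c * θ.density j t⟩,
    fun j hj => (hθ.integrable j hj).const_mul c, fun z hz => ?_⟩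
  rw [hθ.eq z hz, CurveForm.apply, CurveForm.apply, Finset.mul_sum]
  refine Finset.sum_congr rfl fun j _ => ?_
  simp only [mul_assoc]
  rw [intervalIntegral.integral_const_mul]
  ring

theorem single {j : ℕ} (hj : j ≤ n) (c d : ℂ) {k : ℝ → ℂ} (hk : IntervalIntegrable k volume a b) :
    HasForm γ a b n fun z => c * ((γ a - z) ^ j)⁻¹ + d * ((γ b - z) ^ j)⁻¹ +
      ∫ t in a..b, k t * ((γ t - z) ^ j)⁻¹ := by
  refine ⟨.single j c d k, fun i _ => ?_, fun z _ => ?_⟩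
  · by_cases hij : i = j
    · subst hij
      simpa [CurveForm.single] using hk
    · simp only [CurveForm.single, Pi.single_apply, if_neg hij]
      exact intervalIntegrable_const
  · rw [CurveForm.apply, Finset.sum_eq_single j]
    · simp [CurveForm.single, poleFam_replicate]
    · intro i _ hij
      simp [CurveForm.single, Pi.single_apply, hij]
    · intro h
      exact absurd (Finset.mem_range.2 (by omega)) h

theorem const (c : ℂ) : HasForm γ a b n fun _ => c :=
  (single (γ := γ) (Nat.zero_le n) c 0 (k := fun _ => 0) intervalIntegrable_const).of_eqOn
    fun z _ => by simp

theorem leftPole {j : ℕ} (hj : j ≤ n) (c : ℂ) :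
    HasForm γ a b n fun z => c * ((γ a - z) ^ j)⁻¹ :=
  (single (γ := γ) hj c 0 (k := fun _ => 0) intervalIntegrable_const).of_eqOn fun z _ => by simp

theorem cauchy {j : ℕ} (hj : j ≤ n) {k : ℝ → ℂ} (hk : IntervalIntegrable k volume a b) :
    HasForm γ a b n fun z => ∫ t in a..b, k t * ((γ t - z) ^ j)⁻¹ :=
  (single (γ := γ) hj 0 0 hk).of_eqOn fun z _ => by simp

theorem finsetSum (hγ : BiLipArc γ a b C₁ C₂) {ι : Type*} (s : Finset ι) {f : ι → ℂ → ℂ}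
    (hf : ∀ i ∈ s, HasForm γ a b n (f i)) : HasForm γ a b n fun z => ∑ i ∈ s, f i z := by
  classical
  induction s using Finset.induction_on with
  | empty => simpa using const (γ := γ) (n := n) 0
  | insert i s hi ih =>
    simp only [Finset.sum_insert hi]
    exact (hf i (Finset.mem_insert_self i s)).add hγ
      (ih fun j hj => hf j (Finset.mem_insert_of_mem hj))

/-- Any map compatible with sums may be checked on the elementary terms. -/
theorem transform (hγ : BiLipArc γ a b C₁ C₂) (hf : HasForm γ a b n f) {w : ℂ → ℂ}
    (h : ∀ j ≤ n, ∀ (c d : ℂ) (k : ℝ → ℂ), IntervalIntegrable k volume a b →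
      HasForm γ a b m fun z => w z * (c * ((γ a - z) ^ j)⁻¹ + d * ((γ b - z) ^ j)⁻¹ +
        ∫ t in a..b, k t * ((γ t - z) ^ j)⁻¹)) :
    HasForm γ a b m fun z => w z * f z := by
  obtain ⟨θ, hθ⟩ := hf
  have h1 := finsetSum hγ (Finset.range (n + 1)) fun j hj =>
    h j (by simpa [Nat.lt_succ_iff] using hj) (θ.left j) (θ.right j) (θ.density j)
      (hθ.integrable j (by simpa [Nat.lt_succ_iff] using hj))
  refine h1.of_eqOn fun z hz => ?_
  rw [hθ.eq z hz, CurveForm.apply, Finset.mul_sum]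
  simp only [poleFam_replicate]

theorem of_le (hγ : BiLipArc γ a b C₁ C₂) (hf : HasForm γ a b n f) (hnm : n ≤ m) :
    HasForm γ a b m f := by
  simpa only [one_mul] using hf.transform (m := m) hγ (w := fun _ => 1) fun j hj c d k hk => by
    simpa only [one_mul] using single (hj.trans hnm) c d hk

theorem reverse (hγ : BiLipArc γ a b C₁ C₂) (hf : HasForm γ a b n f) :
    HasForm (fun t => γ (a + b - t)) a b n f := by
  have h1 : HasForm (fun t => γ (a + b - t)) a b n fun z => 1 * f z := by
    obtain ⟨θ, hθ⟩ := hf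
    have h1 := finsetSum (n := n) hγ.reverse (Finset.range (n + 1)) fun j hj =>
      single (γ := fun t => γ (a + b - t)) (n := n) (j := j) (by simpa [Nat.lt_succ_iff] using hj)
      (θ.right j) (θ.left j) (k := fun t => θ.density j (a + b - t)) (by
        have := ((hθ.integrable j (by simpa [Nat.lt_succ_iff] using hj)).comp_sub_left (a + b)).symm
        simpa using this)
    refine h1.of_eqOn fun z hz => ?_
    rw [BiLipArc.image_reverse] at hz
    rw [one_mul, hθ.eq z hz, CurveForm.apply]
    refine Finset.sum_congr rfl fun j _ => ?_
    simp only [poleFam_replicate]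
    rw [intervalIntegral.integral_comp_sub_left (fun t => θ.density j t * ((γ t - z) ^ j)⁻¹) (a + b),
      add_sub_cancel_right, add_sub_cancel_left]
    ring
  simpa using h1

end HasForm

/-- Interchange of the integrations over a triangle. -/
theorem integral_triangle {a b C : ℝ} (hab : a ≤ b) {h k e : ℝ → ℂ}
    (hh : AEStronglyMeasurable h (volume.restrict (Ioc a b)))
    (he : AEStronglyMeasurable e (volume.restrict (Ioc a b)))
    (hk : IntervalIntegrable k volume a b)
    (hC : ∀ s t, a < s → s ≤ t → t ≤ b → ‖h s‖ * ‖e t‖ * (t - a) ≤ C) :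
    IntervalIntegrable (fun s => h s * ∫ t in s..b, k t * e t) volume a b ∧
      ∫ t in a..b, k t * e t * ∫ s in a..t, h s = ∫ s in a..b, h s * ∫ t in s..b, k t * e t := by
  set μ := (volume : Measure ℝ).restrict (Ioc a b) with hμ
  have hk' : Integrable k μ := (intervalIntegrable_iff_integrableOn_Ioc_of_le hab).1 hk
  set H : ℝ × ℝ → ℂ := indicator {p : ℝ × ℝ | p.1 ≤ p.2} fun p => h p.1 * (k p.2 * e p.2) with hH
  have hS : MeasurableSet {p : ℝ × ℝ | p.1 ≤ p.2} := measurableSet_le measurable_fst measurable_snd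
  have hm : AEStronglyMeasurable H (μ.prod μ) :=
    (hh.comp_fst.mul (hk'.aestronglyMeasurable.mul he).comp_snd).indicator hS
  have hI1 : ∀ t, (fun s => H (s, t)) = indicator (Iic t) fun s => h s * (k t * e t) := fun t => by
    ext s
    simp only [hH, indicator, mem_Iic]
    rfl
  have hI2 : ∀ s, (fun t => H (s, t)) = indicator (Ici s) fun t => h s * (k t * e t) := fun s => by
    ext t
    simp only [hH, indicator, mem_Ici]
    rfl
  -- The inner interval has length t - a, so the inner integral of the norms is at most C‖k t‖; this
  -- gives absolute integrability over the triangle.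
  have hC0 : ∀ t ∈ Ioc a b, ∀ s ∈ Ioc a t, ‖h s * (k t * e t)‖ ≤ C * ‖k t‖ / (t - a) :=
    fun t ht s hs => by
      have h0 : 0 < t - a := sub_pos.2 ht.1
      rw [le_div_iff₀ h0, norm_mul, norm_mul]
      have := mul_le_mul_of_nonneg_right (hC s t hs.1 hs.2 ht.2) (norm_nonneg (k t))
      linarith
  have hset1 : ∀ t ∈ Ioc a b, Iic t ∩ Ioc a b = Ioc a t := fun t ht => by
    ext s
    simp only [mem_inter_iff, mem_Iic, mem_Ioc]
    exact ⟨fun h => ⟨h.2.1, h.1⟩, fun h => ⟨h.2, h.1, h.2.trans ht.2⟩⟩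
  have hint : Integrable H (μ.prod μ) := by
    rw [integrable_prod_iff' hm]
    constructor
    · refine (ae_restrict_iff' measurableSet_Ioc).2 (Eventually.of_forall fun t ht => ?_)
      rw [hI1, integrable_indicator_iff measurableSet_Iic, IntegrableOn, hμ,
        Measure.restrict_restrict measurableSet_Iic, hset1 t ht]
      exact Integrable.mono' (g := fun _ => C * ‖k t‖ / (t - a)) (integrable_const _)
        ((hh.mul_const _).mono_measure
          (Measure.restrict_mono (Ioc_subset_Ioc_right ht.2) le_rfl))
        ((ae_restrict_iff' measurableSet_Ioc).2 (Eventually.of_forall (hC0 t ht)))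
    · refine Integrable.mono' (hk'.norm.const_mul C)
        hm.norm.prod_swap.integral_prod_right' ?_
      refine (ae_restrict_iff' measurableSet_Ioc).2 (Eventually.of_forall fun t ht => ?_)
      have h1 : (fun s => ‖H (s, t)‖) = indicator (Iic t) fun s => ‖h s * (k t * e t)‖ := by
        ext s
        have h2 : H (s, t) = _ := congrFun (hI1 t) s
        rw [h2, norm_indicator_eq_indicator_norm]
      rw [h1, integral_indicator measurableSet_Iic, hμ,
        Measure.restrict_restrict measurableSet_Iic, hset1 t ht]
      have h2 := norm_setIntegral_le_of_norm_le_const (μ := volume) (s := Ioc a t)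
        (f := fun s => ‖h s * (k t * e t)‖) (C := C * ‖k t‖ / (t - a)) (by simp)
        (fun s hs => by rw [norm_norm]; exact hC0 t ht s hs)
      refine h2.trans ?_
      have h0 : 0 < t - a := sub_pos.2 ht.1
      rw [Measure.real, Real.volume_Ioc, ENNReal.toReal_ofReal h0.le, div_mul_cancel₀ _ h0.ne']
  have hset2 : ∀ s ∈ Ioc a b, Ici s ∩ Ioc a b = Icc s b := fun s hs => by
    ext t
    simp only [mem_inter_iff, mem_Ici, mem_Ioc, mem_Icc]
    exact ⟨fun h => ⟨h.1, h.2.2⟩, fun h => ⟨h.1, hs.1.trans_le h.1, h.2⟩⟩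
  have hE1 : ∀ s ∈ Ioc a b, ∫ t, H (s, t) ∂μ = h s * ∫ t in s..b, k t * e t := fun s hs => by
    rw [hI2, integral_indicator measurableSet_Ici, hμ,
      Measure.restrict_restrict measurableSet_Ici, hset2 s hs, integral_Icc_eq_integral_Ioc,
      intervalIntegral.integral_of_le hs.2, integral_const_mul]
  have hE2 : ∀ t ∈ Ioc a b, ∫ s, H (s, t) ∂μ = k t * e t * ∫ s in a..t, h s := fun t ht => by
    rw [hI1, integral_indicator measurableSet_Iic, hμ,
      Measure.restrict_restrict measurableSet_Iic, hset1 t ht,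
      intervalIntegral.integral_of_le ht.1.le, integral_mul_const, mul_comm]
  refine ⟨(intervalIntegrable_iff_integrableOn_Ioc_of_le hab).2 ?_, ?_⟩
  · exact hint.integral_prod_left.congr
      ((ae_restrict_iff' measurableSet_Ioc).2 (Eventually.of_forall hE1))
  · rw [intervalIntegral.integral_of_le hab, intervalIntegral.integral_of_le hab,
      ← setIntegral_congr_fun measurableSet_Ioc hE1, ← setIntegral_congr_fun measurableSet_Ioc hE2]
    exact (integral_integral_swap (f := fun s t => H (s, t)) hint).symm

namespace HasForm

variable {γ : ℝ → ℂ} {a b C₁ C₂ : ℝ} {n : ℕ} {f : ℂ → ℂ}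

/-- The right side is the primitive of the integrand vanishing at γ(a). Read backwards, it expresses
(γ(a)-z)⁻¹(γ(t)-z)⁻ʲ as an average of poles of order j + 1 between γ(a) and γ(t). -/
theorem _root_.ResolventCalculus.BiLipArc.integral_sub_pow (hγ : BiLipArc γ a b C₁ C₂) {z : ℂ}
    (hz : z ∉ γ '' Icc a b) {j : ℕ} (hj : 1 ≤ j) {t : ℝ} (ht : t ∈ Icc a b) :
    ∫ s in a..t, j * (γ s - γ a) ^ (j - 1) * deriv γ s * ((γ s - z) ^ (j + 1))⁻¹ =
      (γ t - γ a) ^ j * ((γ t - z) ^ j)⁻¹ * (γ a - z)⁻¹ := by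
  obtain ⟨i, rfl⟩ : ∃ i, j = i + 1 := ⟨j - 1, by omega⟩
  have hp := BiLipArc.sub_ne_zero_of_notMem hz hγ.left_mem
  have h1 := (hγ.integral_comp_mul_deriv
    (F := fun w => (w - γ a) ^ (i + 1) * ((w - z) ^ (i + 1))⁻¹ * (γ a - z)⁻¹)
    (F' := fun w => ((i + 1 : ℕ) : ℂ) * (w - γ a) ^ i * ((w - z) ^ (i + 2))⁻¹)
    (fun w hw => ?_) (ContinuousOn.mul (by fun_prop) (ContinuousOn.inv₀ (by fun_prop) fun w hw =>
      pow_ne_zero _ (BiLipArc.sub_ne_zero_of_notMem hz hw))) (left_mem_Icc.2 hγ.lt.le) ht).2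
  · rw [sub_self, zero_pow (Nat.succ_ne_zero i), zero_mul, zero_mul, sub_zero] at h1
    rw [← h1]
    refine intervalIntegral.integral_congr fun s _ => ?_
    simp only [add_tsub_cancel_right]
    ring
  · have hw0 := BiLipArc.sub_ne_zero_of_notMem hz hw
    have h2 := ((((hasDerivAt_id w).sub_const (γ a)).pow (i + 1)).mul
      ((((hasDerivAt_id w).sub_const z).pow (i + 1)).inv (pow_ne_zero _ hw0))).mul_const (γ a - z)⁻¹
    refine (h2.congr_deriv ?_).hasDerivWithinAt
    simp only [Pi.pow_apply, Pi.inv_apply, id, add_tsub_cancel_right]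
    field_simp
    push_cast
    ring

/-- Division by `γ(a) - z` raises the order of a form by one. -/
theorem div_left (hγ : BiLipArc γ a b C₁ C₂) (hf : HasForm γ a b n f) :
    HasForm γ a b (n + 1) fun z => (γ a - z)⁻¹ * f z := by
  refine hf.transform hγ fun j hj c d k hk => ?_
  -- For j = 0 everything is constant in z and becomes a simple pole at γ(a).
  rcases Nat.eq_zero_or_pos j with rfl | hj0
  · refine (leftPole (γ := γ) (n := n + 1) (j := 1) (by omega)
      (c + d + ∫ t in a..b, k t)).of_eqOn fun z _ => ?_
    simp only [pow_zero, inv_one, mul_one, pow_one]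
    ring
  -- The pole at γ(t) is averaged with kernel h(s)e(t) over a < s < t. After interchange of the
  -- integrations, the new density is h(s) times the integral of k·e over (s,b), and the
  -- bi-Lipschitz bounds make the kernel O(1/(t-a)), as in Hardy's inequality in L¹.
  set h : ℝ → ℂ := fun s => j * (γ s - γ a) ^ (j - 1) * deriv γ s with hh
  set e : ℝ → ℂ := fun t => ((γ t - γ a) ^ j)⁻¹ with he
  have hpow : ∀ s t, a < s → s ≤ t → t ≤ b → ‖h s‖ * ‖e t‖ * (t - a) ≤
      j * C₂ ^ (j - 1) * C₂ * (C₁ ^ j)⁻¹ := by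
    intro s t hs hst htb
    have ht0 : 0 < t - a := by linarith
    have h1 : ‖h s‖ ≤ j * (C₂ * (t - a)) ^ (j - 1) * C₂ := by
      rw [hh, norm_mul, norm_mul, norm_pow, Complex.norm_natCast]
      have h3 := hγ.upper a s
      rw [abs_of_pos (by linarith)] at h3
      have h4 : ‖γ s - γ a‖ ≤ C₂ * (t - a) :=
        h3.trans (mul_le_mul_of_nonneg_left (by linarith) hγ.pos₂.le)
      have h5 := hγ.norm_deriv_le s
      have h6 := hγ.pos₂.le
      gcongr
    have h2 : ‖e t‖ ≤ ((C₁ * (t - a)) ^ j)⁻¹ := by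
      rw [he, norm_inv, norm_pow]
      have h3 := hγ.lower a (left_mem_Icc.2 hγ.lt.le) t ⟨by linarith, htb⟩
      rw [abs_of_pos ht0] at h3
      have := hγ.pos₁
      gcongr
    have h0 := (norm_nonneg _).trans h1
    calc ‖h s‖ * ‖e t‖ * (t - a)
        ≤ (j * (C₂ * (t - a)) ^ (j - 1) * C₂) * ((C₁ * (t - a)) ^ j)⁻¹ * (t - a) := by gcongr
      _ = j * C₂ ^ (j - 1) * C₂ * (C₁ ^ j)⁻¹ := by
        obtain ⟨i, rfl⟩ : ∃ i, j = i + 1 := ⟨j - 1, by omega⟩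
        have := hγ.pos₁
        rw [add_tsub_cancel_right, mul_pow, mul_pow]
        field_simp
        ring
  have hem : Measurable e := ((hγ.continuous.measurable.sub_const _).pow_const j).inv
  have hhm : Measurable h := by
    refine Measurable.mul ?_ hγ.measurable_deriv
    exact (((hγ.continuous.measurable.sub_const _).pow_const _).const_mul _)
  have hint := (integral_triangle hγ.lt.le hhm.aestronglyMeasurable hem.aestronglyMeasurable hk
    hpow).1
  have hcont : Continuous fun s => (j : ℂ) * (γ s - γ a) ^ (j - 1) :=
    continuous_const.mul ((hγ.continuous.sub continuous_const).pow _)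
  have hhi : IntervalIntegrable h volume a b :=
    hγ.intervalIntegrable_mul_deriv (hcont.intervalIntegrable a b)
  refine (((leftPole (γ := γ) (n := n + 1) (j := j + 1) (by omega) c).add hγ
    ((cauchy (γ := γ) (n := n + 1) (j := j + 1) (by omega) hhi).const_mul
      (d * ((γ b - γ a) ^ j)⁻¹))).add hγ
    (cauchy (γ := γ) (n := n + 1) (j := j + 1) (by omega) hint)).of_eqOn fun z hz => ?_
  have hba : γ b - γ a ≠ 0 := sub_ne_zero.2 hγ.left_ne_right.symm
  have e1 := hγ.integral_sub_pow hz hj0 (right_mem_Icc.2 hγ.lt.le)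
  set g : ℝ → ℂ := fun s => ((γ s - z) ^ (j + 1))⁻¹ with hg
  obtain ⟨G, hG⟩ := isCompact_Icc.exists_bound_of_continuousOn
    (hγ.continuousOn_inv_sub_pow hz (j + 1))
  have hgm : Measurable g := ((hγ.continuous.measurable.sub_const _).pow_const _).inv
  have e2 := (integral_triangle (h := fun s => h s * g s)
    (C := G * (j * C₂ ^ (j - 1) * C₂ * (C₁ ^ j)⁻¹)) hγ.lt.le
    (hhm.mul hgm).aestronglyMeasurable hem.aestronglyMeasurable hk (fun s t hs hst htb => by
      rw [norm_mul]
      have h1 := hG s ⟨hs.le, hst.trans htb⟩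
      have h2 := hpow s t hs hst htb
      have h3 : 0 ≤ ‖h s‖ * ‖e t‖ * (t - a) :=
        mul_nonneg (by positivity) (by linarith)
      calc ‖h s‖ * ‖g s‖ * ‖e t‖ * (t - a) = ‖g s‖ * (‖h s‖ * ‖e t‖ * (t - a)) := by ring
        _ ≤ G * (j * C₂ ^ (j - 1) * C₂ * (C₁ ^ j)⁻¹) :=
          mul_le_mul h1 h2 h3 ((norm_nonneg _).trans h1))).2
  have e3 : ∫ t in a..b, k t * e t * ∫ s in a..t, h s * g s =
      (γ a - z)⁻¹ * ∫ t in a..b, k t * ((γ t - z) ^ j)⁻¹ := by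
    rw [← intervalIntegral.integral_const_mul]
    refine intervalIntegral.integral_congr_ae (Eventually.of_forall fun t ht => ?_)
    rw [uIoc_of_le hγ.lt.le] at ht
    rw [hγ.integral_sub_pow hz hj0 (Ioc_subset_Icc_self ht), he]
    have := hγ.sub_left_ne_zero ht
    field_simp
  have e4 : ∫ s in a..b, (h s * ∫ t in s..b, k t * e t) * ((γ s - z) ^ (j + 1))⁻¹ =
      ∫ s in a..b, h s * g s * ∫ t in s..b, k t * e t := by
    refine intervalIntegral.integral_congr fun s _ => ?_
    simp only [hg]
    ring
  rw [e4, ← e2, e3, e1]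
  have hp := BiLipArc.sub_ne_zero_of_notMem hz hγ.left_mem
  generalize (∫ t in a..b, k t * ((γ t - z) ^ j)⁻¹) = I
  field_simp
  ring

theorem div_right (hγ : BiLipArc γ a b C₁ C₂) (hf : HasForm γ a b n f) :
    HasForm γ a b (n + 1) fun z => (γ b - z)⁻¹ * f z := by
  have h1 := ((hf.reverse hγ).div_left hγ.reverse).reverse hγ.reverse
  simpa using h1

end HasForm
end ResolventCalculus

/-! ### Forms of the logarithm powers and of f_α -/

namespace ResolventCalculus

/-- The form of order one of `log(γ, ·) ^ k`. -/
noncomputable def logForm (γ : ℝ → ℂ) (N : ℂ → ℂ) (lam : ℝ → ℂ) (k : ℕ) : CurveForm where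
  left := fun j => if j = 0 ∧ k = 0 then 1 else 0
  right := 0
  density := fun j t => if j = 1 then ArcLog.density N lam k 0 t * deriv γ t else 0

/-- The representation of the powers `f_α` as Cauchy integrals. -/
structure JumpFactor (γ : ℝ → ℂ) (a b : ℝ) (lam : ℝ → ℂ) (N : ℂ → ℂ) : Prop where
  differentiable : Differentiable ℂ N
  int : ∀ m : ℤ, N m = 0
  curvePow_eq : ∀ α : ℂ, |α.re| < 1 → ∀ z ∉ γ '' Icc a b, curvePow γ a b α z =
    1 + N α * ∫ t in a..b, Complex.exp (α * lam t) * deriv γ t * (γ t - z)⁻¹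

section

variable {γ : ℝ → ℂ} {a b C₁ C₂ K : ℝ} {lam : ℝ → ℂ} {N : ℂ → ℂ} {n m : ℕ} {f : ℂ → ℂ}

theorem ArcLog.exists_jumpFactor (hl : ArcLog γ a b K lam) (hγ : BiLipArc γ a b C₁ C₂) :
    ∃ N, JumpFactor γ a b lam N := by
  obtain ⟨N, h1, h2, h3⟩ := hl.exists_jump hγ
  exact ⟨N, h1, h2, h3⟩

theorem JumpFactor.hasForm_one (hN : JumpFactor γ a b lam N) (hl : ArcLog γ a b K lam)
    (hγ : BiLipArc γ a b C₁ C₂) (k : ℕ) {β : ℂ} (hβ : |β.re| < 1) :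
    HasForm γ a b 1 fun z => curveLog γ a b z ^ k * curvePow γ a b β z := by
  refine ((HasForm.const (γ := γ) (n := 1) (if k = 0 then 1 else 0)).add hγ
    (HasForm.cauchy (j := 1) le_rfl (hγ.intervalIntegrable_mul_deriv
      (hl.intervalIntegrable_density hγ.lt N k hβ)))).of_eqOn fun z hz => ?_
  rw [hl.curveLog_pow_mul_curvePow hγ hN.differentiable hN.curvePow_eq k hβ hz]
  simp only [pow_one]

theorem JumpFactor.represents_logForm (hN : JumpFactor γ a b lam N) (hl : ArcLog γ a b K lam)
    (hγ : BiLipArc γ a b C₁ C₂) (k : ℕ) :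
    (logForm γ N lam k).Represents γ a b 1 fun z => curveLog γ a b z ^ k := by
  have h0 : |(0 : ℂ).re| < 1 := by simp
  refine ⟨fun j _ => ?_, fun z hz => ?_⟩
  · by_cases hj : j = 1
    · simpa [logForm, hj] using hγ.intervalIntegrable_mul_deriv
        (hl.intervalIntegrable_density hγ.lt N k h0)
    · simp only [logForm, if_neg hj]
      exact intervalIntegrable_const
  · have h1 := hl.curveLog_pow_mul_curvePow hγ hN.differentiable hN.curvePow_eq k h0 hz
    have h2 : curvePow γ a b 0 z = 1 := by simp [curvePow]
    rw [h2, mul_one] at h1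
    rw [h1]
    simp [CurveForm.apply, Finset.sum_range_succ, logForm, poleFam]

theorem exp_curveLog_left (hγ : BiLipArc γ a b C₁ C₂) {z : ℂ} (hz : z ∉ γ '' Icc a b) :
    Complex.exp (curveLog γ a b z) = 1 + (γ b - γ a) * (γ a - z)⁻¹ := by
  have hp := BiLipArc.sub_ne_zero_of_notMem hz hγ.left_mem
  rw [hγ.exp_curveLog hz]
  field_simp
  ring

theorem exp_neg_curveLog_right (hγ : BiLipArc γ a b C₁ C₂) {z : ℂ} (hz : z ∉ γ '' Icc a b) :
    Complex.exp (-curveLog γ a b z) = 1 + (γ a - γ b) * (γ b - z)⁻¹ := by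
  have hp := BiLipArc.sub_ne_zero_of_notMem hz hγ.left_mem
  have hq := BiLipArc.sub_ne_zero_of_notMem hz hγ.right_mem
  rw [Complex.exp_neg, hγ.exp_curveLog hz]
  field_simp
  ring

/-- Each factor exp(log(γ, z)) = 1 + (γ(b)-γ(a))/(γ(a)-z) costs one order. -/
theorem HasForm.exp_pow_mul (hγ : BiLipArc γ a b C₁ C₂) (hf : HasForm γ a b n f) (m : ℕ) :
    HasForm γ a b (n + m) fun z => Complex.exp (curveLog γ a b z) ^ m * f z := by
  induction m with
  | zero => simpa using hf
  | succ m ih =>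
    refine ((ih.of_le hγ (Nat.le_succ _)).add hγ ((ih.div_left hγ).const_mul
      (γ b - γ a))).of_eqOn fun z hz => ?_
    rw [pow_succ, exp_curveLog_left hγ hz]
    ring

theorem HasForm.exp_neg_pow_mul (hγ : BiLipArc γ a b C₁ C₂) (hf : HasForm γ a b n f) (m : ℕ) :
    HasForm γ a b (n + m) fun z => Complex.exp (-curveLog γ a b z) ^ m * f z := by
  induction m with
  | zero => simpa using hf
  | succ m ih =>
    refine ((ih.of_le hγ (Nat.le_succ _)).add hγ ((ih.div_right hγ).const_mul
      (γ a - γ b))).of_eqOn fun z hz => ?_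
    rw [pow_succ, exp_neg_curveLog_right hγ hz]
    ring

/-- The exponent is moved by the integer part m of |Re β| into the strip |Re| < 1, where order one
suffices; the m factors moved out raise the order to m + 1 ≤ n. -/
theorem JumpFactor.hasForm_of_abs_re_lt (hN : JumpFactor γ a b lam N) (hl : ArcLog γ a b K lam)
    (hγ : BiLipArc γ a b C₁ C₂) (k : ℕ) {β : ℂ} (hβ : |β.re| < n) :
    HasForm γ a b n fun z => curveLog γ a b z ^ k * curvePow γ a b β z := by
  have hm : ∃ m : ℕ, m + 1 ≤ n ∧ 0 ≤ |β.re| - m ∧ |β.re| - m < 1 := by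
    refine ⟨⌊|β.re|⌋₊, (Nat.floor_lt (abs_nonneg _)).2 hβ, sub_nonneg.2 (Nat.floor_le (abs_nonneg _)),
      ?_⟩
    linarith [Nat.lt_floor_add_one |β.re|]
  obtain ⟨m, hmn, hm0, hm1⟩ := hm
  rcases le_total 0 β.re with h0 | h0
  · rw [abs_of_nonneg h0] at hm0 hm1
    have h1 := (hN.hasForm_one hl hγ k (β := β - m) (by
      rw [Complex.sub_re, Complex.natCast_re, abs_of_nonneg hm0]; exact hm1)).exp_pow_mul hγ m
    refine (h1.of_le hγ (by omega)).of_eqOn fun z _ => ?_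
    rw [← Complex.exp_nat_mul, mul_left_comm, curvePow, curvePow, ← Complex.exp_add]
    ring_nf
  · rw [abs_of_nonpos h0] at hm0 hm1
    have h1 := (hN.hasForm_one hl hγ k (β := β + m) (by
      rw [Complex.add_re, Complex.natCast_re, abs_of_nonpos (by linarith)]
      linarith)).exp_neg_pow_mul hγ m
    refine (h1.of_le hγ (by omega)).of_eqOn fun z _ => ?_
    rw [← Complex.exp_nat_mul, mul_left_comm, curvePow, curvePow, ← Complex.exp_add]
    ring_nf

/-- At the excluded exponents ±n the function is a power of exp(±log(γ, z)) times the constant 1, a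
form of order zero, so the order is exactly n. -/
theorem JumpFactor.hasForm_curvePow (hN : JumpFactor γ a b lam N) (hl : ArcLog γ a b K lam)
    (hγ : BiLipArc γ a b C₁ C₂) {α : ℂ} (hα : α ∈ openDisc n ∪ realInterval n) :
    HasForm γ a b n (curvePow γ a b α) := by
  have key : |α.re| < n → HasForm γ a b n (curvePow γ a b α) := fun h => by
    simpa using hN.hasForm_of_abs_re_lt hl hγ 0 h
  rcases hα with hα | ⟨hα0, hα⟩
  · exact key ((Complex.abs_re_le_norm α).trans_lt hα)
  rcases hα.lt_or_eq with h | h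
  · exact key h
  have hre : α = α.re := by
    apply Complex.ext
    · simp
    · simpa using hα0
  rcases abs_cases α.re with ⟨h1, _⟩ | ⟨h1, _⟩
  · have h2 := (HasForm.const (γ := γ) (a := a) (b := b) (n := 0) 1).exp_pow_mul hγ n
    rw [zero_add] at h2
    refine h2.of_eqOn fun z _ => ?_
    rw [mul_one, ← Complex.exp_nat_mul, curvePow, hre, ← h1, h]
    simp
  · have h2 := (HasForm.const (γ := γ) (a := a) (b := b) (n := 0) 1).exp_neg_pow_mul hγ n
    rw [zero_add] at h2
    refine h2.of_eqOn fun z _ => ?_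
    have h3 : α.re = -n := by linarith
    rw [mul_one, ← Complex.exp_nat_mul, curvePow, hre, h3]
    simp

end
end ResolventCalculus

/-! ### Taylor tails and the incomplete Gamma integral -/

namespace ResolventCalculus

/-- The series sums to N(α) = 0, so a partial sum is minus a tail. The ratio 1/2 comes from
convergence of the same series at 2α. -/
theorem exists_norm_sum_taylor_le {N : ℂ → ℂ} (hN : Differentiable ℂ N) {α : ℂ} (hα : N α = 0) :
    ∃ C, 0 ≤ C ∧ ∀ m : ℕ, ‖∑ j ∈ Finset.range m, α ^ j / (j.factorial : ℂ) * iteratedDeriv j N 0‖ ≤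
      C * (1 / 2) ^ m := by
  set ν : ℕ → ℂ := fun j => α ^ j / (j.factorial : ℂ) * iteratedDeriv j N 0 with hν
  have h2 : Summable fun j => (2 : ℂ) ^ j * ν j := by
    refine (Complex.hasSum_taylorSeries_of_entire hN 0 (2 * α)).summable.congr fun j => ?_
    simp only [hν, sub_zero, smul_eq_mul, mul_pow]
    ring
  have h1 : HasSum ν 0 := by
    rw [← hα]
    refine (Complex.hasSum_taylorSeries_of_entire hN 0 α).congr_fun fun j => ?_
    simp only [hν, sub_zero, smul_eq_mul]
    ring
  obtain ⟨C, hC⟩ := h2.tendsto_atTop_zero.norm.bddAbove_range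
  have hC' : ∀ j, ‖ν j‖ ≤ C * (1 / 2) ^ j := fun j => by
    have := hC (mem_range_self j)
    simp only [norm_mul, norm_pow, Complex.norm_ofNat] at this
    rw [one_div, inv_pow, ← div_eq_mul_inv, le_div_iff₀ (by positivity)]
    linarith
  have hC0 : 0 ≤ C := by simpa using (norm_nonneg _).trans (hC' 0)
  refine ⟨2 * C, by positivity, fun m => ?_⟩
  have h3 := h1.summable.sum_add_tsum_nat_add m
  rw [h1.tsum_eq] at h3
  rw [eq_neg_of_add_eq_zero_left h3, norm_neg]
  have h4 : HasSum (fun j => C * (1 / 2) ^ m * (1 / 2 : ℝ) ^ j) (C * (1 / 2) ^ m * 2) :=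
    hasSum_geometric_two.mul_left _
  refine (tsum_of_norm_bounded h4 fun j => ?_).trans_eq (by ring)
  rw [mul_assoc, ← pow_add, add_comm m]
  exact hC' _

theorem hasDerivAt_sum_pow_div_factorial (i : ℕ) (y : ℝ) :
    HasDerivAt (fun y : ℝ => ∑ l ∈ Finset.range (i + 1), y ^ l / l.factorial)
      (∑ l ∈ Finset.range (i + 1), y ^ l / l.factorial - y ^ i / i.factorial) y := by
  induction i with
  | zero => simpa using hasDerivAt_const y (1 : ℝ)
  | succ i ih =>
    simp only [Finset.sum_range_succ _ (i + 1)]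
    rw [add_sub_cancel_right]
    have h := ih.add ((hasDerivAt_pow (i + 1) y).div_const ((i + 1).factorial : ℝ))
    refine h.congr_deriv ?_
    rw [Nat.factorial_succ]
    push_cast
    field_simp
    simp

/-- The incomplete Gamma integral, in logarithmic coordinates. -/
theorem integral_pow_mul_log_pow_le {n : ℕ} (hn : 1 ≤ n) {c L : ℝ} (hc : 0 < c)
    (hL : Real.log c ≤ L) (i : ℕ) :
    IntervalIntegrable (fun x => x ^ (n - 1) * ((n * (L - Real.log x)) ^ i / i.factorial))
      volume 0 c ∧
    ∫ x in (0 : ℝ)..c, x ^ (n - 1) * ((n * (L - Real.log x)) ^ i / i.factorial) ≤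
      Real.exp (n * L) / n := by
  have hn0 : (0 : ℝ) < n := by exact_mod_cast hn
  set y : ℝ → ℝ := fun x => n * (L - Real.log x) with hy
  set E : ℝ → ℝ := fun y => ∑ l ∈ Finset.range (i + 1), y ^ l / l.factorial with hE
  -- P is a primitive of the integrand, because the truncated exponential satisfies E' = E - yⁱ/i!.
  -- From E(y) ≤ e^y and xⁿ = e^{nL}e^{-y} follows a bound that does not depend on i.
  set P : ℝ → ℝ := fun x => x ^ n / n * E (y x) with hP
  have hy0 : ∀ x ∈ Ioc 0 c, 0 ≤ y x := fun x hx =>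
    mul_nonneg hn0.le (sub_nonneg.2 ((Real.log_le_log hx.1 hx.2).trans hL))
  have hexp : ∀ x, 0 < x → x ^ n = Real.exp (n * L) * Real.exp (-y x) := fun x hx => by
    rw [← Real.exp_add, hy, show n * L + -(n * (L - Real.log x)) = n * Real.log x by ring,
      Real.exp_nat_mul, Real.exp_log hx]
  have hd : ∀ x ∈ Ioo 0 c, HasDerivAt P (x ^ (n - 1) * ((y x) ^ i / i.factorial)) x := by
    intro x hx
    have h1 : HasDerivAt y (n * (0 - x⁻¹)) x :=
      (((hasDerivAt_const x L).sub (Real.hasDerivAt_log hx.1.ne')).const_mul _)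
    have h2 := ((hasDerivAt_pow n x).div_const (n : ℝ)).mul
      ((hasDerivAt_sum_pow_div_factorial i (y x)).comp x h1)
    refine h2.congr_deriv ?_
    obtain ⟨m, rfl⟩ : ∃ m, n = m + 1 := ⟨n - 1, by omega⟩
    have hx0 := hx.1.ne'
    simp only [add_tsub_cancel_right]
    change _ * E (y x) + _ * ((E (y x) - _) * _) = _
    generalize E (y x) = e
    generalize y x = w
    have : ((m + 1 : ℕ) : ℝ) ≠ 0 := by positivity
    field_simp
    ring
  have hPc : ContinuousOn P (Icc 0 c) := by
    intro x hx
    rcases hx.1.eq_or_lt with rfl | h0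
    · have hP0 : P 0 = 0 := by simp [hP, show n ≠ 0 by omega]
      rw [← continuousWithinAt_diff_self, Icc_diff_left]
      refine (?_ : ContinuousWithinAt P (Ioc 0 c) 0)
      rw [ContinuousWithinAt, hP0]
      have hlim : Tendsto (fun x => 2 ^ i * Real.exp (n * L) / n *
          Real.exp (-(n * L / 2)) * Real.exp (n / 2 * Real.log x)) (𝓝[Ioc 0 c] 0) (𝓝 0) := by
        have h1 : Tendsto (fun x => n / 2 * Real.log x) (𝓝[Ioc 0 c] 0) atBot :=
          (Real.tendsto_log_nhdsGT_zero.mono_left (nhdsWithin_mono _ fun x hx => hx.1)).const_mul_atBot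
            (by positivity)
        simpa using (Real.tendsto_exp_atBot.comp h1).const_mul
          (2 ^ i * Real.exp (n * L) / n * Real.exp (-(n * L / 2)))
      refine squeeze_zero' ?_ ?_ hlim
      · filter_upwards [self_mem_nhdsWithin] with x hx
        exact mul_nonneg (div_nonneg (pow_nonneg hx.1.le _) hn0.le)
          (Finset.sum_nonneg fun l _ => div_nonneg (pow_nonneg (hy0 x hx) _) (by positivity))
      · filter_upwards [self_mem_nhdsWithin] with x hx
        -- Spending only half of the decay e^{-y} leaves a factor tending to zero as x → 0, hence
        -- continuity of P at 0.
        have h1 : E (y x) ≤ 2 ^ i * Real.exp (y x / 2) := by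
          have h2 := Real.sum_le_exp_of_nonneg (x := y x / 2) (by linarith [hy0 x hx]) (i + 1)
          refine le_trans ?_ (mul_le_mul_of_nonneg_left h2 (by positivity))
          rw [Finset.mul_sum]
          refine Finset.sum_le_sum fun l hl => ?_
          have h3 : (2 : ℝ) ^ l ≤ 2 ^ i :=
            pow_le_pow_right₀ (by norm_num) (Nat.lt_succ_iff.1 (Finset.mem_range.1 hl))
          have h4 : 0 ≤ (y x / 2) ^ l / l.factorial :=
            div_nonneg (pow_nonneg (by linarith [hy0 x hx]) _) (by positivity)
          calc y x ^ l / l.factorial = 2 ^ l * ((y x / 2) ^ l / l.factorial) := by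
                rw [div_pow]; field_simp
            _ ≤ _ := mul_le_mul_of_nonneg_right h3 h4
        calc P x ≤ x ^ n / n * (2 ^ i * Real.exp (y x / 2)) :=
              mul_le_mul_of_nonneg_left h1 (div_nonneg (pow_nonneg hx.1.le _) hn0.le)
          _ = 2 ^ i * Real.exp (n * L) / n * (Real.exp (-y x) * Real.exp (y x / 2)) := by
              rw [hexp x hx.1]; ring
          _ = _ := by
              rw [← Real.exp_add, mul_assoc, ← Real.exp_add]
              congr 2
              rw [hy]
              ring
    · have h1 : ContinuousAt y x :=
        continuousAt_const.mul (continuousAt_const.sub (Real.continuousAt_log h0.ne'))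
      have h2 : Continuous E := by fun_prop
      exact (((continuousAt_id.pow n).div_const _).mul
        (h2.continuousAt.comp h1)).continuousWithinAt
  have hnn : ∀ x ∈ Ioo 0 c, 0 ≤ x ^ (n - 1) * ((y x) ^ i / i.factorial) := fun x hx =>
    mul_nonneg (pow_nonneg hx.1.le _)
      (div_nonneg (pow_nonneg (hy0 x ⟨hx.1, hx.2.le⟩) _) (by positivity))
  have hint : IntervalIntegrable (fun x => x ^ (n - 1) * ((y x) ^ i / i.factorial)) volume 0 c :=
    (intervalIntegrable_iff_integrableOn_Ioc_of_le hc.le).2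
      (intervalIntegral.integrableOn_deriv_of_nonneg hPc hd hnn)
  refine ⟨hint, ?_⟩
  rw [intervalIntegral.integral_eq_sub_of_hasDerivAt_of_le hc.le hPc hd hint]
  have hP0 : P 0 = 0 := by simp [hP, show n ≠ 0 by omega]
  rw [hP0, sub_zero]
  have h1 : E (y c) ≤ Real.exp (y c) := Real.sum_le_exp_of_nonneg (hy0 c ⟨hc, le_rfl⟩) _
  calc P c ≤ c ^ n / n * Real.exp (y c) := mul_le_mul_of_nonneg_left h1 (by positivity)
    _ = Real.exp (n * L) / n * (Real.exp (-y c) * Real.exp (y c)) := by rw [hexp c hc]; ring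
    _ = Real.exp (n * L) / n := by rw [← Real.exp_add]; simp

end ResolventCalculus

/-! ### Densities of the partial sums of the exponential series -/

namespace ResolventCalculus
namespace ArcLog

variable {γ : ℝ → ℂ} {a b C₁ C₂ K : ℝ} {lam : ℝ → ℂ} {N : ℂ → ℂ} {n : ℕ}

/-- The borderline estimate. Summing over i leads to the majorant (t-a)⁻ⁿ(b-t)⁻ⁿ up to a constant,
which the weight of exponent n - 1 just fails to make integrable; each single term of the
exponential series, however, has a weighted integral bounded independently of i. -/
theorem exists_integral_pow_le (hl : ArcLog γ a b K lam) (hab : a < b) (hn : 1 ≤ n) :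
    ∃ D, 0 ≤ D ∧ ∀ i : ℕ, IntervalIntegrable (fun t => ((t - a) * (b - t)) ^ (n - 1) *
        ((n * ‖lam t‖) ^ i / i.factorial)) volume a b ∧
      ∫ t in a..b, ((t - a) * (b - t)) ^ (n - 1) * ((n * ‖lam t‖) ^ i / i.factorial) ≤ D := by
  have hc : 0 < b - a := sub_pos.2 hab
  -- Near one endpoint the logarithm at the other is bounded through the first entry; the second
  -- makes L - log x nonnegative on the whole interval.
  set L := max (K - Real.log ((b - a) / 2)) (Real.log (b - a)) with hL
  set W : ℕ → ℝ → ℝ := fun i x => x ^ (n - 1) * ((n * (L - Real.log x)) ^ i / i.factorial) with hW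
  have hw := fun i => integral_pow_mul_log_pow_le hn hc (le_max_right _ _ : Real.log (b - a) ≤ L) i
  have hw0 : ∀ i, ∀ x ∈ Ioo 0 (b - a), 0 ≤ W i x := fun i x hx => by
    have : 0 ≤ L - Real.log x :=
      sub_nonneg.2 ((Real.log_le_log hx.1 hx.2.le).trans (le_max_right _ _))
    have hx0 := hx.1.le
    positivity
  have hleft : ∀ x y, 0 < x → (b - a) / 2 ≤ y → y ≤ b - a → ∀ i, ∀ s ≥ 0,
      s ≤ K - Real.log x - Real.log y → (x * y) ^ (n - 1) * ((n * s) ^ i / i.factorial) ≤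
        (b - a) ^ (n - 1) * W i x := by
    intro x y hx hy hyb i s hs hsx
    have h1 : s ≤ L - Real.log x := by
      have h2 := Real.log_le_log (by linarith) hy
      have h3 := le_max_left (K - Real.log ((b - a) / 2)) (Real.log (b - a))
      linarith
    have hy0 : 0 ≤ y := by linarith
    calc (x * y) ^ (n - 1) * ((n * s) ^ i / i.factorial)
        ≤ (x * (b - a)) ^ (n - 1) * ((n * (L - Real.log x)) ^ i / i.factorial) := by gcongr
      _ = _ := by rw [hW, mul_pow]; ring
  have i1 : ∀ i, IntervalIntegrable (fun t => W i (t - a)) volume a b := fun i => by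
    simpa using (hw i).1.comp_sub_right a
  have i2 : ∀ i, IntervalIntegrable (fun t => W i (b - t)) volume a b := fun i => by
    simpa using ((hw i).1.comp_sub_left b).symm
  have e1 : ∀ i, ∫ t in a..b, W i (t - a) = ∫ x in (0 : ℝ)..(b - a), W i x := fun i => by
    rw [intervalIntegral.integral_comp_sub_right, sub_self]
  have e2 : ∀ i, ∫ t in a..b, W i (b - t) = ∫ x in (0 : ℝ)..(b - a), W i x := fun i => by
    rw [intervalIntegral.integral_comp_sub_left, sub_self]
  have hbd : ∀ i, ∀ t ∈ Ioo a b, ((t - a) * (b - t)) ^ (n - 1) *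
      ((n * ‖lam t‖) ^ i / i.factorial) ≤ (b - a) ^ (n - 1) * (W i (t - a) + W i (b - t)) := by
    intro i t ht
    have h1 := hw0 i (t - a) ⟨by linarith [ht.1], by linarith [ht.2]⟩
    have h2 := hw0 i (b - t) ⟨by linarith [ht.2], by linarith [ht.1]⟩
    have hp : 0 ≤ (b - a) ^ (n - 1) := pow_nonneg hc.le _
    have hlam := hl.norm_le t ht
    rcases le_total t ((a + b) / 2) with h | h
    · refine (hleft (t - a) (b - t) (by linarith [ht.1]) (by linarith) (by linarith [ht.1]) i
        _ (norm_nonneg (lam t)) hlam).trans ?_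
      exact mul_le_mul_of_nonneg_left (by linarith) hp
    · rw [mul_comm (t - a)]
      refine (hleft (b - t) (t - a) (by linarith [ht.2]) (by linarith) (by linarith [ht.2]) i
        _ (norm_nonneg (lam t)) (by linarith)).trans ?_
      exact mul_le_mul_of_nonneg_left (by linarith) hp
  have hnn : ∀ i, ∀ t ∈ Ioo a b, 0 ≤ ((t - a) * (b - t)) ^ (n - 1) *
      ((n * ‖lam t‖) ^ i / i.factorial) := fun i t ht => by
    have h1 : 0 ≤ t - a := by linarith [ht.1]
    have h2 : 0 ≤ b - t := by linarith [ht.2]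
    positivity
  have hint : ∀ i : ℕ, IntervalIntegrable (fun t => ((t - a) * (b - t)) ^ (n - 1) *
      ((n * ‖lam t‖) ^ i / i.factorial)) volume a b := fun i => by
    refine (((i1 i).add (i2 i)).const_mul ((b - a) ^ (n - 1))).mono_fun ?_ ?_
    · have h1 := ((hl.aestronglyMeasurable hab.le).norm.const_mul (n : ℝ)).pow i
      refine AEStronglyMeasurable.mul ?_ (h1.mul_const _)
      exact Continuous.aestronglyMeasurable (by fun_prop)
    · refine (ae_restrict_iff' measurableSet_uIoc).2 ?_
      filter_upwards [ae_mem_Ioo_of_mem_uIoc hab.le] with t ht hm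
      rw [Real.norm_of_nonneg (hnn i t (ht hm))]
      exact (hbd i t (ht hm)).trans (le_abs_self _)
  refine ⟨(b - a) ^ (n - 1) * (Real.exp (n * L) / n + Real.exp (n * L) / n), by positivity,
    fun i => ⟨hint i, ?_⟩⟩
  refine (intervalIntegral.integral_mono_on_of_le_Ioo hab.le (hint i)
    (((i1 i).add (i2 i)).const_mul ((b - a) ^ (n - 1))) (hbd i)).trans ?_
  rw [intervalIntegral.integral_const_mul, intervalIntegral.integral_add (i1 i) (i2 i), e1, e2]
  exact mul_le_mul_of_nonneg_left (add_le_add (hw i).2 (hw i).2) (by positivity)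

/-- The densities of the partial sums of the exponential series. -/
noncomputable def expDensity (N : ℂ → ℂ) (lam : ℝ → ℂ) (α : ℂ) (k : ℕ) (t : ℝ) : ℂ :=
  ∑ i ∈ Finset.range k, α ^ i / (i.factorial : ℂ) * density N lam i 0 t

/-- A truncated Cauchy product of e^{αλ} with the Taylor series of N at 0, grouped by powers of λ so
that the inner sums are Taylor partial sums of N at α, the quantities that decay when N(α) = 0. -/
theorem expDensity_eq (N : ℂ → ℂ) (lam : ℝ → ℂ) (α : ℂ) (k : ℕ) (t : ℝ) :
    expDensity N lam α k t = ∑ i ∈ Finset.range k, (α * lam t) ^ i / (i.factorial : ℂ) *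
      ∑ j ∈ Finset.range (k - i), α ^ j / (j.factorial : ℂ) * iteratedDeriv j N 0 := by
  simp only [Finset.mul_sum]
  rw [← Finset.sum_range_diag_flip k fun i j => (α * lam t) ^ i / (i.factorial : ℂ) *
    (α ^ j / (j.factorial : ℂ) * iteratedDeriv j N 0), expDensity]
  refine Finset.sum_congr rfl fun m _ => ?_
  rw [density, ← Finset.Nat.sum_antidiagonal_swap, Finset.Nat.sum_antidiagonal_eq_sum_range_succ_mk,
    Finset.mul_sum]
  refine Finset.sum_congr rfl fun i hi => ?_
  have him : i ≤ m := Nat.lt_succ_iff.1 (Finset.mem_range.1 hi)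
  simp only [Prod.fst_swap, Prod.snd_swap, zero_mul, Complex.exp_zero, mul_one]
  rw [Nat.choose_symm him, Nat.cast_choose ℂ him]
  have h1 : (m.factorial : ℂ) ≠ 0 := by exact_mod_cast m.factorial_ne_zero
  have h2 : α ^ m = α ^ i * α ^ (m - i) := by rw [← pow_add, Nat.add_sub_cancel' him]
  rw [h2, mul_pow]
  field_simp

theorem intervalIntegrable_expDensity (hl : ArcLog γ a b K lam) (hab : a < b) (N : ℂ → ℂ) (α : ℂ)
    (k : ℕ) : IntervalIntegrable (expDensity N lam α k) volume a b := by
  refine (IntervalIntegrable.sum (Finset.range k) fun i _ =>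
    (hl.intervalIntegrable_density hab N i (β := 0) (by simp)).const_mul
      (α ^ i / (i.factorial : ℂ))).congr fun t _ => ?_
  simp [expDensity]

theorem exists_norm_expDensity_le {α : ℂ} (hα : ‖α‖ = n) (hN : Differentiable ℂ N) (hNα : N α = 0)
    (lam : ℝ → ℂ) : ∃ C, 0 ≤ C ∧ ∀ k t, ‖expDensity N lam α k t‖ ≤
      ∑ i ∈ Finset.range k, (n * ‖lam t‖) ^ i / i.factorial * (C * (1 / 2) ^ (k - i)) := by
  obtain ⟨C, hC0, hC⟩ := exists_norm_sum_taylor_le hN hNα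
  refine ⟨C, hC0, fun k t => ?_⟩
  rw [expDensity_eq]
  refine (norm_sum_le _ _).trans (Finset.sum_le_sum fun i _ => ?_)
  rw [norm_mul, norm_div, norm_pow, norm_mul, hα, Complex.norm_natCast]
  exact mul_le_mul_of_nonneg_left (hC _) (by positivity)

/-- A convolution of a bounded sequence (the weighted moments) with a geometric one (the Taylor
partial sums) is bounded. -/
theorem exists_integral_expDensity_le (hl : ArcLog γ a b K lam) (hab : a < b) (hn : 1 ≤ n) {α : ℂ}
    (hα : ‖α‖ = n) (hN : Differentiable ℂ N) (hNα : N α = 0) :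
    ∃ D, 0 ≤ D ∧ ∀ k, ∫ t in a..b, ((t - a) * (b - t)) ^ (n - 1) * ‖expDensity N lam α k t‖ ≤ D := by
  obtain ⟨C, hC0, hC⟩ := exists_norm_expDensity_le hα hN hNα lam
  obtain ⟨D, hD0, hD⟩ := hl.exists_integral_pow_le hab hn
  refine ⟨2 * (C * D), by positivity, fun k => ?_⟩
  have hsum : ∑ i ∈ Finset.range k, (1 / 2 : ℝ) ^ (k - i) ≤ 2 := by
    have h1 : ∑ i ∈ Finset.range k, (1 / 2 : ℝ) ^ (k - i) ≤
        ∑ i ∈ Finset.range (k + 1), (1 / 2 : ℝ) ^ (k - i) :=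
      Finset.sum_le_sum_of_subset_of_nonneg (Finset.range_mono (Nat.le_succ k))
        fun _ _ _ => by positivity
    refine h1.trans ?_
    rw [Finset.sum_flip fun i => (1 / 2 : ℝ) ^ i]
    exact sum_geometric_two_le _
  have hint : ∀ i ∈ Finset.range k, IntervalIntegrable (fun t => C * (1 / 2) ^ (k - i) *
      (((t - a) * (b - t)) ^ (n - 1) * ((n * ‖lam t‖) ^ i / i.factorial))) volume a b :=
    fun i _ => (hD i).1.const_mul _
  have hcont : Continuous fun t : ℝ => ((t - a) * (b - t)) ^ (n - 1) := by fun_prop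
  have h1 := intervalIntegral.integral_mono_on_of_le_Ioo hab.le
    (f := fun t => ((t - a) * (b - t)) ^ (n - 1) * ‖expDensity N lam α k t‖)
    (g := fun t => ∑ i ∈ Finset.range k, C * (1 / 2) ^ (k - i) *
      (((t - a) * (b - t)) ^ (n - 1) * ((n * ‖lam t‖) ^ i / i.factorial)))
    ((hl.intervalIntegrable_expDensity hab N α k).norm.continuousOn_mul hcont.continuousOn)
    ((IntervalIntegrable.sum _ hint).congr fun t _ => by simp) fun t ht => ?_
  · refine h1.trans ?_
    rw [intervalIntegral.integral_finsetSum hint]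
    calc _ ≤ ∑ i ∈ Finset.range k, C * (1 / 2) ^ (k - i) * D := by
          refine Finset.sum_le_sum fun i _ => ?_
          rw [intervalIntegral.integral_const_mul]
          exact mul_le_mul_of_nonneg_left (hD i).2 (by positivity)
      _ = (C * D) * ∑ i ∈ Finset.range k, (1 / 2 : ℝ) ^ (k - i) := by
          rw [Finset.mul_sum]
          exact Finset.sum_congr rfl fun i _ => by ring
      _ ≤ (C * D) * 2 := mul_le_mul_of_nonneg_left hsum (by positivity)
      _ = _ := by ring
  · have h2 : 0 ≤ (t - a) * (b - t) := mul_nonneg (by linarith [ht.1]) (by linarith [ht.2])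
    refine (mul_le_mul_of_nonneg_left (hC k t) (pow_nonneg h2 _)).trans_eq ?_
    rw [Finset.mul_sum]
    exact Finset.sum_congr rfl fun i _ => by ring

/-- Away from the endpoints the logarithm is bounded by X. The factor 2ⁱ lost in (1/2)^{k-i} is then
absorbed by the exponential series, leaving the full decay (1/2)^k. -/
theorem exists_expDensity_le_of_compact (hl : ArcLog γ a b K lam) {α : ℂ}
    (hα : ‖α‖ = n) (hN : Differentiable ℂ N) (hNα : N α = 0) {δ : ℝ} (hδ : 0 < δ) :
    ∃ C, 0 ≤ C ∧ ∀ k, ∀ t ∈ Icc (a + δ) (b - δ), ‖expDensity N lam α k t‖ ≤ C * (1 / 2) ^ k := by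
  obtain ⟨C, hC0, hC⟩ := exists_norm_expDensity_le hα hN hNα lam
  set X := K - Real.log δ - Real.log δ with hX
  refine ⟨C * Real.exp (2 * (n * X)), by positivity, fun k t ht => ?_⟩
  have hlam : ‖lam t‖ ≤ X := by
    have h1 := hl.norm_le t ⟨by linarith [ht.1], by linarith [ht.2]⟩
    have h2 := Real.log_le_log hδ (show δ ≤ t - a by linarith [ht.1])
    have h3 := Real.log_le_log hδ (show δ ≤ b - t by linarith [ht.2])
    linarith
  have hX0 : 0 ≤ X := (norm_nonneg _).trans hlam
  refine (hC k t).trans ?_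
  calc _ ≤ ∑ i ∈ Finset.range k, C * (1 / 2) ^ k * ((2 * (n * X)) ^ i / i.factorial) := by
        refine Finset.sum_le_sum fun i hi => ?_
        have h1 : (1 / 2 : ℝ) ^ (k - i) = (1 / 2) ^ k * 2 ^ i := by
          have h2 : (1 / 2 : ℝ) ^ k = (1 / 2) ^ (k - i) * (1 / 2) ^ i := by
            rw [← pow_add, Nat.sub_add_cancel (Finset.mem_range.1 hi).le]
          rw [h2, mul_assoc, ← mul_pow]
          norm_num
        rw [h1, mul_pow 2]
        calc _ ≤ (n * X) ^ i / i.factorial * (C * ((1 / 2) ^ k * 2 ^ i)) := by gcongr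
          _ = _ := by ring
    _ = C * (1 / 2) ^ k * ∑ i ∈ Finset.range k, (2 * (n * X)) ^ i / i.factorial := by
        rw [Finset.mul_sum]
    _ ≤ C * (1 / 2) ^ k * Real.exp (2 * (n * X)) :=
        mul_le_mul_of_nonneg_left (Real.sum_le_exp_of_nonneg (by positivity) k) (by positivity)
    _ = _ := by ring

/-- The densities tend to zero when tested against functions that are flat at the endpoints. -/
theorem exists_norm_integral_expDensity_le (hl : ArcLog γ a b K lam) (hγ : BiLipArc γ a b C₁ C₂)
    (hn : 1 ≤ n) {α : ℂ} (hα : ‖α‖ = n) (hN : Differentiable ℂ N) (hNα : N α = 0) :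
    ∃ D, 0 ≤ D ∧ ∀ δ, 0 < δ → ∃ C, 0 ≤ C ∧ ∀ (h : ℝ → ℂ) (ε M : ℝ), 0 ≤ ε → 0 ≤ M →
      (∀ t ∈ Ioo a b, ‖h t‖ ≤ M) →
      (∀ t ∈ Ioo a b, t < a + δ ∨ b - δ < t → ‖h t‖ ≤ ε * ((t - a) * (b - t)) ^ (n - 1)) →
      ∀ k, ‖∫ t in a..b, expDensity N lam α k t * deriv γ t * h t‖ ≤ D * ε + C * M * (1 / 2) ^ k := by
  have hab := hγ.lt
  obtain ⟨D, hD0, hD⟩ := hl.exists_integral_expDensity_le hab hn hα hN hNα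
  have hC2 := hγ.pos₂.le
  refine ⟨C₂ * D, by positivity, fun δ hδ => ?_⟩
  obtain ⟨C, hC0, hC⟩ := hl.exists_expDensity_le_of_compact hα hN hNα hδ
  refine ⟨C * C₂ * (b - a), mul_nonneg (by positivity) (sub_nonneg.2 hab.le),
    fun h ε M hε hM hhM hhε k => ?_⟩
  have hcont : Continuous fun t : ℝ => ((t - a) * (b - t)) ^ (n - 1) := by fun_prop
  have hi : IntervalIntegrable (fun t => ((t - a) * (b - t)) ^ (n - 1) *
      ‖expDensity N lam α k t‖) volume a b :=
    (hl.intervalIntegrable_expDensity hab N α k).norm.continuousOn_mul hcont.continuousOn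
  have hg : IntervalIntegrable (fun t => C₂ * ε * (((t - a) * (b - t)) ^ (n - 1) *
      ‖expDensity N lam α k t‖) + C * (1 / 2) ^ k * C₂ * M) volume a b :=
    (hi.const_mul _).add intervalIntegrable_const
  have h1 := intervalIntegral.norm_integral_le_of_norm_le hab.le
    (f := fun t => expDensity N lam α k t * deriv γ t * h t)
    (g := fun t => C₂ * ε * (((t - a) * (b - t)) ^ (n - 1) * ‖expDensity N lam α k t‖) +
      C * (1 / 2) ^ k * C₂ * M) ?_ hg
  · refine h1.trans ?_
    rw [intervalIntegral.integral_add (hi.const_mul _) intervalIntegrable_const,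
      intervalIntegral.integral_const_mul, intervalIntegral.integral_const, smul_eq_mul]
    have h2 := mul_le_mul_of_nonneg_left (hD k) (mul_nonneg hC2 hε)
    linarith
  · filter_upwards [ae_mem_Ioo_of_mem_uIoc hab.le] with t ht hm
    have ht := ht (by rwa [uIoc_of_le hab.le])
    have hw : 0 ≤ ((t - a) * (b - t)) ^ (n - 1) :=
      pow_nonneg (mul_nonneg (by linarith [ht.1]) (by linarith [ht.2])) _
    rw [norm_mul, norm_mul]
    have hd := hγ.norm_deriv_le t
    by_cases hs : t < a + δ ∨ b - δ < t
    · have h2 := hhε t ht hs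
      calc ‖expDensity N lam α k t‖ * ‖deriv γ t‖ * ‖h t‖
          ≤ ‖expDensity N lam α k t‖ * C₂ * (ε * ((t - a) * (b - t)) ^ (n - 1)) := by gcongr
        _ ≤ C₂ * ε * (((t - a) * (b - t)) ^ (n - 1) * ‖expDensity N lam α k t‖) +
            C * (1 / 2) ^ k * C₂ * M := by
          have : 0 ≤ C * (1 / 2) ^ k * C₂ * M := by positivity
          linarith
    · push Not at hs
      have h2 := hC k t ⟨hs.1, hs.2⟩
      have h3 := hhM t ht
      calc ‖expDensity N lam α k t‖ * ‖deriv γ t‖ * ‖h t‖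
          ≤ C * (1 / 2) ^ k * C₂ * M := by gcongr
        _ ≤ _ := le_add_of_nonneg_left (by positivity)

end ArcLog
end ResolventCalculus

/-! ### Families flat at the endpoints, and reduction to them -/

namespace ResolventCalculus

section Flat

variable {V : Type*} [AddCommGroup V] [Module ℂ V] [TopologicalSpace V] {n : ℕ} {Γ : Set ℂ}
  {φ : Multiset ℂ → V}

/-- The family vanishes to order `n` at `p`. -/
def IsFlatAt (n : ℕ) (φ : Multiset ℂ → V) (p : ℂ) : Prop :=
  ∀ i < n, φ (Multiset.replicate (i + 1) p) = 0

/-- The resolvent equation between p^{j+1} and (p^j,w) has one vanishing term, so each use extracts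
a factor p - w. -/
theorem ResFam.eq_pow_smul_of_flat (h : ResFam n Γ φ) {p : ℂ} (hp : p ∈ Γ) (h0 : IsFlatAt n φ p)
    {w : ℂ} (hw : w ∈ Γ) {j : ℕ} (hj : j + 1 ≤ n) : φ (Multiset.replicate 1 w) =
      (p - w) ^ j • φ (Multiset.replicate j p + Multiset.replicate 1 w) := by
  induction j with
  | zero => simp
  | succ j ih =>
    rw [ih (by omega)]
    have h1 := h.sub_eq (Multiset.replicate j p) p w (by simp; omega)
      (fun x hx => by rwa [Multiset.eq_of_mem_replicate hx]) hp hw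
    rw [← Multiset.replicate_succ, h0 j (by omega), zero_sub] at h1
    have h2 : Multiset.replicate j p + Multiset.replicate 1 w = w ::ₘ Multiset.replicate j p := by
      rw [Multiset.replicate_one, add_comm, Multiset.singleton_add]
    have h3 : Multiset.replicate (j + 1) p + Multiset.replicate 1 w =
        p ::ₘ w ::ₘ Multiset.replicate j p := by
      rw [Multiset.replicate_succ, Multiset.cons_add, h2]
    rw [h2, h3, pow_succ, mul_smul, ← neg_sub w p, neg_smul (w - p), ← h1, neg_neg]

variable {γ : ℝ → ℂ} {a b C₁ C₂ : ℝ}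

/-- Families that are flat at both endpoints are small near the endpoints. -/
theorem BiLipArc.exists_flat_bound (hγ : BiLipArc γ a b C₁ C₂) (hn : 1 ≤ n) :
    ∃ κ, 0 ≤ κ ∧ ∀ {φ : Multiset ℂ → V}, ResFam n (γ '' Icc a b) φ → IsFlatAt n φ (γ a) →
      IsFlatAt n φ (γ b) → ∀ q : Seminorm ℂ V, ∀ t ∈ Ioo a b,
      (t ≤ (a + b) / 2 → q (φ (Multiset.replicate 1 (γ t))) ≤ κ * ((t - a) * (b - t)) ^ (n - 1) *
        q (φ (Multiset.replicate (n - 1) (γ a) + Multiset.replicate 1 (γ t)))) ∧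
      ((a + b) / 2 ≤ t → q (φ (Multiset.replicate 1 (γ t))) ≤ κ * ((t - a) * (b - t)) ^ (n - 1) *
        q (φ (Multiset.replicate (n - 1) (γ b) + Multiset.replicate 1 (γ t)))) := by
  have hab : 0 < b - a := sub_pos.2 hγ.lt
  have hC := hγ.pos₂
  refine ⟨(2 * C₂ / (b - a)) ^ (n - 1), by positivity, fun {φ} hφ ha hb q t ht => ⟨fun hm => ?_,
    fun hm => ?_⟩⟩
  · rw [hφ.eq_pow_smul_of_flat hγ.left_mem ha (mem_image_of_mem γ (Ioo_subset_Icc_self ht))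
      (j := n - 1) (by omega), map_smul_eq_mul, norm_pow, ← mul_pow]
    refine mul_le_mul_of_nonneg_right (pow_le_pow_left₀ (norm_nonneg _) ?_ _) (apply_nonneg q _)
    have h1 := hγ.upper t a
    rw [abs_sub_comm, abs_of_pos (sub_pos.2 ht.1)] at h1
    refine h1.trans ?_
    rw [div_mul_eq_mul_div, le_div_iff₀ hab]
    have h2 : 0 ≤ C₂ * (t - a) := mul_nonneg hC.le (sub_nonneg.2 ht.1.le)
    nlinarith
  · rw [hφ.eq_pow_smul_of_flat hγ.right_mem hb (mem_image_of_mem γ (Ioo_subset_Icc_self ht))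
      (j := n - 1) (by omega), map_smul_eq_mul, norm_pow, ← mul_pow]
    refine mul_le_mul_of_nonneg_right (pow_le_pow_left₀ (norm_nonneg _) ?_ _) (apply_nonneg q _)
    have h1 := hγ.upper t b
    rw [abs_of_pos (sub_pos.2 ht.2)] at h1
    refine h1.trans ?_
    rw [div_mul_eq_mul_div, le_div_iff₀ hab]
    have h2 : 0 ≤ C₂ * (b - t) := mul_nonneg hC.le (sub_nonneg.2 ht.2.le)
    nlinarith

end Flat

/-- Uniqueness of the coefficients of a partial fraction decomposition with two poles. -/
theorem partialFraction_eq_zero {p q : ℂ} (hpq : p ≠ q) {S : Set ℂ} (hS : Dense S) (hp : p ∉ S)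
    (hq : q ∉ S) {n : ℕ} {c d : ℕ → ℂ} (h : ∀ z ∈ S, ∑ i ∈ Finset.range n,
      (c i * ((p - z) ^ (i + 1))⁻¹ + d i * ((q - z) ^ (i + 1))⁻¹) = 0) :
    ∀ i < n, c i = 0 ∧ d i = 0 := by
  induction n with
  | zero => exact fun i hi => absurd hi (Nat.not_lt_zero i)
  | succ n ih =>
    -- Clearing denominators gives a polynomial identity, which extends from the dense set to the
    -- poles; evaluation at p and q isolates the top coefficients.
    have h1 : (fun z => ∑ i ∈ Finset.range (n + 1), (c i * (p - z) ^ (n - i) * (q - z) ^ (n + 1) +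
        d i * (q - z) ^ (n - i) * (p - z) ^ (n + 1))) = fun _ => 0 := by
      refine Continuous.ext_on hS (by fun_prop) continuous_const fun z hz => ?_
      have hpz : p - z ≠ 0 := sub_ne_zero.2 fun h0 => hp (h0 ▸ hz)
      have hqz : q - z ≠ 0 := sub_ne_zero.2 fun h0 => hq (h0 ▸ hz)
      have h2 := congrArg (fun x => (p - z) ^ (n + 1) * (q - z) ^ (n + 1) * x) (h z hz)
      simp only [mul_zero, Finset.mul_sum] at h2
      refine Eq.trans (Finset.sum_congr rfl fun i hi => ?_) h2
      have hin : n + 1 = n - i + (i + 1) := by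
        have := Finset.mem_range.1 hi
        omega
      have e1 : (p - z) ^ (n - i) = (p - z) ^ (n + 1) * ((p - z) ^ (i + 1))⁻¹ := by
        rw [eq_mul_inv_iff_mul_eq₀ (pow_ne_zero _ hpz), ← pow_add, ← hin]
      have e2 : (q - z) ^ (n - i) = (q - z) ^ (n + 1) * ((q - z) ^ (i + 1))⁻¹ := by
        rw [eq_mul_inv_iff_mul_eq₀ (pow_ne_zero _ hqz), ← pow_add, ← hin]
      rw [e1, e2]
      ring
    have hc : c n = 0 := by
      have h2 := congrFun h1 p
      simp only [sub_self] at h2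
      rw [Finset.sum_range_succ, Finset.sum_eq_zero fun i hi => ?_] at h2
      · simpa [sub_ne_zero.2 hpq.symm] using h2
      · have := Finset.mem_range.1 hi
        rw [zero_pow (by omega : n - i ≠ 0), zero_pow (by omega : n + 1 ≠ 0)]
        ring
    have hd : d n = 0 := by
      have h2 := congrFun h1 q
      simp only [sub_self] at h2
      rw [Finset.sum_range_succ, Finset.sum_eq_zero fun i hi => ?_] at h2
      · simpa [sub_ne_zero.2 hpq] using h2
      · have := Finset.mem_range.1 hi
        rw [zero_pow (by omega : n - i ≠ 0), zero_pow (by omega : n + 1 ≠ 0)]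
        ring
    have h3 := ih fun z hz => by
      have := h z hz
      rwa [Finset.sum_range_succ, hc, hd, zero_mul, zero_mul, add_zero, add_zero] at this
    intro i hi
    rcases Nat.lt_succ_iff_lt_or_eq.1 hi with hi | rfl
    · exact h3 i hi
    · exact ⟨hc, hd⟩

/-- The nodes `p, …, pⁿ, q, …, qⁿ`. -/
def endNode (p q : ℂ) (n : ℕ) : Fin n ⊕ Fin n → Multiset ℂ :=
  Sum.elim (fun i => Multiset.replicate (i + 1) p) fun i => Multiset.replicate (i + 1) q

variable {γ : ℝ → ℂ} {a b C₁ C₂ : ℝ}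

theorem BiLipArc.dense_compl (hγ : BiLipArc γ a b C₁ C₂) : Dense (γ '' Icc a b)ᶜ := by
  rw [← interior_eq_empty_iff_dense_compl]
  by_contra h
  have h1 := (isOpen_interior.measure_pos volume (nonempty_iff_ne_empty.2 h)).trans_le
    (measure_mono interior_subset)
  exact h1.ne' hγ.volume_eq_zero

/-- The span of the families `poleFam ζ`. -/
noncomputable def poleSpan (Γ : Set ℂ) : Submodule ℂ (Multiset ℂ → ℂ) :=
  Submodule.span ℂ (poleFam '' Γᶜ)

/-- Interpolation at the 2n endpoint nodes by pole families: if evaluation were not onto, a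
nontrivial linear relation between the nodes would be a vanishing partial fraction with poles at the
two endpoints. -/
theorem BiLipArc.exists_dual_family (hγ : BiLipArc γ a b C₁ C₂) (n : ℕ) :
    ∃ χ : Fin n ⊕ Fin n → Multiset ℂ → ℂ, (∀ i, χ i ∈ poleSpan (γ '' Icc a b)) ∧
      ∀ i j, χ i (endNode (γ a) (γ b) n j) = if j = i then 1 else 0 := by
  set ev : (Multiset ℂ → ℂ) →ₗ[ℂ] (Fin n ⊕ Fin n → ℂ) :=
    LinearMap.pi fun i => LinearMap.proj (endNode (γ a) (γ b) n i) with hev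
  have htop : (poleSpan (γ '' Icc a b)).map ev = ⊤ := by
    by_contra hne
    obtain ⟨f, hf0, hf⟩ := Submodule.exists_le_ker_of_lt_top _ (lt_top_iff_ne_top.2 hne)
    refine hf0 ?_
    set e : Fin n ⊕ Fin n → ℂ := fun i => f (Pi.single i 1) with he
    have hfe : ∀ v, f v = ∑ i, v i * e i := fun v => by
      rw [LinearMap.pi_apply_eq_sum_univ f v]
      refine Finset.sum_congr rfl fun i _ => ?_
      rw [smul_eq_mul, he]
      congr 2
      ext j
      simp [Pi.single_apply, eq_comm]
    set c : ℕ → ℂ := fun i => if h : i < n then e (.inl ⟨i, h⟩) else 0 with hc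
    set d : ℕ → ℂ := fun i => if h : i < n then e (.inr ⟨i, h⟩) else 0 with hd
    have h1 := partialFraction_eq_zero (n := n) (c := c) (d := d) hγ.left_ne_right hγ.dense_compl
      (fun h => h hγ.left_mem) (fun h => h hγ.right_mem) fun z hz => by
        have h2 : f (ev (poleFam z)) = 0 :=
          hf (Submodule.mem_map_of_mem (Submodule.subset_span (mem_image_of_mem _ hz)))
        rw [hfe, Fintype.sum_sum_type] at h2
        have h3 : ∀ i, ev (poleFam z) (.inl i) = ((γ a - z) ^ ((i : ℕ) + 1))⁻¹ := fun i =>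
          poleFam_replicate _ _ _
        have h4 : ∀ i, ev (poleFam z) (.inr i) = ((γ b - z) ^ ((i : ℕ) + 1))⁻¹ := fun i =>
          poleFam_replicate _ _ _
        simp only [h3, h4] at h2
        rw [← h2, Finset.sum_add_distrib, Finset.sum_range, Finset.sum_range]
        congr 1
        · refine Finset.sum_congr rfl fun i _ => ?_
          simp [hc, mul_comm]
        · refine Finset.sum_congr rfl fun i _ => ?_
          simp [hd, mul_comm]
    ext i
    rcases i with i | i
    · simpa [hc] using (h1 i i.2).1
    · simpa [hd] using (h1 i i.2).2
  have hex : ∀ i, ∃ χ ∈ poleSpan (γ '' Icc a b), ev χ = Pi.single i 1 := fun i => by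
    have : (Pi.single i 1 : Fin n ⊕ Fin n → ℂ) ∈ (poleSpan (γ '' Icc a b)).map ev := by
      rw [htop]
      trivial
    exact Submodule.mem_map.1 this
  choose χ h1 h2 using hex
  refine ⟨χ, h1, fun i j => ?_⟩
  have := congrFun (h2 i) j
  rw [Pi.single_apply] at this
  exact this

theorem ResFam.of_mem_poleSpan {Γ : Set ℂ} {χ : Multiset ℂ → ℂ} (n : ℕ) (h : χ ∈ poleSpan Γ) :
    ResFam n Γ χ := by
  induction h using Submodule.span_induction with
  | mem x hx =>
    obtain ⟨z, hz, rfl⟩ := hx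
    exact ResFam.poleFam n hz
  | zero => exact ResFam.zero n Γ
  | add x y _ _ hx hy => exact hx.add hy
  | smul c x _ hx => exact hx.const_mul c

end ResolventCalculus

/-! ### Uniform bounds for the exponential series -/

namespace ResolventCalculus

theorem ResFam.exists_bound {n : ℕ} {Γ : Set ℂ} {φ : Multiset ℂ → ℂ} (h : ResFam n Γ φ)
    (hΓ : IsCompact Γ) :
    ∃ B, 0 ≤ B ∧ ∀ s : Multiset ℂ, s.card ≤ n → (∀ x ∈ s, x ∈ Γ) → ‖φ s‖ ≤ B := by
  have h1 : ∀ m, ∃ B, m ≤ n → ∀ z : Fin m → ℂ, (∀ i, z i ∈ Γ) → ‖φ (List.ofFn z)‖ ≤ B := by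
    intro m
    by_cases hm : m ≤ n
    · have hc : IsCompact {z : Fin m → ℂ | ∀ i, z i ∈ Γ} := by
        have := isCompact_univ_pi (s := fun _ : Fin m => Γ) fun _ => hΓ
        simpa [Set.pi] using this
      obtain ⟨B, hB⟩ := hc.exists_bound_of_continuousOn (h.cont m hm)
      exact ⟨B, fun _ z hz => hB z hz⟩
    · exact ⟨0, fun h => absurd h hm⟩
  choose B hB using h1
  refine ⟨∑ m ∈ Finset.range (n + 1), |B m|, Finset.sum_nonneg fun _ _ => abs_nonneg _,
    fun s hs hsΓ => ?_⟩
  obtain ⟨w, hw⟩ := exists_eq_ofFn s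
  have h2 : ∀ i, w i ∈ Γ := fun i => hsΓ _ (by
    rw [hw]
    exact Multiset.mem_coe.2 (List.mem_ofFn.2 ⟨i, rfl⟩))
  have h3 := hB _ hs w h2
  rw [← hw] at h3
  exact h3.trans ((le_abs_self _).trans (Finset.single_le_sum (f := fun m => |B m|)
    (fun _ _ => abs_nonneg _) (Finset.mem_range.2 (by omega))))

theorem IsBddFunctional.const_mul {n : ℕ} {Γ : Set ℂ} {Λ : (Multiset ℂ → ℂ) → ℂ}
    (h : IsBddFunctional n Γ Λ) (c : ℂ) : IsBddFunctional n Γ fun φ => c * Λ φ := by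
  obtain ⟨C, hC⟩ := h.bound
  refine ⟨fun φ ψ hφ hψ => ?_, fun e φ hφ => ?_, ‖c‖ * C, fun φ hφ δ hδ => ?_⟩
  · rw [h.add φ ψ hφ hψ, mul_add]
  · rw [h.smul e φ hφ, mul_left_comm]
  · rw [norm_mul, mul_assoc]
    exact mul_le_mul_of_nonneg_left (hC φ hφ δ hδ) (norm_nonneg c)

/-- The partial sums of the exponential series, on scalar families. -/
noncomputable def expFunctional (γ : ℝ → ℂ) (a b : ℝ) (N : ℂ → ℂ) (lam : ℝ → ℂ) (α : ℂ) (k : ℕ)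
    (φ : Multiset ℂ → ℂ) : ℂ :=
  ∑ i ∈ Finset.range k, α ^ i / (i.factorial : ℂ) * (logForm γ N lam i).apply γ a b 1 φ

/-- The value of `log(γ, ·) ^ k` on a vector valued family. -/
noncomputable def logEval {V : Type*} [AddCommGroup V] [Module ℂ V] [UniformSpace V] (γ : ℝ → ℂ)
    (a b : ℝ) (N : ℂ → ℂ) (lam : ℝ → ℂ) (Φ : Multiset ℂ → V) (k : ℕ) : V :=
  (logForm γ N lam k).eval γ a b 1 Φ

/-- The partial sums of the exponential series, on vector valued families. -/
noncomputable def expPartial {V : Type*} [AddCommGroup V] [Module ℂ V] [UniformSpace V] (γ : ℝ → ℂ)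
    (a b : ℝ) (N : ℂ → ℂ) (lam : ℝ → ℂ) (α : ℂ) (Φ : Multiset ℂ → V) (k : ℕ) : V :=
  ∑ i ∈ Finset.range k, (α ^ i / (i.factorial : ℂ)) • logEval γ a b N lam Φ i

section Scalar

variable {γ : ℝ → ℂ} {a b C₁ C₂ K : ℝ} {lam : ℝ → ℂ} {N : ℂ → ℂ} {n : ℕ} {α : ℂ}

theorem isBddFunctional_expFunctional (hN : JumpFactor γ a b lam N) (hl : ArcLog γ a b K lam)
    (hγ : BiLipArc γ a b C₁ C₂) (hn : 1 ≤ n) (α : ℂ) (k : ℕ) :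
    IsBddFunctional n (γ '' Icc a b) (expFunctional γ a b N lam α k) :=
  IsBddFunctional.finsetSum _ fun i _ => ((CurveForm.isBddFunctional hγ
    (hN.represents_logForm hl hγ i).integrable).of_le hn).const_mul _

theorem expFunctional_poleFam (hN : JumpFactor γ a b lam N) (hl : ArcLog γ a b K lam)
    (hγ : BiLipArc γ a b C₁ C₂) (α : ℂ) {z : ℂ} (hz : z ∉ γ '' Icc a b) :
    Tendsto (fun k => expFunctional γ a b N lam α k (poleFam z)) atTop
      (𝓝 (curvePow γ a b α z)) := by
  have h1 := (NormedSpace.expSeries_div_hasSum_exp (α * curveLog γ a b z)).tendsto_sum_nat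
  rw [← Complex.exp_eq_exp_ℂ] at h1
  refine h1.congr fun k => ?_
  refine Finset.sum_congr rfl fun i _ => ?_
  rw [← (hN.represents_logForm hl hγ i).eq z hz, mul_pow]
  ring

theorem exists_tendsto_expFunctional_of_mem_poleSpan (hN : JumpFactor γ a b lam N)
    (hl : ArcLog γ a b K lam) (hγ : BiLipArc γ a b C₁ C₂) (α : ℂ) {χ : Multiset ℂ → ℂ}
    (hχ : χ ∈ poleSpan (γ '' Icc a b)) :
    ∃ c, Tendsto (fun k => expFunctional γ a b N lam α k χ) atTop (𝓝 c) := by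
  have hb := fun k => isBddFunctional_expFunctional hN hl hγ (le_refl 1) α k
  induction hχ using Submodule.span_induction with
  | mem x hx =>
    obtain ⟨z, hz, rfl⟩ := hx
    exact ⟨_, expFunctional_poleFam hN hl hγ α hz⟩
  | zero =>
    exact ⟨0, tendsto_const_nhds.congr fun k => ((hb k).map_zero).symm⟩
  | add x y hx hy ihx ihy =>
    obtain ⟨c, hc⟩ := ihx
    obtain ⟨d, hd⟩ := ihy
    exact ⟨c + d, (hc.add hd).congr fun k => ((hb k).add x y (ResFam.of_mem_poleSpan 1 hx)
      (ResFam.of_mem_poleSpan 1 hy)).symm⟩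
  | smul e x hx ihx =>
    obtain ⟨c, hc⟩ := ihx
    exact ⟨e * c, (hc.const_mul e).congr fun k =>
      ((hb k).smul e x (ResFam.of_mem_poleSpan 1 hx)).symm⟩

/-- Only the zeroth power of the logarithm carries a term of order zero; hence the index k + 1 and
the single summand φ(∅). -/
theorem expFunctional_eq (hl : ArcLog γ a b K lam) (hγ : BiLipArc γ a b C₁ C₂) (hn : 1 ≤ n) (α : ℂ)
    {φ : Multiset ℂ → ℂ} (hφ : ResFam n (γ '' Icc a b) φ) (k : ℕ) :
    expFunctional γ a b N lam α (k + 1) φ = φ 0 + ∫ t in a..b,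
      ArcLog.expDensity N lam α (k + 1) t * deriv γ t * φ (Multiset.replicate 1 (γ t)) := by
  have hc : ContinuousOn (fun t => φ (Multiset.replicate 1 (γ t))) (uIcc a b) := by
    rw [uIcc_of_le hγ.lt.le]
    exact hφ.continuousOn_curve hγ hn
  have hint : ∀ i ∈ Finset.range (k + 1), IntervalIntegrable (fun t => α ^ i / (i.factorial : ℂ) *
      (ArcLog.density N lam i 0 t * deriv γ t * φ (Multiset.replicate 1 (γ t)))) volume a b :=
    fun i _ => ((hγ.intervalIntegrable_mul_deriv (hl.intervalIntegrable_density hγ.lt N i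
      (β := 0) (by simp))).mul_continuousOn hc).const_mul _
  have h1 : ∀ i, (logForm γ N lam i).apply γ a b 1 φ = (if i = 0 then φ 0 else 0) +
      ∫ t in a..b, ArcLog.density N lam i 0 t * deriv γ t * φ (Multiset.replicate 1 (γ t)) :=
    fun i => by
      by_cases hi : i = 0 <;>
      simp [CurveForm.apply, Finset.sum_range_succ, logForm, hi]
  simp only [expFunctional, h1, mul_add, Finset.sum_add_distrib]
  congr 1
  · rw [Finset.sum_eq_single 0]
    · simp
    · intro i _ hi
      simp [hi]
    · simp
  · simp only [← intervalIntegral.integral_const_mul]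
    rw [← intervalIntegral.integral_finsetSum hint]
    refine intervalIntegral.integral_congr fun t _ => ?_
    simp only [ArcLog.expDensity, Finset.sum_mul, mul_assoc]

/-- The partial sums are uniformly bounded on flat families. -/
theorem exists_norm_expFunctional_flat_le (hN : JumpFactor γ a b lam N) (hl : ArcLog γ a b K lam)
    (hγ : BiLipArc γ a b C₁ C₂) (hn : 1 ≤ n) (hα : ‖α‖ = n) (hNα : N α = 0) :
    ∃ C, 0 ≤ C ∧ ∀ ψ : Multiset ℂ → ℂ, ResFam n (γ '' Icc a b) ψ → IsFlatAt n ψ (γ a) →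
      IsFlatAt n ψ (γ b) → ∀ δ, (∀ s : Multiset ℂ, s.card ≤ n → (∀ x ∈ s, x ∈ γ '' Icc a b) →
        ‖ψ s‖ ≤ δ) → ∀ k, ‖expFunctional γ a b N lam α k ψ‖ ≤ C * δ := by
  obtain ⟨D, hD0, hD⟩ := hl.exists_norm_integral_expDensity_le hγ hn hα hN.differentiable hNα
  obtain ⟨C, hC0, hC⟩ := hD (b - a) (sub_pos.2 hγ.lt)
  obtain ⟨κ, hκ0, hκ⟩ := hγ.exists_flat_bound (V := ℂ) hn
  refine ⟨1 + (D * κ + C), by positivity, fun ψ hψ ha hb δ hδ k => ?_⟩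
  have hδ0 : 0 ≤ δ := (norm_nonneg _).trans (hδ 0 (by simp) (by simp))
  have hrep : ∀ p ∈ γ '' Icc a b, ∀ t ∈ Ioo a b, ‖ψ (Multiset.replicate (n - 1) p +
      Multiset.replicate 1 (γ t))‖ ≤ δ := fun p hp t ht => hδ _ (by simp; omega) fun x hx => by
    rcases Multiset.mem_add.1 hx with hx | hx
    · rwa [Multiset.eq_of_mem_replicate hx]
    · rw [Multiset.eq_of_mem_replicate hx]
      exact mem_image_of_mem γ (Ioo_subset_Icc_self ht)
  rcases k with _ | k
  · simp only [expFunctional, Finset.range_zero, Finset.sum_empty, norm_zero]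
    positivity
  rw [expFunctional_eq hl hγ hn α hψ k]
  have h1 := hC (fun t => ψ (Multiset.replicate 1 (γ t))) (κ * δ) δ (by positivity) hδ0
    (fun t ht => hδ _ (by simpa using hn) fun x hx => by
      rw [Multiset.eq_of_mem_replicate hx]
      exact mem_image_of_mem γ (Ioo_subset_Icc_self ht)) (fun t ht _ => by
      have hw : 0 ≤ ((t - a) * (b - t)) ^ (n - 1) :=
        pow_nonneg (mul_nonneg (by linarith [ht.1]) (by linarith [ht.2])) _
      have h2 := hκ hψ ha hb (normSeminorm ℂ ℂ) t ht
      simp only [coe_normSeminorm] at h2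
      rw [show κ * δ * ((t - a) * (b - t)) ^ (n - 1) = κ * ((t - a) * (b - t)) ^ (n - 1) * δ by ring]
      rcases le_total t ((a + b) / 2) with h | h
      · exact (h2.1 h).trans (mul_le_mul_of_nonneg_left (hrep _ hγ.left_mem t ht) (by positivity))
      · exact (h2.2 h).trans (mul_le_mul_of_nonneg_left (hrep _ hγ.right_mem t ht)
          (by positivity))) (k + 1)
  have h2 : ‖ψ 0‖ ≤ δ := hδ 0 (by simp) (by simp)
  have h3 : C * δ * (1 / 2 : ℝ) ^ (k + 1) ≤ C * δ :=
    mul_le_of_le_one_right (by positivity) (pow_le_one₀ (by norm_num) (by norm_num))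
  refine (norm_add_le _ _).trans ?_
  linarith

/-- The partial sums are uniformly bounded functionals. -/
theorem exists_norm_expFunctional_le (hN : JumpFactor γ a b lam N) (hl : ArcLog γ a b K lam)
    (hγ : BiLipArc γ a b C₁ C₂) (hn : 1 ≤ n) (hα : ‖α‖ = n) (hNα : N α = 0) :
    ∃ C, 0 ≤ C ∧ ∀ φ : Multiset ℂ → ℂ, ResFam n (γ '' Icc a b) φ →
      ∀ δ, (∀ s : Multiset ℂ, s.card ≤ n → (∀ x ∈ s, x ∈ γ '' Icc a b) →
        ‖φ s‖ ≤ δ) → ∀ k, ‖expFunctional γ a b N lam α k φ‖ ≤ C * δ := by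
  obtain ⟨C, hC0, hC⟩ := exists_norm_expFunctional_flat_le hN hl hγ hn hα hNα
  obtain ⟨χ, hχ, hχe⟩ := hγ.exists_dual_family n
  have hχr := fun i => ResFam.of_mem_poleSpan n (hχ i)
  choose B hB0 hB using fun i => (hχr i).exists_bound hγ.isCompact
  choose c hc using fun i => exists_tendsto_expFunctional_of_mem_poleSpan hN hl hγ α (hχ i)
  choose E hE using fun i => (hc i).norm.bddAbove_range
  refine ⟨C * (1 + ∑ i, B i) + ∑ i, |E i|, by
    have : 0 ≤ ∑ i, B i := Finset.sum_nonneg fun i _ => hB0 i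
    have : 0 ≤ ∑ i, |E i| := Finset.sum_nonneg fun i _ => abs_nonneg _
    positivity, fun φ hφ δ hδ k => ?_⟩
  have hnode : ∀ i, ‖φ (endNode (γ a) (γ b) n i)‖ ≤ δ := by
    rintro (i | i)
    · refine hδ _ (by simp [endNode]) fun x hx => ?_
      rw [Multiset.eq_of_mem_replicate hx]
      exact hγ.left_mem
    · refine hδ _ (by simp [endNode]) fun x hx => ?_
      rw [Multiset.eq_of_mem_replicate hx]
      exact hγ.right_mem
  have hsr : ∀ i ∈ (Finset.univ : Finset (Fin n ⊕ Fin n)), ResFam n (γ '' Icc a b)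
      fun s => φ (endNode (γ a) (γ b) n i) * χ i s := fun i _ => (hχr i).const_mul _
  have hsum := ResFam.sum Finset.univ hsr
  -- Subtracting the interpolating pole families makes φ flat at both ends. The finitely many
  -- subtracted families have convergent, hence bounded, partial sums.
  have hψ := hφ.sub hsum
  have hev : ∀ j, φ (endNode (γ a) (γ b) n j) - ∑ i, φ (endNode (γ a) (γ b) n i) *
      χ i (endNode (γ a) (γ b) n j) = 0 := fun j => by simp [hχe]
  have h1 := hC _ hψ (fun i hi => hev (.inl ⟨i, hi⟩)) (fun i hi => hev (.inr ⟨i, hi⟩))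
    ((1 + ∑ i, B i) * δ) (fun s hs hsΓ => by
      refine (norm_sub_le _ _).trans ?_
      rw [add_mul, one_mul, Finset.sum_mul]
      refine add_le_add (hδ s hs hsΓ) (norm_sum_le_of_le _ fun i _ => ?_)
      rw [norm_mul, mul_comm]
      exact mul_le_mul (hB i s hs hsΓ) (hnode i) (norm_nonneg _) (hB0 i)) k
  have hb := isBddFunctional_expFunctional hN hl hγ hn α k
  have h2 := hb.map_sub hφ hsum
  rw [hb.map_sum _ hsr] at h2
  rw [h2] at h1
  have h3 : ‖∑ i, expFunctional γ a b N lam α k fun s => φ (endNode (γ a) (γ b) n i) * χ i s‖ ≤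
      (∑ i, |E i|) * δ := by
    rw [Finset.sum_mul]
    refine norm_sum_le_of_le _ fun i _ => ?_
    rw [hb.smul _ _ (hχr i), norm_mul, mul_comm]
    exact mul_le_mul ((hE i (mem_range_self k)).trans (le_abs_self _)) (hnode i) (norm_nonneg _)
      (abs_nonneg _)
  have h4 := norm_le_norm_sub_add (expFunctional γ a b N lam α k φ)
    (∑ i, expFunctional γ a b N lam α k fun s => φ (endNode (γ a) (γ b) n i) * χ i s)
  linarith

end Scalar
end ResolventCalculus

/-! ### Convergence of the exponential series at ±n -/

namespace ResolventCalculus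

section Vector

variable {γ : ℝ → ℂ} {a b C₁ C₂ K : ℝ} {lam : ℝ → ℂ} {N : ℂ → ℂ} {n : ℕ} {α : ℂ}
  {V : Type*} [AddCommGroup V] [Module ℂ V] [UniformSpace V] [IsUniformAddGroup V]
  [ContinuousSMul ℂ V] [PolynormableSpace ℂ V] {Φ : Multiset ℂ → V}

theorem clm_logEval (hV : ∀ x : ℕ → V, CauchySeq x → ∃ y, Tendsto x atTop (𝓝 y))
    (hN : JumpFactor γ a b lam N) (hl : ArcLog γ a b K lam) (hγ : BiLipArc γ a b C₁ C₂) (hn : 1 ≤ n)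
    (hΦ : ResFam n (γ '' Icc a b) Φ) (ℓ : V →L[ℂ] ℂ) (k : ℕ) :
    ℓ (logEval γ a b N lam Φ k) = (logForm γ N lam k).apply γ a b 1 fun s => ℓ (Φ s) :=
  CurveForm.clm_eval hV hγ (hN.represents_logForm hl hγ k).integrable (hΦ.of_le hn) ℓ

theorem clm_expPartial (hV : ∀ x : ℕ → V, CauchySeq x → ∃ y, Tendsto x atTop (𝓝 y))
    (hN : JumpFactor γ a b lam N) (hl : ArcLog γ a b K lam) (hγ : BiLipArc γ a b C₁ C₂) (hn : 1 ≤ n)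
    (hΦ : ResFam n (γ '' Icc a b) Φ) (ℓ : V →L[ℂ] ℂ) (α : ℂ) (k : ℕ) :
    ℓ (expPartial γ a b N lam α Φ k) = expFunctional γ a b N lam α k fun s => ℓ (Φ s) := by
  rw [expPartial, expFunctional, map_sum]
  refine Finset.sum_congr rfl fun i _ => ?_
  rw [map_smul, clm_logEval hV hN hl hγ hn hΦ, smul_eq_mul]

/-- Convergence of the exponential series on flat families. -/
theorem tendsto_expPartial_of_flat (hV : ∀ x : ℕ → V, CauchySeq x → ∃ y, Tendsto x atTop (𝓝 y))
    (hN : JumpFactor γ a b lam N) (hl : ArcLog γ a b K lam) (hγ : BiLipArc γ a b C₁ C₂) (hn : 1 ≤ n)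
    (hα : ‖α‖ = n) (hNα : N α = 0) (hΦ : ResFam n (γ '' Icc a b) Φ) (ha : IsFlatAt n Φ (γ a))
    (hb : IsFlatAt n Φ (γ b)) :
    Tendsto (expPartial γ a b N lam α Φ) atTop (𝓝 (Φ 0)) := by
  have hab := hγ.lt
  obtain ⟨D, hD0, hD⟩ := hl.exists_norm_integral_expDensity_le hγ hn hα hN.differentiable hNα
  obtain ⟨κ, hκ0, hκ⟩ := hγ.exists_flat_bound (V := V) hn
  refine tendsto_nhds_iff_seminorm.2 fun q hq => ?_
  rw [Metric.tendsto_nhds]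
  intro ε hε
  set ε' := ε / 2 / (D * κ + 1) with hε'
  have hε'0 : 0 < ε' := by positivity
  have hεD : D * (κ * ε') ≤ ε / 2 := by
    rw [← mul_assoc, hε', mul_div_assoc', div_le_iff₀ (by positivity)]
    nlinarith
  -- The cofactor φ(γ(c)^{n-1}, γ(t)) in the flat estimate tends to φ(γ(c)ⁿ) = 0 at the endpoint.
  -- This extra smallness turns boundedness of the weighted integral into convergence.
  have hnear : ∀ c ∈ Icc a b, IsFlatAt n Φ (γ c) → ∃ δ > 0, ∀ t ∈ Icc a b, |t - c| < δ →
      q (Φ (Multiset.replicate (n - 1) (γ c) + Multiset.replicate 1 (γ t))) ≤ ε' := by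
    intro c hc hflat
    have h1 : ContinuousOn (fun t => Φ (Multiset.replicate (n - 1) (γ c) +
        Multiset.replicate 1 (γ t))) (Icc a b) :=
      hΦ.continuousOn_add_replicate (fun x hx => by
        rw [Multiset.eq_of_mem_replicate hx]
        exact mem_image_of_mem γ hc) (by simp; omega) hγ.continuous.continuousOn (mapsTo_image γ _)
    have h2 := (hq.comp_continuousOn h1) c hc
    have h3 : q (Φ (Multiset.replicate (n - 1) (γ c) + Multiset.replicate 1 (γ c))) = 0 := by
      rw [← Multiset.replicate_add, hflat (n - 1) (by omega), map_zero]
    rw [ContinuousWithinAt, Metric.tendsto_nhdsWithin_nhds] at h2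
    obtain ⟨δ, hδ, h4⟩ := h2 ε' hε'0
    refine ⟨δ, hδ, fun t ht htc => ?_⟩
    have h5 := h4 ht (by rwa [Real.dist_eq])
    simp only [Function.comp_apply] at h5
    rw [h3, Real.dist_0_eq_abs] at h5
    exact (le_abs_self _).trans h5.le
  obtain ⟨δ₁, hδ₁, h1⟩ := hnear a (left_mem_Icc.2 hab.le) ha
  obtain ⟨δ₂, hδ₂, h2⟩ := hnear b (right_mem_Icc.2 hab.le) hb
  set δ := min (min δ₁ δ₂) ((b - a) / 2) with hδ
  have hδ0 : 0 < δ := lt_min (lt_min hδ₁ hδ₂) (by linarith)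
  obtain ⟨C, hC0, hC⟩ := hD δ hδ0
  obtain ⟨M, hM⟩ := isCompact_Icc.exists_bound_of_continuousOn
    (hq.comp_continuousOn (hΦ.continuousOn_curve hγ hn))
  have hM' : ∀ t ∈ Icc a b, q (Φ (Multiset.replicate 1 (γ t))) ≤ M := fun t ht =>
    (le_abs_self _).trans (hM t ht)
  have hM0 : 0 ≤ M := (apply_nonneg q _).trans (hM' a (left_mem_Icc.2 hab.le))
  have hlim : Tendsto (fun k : ℕ => C * M * (1 / 2 : ℝ) ^ k) atTop (𝓝 0) := by
    simpa using (tendsto_pow_atTop_nhds_zero_of_lt_one (r := (1 / 2 : ℝ)) (by norm_num)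
      (by norm_num)).const_mul (C * M)
  filter_upwards [hlim.eventually_lt_const (half_pos hε), eventually_ge_atTop 1] with k hk hk1
  rw [Real.dist_0_eq_abs, abs_of_nonneg (apply_nonneg q _)]
  refine (seminorm_le_of_dual hq (c := D * (κ * ε') + C * M * (1 / 2) ^ k) fun ℓ hℓ => ?_).trans_lt
    (by linarith)
  rw [map_sub, clm_expPartial hV hN hl hγ hn hΦ]
  obtain ⟨k, rfl⟩ : ∃ j, k = j + 1 := ⟨k - 1, by omega⟩
  rw [expFunctional_eq hl hγ hn α (hΦ.clm ℓ), add_sub_cancel_left]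
  refine hC _ (κ * ε') M (by positivity) hM0 (fun t ht =>
    (hℓ _).trans (hM' t (Ioo_subset_Icc_self ht))) (fun t ht hts => (hℓ _).trans ?_) _
  have hw : 0 ≤ κ * ((t - a) * (b - t)) ^ (n - 1) :=
    mul_nonneg hκ0 (pow_nonneg (mul_nonneg (by linarith [ht.1]) (by linarith [ht.2])) _)
  rw [mul_right_comm]
  have h3 := hκ hΦ ha hb q t ht
  have hm1 := min_le_right (min δ₁ δ₂) ((b - a) / 2)
  have hm2 := (min_le_left (min δ₁ δ₂) ((b - a) / 2)).trans (min_le_left _ _)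
  have hm3 := (min_le_left (min δ₁ δ₂) ((b - a) / 2)).trans (min_le_right _ _)
  rw [← hδ] at hm1 hm2 hm3
  rcases hts with hts | hts
  · refine (h3.1 (by linarith)).trans (mul_le_mul_of_nonneg_left
      (h1 t (Ioo_subset_Icc_self ht) ?_) hw)
    rw [abs_of_pos (sub_pos.2 ht.1)]
    linarith
  · refine (h3.2 (by linarith)).trans (mul_le_mul_of_nonneg_left
      (h2 t (Ioo_subset_Icc_self ht) ?_) hw)
    rw [abs_of_neg (sub_neg.2 ht.2)]
    linarith

/-- Convergence of the exponential series at the boundary points. -/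
theorem exists_tendsto_expPartial [T2Space V]
    (hV : ∀ x : ℕ → V, CauchySeq x → ∃ y, Tendsto x atTop (𝓝 y))
    (hN : JumpFactor γ a b lam N) (hl : ArcLog γ a b K lam) (hγ : BiLipArc γ a b C₁ C₂) (hn : 1 ≤ n)
    (hα : ‖α‖ = n) (hNα : N α = 0) (hΦ : ResFam n (γ '' Icc a b) Φ) :
    ∃ y, Tendsto (expPartial γ a b N lam α Φ) atTop (𝓝 y) := by
  obtain ⟨χ, hχ, hχe⟩ := hγ.exists_dual_family n
  have hχr := fun i => ResFam.of_mem_poleSpan n (hχ i)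
  choose c hc using fun i => exists_tendsto_expFunctional_of_mem_poleSpan hN hl hγ α (hχ i)
  set x : Fin n ⊕ Fin n → V := fun i => Φ (endNode (γ a) (γ b) n i) with hx
  have hsum := ResFam.sum Finset.univ fun i (_ : i ∈ (Finset.univ : Finset (Fin n ⊕ Fin n))) =>
    (hχr i).smul_const (x i)
  -- Interpolation with vector coefficients: the remainder is flat, and the subtracted part is a
  -- finite sum of scalar convergent series times vectors.
  have hΨ := hΦ.sub hsum
  have hev : ∀ j, Φ (endNode (γ a) (γ b) n j) - ∑ i, χ i (endNode (γ a) (γ b) n j) • x i = 0 :=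
    fun j => by simp [hχe, hx]
  have h1 := tendsto_expPartial_of_flat hV hN hl hγ hn hα hNα hΨ (fun i hi => hev (.inl ⟨i, hi⟩))
    (fun i hi => hev (.inr ⟨i, hi⟩))
  have h2 : Tendsto (fun k => ∑ i, expFunctional γ a b N lam α k (χ i) • x i) atTop
      (𝓝 (∑ i, c i • x i)) := tendsto_finset_sum _ fun i _ => (hc i).smul_const (x i)
  refine ⟨_, (h1.add h2).congr fun k => eq_of_forall_dual fun ℓ => ?_⟩
  have hb := isBddFunctional_expFunctional hN hl hγ hn α k
  rw [map_add, clm_expPartial hV hN hl hγ hn hΨ, clm_expPartial hV hN hl hγ hn hΦ, map_sum]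
  have hsr : ∀ i ∈ (Finset.univ : Finset (Fin n ⊕ Fin n)), ResFam n (γ '' Icc a b)
      fun s => ℓ (x i) * χ i s := fun i _ => (hχr i).const_mul _
  have h3 := hb.map_sub (hΦ.clm ℓ) (ResFam.sum Finset.univ hsr)
  rw [hb.map_sum _ hsr] at h3
  simp only [map_sub, map_sum, map_smul, smul_eq_mul, mul_comm _ (ℓ _)]
  rw [h3, sub_add_eq_add_sub, sub_eq_iff_eq_add]
  congr 1
  exact Finset.sum_congr rfl fun i _ => (hb.smul _ _ (hχr i)).symm

end Vector
end ResolventCalculus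

/-! ### From the points ±n to the disc and the segment -/

namespace ResolventCalculus

section Limits

variable {V : Type*} [AddCommGroup V] [Module ℂ V] [UniformSpace V] [IsUniformAddGroup V]
  [ContinuousSMul ℂ V] [PolynormableSpace ℂ V]

theorem exists_tendsto_of_seminorm (hV : ∀ x : ℕ → V, CauchySeq x → ∃ y, Tendsto x atTop (𝓝 y))
    {P : ℕ → V} (h : ∀ q : Seminorm ℂ V, Continuous q → ∀ ε > 0, ∃ m, ∀ k ≥ m, q (P k - P m) ≤ ε) :
    ∃ y, Tendsto P atTop (𝓝 y) := by
  refine hV P (cauchySeq_of_seminorm fun q hq ε hε => ?_)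
  obtain ⟨m, hm⟩ := h q hq (ε / 3) (by positivity)
  refine ⟨m, fun i hi j hj => ?_⟩
  have h1 := map_sub_le_add q (P i - P m) (P j - P m)
  rw [sub_sub_sub_cancel_right] at h1
  linarith [hm i hi, hm j hj]

theorem seminorm_sub_le_of_tendsto {P : ℕ → V} {y z : V} (hy : Tendsto P atTop (𝓝 y))
    {q : Seminorm ℂ V} (hq : Continuous q) {m : ℕ} {ε : ℝ} (h : ∀ k ≥ m, q (P k - z) ≤ ε) :
    q (y - z) ≤ ε :=
  le_of_tendsto ((hq.tendsto _).comp (hy.sub_const z)) ((eventually_ge_atTop m).mono h)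

theorem continuousOn_of_seminorm {X : Type*} [TopologicalSpace X] {E : Set X} {P : ℕ → X → V}
    {F : X → V} (hP : ∀ k, ContinuousOn (P k) E)
    (hF : ∀ t ∈ E, Tendsto (fun k => P k t) atTop (𝓝 (F t)))
    (h : ∀ q : Seminorm ℂ V, Continuous q → ∀ ε > 0, ∃ m, ∀ k ≥ m, ∀ t ∈ E,
      q (P k t - P m t) ≤ ε) : ContinuousOn F E := by
  intro t₀ ht₀
  refine tendsto_nhds_iff_seminorm.2 fun q hq => ?_
  rw [Metric.tendsto_nhds]
  intro ε hε
  obtain ⟨m, hm⟩ := h q hq (ε / 4) (by positivity)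
  have h1 := (tendsto_nhds_iff_seminorm.1 (hP m t₀ ht₀) q hq).eventually_lt_const
    (show (0 : ℝ) < ε / 4 by positivity)
  filter_upwards [h1, self_mem_nhdsWithin] with t ht htE
  rw [Real.dist_0_eq_abs, abs_of_nonneg (apply_nonneg q _)]
  have h2 := fun s (hs : s ∈ E) => seminorm_sub_le_of_tendsto (hF s hs) hq fun k hk => hm k hk s hs
  have h3 := map_add_le_add q (F t - P m t - (F t₀ - P m t₀)) (P m t - P m t₀)
  have h4 := map_sub_le_add q (F t - P m t) (F t₀ - P m t₀)
  rw [show F t - P m t - (F t₀ - P m t₀) + (P m t - P m t₀) = F t - F t₀ by abel] at h3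
  linarith [h2 t htE, h2 t₀ ht₀]

end Limits

section ExpSum

variable {V : Type*} [AddCommGroup V] [Module ℂ V]

/-- The partial sums of `∑ αᵏ / k! xₖ`. -/
noncomputable def expSum (x : ℕ → V) (α : ℂ) (k : ℕ) : V :=
  ∑ i ∈ Finset.range k, (α ^ i / (i.factorial : ℂ)) • x i

theorem expSum_zero (x : ℕ → V) (α : ℂ) : expSum x α 0 = 0 := rfl

theorem expSum_add_sub (x : ℕ → V) (α : ℂ) (m k : ℕ) : expSum x α (m + k) - expSum x α m =
    ∑ i ∈ Finset.range k, (α ^ (m + i) / ((m + i).factorial : ℂ)) • x (m + i) := by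
  rw [expSum, expSum, Finset.sum_range_add, add_sub_cancel_left]

/-- Summation by parts. -/
theorem seminorm_sum_smul_le (q : Seminorm ℂ V) {x : ℕ → V} {w : ℕ → ℝ} (hw : Antitone w)
    (hw0 : ∀ i, 0 ≤ w i) {ε : ℝ} (hx : ∀ j, q (∑ i ∈ Finset.range j, x i) ≤ ε) (k : ℕ) :
    q (∑ i ∈ Finset.range k, (w i : ℂ) • x i) ≤ w 0 * ε := by
  have key : ∀ k, ∑ i ∈ Finset.range (k + 1), (w i : ℂ) • x i =
      (w k : ℂ) • ∑ i ∈ Finset.range (k + 1), x i +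
        ∑ i ∈ Finset.range k, ((w i - w (i + 1) : ℝ) : ℂ) • ∑ j ∈ Finset.range (i + 1), x j := by
    intro k
    induction k with
    | zero => simp
    | succ k ih =>
      rw [Finset.sum_range_succ, ih, Finset.sum_range_succ x (k + 1),
        Finset.sum_range_succ (fun i => ((w i - w (i + 1) : ℝ) : ℂ) •
          ∑ j ∈ Finset.range (i + 1), x j)]
      push_cast
      module
  have hε : 0 ≤ ε := (apply_nonneg q _).trans (hx 0)
  rcases k with _ | k
  · simpa using mul_nonneg (hw0 0) hε
  rw [key]
  have h1 : q (∑ i ∈ Finset.range k, ((w i - w (i + 1) : ℝ) : ℂ) •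
      ∑ j ∈ Finset.range (i + 1), x j) ≤ (w 0 - w k) * ε := by
    induction k with
    | zero => simp
    | succ k ih =>
      rw [Finset.sum_range_succ]
      refine (map_add_le_add q _ _).trans ?_
      rw [map_smul_eq_mul, Complex.norm_real, Real.norm_of_nonneg (sub_nonneg.2 (hw (Nat.le_succ k)))]
      have := mul_le_mul_of_nonneg_left (hx (k + 1)) (sub_nonneg.2 (hw (Nat.le_succ k)))
      linarith
  refine (map_add_le_add q _ _).trans ?_
  rw [map_smul_eq_mul, Complex.norm_real, Real.norm_of_nonneg (hw0 k)]
  have := mul_le_mul_of_nonneg_left (hx (k + 1)) (hw0 k)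
  linarith

/-- Abel's estimate on the segment from `0` to `β`. -/
theorem seminorm_expSum_segment_le (q : Seminorm ℂ V) {x : ℕ → V} {β : ℂ} {m : ℕ} {ε : ℝ}
    (h : ∀ k ≥ m, q (expSum x β k - expSum x β m) ≤ ε) {t : ℝ} (ht0 : 0 ≤ t) (ht1 : t ≤ 1) :
    ∀ k ≥ m, q (expSum x (t * β) k - expSum x (t * β) m) ≤ ε := by
  intro k hk
  obtain ⟨j, rfl⟩ := Nat.exists_eq_add_of_le hk
  have hε : 0 ≤ ε := (apply_nonneg q _).trans (h m le_rfl)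
  have h1 := seminorm_sum_smul_le q (w := fun i => t ^ (m + i))
    (x := fun i => (β ^ (m + i) / ((m + i).factorial : ℂ)) • x (m + i))
    (fun i j hij => pow_le_pow_of_le_one ht0 ht1 (by omega)) (fun i => pow_nonneg ht0 _)
    (fun j => by rw [← expSum_add_sub]; exact h _ (Nat.le_add_right m j)) j
  rw [expSum_add_sub]
  refine le_trans (le_of_eq ?_) (h1.trans (mul_le_of_le_one_left hε (pow_le_one₀ ht0 ht1)))
  congr 1
  refine Finset.sum_congr rfl fun i _ => ?_
  rw [smul_smul, mul_pow]
  push_cast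
  congr 1
  ring

/-- The geometric estimate in the interior of the disc. -/
theorem seminorm_expSum_disc_le (q : Seminorm ℂ V) {x : ℕ → V} {R B : ℝ}
    (h : ∀ k : ℕ, R ^ k / k.factorial * q (x k) ≤ B) {r : ℝ} (hr0 : 0 ≤ r) (hr1 : r < 1)
    {α : ℂ} (hα : ‖α‖ ≤ r * R) {m : ℕ} :
    ∀ k ≥ m, q (expSum x α k - expSum x α m) ≤ B * r ^ m / (1 - r) := by
  intro k hk
  obtain ⟨j, rfl⟩ := Nat.exists_eq_add_of_le hk
  have hB : 0 ≤ B := le_trans (by simpa using apply_nonneg q (x 0)) (h 0)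
  rw [expSum_add_sub]
  have h1 : ∀ i, q ((α ^ i / (i.factorial : ℂ)) • x i) ≤ B * r ^ i := fun i => by
    rw [map_smul_eq_mul, norm_div, norm_pow, Complex.norm_natCast]
    calc ‖α‖ ^ i / i.factorial * q (x i) ≤ (r * R) ^ i / i.factorial * q (x i) := by
          have := apply_nonneg q (x i)
          gcongr
      _ = r ^ i * (R ^ i / i.factorial * q (x i)) := by rw [mul_pow]; ring
      _ ≤ r ^ i * B := mul_le_mul_of_nonneg_left (h i) (pow_nonneg hr0 i)
      _ = _ := mul_comm _ _
  have h2 : ∑ i ∈ Finset.range j, B * r ^ (m + i) ≤ B * r ^ m / (1 - r) := by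
    have h3 := (summable_geometric_of_lt_one hr0 hr1).sum_le_tsum (Finset.range j)
      fun i _ => pow_nonneg hr0 i
    rw [tsum_geometric_of_lt_one hr0 hr1] at h3
    calc ∑ i ∈ Finset.range j, B * r ^ (m + i) = B * r ^ m * ∑ i ∈ Finset.range j, r ^ i := by
          rw [Finset.mul_sum]
          exact Finset.sum_congr rfl fun i _ => by rw [pow_add]; ring
      _ ≤ B * r ^ m * (1 - r)⁻¹ := mul_le_mul_of_nonneg_left h3 (by positivity)
      _ = _ := (div_eq_mul_inv _ _).symm
  refine le_trans ?_ h2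
  clear h2 hk
  induction j with
  | zero => simp
  | succ j ih =>
    rw [Finset.sum_range_succ, Finset.sum_range_succ]
    exact (map_add_le_add q _ _).trans (add_le_add ih (h1 _))

theorem mem_realInterval_iff {n : ℕ} {α : ℂ} : α ∈ realInterval n ↔
    ∃ t : ℝ, 0 ≤ t ∧ t ≤ 1 ∧ (α = t * (n : ℂ) ∨ α = t * (-n : ℂ)) := by
  constructor
  · rintro ⟨h0, h1⟩
    have hα : α = α.re := Complex.ext (by simp) (by simpa using h0)
    rcases Nat.eq_zero_or_pos n with rfl | hn
    · refine ⟨0, le_rfl, zero_le_one, .inl ?_⟩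
      rw [Nat.cast_zero, abs_nonpos_iff] at h1
      rw [hα, h1]
      simp
    have hn' : (0 : ℝ) < n := by exact_mod_cast hn
    have hnc : (n : ℂ) ≠ 0 := by exact_mod_cast hn.ne'
    refine ⟨|α.re| / n, by positivity, (div_le_one hn').2 h1, ?_⟩
    rcases abs_cases α.re with ⟨h, -⟩ | ⟨h, -⟩
    · left
      rw [h]
      push_cast
      rw [div_mul_cancel₀ _ hnc]
      exact hα
    · right
      rw [h]
      push_cast
      rw [mul_neg, div_mul_cancel₀ _ hnc, neg_neg]
      exact hα
  · rintro ⟨t, h0, h1, rfl | rfl⟩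
    · refine ⟨by simp, ?_⟩
      simp only [Complex.re_ofReal_mul, Complex.natCast_re]
      rw [abs_of_nonneg (by positivity)]
      exact mul_le_of_le_one_left (by positivity) h1
    · refine ⟨by simp, ?_⟩
      simp only [Complex.re_ofReal_mul, Complex.neg_re, Complex.natCast_re, mul_neg, abs_neg]
      rw [abs_of_nonneg (by positivity)]
      exact mul_le_of_le_one_left (by positivity) h1

section Topological

variable [UniformSpace V] [IsUniformAddGroup V] [ContinuousSMul ℂ V] [PolynormableSpace ℂ V]
  {x : ℕ → V} {n : ℕ}

/-- A term is a difference of consecutive partial sums, and convergent partial sums are bounded for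
q. -/
theorem exists_bound_of_tendsto_expSum (hx : ∃ y, Tendsto (expSum x n) atTop (𝓝 y))
    {q : Seminorm ℂ V} (hq : Continuous q) :
    ∃ B, ∀ k : ℕ, (n : ℝ) ^ k / k.factorial * q (x k) ≤ B := by
  obtain ⟨y, hy⟩ := hx
  obtain ⟨B, hB⟩ := ((hq.tendsto y).comp hy).bddAbove_range
  refine ⟨B + B, fun k => ?_⟩
  have h1 := map_sub_le_add q (expSum x n (k + 1)) (expSum x n k)
  rw [expSum_add_sub, Finset.sum_range_one, add_zero, map_smul_eq_mul, norm_div, norm_pow,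
    Complex.norm_natCast, Complex.norm_natCast] at h1
  exact h1.trans (add_le_add (hB ⟨k + 1, rfl⟩) (hB ⟨k, rfl⟩))

theorem exists_seminorm_expSum_disc_le (hx : ∃ y, Tendsto (expSum x n) atTop (𝓝 y))
    {q : Seminorm ℂ V} (hq : Continuous q) {r : ℝ} (hr0 : 0 ≤ r) (hr1 : r < 1) {ε : ℝ}
    (hε : 0 < ε) :
    ∃ m, ∀ k ≥ m, ∀ α : ℂ, ‖α‖ ≤ r * n → q (expSum x α k - expSum x α m) ≤ ε := by
  obtain ⟨B, hB⟩ := exists_bound_of_tendsto_expSum hx hq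
  have hlim : Tendsto (fun m : ℕ => B * r ^ m / (1 - r)) atTop (𝓝 0) := by
    simpa using ((tendsto_pow_atTop_nhds_zero_of_lt_one hr0 hr1).const_mul B).div_const (1 - r)
  obtain ⟨m, hm⟩ := (hlim.eventually_lt_const hε).exists
  exact ⟨m, fun k hk α hα => (seminorm_expSum_disc_le q hB hr0 hr1 hα k hk).trans hm.le⟩

theorem exists_seminorm_expSum_segment_le {β : ℂ} (hx : ∃ y, Tendsto (expSum x β) atTop (𝓝 y))
    {q : Seminorm ℂ V} (hq : Continuous q) {ε : ℝ} (hε : 0 < ε) :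
    ∃ m, ∀ k ≥ m, ∀ t : ℝ, 0 ≤ t → t ≤ 1 →
      q (expSum x (t * β) k - expSum x (t * β) m) ≤ ε := by
  obtain ⟨y, hy⟩ := hx
  have h1 := tendsto_nhds_iff_seminorm.1 hy q hq
  obtain ⟨m, hm⟩ := eventually_atTop.1 (h1.eventually_lt_const (half_pos hε))
  refine ⟨m, fun k hk t ht0 ht1 => seminorm_expSum_segment_le q (fun k hk => ?_) ht0 ht1 k hk⟩
  have h2 := map_sub_le_add q (expSum x β k - y) (expSum x β m - y)
  rw [sub_sub_sub_cancel_right] at h2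
  linarith [hm k hk, hm m le_rfl]

theorem exists_ratio_of_mem_openDisc {α : ℂ} (hα : α ∈ openDisc n) :
    ∃ r, 0 ≤ r ∧ r < 1 ∧ ‖α‖ < r * n := by
  have h0 : (0 : ℝ) < n := (norm_nonneg α).trans_lt hα
  obtain ⟨s, hs1, hs2⟩ := exists_between (show ‖α‖ < n from hα)
  refine ⟨s / n, div_nonneg ((norm_nonneg _).trans hs1.le) h0.le, (div_lt_one h0).2 hs2, ?_⟩
  rwa [div_mul_cancel₀ _ h0.ne']

/-- If the exponential series converges at `±n`, then it converges on `S_n`. -/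
theorem exists_tendsto_expSum (hV : ∀ x : ℕ → V, CauchySeq x → ∃ y, Tendsto x atTop (𝓝 y))
    (h₁ : ∃ y, Tendsto (expSum x n) atTop (𝓝 y)) (h₂ : ∃ y, Tendsto (expSum x (-n)) atTop (𝓝 y))
    {α : ℂ} (hα : α ∈ openDisc n ∪ realInterval n) : ∃ y, Tendsto (expSum x α) atTop (𝓝 y) := by
  refine exists_tendsto_of_seminorm hV fun q hq ε hε => ?_
  rcases hα with hα | hα
  · obtain ⟨r, hr0, hr1, hr⟩ := exists_ratio_of_mem_openDisc hα
    obtain ⟨m, hm⟩ := exists_seminorm_expSum_disc_le h₁ hq hr0 hr1 hε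
    exact ⟨m, fun k hk => hm k hk α hr.le⟩
  · obtain ⟨t, ht0, ht1, rfl | rfl⟩ := mem_realInterval_iff.1 hα
    · obtain ⟨m, hm⟩ := exists_seminorm_expSum_segment_le h₁ hq hε
      exact ⟨m, fun k hk => hm k hk t ht0 ht1⟩
    · obtain ⟨m, hm⟩ := exists_seminorm_expSum_segment_le h₂ hq hε
      exact ⟨m, fun k hk => hm k hk t ht0 ht1⟩

variable {F : ℂ → V}

theorem continuous_expSum (x : ℕ → V) (k : ℕ) : Continuous fun α => expSum x α k :=
  continuous_finsetSum _ fun i _ => ((continuous_id.pow i).div_const _).smul continuous_const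

theorem continuousOn_openDisc_of_tendsto_expSum (h₁ : ∃ y, Tendsto (expSum x n) atTop (𝓝 y))
    (hF : ∀ α ∈ openDisc n, Tendsto (expSum x α) atTop (𝓝 (F α))) : ContinuousOn F (openDisc n) := by
  intro α hα
  obtain ⟨r, hr0, hr1, hr⟩ := exists_ratio_of_mem_openDisc hα
  have hsub : ∀ β ∈ Metric.ball (0 : ℂ) (r * n), ‖β‖ ≤ r * n ∧ β ∈ openDisc n := fun β hβ => by
    rw [mem_ball_zero_iff] at hβ
    exact ⟨hβ.le, hβ.trans_le (mul_le_of_le_one_left (Nat.cast_nonneg n) hr1.le)⟩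
  have h : ContinuousOn F (Metric.ball 0 (r * n)) :=
    continuousOn_of_seminorm (P := fun k α => expSum x α k)
      (fun k => (continuous_expSum x k).continuousOn) (fun β hβ => hF β (hsub β hβ).2)
      fun q hq ε hε => by
        obtain ⟨m, hm⟩ := exists_seminorm_expSum_disc_le h₁ hq hr0 hr1 hε
        exact ⟨m, fun k hk β hβ => hm k hk β (hsub β hβ).1⟩
  exact (h.continuousAt (Metric.isOpen_ball.mem_nhds (by simpa using hr))).continuousWithinAt

/-- Abel's theorem. -/
theorem continuousOn_realInterval_of_tendsto_expSum
    (h₁ : ∃ y, Tendsto (expSum x n) atTop (𝓝 y)) (h₂ : ∃ y, Tendsto (expSum x (-n)) atTop (𝓝 y))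
    (hF : ∀ α ∈ realInterval n, Tendsto (expSum x α) atTop (𝓝 (F α))) :
    ContinuousOn F (realInterval n) := by
  have key : ∀ β : ℂ, (∃ y, Tendsto (expSum x β) atTop (𝓝 y)) →
      (∀ t : ℝ, 0 ≤ t → t ≤ 1 → (t : ℂ) * β ∈ realInterval n) →
      ContinuousOn F ((fun t : ℝ => (t : ℂ) * β) '' Icc 0 1) := fun β hβ hm =>
    continuousOn_of_seminorm (P := fun k α => expSum x α k)
      (fun k => (continuous_expSum x k).continuousOn)
      (by rintro _ ⟨t, ht, rfl⟩; exact hF _ (hm t ht.1 ht.2)) fun q hq ε hε => by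
        obtain ⟨m, hm⟩ := exists_seminorm_expSum_segment_le hβ hq hε
        refine ⟨m, fun k hk => ?_⟩
        rintro _ ⟨t, ht, rfl⟩
        exact hm k hk t ht.1 ht.2
  have hcl : ∀ β : ℂ, IsClosed ((fun t : ℝ => (t : ℂ) * β) '' Icc 0 1) := fun β =>
    (isCompact_Icc.image (by fun_prop)).isClosed
  refine ((key n h₁ fun t ht0 ht1 => mem_realInterval_iff.2 ⟨t, ht0, ht1, .inl rfl⟩).union_of_isClosed
    (key (-n) h₂ fun t ht0 ht1 => mem_realInterval_iff.2 ⟨t, ht0, ht1, .inr rfl⟩) (hcl _)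
    (hcl _)).mono ?_
  intro α hα
  obtain ⟨t, ht0, ht1, rfl | rfl⟩ := mem_realInterval_iff.1 hα
  · exact .inl ⟨t, ⟨ht0, ht1⟩, rfl⟩
  · exact .inr ⟨t, ⟨ht0, ht1⟩, rfl⟩

/-- The geometric estimate from index 2 bounds the remainder by a multiple of |α|², so the
difference quotient differs from the first coefficient by O(|α|). -/
theorem tendsto_inv_smul_of_tendsto_expSum (hn : 1 ≤ n)
    (h₁ : ∃ y, Tendsto (expSum x n) atTop (𝓝 y))
    (hF : ∀ α ∈ openDisc n, Tendsto (expSum x α) atTop (𝓝 (F α))) :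
    Tendsto (fun α : ℂ => α⁻¹ • (F α - x 0)) (𝓝[≠] 0) (𝓝 (x 1)) := by
  have hn0 : (0 : ℝ) < n := by exact_mod_cast hn
  refine tendsto_nhds_iff_seminorm.2 fun q hq => ?_
  obtain ⟨B, hB⟩ := exists_bound_of_tendsto_expSum h₁ hq
  have hlim : Tendsto (fun α : ℂ => B / n * (‖α‖ / n) / (1 - ‖α‖ / n)) (𝓝[≠] 0) (𝓝 0) := by
    have h2 : ContinuousAt (fun α : ℂ => B / n * (‖α‖ / n) / (1 - ‖α‖ / n)) 0 :=
      ContinuousAt.div (by fun_prop) (by fun_prop) (by simp)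
    have h3 := h2.tendsto.mono_left (nhdsWithin_le_nhds (s := {0}ᶜ))
    simpa using h3
  refine squeeze_zero' (Eventually.of_forall fun _ => apply_nonneg q _) ?_ hlim
  have hball : ∀ᶠ α : ℂ in 𝓝[≠] 0, ‖α‖ < n := by
    refine nhdsWithin_le_nhds ?_
    filter_upwards [Metric.ball_mem_nhds (0 : ℂ) hn0] with α hα
    simpa using hα
  filter_upwards [hball, self_mem_nhdsWithin] with α hα hα0
  have hα0 : α ≠ 0 := hα0
  have hr1 : ‖α‖ / n < 1 := (div_lt_one hn0).2 hα
  have h2 := seminorm_sub_le_of_tendsto (hF α hα) hq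
    (seminorm_expSum_disc_le q hB (by positivity) hr1 (α := α)
      (by rw [div_mul_cancel₀ _ hn0.ne']) (m := 2))
  have h3 : α⁻¹ • (F α - x 0) - x 1 = α⁻¹ • (F α - expSum x α 2) := by
    simp only [expSum, Finset.sum_range_succ, Finset.range_zero, Finset.sum_empty, zero_add,
      pow_zero, Nat.factorial_zero, Nat.factorial_one, Nat.cast_one, div_one, one_smul, pow_one]
    rw [← sub_sub, smul_sub α⁻¹ (F α - x 0), smul_smul, inv_mul_cancel₀ hα0, one_smul]
  rw [h3, map_smul_eq_mul, norm_inv]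
  have hα' : 0 < ‖α‖ := norm_pos_iff.2 hα0
  calc ‖α‖⁻¹ * q (F α - expSum x α 2) ≤ ‖α‖⁻¹ * (B * (‖α‖ / n) ^ 2 / (1 - ‖α‖ / n)) :=
        mul_le_mul_of_nonneg_left h2 (by positivity)
    _ = _ := by
        have : 1 - ‖α‖ / n ≠ 0 := (sub_pos.2 hr1).ne'
        field_simp

end Topological

end ExpSum
end ResolventCalculus

/-! ### Identification of the limit with f_α -/

namespace ResolventCalculus

theorem IsBddFunctional.of_tendsto {n : ℕ} {Γ : Set ℂ} {Λ : ℕ → (Multiset ℂ → ℂ) → ℂ}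
    {L : (Multiset ℂ → ℂ) → ℂ} (h : ∀ k, IsBddFunctional n Γ (Λ k))
    (hL : ∀ φ, ResFam n Γ φ → Tendsto (fun k => Λ k φ) atTop (𝓝 (L φ))) {C : ℝ}
    (hC : ∀ φ, ResFam n Γ φ → ∀ δ, (∀ s : Multiset ℂ, s.card ≤ n → (∀ x ∈ s, x ∈ Γ) →
      ‖φ s‖ ≤ δ) → ∀ k, ‖Λ k φ‖ ≤ C * δ) : IsBddFunctional n Γ L := by
  refine ⟨fun φ ψ hφ hψ => ?_, fun c φ hφ => ?_, C, fun φ hφ δ hδ => ?_⟩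
  · refine tendsto_nhds_unique (hL _ (hφ.add hψ)) (((hL φ hφ).add (hL ψ hψ)).congr fun k => ?_)
    exact ((h k).add φ ψ hφ hψ).symm
  · refine tendsto_nhds_unique (hL _ (hφ.const_mul c)) (((hL φ hφ).const_mul c).congr fun k => ?_)
    exact ((h k).smul c φ hφ).symm
  · exact le_of_tendsto (hL φ hφ).norm (Eventually.of_forall fun k => hC φ hφ δ hδ k)

theorem openDisc_union_mono {m n : ℕ} (h : m ≤ n) :
    openDisc m ∪ realInterval m ⊆ openDisc n ∪ realInterval n := by
  have h' : (m : ℝ) ≤ n := by exact_mod_cast h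
  rintro α (hα | ⟨h0, h1⟩)
  · exact .inl (lt_of_lt_of_le hα h')
  · exact .inr ⟨h0, h1.trans h'⟩

theorem add_mem_openDisc_union {m n : ℕ} {α β : ℂ} (hα : α ∈ openDisc m ∪ realInterval m)
    (hβ : β ∈ openDisc n ∪ realInterval n) :
    α + β ∈ openDisc (m + n) ∪ realInterval (m + n) := by
  have hle : ∀ {k : ℕ} {z : ℂ}, z ∈ realInterval k → ‖z‖ ≤ k := fun {k z} hz => by
    have : z = z.re := Complex.ext (by simp) (by simpa using hz.1)
    rw [this, Complex.norm_real]
    exact hz.2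
  rcases hα with hα | hα
  · have h1 : ‖β‖ ≤ n := hβ.elim (fun h => le_of_lt h) hle
    refine .inl ((norm_add_le _ _).trans_lt ?_)
    push_cast
    exact add_lt_add_of_lt_of_le hα h1
  · rcases hβ with hβ | hβ
    · refine .inl ((norm_add_le _ _).trans_lt ?_)
      push_cast
      exact add_lt_add_of_le_of_lt (hle hα) hβ
    · refine .inr ⟨by rw [Complex.add_im, hα.1, hβ.1, add_zero], ?_⟩
      push_cast
      rw [Complex.add_re]
      exact (abs_add_le _ _).trans (add_le_add hα.2 hβ.2)

section

variable {γ : ℝ → ℂ} {a b C₁ C₂ K : ℝ} {lam : ℝ → ℂ} {N : ℂ → ℂ} {n m : ℕ} {α : ℂ}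

theorem JumpFactor.natCast (hN : JumpFactor γ a b lam N) (n : ℕ) : N n = 0 := by
  simpa using hN.int n

theorem JumpFactor.neg_natCast (hN : JumpFactor γ a b lam N) (n : ℕ) : N (-n) = 0 := by
  simpa using hN.int (-n)

/-- The bounds at ±n spread over S_n by the geometric and Abel estimates, applied from index 0 with
the constant kept proportional to δ. -/
theorem exists_norm_expFunctional_le_of_mem (hN : JumpFactor γ a b lam N) (hl : ArcLog γ a b K lam)
    (hγ : BiLipArc γ a b C₁ C₂) (hn : 1 ≤ n) (hα : α ∈ openDisc n ∪ realInterval n) :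
    ∃ C, ∀ φ : Multiset ℂ → ℂ, ResFam n (γ '' Icc a b) φ →
      ∀ δ, (∀ s : Multiset ℂ, s.card ≤ n → (∀ x ∈ s, x ∈ γ '' Icc a b) →
        ‖φ s‖ ≤ δ) → ∀ k, ‖expFunctional γ a b N lam α k φ‖ ≤ C * δ := by
  obtain ⟨C, hC0, hC⟩ := exists_norm_expFunctional_le (α := n) hN hl hγ hn (by simp) (hN.natCast n)
  obtain ⟨D, hD0, hD⟩ := exists_norm_expFunctional_le (α := -n) hN hl hγ hn (by simp)
    (hN.neg_natCast n)
  rcases hα with hα | hα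
  · obtain ⟨r, hr0, hr1, hr⟩ := exists_ratio_of_mem_openDisc hα
    refine ⟨2 * C / (1 - r), fun φ hφ δ hδ k => ?_⟩
    set x : ℕ → ℂ := fun i => (logForm γ N lam i).apply γ a b 1 φ with hx
    have hx' : ∀ k, ‖expSum x n k‖ ≤ C * δ := hC φ hφ δ hδ
    have h1 := seminorm_expSum_disc_le (normSeminorm ℂ ℂ) (x := x) (R := n) (B := 2 * C * δ)
      (fun k => by
        have h2 := norm_sub_le (expSum x n (k + 1)) (expSum x n k)
        rw [expSum_add_sub, Finset.sum_range_one, add_zero, norm_smul, norm_div, norm_pow,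
          Complex.norm_natCast, Complex.norm_natCast] at h2
        have h3 := hx' k
        have h4 := hx' (k + 1)
        refine h2.trans ?_
        linarith) hr0 hr1 hr.le k (Nat.zero_le k)
    rw [expSum_zero, sub_zero, pow_zero, mul_one] at h1
    exact h1.trans_eq (by ring)
  · have key : ∀ (β : ℂ) (C : ℝ), (∀ φ : Multiset ℂ → ℂ, ResFam n (γ '' Icc a b) φ →
      ∀ δ, (∀ s : Multiset ℂ, s.card ≤ n → (∀ x ∈ s, x ∈ γ '' Icc a b) →
        ‖φ s‖ ≤ δ) → ∀ k, ‖expFunctional γ a b N lam β k φ‖ ≤ C * δ) → ∀ t : ℝ, 0 ≤ t → t ≤ 1 →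
        ∀ φ : Multiset ℂ → ℂ, ResFam n (γ '' Icc a b) φ →
      ∀ δ, (∀ s : Multiset ℂ, s.card ≤ n → (∀ x ∈ s, x ∈ γ '' Icc a b) →
        ‖φ s‖ ≤ δ) → ∀ k, ‖expFunctional γ a b N lam (t * β) k φ‖ ≤ C * δ := by
      intro β C hC t ht0 ht1 φ hφ δ hδ k
      set x : ℕ → ℂ := fun i => (logForm γ N lam i).apply γ a b 1 φ with hx
      have h1 := seminorm_expSum_segment_le (normSeminorm ℂ ℂ) (x := x) (β := β) (m := 0)
        (ε := C * δ) (fun k _ => by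
          rw [expSum_zero, sub_zero]
          exact hC φ hφ δ hδ k) ht0 ht1 k (Nat.zero_le k)
      rw [expSum_zero, sub_zero] at h1
      exact h1
    obtain ⟨t, ht0, ht1, rfl | rfl⟩ := mem_realInterval_iff.1 hα
    · exact ⟨C, key _ C hC t ht0 ht1⟩
    · exact ⟨D, key _ D hD t ht0 ht1⟩

variable {V : Type*} [AddCommGroup V] [Module ℂ V] [UniformSpace V] [IsUniformAddGroup V]
  [ContinuousSMul ℂ V] [PolynormableSpace ℂ V] [T2Space V] {Φ : Multiset ℂ → V}

theorem exists_tendsto_expSum_logEval (hV : ∀ x : ℕ → V, CauchySeq x → ∃ y, Tendsto x atTop (𝓝 y))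
    (hN : JumpFactor γ a b lam N) (hl : ArcLog γ a b K lam) (hγ : BiLipArc γ a b C₁ C₂) (hn : 1 ≤ n)
    (hΦ : ResFam n (γ '' Icc a b) Φ) :
    (∃ y, Tendsto (expSum (logEval γ a b N lam Φ) n) atTop (𝓝 y)) ∧
      ∃ y, Tendsto (expSum (logEval γ a b N lam Φ) (-n)) atTop (𝓝 y) :=
  ⟨exists_tendsto_expPartial hV hN hl hγ hn (by simp) (hN.natCast n) hΦ,
    exists_tendsto_expPartial hV hN hl hγ hn (by simp) (hN.neg_natCast n) hΦ⟩

theorem exists_tendsto_expFunctional (hN : JumpFactor γ a b lam N) (hl : ArcLog γ a b K lam)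
    (hγ : BiLipArc γ a b C₁ C₂) (hn : 1 ≤ n) (hα : α ∈ openDisc n ∪ realInterval n)
    {φ : Multiset ℂ → ℂ} (hφ : ResFam n (γ '' Icc a b) φ) :
    ∃ y, Tendsto (fun k => expFunctional γ a b N lam α k φ) atTop (𝓝 y) := by
  have hV : ∀ x : ℕ → ℂ, CauchySeq x → ∃ y, Tendsto x atTop (𝓝 y) :=
    fun _ hx => cauchySeq_tendsto_of_complete hx
  obtain ⟨h₁, h₂⟩ := exists_tendsto_expSum_logEval hV hN hl hγ hn hφ
  obtain ⟨y, hy⟩ := exists_tendsto_expSum hV h₁ h₂ hα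
  refine ⟨y, hy.congr fun k => ?_⟩
  exact clm_expPartial hV hN hl hγ hn hφ (ContinuousLinearMap.id ℂ ℂ) α k

/-- The exponential series of `log(γ, ·)` converges to the value of `f_α`. -/
theorem tendsto_expSum_logEval (hV : ∀ x : ℕ → V, CauchySeq x → ∃ y, Tendsto x atTop (𝓝 y))
    (hN : JumpFactor γ a b lam N) (hl : ArcLog γ a b K lam) (hγ : BiLipArc γ a b C₁ C₂) (hn : 1 ≤ n)
    (hΦ : ResFam n (γ '' Icc a b) Φ) (hα : α ∈ openDisc n ∪ realInterval n) {θ : CurveForm}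
    (hθ : θ.Represents γ a b m (curvePow γ a b α)) (hm : m ≤ n) :
    Tendsto (expSum (logEval γ a b N lam Φ) α) atTop (𝓝 (θ.eval γ a b m Φ)) := by
  obtain ⟨h₁, h₂⟩ := exists_tendsto_expSum_logEval hV hN hl hγ hn hΦ
  obtain ⟨y, hy⟩ := exists_tendsto_expSum hV h₁ h₂ hα
  have hlim : ∀ φ, ResFam n (γ '' Icc a b) φ → Tendsto (fun k => expFunctional γ a b N lam α k φ)
      atTop (𝓝 (limUnder atTop fun k => expFunctional γ a b N lam α k φ)) := fun φ hφ =>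
    tendsto_nhds_limUnder (exists_tendsto_expFunctional hN hl hγ hn hα hφ)
  obtain ⟨C, hC⟩ := exists_norm_expFunctional_le_of_mem hN hl hγ hn hα
  have hb := IsBddFunctional.of_tendsto (isBddFunctional_expFunctional hN hl hγ hn α) hlim hC
  suffices y = θ.eval γ a b m Φ by rwa [← this]
  refine eq_of_forall_dual fun ℓ => ?_
  rw [CurveForm.clm_eval hV hγ hθ.integrable (hΦ.of_le hm)]
  -- The limit of the partial sums is a bounded functional of order n; on poles it is the scalar
  -- exponential f_α(z), as for θ.
  have h9 := hb.eq_of_poleFam hγ ((CurveForm.isBddFunctional hγ hθ.integrable).of_le hm)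
    (fun z hz => by
      rw [← hθ.eq z hz]
      exact tendsto_nhds_unique (hlim _ (ResFam.poleFam n hz))
        (expFunctional_poleFam hN hl hγ α hz)) (hΦ.clm ℓ)
  rw [← h9]
  refine tendsto_nhds_unique (((ℓ.continuous.tendsto y).comp hy).congr fun k => ?_)
    (hlim _ (hΦ.clm ℓ))
  exact clm_expPartial hV hN hl hγ hn hΦ ℓ α k

end
end ResolventCalculus

/-! ### Iterates, powers and the main theorem -/

namespace ResolventCalculus

section

variable {γ : ℝ → ℂ} {a b C₁ C₂ K : ℝ} {lam : ℝ → ℂ} {N : ℂ → ℂ} {n m n₁ n₂ : ℕ} {α : ℂ}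
  {V : Type*} [AddCommGroup V] [Module ℂ V] [UniformSpace V] [IsUniformAddGroup V]
  [ContinuousSMul ℂ V] [PolynormableSpace ℂ V] [T2Space V] {A : Submodule ℂ (V × V)} {u : V}
  {Φ : Multiset ℂ → V} {f : ℂ → ℂ} {θ η : CurveForm}

theorem CurveForm.Represents.eval_one (hV : ∀ x : ℕ → V, CauchySeq x → ∃ y, Tendsto x atTop (𝓝 y))
    (hγ : BiLipArc γ a b C₁ C₂) (hθ : θ.Represents γ a b n f) (hf : ∀ z ∉ γ '' Icc a b, f z = 1)
    (hΦ : ResFam n (γ '' Icc a b) Φ) : θ.eval γ a b n Φ = Φ 0 := by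
  refine eq_of_forall_dual fun ℓ => ?_
  rw [CurveForm.clm_eval hV hγ hθ.integrable hΦ]
  have h := (θ.isBddFunctional hγ hθ.integrable).eq_of_poleFam hγ
    (isBddFunctional_const_mul_apply 1 hγ.left_mem (Nat.zero_le n)) (fun z hz => by
      rw [← hθ.eq z hz, hf z hz]
      simp) (hΦ.clm ℓ)
  simpa using h

theorem logEval_zero (hV : ∀ x : ℕ → V, CauchySeq x → ∃ y, Tendsto x atTop (𝓝 y))
    (hN : JumpFactor γ a b lam N) (hl : ArcLog γ a b K lam) (hγ : BiLipArc γ a b C₁ C₂)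
    (hn : 1 ≤ n) (hΦ : ResFam n (γ '' Icc a b) Φ) : logEval γ a b N lam Φ 0 = Φ 0 :=
  (hN.represents_logForm hl hγ 0).eval_one hV hγ (fun z _ => pow_zero _) (hΦ.of_le hn)

theorem hasValue_logPowOp (hV : ∀ x : ℕ → V, CauchySeq x → ∃ y, Tendsto x atTop (𝓝 y))
    (hN : JumpFactor γ a b lam N) (hl : ArcLog γ a b K lam) (hγ : BiLipArc γ a b C₁ C₂)
    (hn : 1 ≤ n) (hΦ : OpFam n (γ '' Icc a b) A u Φ) (k : ℕ) :
    HasValue (logPowOp γ a b k A) u (logEval γ a b N lam Φ k) :=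
  (hN.represents_logForm hl hγ k).hasValue hV hγ (hΦ.of_le hn)

theorem logPowOp_one (γ : ℝ → ℂ) (a b : ℝ) (A : Submodule ℂ (V × V)) :
    logPowOp γ a b 1 A = logOp γ a b A := by
  simp only [logPowOp, logOp, pow_one]

/-- The logarithm applied to the value of a form of smaller order. -/
theorem hasValue_logOp_eval (hV : ∀ x : ℕ → V, CauchySeq x → ∃ y, Tendsto x atTop (𝓝 y))
    (hA : IsSeqClosed (A : Set (V × V)))
    (hN : JumpFactor γ a b lam N) (hl : ArcLog γ a b K lam) (hγ : BiLipArc γ a b C₁ C₂)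
    (hΦ : OpFam n (γ '' Icc a b) A u Φ) (hθ : θ.Represents γ a b m f) (hm : m + 1 ≤ n)
    (hη : η.Represents γ a b n₁ fun z => curveLog γ a b z * f z) (hn₁ : n₁ ≤ n) :
    HasValue (logOp γ a b A) (θ.eval γ a b m Φ) (η.eval γ a b n₁ Φ) := by
  have hΦ' := CurveForm.opFam_eval (m := 1) hV hA hγ hθ.integrable hΦ (by omega)
  have h1 := hasValue_logPowOp hV hN hl hγ le_rfl hΦ' 1
  rw [logPowOp_one] at h1
  have h2 := (hN.represents_logForm hl hγ 1).eval_eval hV hγ hθ hη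
    (fun z _ => by simp only [pow_one]) hΦ.resFam (by omega) hn₁
  rw [← h2]
  exact h1

/-- Every power of the logarithm has a form of order one, so each iterate retains at least one
order, enough to apply the logarithm again; multiplicativity identifies the result with the next
power. The order does not decrease with k. -/
theorem iterValue_logOp (hV : ∀ x : ℕ → V, CauchySeq x → ∃ y, Tendsto x atTop (𝓝 y))
    (hA : IsSeqClosed (A : Set (V × V)))
    (hN : JumpFactor γ a b lam N) (hl : ArcLog γ a b K lam) (hγ : BiLipArc γ a b C₁ C₂)
    (hn : 2 ≤ n) (hΦ : OpFam n (γ '' Icc a b) A u Φ) (k : ℕ) :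
    IterValue (logOp γ a b A) k u (logEval γ a b N lam Φ k) := by
  induction k with
  | zero => exact (logEval_zero hV hN hl hγ (by omega) hΦ.resFam).trans hΦ.zero
  | succ k ih =>
    refine ⟨_, ih, hasValue_logOp_eval hV hA hN hl hγ hΦ (hN.represents_logForm hl hγ k) hn
      ((hN.represents_logForm hl hγ (k + 1)).of_eqOn fun z _ => ?_) (by omega)⟩
    exact (pow_succ' _ _).symm

theorem expValue_logOp (hV : ∀ x : ℕ → V, CauchySeq x → ∃ y, Tendsto x atTop (𝓝 y))
    (hA : IsSeqClosed (A : Set (V × V)))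
    (hN : JumpFactor γ a b lam N) (hl : ArcLog γ a b K lam) (hγ : BiLipArc γ a b C₁ C₂)
    (hn : 2 ≤ n) (hΦ : OpFam n (γ '' Icc a b) A u Φ) (hα : α ∈ openDisc n ∪ realInterval n)
    (hθ : θ.Represents γ a b m (curvePow γ a b α)) (hm : m ≤ n) :
    ExpValue (logOp γ a b A) α u (θ.eval γ a b m Φ) :=
  ⟨_, iterValue_logOp hV hA hN hl hγ hn hΦ,
    tendsto_expSum_logEval hV hN hl hγ (by omega) hΦ.resFam hα hθ hm⟩

/-- When |α| < m, the products log(γ, z)^k f_α have forms of the same order m as f_α, so one spare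
order allows all iterations. At |α| = m this argument is not available. -/
theorem iterValue_logOp_curvePow (hV : ∀ x : ℕ → V, CauchySeq x → ∃ y, Tendsto x atTop (𝓝 y))
    (hA : IsSeqClosed (A : Set (V × V)))
    (hN : JumpFactor γ a b lam N) (hl : ArcLog γ a b K lam) (hγ : BiLipArc γ a b C₁ C₂)
    (hΦ : OpFam n (γ '' Icc a b) A u Φ) (hα : ‖α‖ < m) (hm : m + 1 ≤ n)
    (hθ : θ.Represents γ a b m (curvePow γ a b α)) (k : ℕ) :
    IterValue (logOp γ a b A) k (θ.eval γ a b m Φ)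
      (logEval γ a b N lam (fun s => θ.eval γ a b m fun t => Φ (s + t)) k) := by
  have hform := fun k => hN.hasForm_of_abs_re_lt hl hγ k ((Complex.abs_re_le_norm α).trans_lt hα)
  choose η hη using hform
  have heq : ∀ k, logEval γ a b N lam (fun s => θ.eval γ a b m fun t => Φ (s + t)) k =
      (η k).eval γ a b m Φ := fun k =>
    (hN.represents_logForm hl hγ k).eval_eval hV hγ hθ (hη k) (fun z _ => rfl) hΦ.resFam
      (by omega) (by omega)
  induction k with
  | zero =>
    rw [heq]
    exact (hη 0).eval_eq hV hγ (hθ.of_eqOn fun z _ => by rw [pow_zero, one_mul]) hΦ.resFam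
      (by omega) (by omega)
  | succ k ih =>
    refine ⟨_, ih, ?_⟩
    rw [heq, heq]
    exact hasValue_logOp_eval hV hA hN hl hγ hΦ (hη k) hm
      ((hη (k + 1)).of_eqOn fun z _ => by rw [pow_succ']; ring) (by omega)

/-- The values `f_α(A) u`. -/
theorem exists_powers (hV : ∀ x : ℕ → V, CauchySeq x → ∃ y, Tendsto x atTop (𝓝 y))
    (hN : JumpFactor γ a b lam N) (hl : ArcLog γ a b K lam) (hγ : BiLipArc γ a b C₁ C₂)
    (hΦ : OpFam n (γ '' Icc a b) A u Φ) :
    ∃ F : ℂ → V, (∀ α ∈ openDisc n ∪ realInterval n, ∃ θ : CurveForm,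
      θ.Represents γ a b n (curvePow γ a b α) ∧ F α = θ.eval γ a b n Φ) ∧
      ContinuousOn F (openDisc n) ∧ ContinuousOn F (realInterval n) := by
  have hform := fun α (hα : α ∈ openDisc n ∪ realInterval n) => hN.hasForm_curvePow hl hγ hα
  have : Nonempty CurveForm := ⟨⟨0, 0, 0⟩⟩
  choose! θ hθ using hform
  refine ⟨fun α => (θ α).eval γ a b n Φ, fun α hα => ⟨θ α, hθ α hα, rfl⟩, ?_⟩
  -- In order zero the disc is empty and the interval is {0}, so continuity is trivial.
  rcases Nat.eq_zero_or_pos n with rfl | hn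
  · constructor
    · intro α hα
      have h1 : ‖α‖ < ((0 : ℕ) : ℝ) := hα
      rw [Nat.cast_zero] at h1
      exact absurd h1 (norm_nonneg α).not_gt
    · refine Set.Subsingleton.continuousOn (fun α hα β hβ => ?_) _
      have h0 : ∀ z ∈ realInterval 0, z = 0 := fun z hz => by
        have h1 := hz.2
        rw [Nat.cast_zero, abs_nonpos_iff] at h1
        exact Complex.ext h1 hz.1
      rw [h0 α hα, h0 β hβ]
  · obtain ⟨h₁, h₂⟩ := exists_tendsto_expSum_logEval hV hN hl hγ hn hΦ.resFam
    have hlim := fun α (hα : α ∈ openDisc n ∪ realInterval n) =>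
      tendsto_expSum_logEval hV hN hl hγ hn hΦ.resFam hα (hθ α hα) le_rfl
    exact ⟨continuousOn_openDisc_of_tendsto_expSum h₁ fun α hα => hlim α (.inl hα),
      continuousOn_realInterval_of_tendsto_expSum h₁ h₂ fun α hα => hlim α (.inr hα)⟩

end

/-- Extending a Lipschitz curve by constants. -/
theorem IsLipschitzCurve.exists_biLipArc {γ : ℝ → ℂ} {a b : ℝ} (h : IsLipschitzCurve γ a b) :
    ∃ (δ : ℝ → ℂ) (C₁ C₂ : ℝ), BiLipArc δ a b C₁ C₂ ∧ (∀ t ∈ Icc a b, δ t = γ t) ∧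
      δ '' Icc a b = γ '' Icc a b ∧ curveLog δ a b = curveLog γ a b := by
  obtain ⟨C₁, C₂, h1, h2, h3⟩ := h.biLipschitz
  set δ : ℝ → ℂ := fun t => γ (projIcc a b h.lt.le t) with hδ
  have heq : ∀ t ∈ Icc a b, δ t = γ t := fun t ht =>
    congrArg (fun s : Icc a b => γ s) (projIcc_of_mem h.lt.le ht)
  refine ⟨δ, C₁, C₂, ⟨h.lt, h1, h2, fun s hs t ht => ?_, fun s t => ?_⟩, heq, image_congr heq, ?_⟩
  · rw [heq s hs, heq t ht]
    exact (h3 s hs t ht).1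
  · exact ((h3 _ (projIcc a b h.lt.le s).2 _ (projIcc a b h.lt.le t).2).2).trans
      (mul_le_mul_of_nonneg_left (abs_projIcc_sub_projIcc h.lt.le) h2.le)
  · ext z
    rw [curveLog, curveLog]
    refine intervalIntegral.integral_congr_ae ?_
    -- The derivatives of the curve and of its extension may differ at the endpoints, which form a
    -- null set.
    filter_upwards [ae_mem_Ioo_of_mem_uIoc h.lt.le] with t ht hm
    have hev : δ =ᶠ[𝓝 t] γ := by
      filter_upwards [isOpen_Ioo.mem_nhds (ht hm)] with s hs using heq s (Ioo_subset_Icc_self hs)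
    rw [hev.deriv_eq, hev.eq_of_nhds]

end ResolventCalculus

theorem mainTheorem8
    {V : Type*} [AddCommGroup V] [Module ℂ V] [UniformSpace V] [IsUniformAddGroup V]
    [ContinuousSMul ℂ V] [LocallyConvexSpace ℝ V] [T2Space V]
    (hV : ∀ x : ℕ → V, CauchySeq x → ∃ y, Tendsto x atTop (𝓝 y))
    (A : Submodule ℂ (V × V)) (hA : IsSeqClosed (A : Set (V × V)))
    (γ : ℝ → ℂ) (a b : ℝ) (hγ : IsLipschitzCurve γ a b) :
    -- (a) the iterates of the logarithm
    (∀ u ∈ resolventDomain 2 (γ '' Icc a b) A, ∀ n : ℕ, ∃ v,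
      IterValue (logOp γ a b A) n u v ∧ HasValue (logPowOp γ a b n A) u v) ∧
    -- (b) the powers: well-definedness, continuity, exponential series
    (∀ n : ℕ, ∀ u ∈ resolventDomain n (γ '' Icc a b) A, ∃ F : ℂ → V,
      (∀ α ∈ openDisc n ∪ realInterval n, HasValue (powOp γ a b α A) u (F α)) ∧
      ContinuousOn F (openDisc n) ∧
      ContinuousOn F (realInterval n) ∧
      (2 ≤ n → ∃ s : ℕ → V, (∀ k, HasValue (logPowOp γ a b k A) u (s k)) ∧
        ∀ α ∈ openDisc n ∪ realInterval n,
          IsExpSum α s (F α) ∧ ExpValue (logOp γ a b A) α u (F α))) ∧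
    -- (c) the law of exponents
    (∀ n : ℕ, 2 ≤ n → ∀ u ∈ resolventDomain n (γ '' Icc a b) A,
      ∀ n₁ n₂ : ℕ, n₁ + n₂ ≤ n →
      ∀ α₁ ∈ openDisc n₁ ∪ realInterval n₁, ∀ α₂ ∈ openDisc n₂ ∪ realInterval n₂,
      ∃ v w : V,
        -- `v = f_{α₂}(A) u = exp(α₂ log(γ, A)) u`
        (v ∈ resolventDomain (n - n₂) (γ '' Icc a b) A ∧
          HasValue (powOp γ a b α₂ A) u v ∧ ExpValue (logOp γ a b A) α₂ u v) ∧
        -- `w = f_{α₁}(A) v`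
        HasValue (powOp γ a b α₁ A) v w ∧
        -- `w = f_{α₁ + α₂}(A) u = exp((α₁ + α₂) log(γ, A)) u`
        (HasValue (powOp γ a b (α₁ + α₂) A) u w ∧
          ExpValue (logOp γ a b A) (α₁ + α₂) u w) ∧
        -- the outer exponential as a series in the operators `g_k(A)`
        (1 ≤ n₁ → ∃ s : ℕ → V, (∀ k, HasValue (logPowOp γ a b k A) v (s k)) ∧
          IsExpSum α₁ s w) ∧
        -- the outer exponential as a series in the iterates of `log(γ, A)`
        (2 ≤ n - n₂ ∨ (1 ≤ n - n₂ ∧ ‖α₂‖ < n₂) → ExpValue (logOp γ a b A) α₁ v w)) ∧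
    -- (c) the local group and its infinitesimal generator
    (∀ n : ℕ, 2 ≤ n → ∀ u ∈ resolventDomain n (γ '' Icc a b) A, ∃ (F : ℂ → V) (u' : V),
      (∀ α ∈ openDisc n ∪ realInterval n, ExpValue (logOp γ a b A) α u (F α)) ∧
      F 0 = u ∧
      ContinuousOn F (openDisc n) ∧
      ContinuousOn F (realInterval n) ∧
      HasValue (logOp γ a b A) u u' ∧
      Tendsto (fun α : ℂ => α⁻¹ • (F α - u)) (𝓝[≠] 0) (𝓝 u')) := by
  have := polynormableSpace_of_locallyConvexSpace_real V
  obtain ⟨δ, C₁, C₂, hδ, hδγ, hΓ, hlog⟩ := hγ.exists_biLipArc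
  have hpow : ∀ α, curvePow δ a b α = curvePow γ a b α := fun α => by
    ext z
    rw [curvePow, curvePow, hlog]
  have hend : ∀ t ∈ Icc a b, LipGraphAt (δ '' Icc a b) (δ t) := fun t ht => by
    rw [hΓ, hδγ t ht]
    exact hγ.locallyGraph t ht
  obtain ⟨K, lam, hl⟩ := hδ.exists_arcLog (hend a (left_mem_Icc.2 hγ.lt.le))
    (hend b (right_mem_Icc.2 hγ.lt.le))
  obtain ⟨N, hN⟩ := hl.exists_jumpFactor hδ
  have e1 : logOp γ a b A = logOp δ a b A := by rw [logOp, logOp, hΓ, hlog]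
  have e2 : ∀ k, logPowOp γ a b k A = logPowOp δ a b k A := fun k => by
    rw [logPowOp, logPowOp, hΓ, hlog]
  have e3 : ∀ α, powOp γ a b α A = powOp δ a b α A := fun α => by rw [powOp, powOp, hΓ, hpow]
  simp only [e1, e2, e3, ← hΓ]
  refine ⟨fun u hu n => ?_, fun n u hu => ?_, fun n hn u hu n₁ n₂ hn₁₂ α₁ hα₁ α₂ hα₂ => ?_,
    fun n hn u hu => ?_⟩
  · obtain ⟨Φ, hΦ⟩ := exists_opFam hu
    exact ⟨_, iterValue_logOp hV hA hN hl hδ le_rfl hΦ n,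
      hasValue_logPowOp hV hN hl hδ (by norm_num) hΦ n⟩
  · obtain ⟨Φ, hΦ⟩ := exists_opFam hu
    obtain ⟨F, hF, hF1, hF2⟩ := exists_powers hV hN hl hδ hΦ
    refine ⟨F, fun α hα => ?_, hF1, hF2, fun hn => ⟨_, hasValue_logPowOp hV hN hl hδ (by omega) hΦ,
      fun α hα => ?_⟩⟩
    · obtain ⟨θ, hθ, hθF⟩ := hF α hα
      rw [hθF]
      exact hθ.hasValue hV hδ hΦ
    · obtain ⟨θ, hθ, hθF⟩ := hF α hα
      rw [hθF]
      exact ⟨tendsto_expSum_logEval hV hN hl hδ (by omega) hΦ.resFam hα hθ le_rfl,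
        expValue_logOp hV hA hN hl hδ hn hΦ hα hθ le_rfl⟩
  · obtain ⟨Φ, hΦ⟩ := exists_opFam hu
    obtain ⟨θ₁, hθ₁⟩ := hN.hasForm_curvePow hl hδ hα₁
    obtain ⟨θ₂, hθ₂⟩ := hN.hasForm_curvePow hl hδ hα₂
    have hα₃ := openDisc_union_mono hn₁₂ (add_mem_openDisc_union hα₁ hα₂)
    obtain ⟨θ₃, hθ₃⟩ := hN.hasForm_curvePow hl hδ hα₃
    have hα₂' := openDisc_union_mono (show n₂ ≤ n by omega) hα₂
    -- The order left to v is n - n₂ ≥ n₁, so f_{α₁} may be applied to it.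
    have hα₁' := openDisc_union_mono (show n₁ ≤ n - n₂ by omega) hα₁
    have hΨ := CurveForm.opFam_eval (m := n - n₂) hV hA hδ hθ₂.integrable hΦ (by omega)
    -- Ψ is the resolvent family of v.
    set Ψ : Multiset ℂ → V := fun s => θ₂.eval δ a b n₂ fun t => Φ (s + t) with hΨdef
    have hw : θ₁.eval δ a b n₁ Ψ = θ₃.eval δ a b n Φ :=
      hθ₁.eval_eval hV hδ hθ₂ hθ₃ (fun z _ => by
        rw [curvePow, curvePow, curvePow, ← Complex.exp_add, add_mul]) hΦ.resFam hn₁₂ le_rfl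
    have hser : 1 ≤ n - n₂ →
        IsExpSum α₁ (logEval δ a b N lam Ψ) (θ₁.eval δ a b n₁ Ψ) := fun h =>
      tendsto_expSum_logEval hV hN hl hδ h hΨ.resFam hα₁' hθ₁ (by omega)
    refine ⟨θ₂.eval δ a b n₂ Φ, θ₁.eval δ a b n₁ Ψ, ⟨hΨ.mem_resolventDomain,
      hθ₂.hasValue hV hδ (hΦ.of_le (by omega)),
      expValue_logOp hV hA hN hl hδ hn hΦ hα₂' hθ₂ (by omega)⟩,
      hθ₁.hasValue hV hδ (hΨ.of_le (by omega)), ?_, fun h1 => ⟨_,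
        hasValue_logPowOp hV hN hl hδ (by omega) hΨ, hser (by omega)⟩, ?_⟩
    · rw [hw]
      exact ⟨hθ₃.hasValue hV hδ hΦ, expValue_logOp hV hA hN hl hδ hn hΦ hα₃ hθ₃ le_rfl⟩
    -- With two orders left, the general iteration applies to v. With one order left and |α₂| < n₂,
    -- the iterates of v are computed from u, as values of log(γ, ·)^k f_{α₂}.
    · rintro (h | ⟨h, hα⟩)
      · exact ⟨_, iterValue_logOp hV hA hN hl hδ h hΨ, hser (by omega)⟩
      · exact ⟨_, iterValue_logOp_curvePow hV hA hN hl hδ hΦ hα (by omega) hθ₂, hser h⟩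
  · obtain ⟨Φ, hΦ⟩ := exists_opFam hu
    have hn1 : 1 ≤ n := by omega
    obtain ⟨F, hF, hF1, hF2⟩ := exists_powers hV hN hl hδ hΦ
    have hlim : ∀ α ∈ openDisc n ∪ realInterval n,
        Tendsto (expSum (logEval δ a b N lam Φ) α) atTop (𝓝 (F α)) := fun α hα => by
      obtain ⟨θ, hθ, hθF⟩ := hF α hα
      rw [hθF]
      exact tendsto_expSum_logEval hV hN hl hδ hn1 hΦ.resFam hα hθ le_rfl
    have hzero : logEval δ a b N lam Φ 0 = u :=
      (logEval_zero hV hN hl hδ hn1 hΦ.resFam).trans hΦ.zero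
    have hlog1 := hasValue_logPowOp hV hN hl hδ hn1 hΦ 1
    rw [logPowOp_one] at hlog1
    refine ⟨F, logEval δ a b N lam Φ 1, fun α hα => ⟨_, iterValue_logOp hV hA hN hl hδ hn hΦ,
      hlim α hα⟩, ?_, hF1, hF2, hlog1, ?_⟩
    · obtain ⟨θ, hθ, hθF⟩ := hF 0 (.inr ⟨rfl, by simp⟩)
      rw [hθF, hθ.eval_one hV hδ (fun z _ => by simp [curvePow]) hΦ.resFam, hΦ.zero]
    · have h := tendsto_inv_smul_of_tendsto_expSum hn1
        (exists_tendsto_expSum_logEval hV hN hl hδ hn1 hΦ.resFam).1 fun α hα => hlim α (.inl hα)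
      rwa [hzero] at h
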